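/- Let $\mathfrak g$ be the affine Lie algebra of type $A_2^{(2)}$ in its Drinfeld presentation, i.e. the Lie algebra over $\mathbb Q$ generated by $c$, $h_r$, $x_r^{\pm}$, $X_{2r+1}^{\pm}$ ($r\in\mathbb Z$) with the relations: $c$ is central and $$[h_r,h_s]=\delta_{r+s,0}\,2r(2+(-1)^{r-1})c,\qquad [h_r,x_s^{\pm}]=\pm 2(2+(-1)^{r-1})x_{r+s}^{\pm},$$ $$[h_r,X_s^{\pm}]=\pm4X_{r+s}^{\pm}\ (r\text{ even}),\qquad [h_r,X_s^{\pm}]=0\ (r\text{ odd}),$$ $$[x_r^{\pm},x_s^{\pm}]=0\ (r+s\text{ even}),\qquad [x_r^{\pm},x_s^{\pm}]=\pm(-1)^sX_{r+s}^{\pm}\ (r+s\text{ odd}),$$ $$[x_r^{\pm},X_s^{\pm}]=[X_r^{\pm},X_s^{\pm}]=0,\qquad [x_r^+,x_s^-]=h_{r+s}+\delta_{r+s,0}\,rc,$$ $$[x_r^{\pm},X_s^{\mp}]=\pm(-1)^r4x_{r+s}^{\mp},\qquad [X_r^+,X_s^-]=8h_{r+s}+4\delta_{r+s,0}\,rc$$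 (the indices of the $X$'s being odd). Let $U$ be its universal enveloping algebra. For $a\in U$ and $k\in\mathbb N$ put $a^{(k)}=a^k/k!$ and $\binom ak=a(a-1)\cdots(a-k+1)/k!$. An integral form of a $\mathbb Q$-algebra $A$ is a $\mathbb Z$-subalgebra $A_{\mathbb Z}$ that is a free $\mathbb Z$-module and for which the natural map $\mathbb Q\otimes_{\mathbb Z}A_{\mathbb Z}\to A$ is an isomorphism. Let $U_{\mathbb Z}\subseteq U$ be the $\mathbb Z$-subalgebra generated by all $(x_r^+)^{(k)},(x_r^-)^{(k)}$ ($r\in\mathbb Z$, $k\in\mathbb N$). Let $U_{\mathbb Z}^{\pm,0}$, $U_{\mathbb Z}^{\pm,1}$, $U_{\mathbb Z}^{\pm,c}$ be the $\mathbb Z$-subalgebras generated by the divided powers $a^{(k)}$ of all elements $a$ of the $\mathbb Z$-span of $\{x_{2r}^{\pm}\}_{r\in\mathbb Z}$, of $\{x_{2r+1}^{\pm}\}_{r\in\mathbb Z}$ and of $\{X_{2r+1}^{\pm}\}_{r\in\mathbb Z}$ respectively. Let $U_{\mathbb Z}^{0,0}$ be the $\mathbb Z$-subalgebra generated by the binomials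 $\binom ak$ with $a\in\mathbb Zh_0+\mathbb Zc$. Put $\varepsilon_r=-1$ if $4\mid r$ and $\varepsilon_r=1$ otherwise, define $\tilde h_{\pm k}$ by $$\sum_{k\ge0}\tilde h_{\pm k}u^k=\exp\Big(\sum_{r>0}(-1)^{r-1}\frac{\varepsilon_rh_{\pm r}}r\,u^r\Big),$$ and let $U_{\mathbb Z}^{0,\pm}$ be the $\mathbb Z$-subalgebra generated by $\{\tilde h_{\pm k}\mid k>0\}$. Theorem. (1) $U_{\mathbb Z}$ is an integral form of $U$. (2) Multiplication in $U$ induces an isomorphism of $\mathbb Z$-modules $$U_{\mathbb Z}^{-,1}\otimes U_{\mathbb Z}^{-,c}\otimes U_{\mathbb Z}^{-,0}\otimes U_{\mathbb Z}^{0,-}\otimes U_{\mathbb Z}^{0,0}\otimes U_{\mathbb Z}^{0,+}\otimes U_{\mathbb Z}^{+,1}\otimes U_{\mathbb Z}^{+,c}\otimes U_{\mathbb Z}^{+,0}\;\cong\;U_{\mathbb Z}$$ (tensor products over $\mathbb Z$). (3) The following are $\mathbb Z$-bases of $U_{\mathbb Z}^{\pm,0}$, $U_{\mathbb Z}^{\pm,1}$,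 $U_{\mathbb Z}^{\pm,c}$, $U_{\mathbb Z}^{0,\pm}$, $U_{\mathbb Z}^{0,0}$ respectively, where $\mathbf k$ runs over the finitely supported functions to $\mathbb N$ on $\mathbb Z$, respectively (for $B^{0,\pm}$) on the positive integers: $$B^{\pm,0}=\Big\{\prod_{r\in\mathbb Z}(x_{2r}^{\pm})^{(k_r)}\Big\},\quad B^{\pm,1}=\Big\{\prod_{r\in\mathbb Z}(x_{2r+1}^{\pm})^{(k_r)}\Big\},\quad B^{\pm,c}=\Big\{\prod_{r\in\mathbb Z}(X_{2r+1}^{\pm})^{(k_r)}\Big\},$$ $$B^{0,\pm}=\Big\{\prod_{l>0}\tilde h_{\pm l}^{\,k_l}\Big\},\qquad B^{0,0}=\Big\{\binom{h_0}k\binom c{k'}\;\Big|\;k,k'\in\mathbb N\Big\}.$$ In particular $U_{\mathbb Z}^{0,\pm}$ is the polynomial algebra $\mathbb Z[\tilde h_{\pm k}\mid k>0]$. (4) The products $B^{-,1}B^{-,c}B^{-,0}B^{0,-}B^{0,0}B^{0,+}B^{+,1}B^{+,c}B^{+,0}$ form a $\mathbb Z$-basis of $U_{\mathbb Z}$ (distinct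 choices of the nine factors giving distinct basis elements). -/

import Mathlib

noncomputable section

namespace A22

open scoped TensorProduct Nat

/-! ## Integral forms and the commutative constructions over a rational algebra -/

section General

variable {R : Type*} [Ring R] [Algebra ℚ R]

/-- A `ℤ`-subalgebra `S` of a `ℚ`-algebra `R` is an integral form of `R` when it is a free
`ℤ`-module and `ℚ ⊗ S → R`, `q ⊗ s ↦ q • s`, is an isomorphism. -/
def IsIntegralForm (S : Subalgebra ℤ R) : Prop :=
  Module.Free ℤ S ∧ IsBaseChange ℚ S.val.toLinearMap

/-- The family `v` of elements of `R` is a `ℤ`-basis of the `ℤ`-subalgebra `S`. -/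
def IsZBasis {ι : Type*} (v : ι → R) (S : Subalgebra ℤ R) : Prop :=
  LinearIndependent ℤ v ∧ Submodule.span ℤ (Set.range v) = Subalgebra.toSubmodule S

/-- The divided power `a ^ k / k!`. -/
def divPow (a : R) (k : ℕ) : R := ((k ! : ℚ)⁻¹) • a ^ k

/-- The binomial `a (a - 1) ⋯ (a - k + 1) / k!`. -/
def binom (a : R) (k : ℕ) : R := ((k ! : ℚ)⁻¹) • Polynomial.aeval a (descPochhammer ℚ k)

/-- The exponential of a power series `f` with zero constant term. As `f ^ n` is divisible by
`u ^ n`, only the terms `f ^ n / n!` with `n ≤ k` contribute to the coefficient of `u ^ k`. -/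
def expSeries (f : PowerSeries R) : PowerSeries R :=
  PowerSeries.mk fun k => ∑ n ∈ Finset.range (k + 1), ((n ! : ℚ)⁻¹) • PowerSeries.coeff k (f ^ n)

/-- The series `∑ p̂_k u ^ k = exp (∑_{r > 0} (-1) ^ (r - 1) (p_r / r) u ^ r)`.
The value of `p` at `0` is not used. -/
def hatSeries (p : ℕ → R) : PowerSeries R :=
  expSeries (PowerSeries.mk fun r => if r = 0 then 0 else ((-1 : ℚ) ^ (r - 1) / (r : ℚ)) • p r)

/-- `ℤ^(div)[x | x ∈ s]`: the `ℤ`-subalgebra generated by the divided powers of the elements of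
the `ℤ`-span of `s`. -/
def divAlg (s : Set R) : Subalgebra ℤ R :=
  Algebra.adjoin ℤ {y | ∃ a ∈ Submodule.span ℤ s, ∃ k : ℕ, y = divPow a k}

/-- `ℤ^(bin)[x | x ∈ s]`: the `ℤ`-subalgebra generated by the binomials of the elements of
the `ℤ`-span of `s`. -/
def binAlg (s : Set R) : Subalgebra ℤ R :=
  Algebra.adjoin ℤ {y | ∃ a ∈ Submodule.span ℤ s, ∃ k : ℕ, y = binom a k}

/-- `ℤ^(sym)[p_r | r > 0]`: the `ℤ`-subalgebra generated by the `p̂_k` with `k > 0`. -/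
def symAlg (p : ℕ → R) : Subalgebra ℤ R :=
  Algebra.adjoin ℤ {y | ∃ k : ℕ, 0 < k ∧ y = PowerSeries.coeff k (hatSeries p)}

/-- The product of the `f i (k i)` over the support of `k`, in increasing order of `i`. (It is
only used for families of commuting factors, where the order is irrelevant.) -/
def monomialProd {ι : Type*} [LinearOrder ι] (f : ι → ℕ → R) (k : ι →₀ ℕ) : R :=
  ((k.support.sort (· ≤ ·)).map fun i => f i (k i)).prod

/-- The ordered multiplication map `A 0 ⊗ ⋯ ⊗ A (n - 1) → R`, `a₀ ⊗ ⋯ ↦ a₀ a₁ ⋯`,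
for `ℤ`-subalgebras `A i` of `R`. -/
def mulMap {n : ℕ} (A : Fin n → Subalgebra ℤ R) : (⨂[ℤ] i, A i) →ₗ[ℤ] R :=
  PiTensorProduct.lift
    ((MultilinearMap.mkPiAlgebraFin ℤ n R).compLinearMap fun i => (A i).val.toLinearMap)

end General

/-! ## The affine Lie algebra of type `A₂⁽²⁾` and its enveloping algebra -/

/-- The Drinfeld generators. The sign `σ` in the superscript is a unit of `ℤ`;
`X σ m` stands for the element `X_{2m+1}^σ`. -/
inductive Gen : Type
  | c : Gen
  | h (r : ℤ) : Gen
  | x (σ : ℤˣ) (r : ℤ) : Gen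
  | X (σ : ℤˣ) (m : ℤ) : Gen

/-- The free Lie algebra on the Drinfeld generators. -/
abbrev Free : Type := FreeLieAlgebra ℚ Gen

/-- A Drinfeld generator as an element of the free Lie algebra. -/
abbrev gen (g : Gen) : Free := FreeLieAlgebra.of ℚ g

/-- The sign `±1` as a rational number. -/
abbrev sgn (σ : ℤˣ) : ℚ := ((σ : ℤ) : ℚ)

/-- The defining relations; `Rel a b` stands for the relation `a = b`. -/
inductive Rel : Free → Free → Prop
  | c_central (g : Gen) : Rel ⁅gen .c, gen g⁆ 0
  | h_h (r s : ℤ) :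
      Rel ⁅gen (.h r), gen (.h s)⁆
        ((if r + s = 0 then 2 * (r : ℚ) * (2 + (-1 : ℚ) ^ (r - 1)) else 0) • gen .c)
  | h_x (σ : ℤˣ) (r s : ℤ) :
      Rel ⁅gen (.h r), gen (.x σ s)⁆
        ((sgn σ * (2 * (2 + (-1 : ℚ) ^ (r - 1)))) • gen (.x σ (r + s)))
  | h_X_even (σ : ℤˣ) (n m : ℤ) :
      Rel ⁅gen (.h (2 * n)), gen (.X σ m)⁆ ((sgn σ * 4) • gen (.X σ (n + m)))
  | h_X_odd (σ : ℤˣ) (n m : ℤ) :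
      Rel ⁅gen (.h (2 * n + 1)), gen (.X σ m)⁆ 0
  | x_x_even (σ : ℤˣ) (r s : ℤ) (_ : Even (r + s)) :
      Rel ⁅gen (.x σ r), gen (.x σ s)⁆ 0
  | x_x_odd (σ : ℤˣ) (r s m : ℤ) (_ : r + s = 2 * m + 1) :
      Rel ⁅gen (.x σ r), gen (.x σ s)⁆ ((sgn σ * (-1 : ℚ) ^ s) • gen (.X σ m))
  | x_X_same (σ : ℤˣ) (r m : ℤ) : Rel ⁅gen (.x σ r), gen (.X σ m)⁆ 0
  | X_X_same (σ : ℤˣ) (n m : ℤ) : Rel ⁅gen (.X σ n), gen (.X σ m)⁆ 0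
  | x_x_opp (r s : ℤ) :
      Rel ⁅gen (.x 1 r), gen (.x (-1) s)⁆
        (gen (.h (r + s)) + (if r + s = 0 then (r : ℚ) else 0) • gen .c)
  | x_X_opp (σ : ℤˣ) (r m : ℤ) :
      Rel ⁅gen (.x σ r), gen (.X (-σ) m)⁆
        ((sgn σ * ((-1 : ℚ) ^ r * 4)) • gen (.x (-σ) (r + (2 * m + 1))))
  | X_X_opp (n m : ℤ) :
      Rel ⁅gen (.X 1 n), gen (.X (-1) m)⁆
        ((8 : ℚ) • gen (.h ((2 * n + 1) + (2 * m + 1))) +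
          (if (2 * n + 1) + (2 * m + 1) = 0 then 4 * ((2 * n + 1 : ℤ) : ℚ) else 0) • gen .c)

/-- The ideal generated by the defining relations. -/
def relIdeal : LieIdeal ℚ Free :=
  LieSubmodule.lieSpan ℚ Free {y | ∃ a b : Free, Rel a b ∧ y = a - b}

/-- The affine Lie algebra of type `A₂⁽²⁾`, by generators and relations. -/
abbrev LieA22 : Type := Free ⧸ relIdeal

/-- Its universal enveloping algebra. -/
abbrev U : Type := UniversalEnvelopingAlgebra ℚ LieA22

/-- The image of a Drinfeld generator in the enveloping algebra. -/
def toU (g : Gen) : U :=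
  UniversalEnvelopingAlgebra.ι ℚ (LieSubmodule.Quotient.mk (N := relIdeal) (gen g))

/-- The central element `c`. -/
def c : U := toU .c

/-- The element `h_r`. -/
def h (r : ℤ) : U := toU (.h r)

/-- The element `x_r^σ`. -/
def x (σ : ℤˣ) (r : ℤ) : U := toU (.x σ r)

/-- The element `X_{2m+1}^σ`. -/
def X (σ : ℤˣ) (m : ℤ) : U := toU (.X σ m)

/-! ## The integral subalgebras -/

/-- The `ℤ`-subalgebra generated by the divided powers of all `x_r^+` and `x_r^-`. -/
def UZ : Subalgebra ℤ U :=
  Algebra.adjoin ℤ {y | ∃ (σ : ℤˣ) (r : ℤ) (k : ℕ), y = divPow (x σ r) k}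

/-- `ℤ^(div)[x_{2r}^σ | r ∈ ℤ]`. -/
def UZeven (σ : ℤˣ) : Subalgebra ℤ U := divAlg (Set.range fun r : ℤ => x σ (2 * r))

/-- `ℤ^(div)[x_{2r+1}^σ | r ∈ ℤ]`. -/
def UZodd (σ : ℤˣ) : Subalgebra ℤ U := divAlg (Set.range fun r : ℤ => x σ (2 * r + 1))

/-- `ℤ^(div)[X_{2r+1}^σ | r ∈ ℤ]`. -/
def UZc (σ : ℤˣ) : Subalgebra ℤ U := divAlg (Set.range fun r : ℤ => X σ r)

/-- `ℤ^(bin)[h_0, c]`. -/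
def UZzero : Subalgebra ℤ U := binAlg {h 0, c}

/-- `ε_r`, equal to `-1` if `4 ∣ r` and to `1` otherwise. -/
def eps (r : ℕ) : ℚ := if 4 ∣ r then -1 else 1

/-- The elements `ε_r h_{σ r}`. -/
def epsH (σ : ℤˣ) (r : ℕ) : U := eps r • h ((σ : ℤ) * (r : ℤ))

/-- `h̃_{σ k}`, the coefficient of `u ^ k` in `exp (∑_{r > 0} (-1)^(r-1) ε_r h_{σ r} u ^ r / r)`. -/
def hTilde (σ : ℤˣ) (k : ℕ) : U := PowerSeries.coeff k (hatSeries (epsH σ))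

/-- `ℤ^(sym)[ε_r h_{σ r} | r > 0]`. -/
def UZim (σ : ℤˣ) : Subalgebra ℤ U := symAlg (epsH σ)

/-- The nine factors, in order. -/
def factors : Fin 9 → Subalgebra ℤ U :=
  ![UZodd (-1), UZc (-1), UZeven (-1), UZim (-1), UZzero, UZim 1, UZodd 1, UZc 1, UZeven 1]

/-! ## The bases -/

/-- `∏_r (x_{2r}^σ)^(k_r)`. -/
def Beven (σ : ℤˣ) (k : ℤ →₀ ℕ) : U := monomialProd (fun r n => divPow (x σ (2 * r)) n) k

/-- `∏_r (x_{2r+1}^σ)^(k_r)`. -/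
def Bodd (σ : ℤˣ) (k : ℤ →₀ ℕ) : U := monomialProd (fun r n => divPow (x σ (2 * r + 1)) n) k

/-- `∏_r (X_{2r+1}^σ)^(k_r)`. -/
def Bc (σ : ℤˣ) (k : ℤ →₀ ℕ) : U := monomialProd (fun r n => divPow (X σ r) n) k

/-- `∏_{l > 0} h̃_{σ l} ^ (k_l)`. -/
def Bim (σ : ℤˣ) (k : ℕ+ →₀ ℕ) : U := monomialProd (fun (l : ℕ+) n => hTilde σ l ^ n) k

/-- `binom (h_0, k) binom (c, k')`. -/
def Bzero (k : ℕ × ℕ) : U := binom (h 0) k.1 * binom c k.2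

/-- The exponents of the elements of the product of the nine bases. -/
structure Exponents : Type where
  oddMinus : ℤ →₀ ℕ
  cMinus : ℤ →₀ ℕ
  evenMinus : ℤ →₀ ℕ
  imMinus : ℕ+ →₀ ℕ
  zero : ℕ × ℕ
  imPlus : ℕ+ →₀ ℕ
  oddPlus : ℤ →₀ ℕ
  cPlus : ℤ →₀ ℕ
  evenPlus : ℤ →₀ ℕ

/-- The ordered products of elements of the nine bases. -/
def Btotal (k : Exponents) : U :=
  Bodd (-1) k.oddMinus * Bc (-1) k.cMinus * Beven (-1) k.evenMinus *
    Bim (-1) k.imMinus * Bzero k.zero * Bim 1 k.imPlus *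
    Bodd 1 k.oddPlus * Bc 1 k.cPlus * Beven 1 k.evenPlus

end A22

end

noncomputable section

set_option linter.unusedSectionVars false

namespace A22

open scoped Nat
open Finset PowerSeries

/-! ### Summable families of power series over a noncommutative ring -/

section Summation

variable {R : Type*} [Ring R]

/-! The proof has two halves: ℤ-span (straightening) and linear independence (a representation).

Straightening x⁺_r against x⁻_s. Put n = r + s. The elements x⁺_{r+nk}, x⁻_{-r+nk}, h_{nk} and the
matching X's with k ≥ 0 satisfy the uniform relations of a `HalfLoop`, in which x⁺_r is e_0 and x⁻_s
is f_1. The conjugate W(u) = exp(u e_0) exp(t f_1) exp(-u e_0) solves W' = e_0 W - W e_0. A solution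
is written down explicitly as a Gauss decomposition W = N D P into a lower, a Cartan and an upper
factor. The equation for W becomes a system of Riccati type for the parameters of N, D and P
(`HalfLoop.du_gauss`), solved by rational functions whose denominators are powers of a series with
constant term 1 (`nonempty_gaussData`). Integrating in u gives e_0^(k) W_0 = ∑ W_i e_0^(k-i)
(`divPow_mul_eq_sum`), and the coefficient of t^l rewrites (x⁺_r)^(k) (x⁻_s)^(l) in the order lower,
Cartan, upper, with the upper height bounded by k. This bound drives the induction that straightens
arbitrary words (`heightSub_mul_lower_le`).

Integrality of D. The factors N and P are products of divided powers, but D = exp(∑ ψ_k h_{nk}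
(ut)^k) for n ≠ 0, where exp(2ψ) is (1 + w)² for n even and 1 + 2w - w² for n odd. By the theory of
symmetric functions, the coefficients p̂_k attached to a product sequence p_r b_r are integral
polynomials in those attached to p and to b (`coeff_hatSeries_mul_mem`). So D has coefficients in
the ring of the h̃'s once the numerical series exp(∑ ε_{nk} ψ_k w^k) is integral
(`coeff_exp_h_mem`). For odd n this explains the signs: √(1 + 2w - w²) is not integral, but
reversing the sign of every fourth coefficient of its logarithm makes it so
(`expSeries_eps_mem_intSeries`). For n = 0 the factor D is (1 + ut)^(h_0 + rc), which gives
binomials.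

Rearranging the Cartan part. The series of the h̃_k and of the h̃_{-l} commute up to the integral
series ((1 + w)²/(1 - w)⁴)^c. Conjugation by the h̃ series maps x_r to ∑ Θ_j x_{r±j} t^j, where Θ is
integral with even coefficients in odd degree. This parity cancels the denominator 2 of the
Baker–Campbell–Hausdorff formula, so divided powers stay integral (`coeff_divPow_shift_mem`).

The Cartan part lies in `UZ`. The same decompositions are read backwards: W, N and P have
coefficients in `UZ`, hence so does D. Two suitable initial values produce (1 + t)(1 - t⁴)^(1/2) and
1 - t⁴ in the place of exp ψ, and their quotient gives the h̃'s (`hTilde_mem_UZ`). Thus `UZ` is the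
triangular product (`toSubmodule_UZ`).

Independence is proved directly. Quadratic oscillator operators on a polynomial ring represent a
central extension of the loop algebra of 3 × 3 matrices, in which the Drinfeld generators act by
twisted matrices and c acts by 4. Matrix entries and the vacuum value give functionals dual to the
generators. Iterating them along the comultiplication separates words up to permutation
(`pairing_word`), so ordered monomials are independent over ℚ. Exchanging, one factor at a time,
monomials in the h's for monomials in the h̃'s and powers for binomials yields the independence of
`Btotal`. Everything else is formal. -/

theorem coeff_mul_eq_zero_of_lt {f g : PowerSeries R} {i j : ℕ} (hf : ∀ m < i, coeff m f = 0)
    (hg : ∀ m < j, coeff m g = 0) (m : ℕ) (hm : m < i + j) : coeff m (f * g) = 0 := by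
  rw [coeff_mul]
  refine sum_eq_zero fun p hp => ?_
  rw [HasAntidiagonal.mem_antidiagonal] at hp
  by_cases h : p.1 < i
  · rw [hf _ h, zero_mul]
  · rw [hg _ (by omega), mul_zero]

theorem coeff_pow_eq_zero_of_lt {f : PowerSeries R} (hf : constantCoeff f = 0) (n : ℕ) :
    ∀ m < n, coeff m (f ^ n) = 0 := by
  induction n with
  | zero => intro m hm; omega
  | succ n ih =>
    rw [pow_succ]
    refine fun m hm => coeff_mul_eq_zero_of_lt ih (j := 1) (fun l hl => ?_) m hm
    obtain rfl : l = 0 := by omega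
    simpa using hf

/-- The `n`-th term of the sequence is divisible by the `n`-th power of the variable. -/
def Summable (a : ℕ → PowerSeries R) : Prop := ∀ n, ∀ m < n, coeff m (a n) = 0

/-- The sum of a sequence of power series that is summable in the sense of `A22.Summable`. -/
def ssum (a : ℕ → PowerSeries R) : PowerSeries R :=
  PowerSeries.mk fun k => ∑ n ∈ range (k + 1), coeff k (a n)

theorem coeff_ssum {a : ℕ → PowerSeries R} (ha : Summable a) {k N : ℕ} (hN : k < N) :
    coeff k (ssum a) = ∑ n ∈ range N, coeff k (a n) := by
  rw [ssum, coeff_mk]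
  refine sum_subset (fun i hi => by simp at *; omega) fun i _ hi => ha i k ?_
  simp at hi; omega

theorem ssum_mul_ssum {a b : ℕ → PowerSeries R} (ha : Summable a) (hb : Summable b) :
    ssum a * ssum b = ssum fun n => ∑ p ∈ antidiagonal n, a p.1 * b p.2 := by
  ext k
  have h1 : coeff k (ssum a * ssum b) =
      ∑ q ∈ range (k + 1) ×ˢ range (k + 1), coeff k (a q.1 * b q.2) := by
    simp_rw [coeff_mul]
    rw [sum_comm]
    refine sum_congr rfl fun p hp => ?_
    rw [HasAntidiagonal.mem_antidiagonal] at hp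
    rw [coeff_ssum ha (N := k + 1) (by omega), coeff_ssum hb (N := k + 1) (by omega),
      sum_mul_sum, sum_product]
  rw [h1, ssum, coeff_mk]
  simp_rw [map_sum]
  -- Pairs with i + j > k contribute nothing in degree k, so the square of indices may be cut down
  -- to the triangle.
  have h2 : ∑ q ∈ range (k + 1) ×ˢ range (k + 1), coeff k (a q.1 * b q.2) =
      ∑ q ∈ (range (k + 1) ×ˢ range (k + 1)).filter (fun q => q.1 + q.2 ∈ range (k + 1)),
        coeff k (a q.1 * b q.2) := by
    symm
    refine sum_subset (filter_subset _ _) fun q hq hq' => ?_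
    refine coeff_mul_eq_zero_of_lt (ha q.1) (hb q.2) k ?_
    have := mt (fun h => mem_filter.2 ⟨hq, h⟩) hq'
    rw [mem_range] at this
    omega
  rw [h2, ← sum_fiberwise_of_maps_to (t := range (k + 1)) (g := fun q : ℕ × ℕ => q.1 + q.2)]
  · refine sum_congr rfl fun n hn => sum_congr ?_ fun _ _ => rfl
    ext q
    simp only [mem_filter, mem_product, mem_range, HasAntidiagonal.mem_antidiagonal] at *
    omega
  · intro q hq
    exact (mem_filter.1 hq).2

theorem mul_ssum (c : PowerSeries R) {a : ℕ → PowerSeries R} (ha : Summable a) :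
    c * ssum a = ssum fun n => c * a n := by
  ext k
  rw [coeff_mul, ssum.eq_def fun n => c * a n, coeff_mk]
  simp_rw [coeff_mul]
  rw [sum_comm]
  refine sum_congr rfl fun p hp => ?_
  rw [HasAntidiagonal.mem_antidiagonal] at hp
  rw [coeff_ssum ha (N := k + 1) (by omega), mul_sum]

theorem ssum_congr {a b : ℕ → PowerSeries R} (h : ∀ n, a n = b n) : ssum a = ssum b := by
  rw [funext h]

/-- An additive map satisfying the Leibniz rule. -/
structure IsLeibniz (δ : R →+ R) : Prop where
  leibniz : ∀ a b, δ (a * b) = δ a * b + a * δ b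

/-- The coefficientwise application of an additive map. -/
def cmap {S T : Type*} [Ring S] [Ring T] (δ : S →+ T) : PowerSeries S →+ PowerSeries T where
  toFun f := PowerSeries.mk fun k => δ (coeff k f)
  map_zero' := by ext; simp
  map_add' f g := by ext; simp

@[simp] theorem coeff_cmap {S T : Type*} [Ring S] [Ring T] (δ : S →+ T) (f : PowerSeries S)
    (k : ℕ) : coeff k (cmap δ f) = δ (coeff k f) := by simp [cmap]

theorem cmap_mul {δ : R →+ R} (hδ : IsLeibniz δ) (f g : PowerSeries R) :
    cmap δ (f * g) = cmap δ f * g + f * cmap δ g := by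
  ext k
  simp only [coeff_cmap, coeff_mul, map_add, map_sum, hδ.leibniz, sum_add_distrib]

theorem cmap_one {δ : R →+ R} (hδ : IsLeibniz δ) : cmap δ (1 : PowerSeries R) = 0 := by
  have := cmap_mul hδ 1 1
  simpa using this

theorem cmap_pow_succ {δ : R →+ R} (hδ : IsLeibniz δ) {A : PowerSeries R}
    (h : Commute A (cmap δ A)) (n : ℕ) :
    cmap δ (A ^ (n + 1)) = (n + 1) • (A ^ n * cmap δ A) := by
  induction n with
  | zero => simp
  | succ n ih =>
    rw [pow_succ, cmap_mul hδ, ih, smul_mul_assoc, mul_assoc, ← h.eq, ← mul_assoc, ← pow_succ,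
      succ_nsmul (A ^ (n + 1) * _) (n + 1)]

end Summation

/-! ### Exponentials of power series and conjugation by them -/

section Exp

variable {R : Type*} [Ring R] [Algebra ℚ R]

theorem expSeries_eq_ssum (f : PowerSeries R) :
    expSeries f = ssum fun n => ((n ! : ℚ)⁻¹) • f ^ n := by
  ext k
  simp [expSeries, ssum]

theorem summable_exp {f : PowerSeries R} (hf : constantCoeff f = 0) :
    Summable fun n => ((n ! : ℚ)⁻¹) • f ^ n := fun n m hm => by
  simp [coeff_pow_eq_zero_of_lt hf n m hm]

theorem coeff_expSeries {f : PowerSeries R} (hf : constantCoeff f = 0) {k N : ℕ} (hN : k < N) :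
    coeff k (expSeries f) = ∑ n ∈ range N, ((n ! : ℚ)⁻¹) • coeff k (f ^ n) := by
  rw [expSeries_eq_ssum, coeff_ssum (summable_exp hf) hN]
  simp

@[simp] theorem constantCoeff_expSeries (f : PowerSeries R) : constantCoeff (expSeries f) = 1 := by
  rw [← coeff_zero_eq_constantCoeff_apply, expSeries, coeff_mk]
  simp

@[simp] theorem expSeries_zero : expSeries (0 : PowerSeries R) = 1 := by
  ext k
  rw [expSeries, coeff_mk, sum_range_succ', sum_eq_zero]
  · simp
  · intro i _; simp

theorem inv_factorial_mul_choose (i j : ℕ) :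
    (((i + j) ! : ℕ) : ℚ)⁻¹ * ((i + j).choose i : ℕ) = ((i ! : ℕ) : ℚ)⁻¹ * ((j ! : ℕ) : ℚ)⁻¹ := by
  have h := congrArg (Nat.cast (R := ℚ)) (Nat.add_choose_mul_factorial_mul_factorial i j)
  rw [← Nat.choose_symm_add] at h
  push_cast at h
  field_simp
  linarith

theorem inv_factorial_smul_add_pow {A B : PowerSeries R} (h : Commute A B) (n : ℕ) :
    ((n ! : ℚ)⁻¹) • (A + B) ^ n =
      ∑ p ∈ antidiagonal n, (((p.1 ! : ℚ)⁻¹) • A ^ p.1) * (((p.2 ! : ℚ)⁻¹) • B ^ p.2) := by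
  rw [h.add_pow', smul_sum]
  refine sum_congr rfl fun p hp => ?_
  rw [HasAntidiagonal.mem_antidiagonal] at hp
  rw [smul_mul_smul_comm, ← Nat.cast_smul_eq_nsmul ℚ, smul_smul]
  congr 1
  rw [← hp, inv_factorial_mul_choose]

theorem expSeries_add {A B : PowerSeries R} (h : Commute A B) (hA : constantCoeff A = 0)
    (hB : constantCoeff B = 0) : expSeries (A + B) = expSeries A * expSeries B := by
  rw [expSeries_eq_ssum A, expSeries_eq_ssum B, ssum_mul_ssum (summable_exp hA) (summable_exp hB),
    expSeries_eq_ssum]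
  exact ssum_congr fun n => inv_factorial_smul_add_pow h n

theorem expSeries_mul_expSeries_neg {A : PowerSeries R} (hA : constantCoeff A = 0) :
    expSeries A * expSeries (-A) = 1 := by
  rw [← expSeries_add (Commute.neg_right (Commute.refl A)) hA (by simp [hA])]
  simp

theorem expSeries_neg_mul_expSeries {A : PowerSeries R} (hA : constantCoeff A = 0) :
    expSeries (-A) * expSeries A = 1 := by
  rw [← expSeries_add (Commute.neg_left (Commute.refl A)) (by simp [hA]) hA]
  simp

/-- Each commutator with `A`, which has no constant term, raises the order by at least one. This
makes infinite chains of iterated commutators summable. -/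
theorem summable_chain {A : PowerSeries R} (hA : constantCoeff A = 0) {Y : ℕ → PowerSeries R}
    (h : ∀ j, Y j * A = A * Y j + Y (j + 1)) : Summable Y := by
  intro n
  have hA' : ∀ m < 1, coeff m A = 0 := fun m hm => by
    obtain rfl : m = 0 := by omega
    simpa using hA
  induction n with
  | zero => intro m hm; omega
  | succ n ih =>
    intro m hm
    have e : Y (n + 1) = Y n * A - A * Y n := by rw [h]; abel
    rw [e, map_sub, coeff_mul_eq_zero_of_lt ih hA' m hm,
      coeff_mul_eq_zero_of_lt hA' ih m (by omega), sub_zero]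

/-- Right multiplication by `A` is left multiplication by `A` plus the shift along the chain. These
two operations commute, so their sum obeys the binomial formula. -/
theorem chain_mul_pow {A : PowerSeries R} {Y : ℕ → PowerSeries R}
    (h : ∀ j, Y j * A = A * Y j + Y (j + 1)) (n i : ℕ) :
    Y i * A ^ n = ∑ p ∈ antidiagonal n, n.choose p.1 • (A ^ p.1 * Y (i + p.2)) := by
  induction n generalizing i with
  | zero => simp
  | succ n ih =>
    rw [pow_succ', ← mul_assoc, h, add_mul, mul_assoc, ih, ih,
      Finset.sum_antidiagonal_choose_succ_nsmul (fun a b => A ^ a * Y (i + b)) n, mul_sum,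
      add_comm]
    congr 1
    · refine sum_congr rfl fun p hp => ?_
      rw [HasAntidiagonal.mem_antidiagonal] at hp
      rw [show i + 1 + p.2 = i + (p.2 + 1) by ring]
    · refine sum_congr rfl fun p hp => ?_
      rw [HasAntidiagonal.mem_antidiagonal] at hp
      rw [mul_smul_comm, ← mul_assoc, ← pow_succ', Nat.choose_symm_of_eq_add hp.symm]

/-- Conjugation by an exponential: the `Y j` are the iterated commutators of `Y 0` with `A`. -/
theorem mul_expSeries_of_chain {A : PowerSeries R} (hA : constantCoeff A = 0)
    {Y : ℕ → PowerSeries R} (h : ∀ j, Y j * A = A * Y j + Y (j + 1)) :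
    Y 0 * expSeries A = expSeries A * ssum fun j => ((j ! : ℚ)⁻¹) • Y j := by
  have hY : Summable fun j => ((j ! : ℚ)⁻¹) • Y j := fun n m hm => by
    simp [summable_chain hA h n m hm]
  rw [expSeries_eq_ssum, ssum_mul_ssum (summable_exp hA) hY, mul_ssum _ (summable_exp hA)]
  refine ssum_congr fun n => ?_
  rw [mul_smul_comm, chain_mul_pow h, smul_sum]
  refine sum_congr rfl fun p hp => ?_
  rw [HasAntidiagonal.mem_antidiagonal] at hp
  rw [smul_mul_smul_comm, zero_add, ← Nat.cast_smul_eq_nsmul ℚ, smul_smul]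
  congr 1
  rw [← hp, inv_factorial_mul_choose]

/-- A finite form of `mul_expSeries_of_chain`. -/
theorem mul_expSeries_of_chain_three {A Y₀ Y₁ Y₂ Y₃ : PowerSeries R} (hA : constantCoeff A = 0)
    (h₀ : Y₀ * A = A * Y₀ + Y₁) (h₁ : Y₁ * A = A * Y₁ + Y₂) (h₂ : Y₂ * A = A * Y₂ + Y₃)
    (h₃ : Y₃ * A = A * Y₃) :
    Y₀ * expSeries A =
      expSeries A * (Y₀ + Y₁ + (2⁻¹ : ℚ) • Y₂ + (6⁻¹ : ℚ) • Y₃) := by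
  let Y : ℕ → PowerSeries R := fun j => match j with
    | 0 => Y₀ | 1 => Y₁ | 2 => Y₂ | 3 => Y₃ | _ + 4 => 0
  have hc : ∀ j, Y j * A = A * Y j + Y (j + 1) := fun j => match j with
    | 0 => h₀ | 1 => h₁ | 2 => h₂ | 3 => by simpa [Y] using h₃ | _ + 4 => by simp [Y]
  rw [show Y₀ = Y 0 from rfl, mul_expSeries_of_chain hA hc]
  congr 1
  ext k
  have hY : Summable fun j => ((j ! : ℚ)⁻¹) • Y j := fun n m hm => by
    simp [summable_chain hA hc n m hm]
  rw [coeff_ssum hY (N := k + 4) (by omega), add_comm k 4, sum_range_add]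
  simp [sum_range_succ, Y, Nat.factorial, add_comm 4]

theorem commute_expSeries {A Y : PowerSeries R} (hA : constantCoeff A = 0) (h : Commute Y A) :
    Commute Y (expSeries A) := by
  have := mul_expSeries_of_chain_three (Y₀ := Y) (Y₁ := 0) (Y₂ := 0) (Y₃ := 0) hA
    (by simpa using h.eq) (by simp) (by simp) (by simp)
  simpa [Commute, SemiconjBy] using this

theorem map_expSeries {S : Type*} [Ring S] [Algebra ℚ S] (ρ : R →+* S) (f : PowerSeries R) :
    PowerSeries.map ρ (expSeries f) = expSeries (PowerSeries.map ρ f) := by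
  ext k
  simp only [expSeries, coeff_map, coeff_mk, map_sum, map_rat_smul, ← map_pow]

theorem cmap_expSeries {δ : R →+ R} (hδ : IsLeibniz δ) {A : PowerSeries R}
    (hA : constantCoeff A = 0) (h : Commute A (cmap δ A)) :
    cmap δ (expSeries A) = expSeries A * cmap δ A := by
  have h1 : ∀ k, coeff k (cmap δ (expSeries A)) =
      coeff k ((∑ n ∈ range (k + 1), ((n ! : ℚ)⁻¹) • A ^ n) * cmap δ A) := by
    intro k
    rw [coeff_cmap, coeff_expSeries hA (N := k + 2) (by omega), map_sum, sum_range_succ']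
    have h0 : δ (((0 ! : ℚ)⁻¹) • coeff k (A ^ 0)) = 0 := by
      have := congrArg (coeff k) (cmap_one hδ)
      simpa using this
    rw [h0, add_zero, sum_mul, map_sum]
    refine sum_congr rfl fun n _ => ?_
    rw [map_rat_smul, ← coeff_cmap, cmap_pow_succ hδ h, smul_mul_assoc, map_nsmul, coeff_smul,
      ← Nat.cast_smul_eq_nsmul ℚ, smul_smul]
    congr 1
    rw [Nat.factorial_succ]
    push_cast
    field_simp
  ext k
  rw [h1, coeff_mul, coeff_mul]
  refine sum_congr rfl fun p hp => ?_
  rw [HasAntidiagonal.mem_antidiagonal] at hp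
  rw [coeff_expSeries hA (N := k + 1) (by omega)]
  simp

end Exp

/-! ### Commutative exponentials: differential equations and logarithms -/

section CommExp

variable {R : Type*} [CommRing R] [Algebra ℚ R]

theorem derivative_expSeries {A : PowerSeries R} (hA : constantCoeff A = 0) :
    derivative R (expSeries A) = expSeries A * derivative R A := by
  ext k
  have h1 : coeff k (derivative R (expSeries A)) =
      coeff k (derivative R (∑ n ∈ range (k + 2), ((n ! : ℚ)⁻¹) • A ^ n)) := by
    rw [coeff_derivative, coeff_derivative, coeff_expSeries hA (N := k + 2) (by omega)]
    simp
  have h2 : derivative R (∑ n ∈ range (k + 2), ((n ! : ℚ)⁻¹) • A ^ n) =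
      (∑ n ∈ range (k + 1), ((n ! : ℚ)⁻¹) • A ^ n) * derivative R A := by
    rw [map_sum, sum_range_succ', sum_mul]
    have h0 : derivative R (((0 ! : ℚ)⁻¹) • A ^ 0) = 0 := by simp
    rw [h0, add_zero]
    refine sum_congr rfl fun n _ => ?_
    rw [map_rat_smul (derivative R), derivative_pow, Nat.factorial_succ, Nat.add_sub_cancel,
      mul_assoc, ← nsmul_eq_mul, ← Nat.cast_smul_eq_nsmul ℚ, smul_smul, smul_mul_assoc]
    congr 1
    push_cast
    field_simp
  rw [h1, h2, coeff_mul, coeff_mul]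
  refine sum_congr rfl fun p hp => ?_
  rw [HasAntidiagonal.mem_antidiagonal] at hp
  rw [coeff_expSeries hA (N := k + 1) (by omega)]
  simp

/-- The equation determines the coefficients recursively, since k + 1 is invertible in a ℚ-algebra.
-/
theorem eq_of_derivative_eq {F G A : PowerSeries R} (h0 : constantCoeff F = constantCoeff G)
    (hF : derivative R F = F * A) (hG : derivative R G = G * A) : F = G := by
  have key : ∀ k, ∀ m ≤ k, coeff m F = coeff m G := by
    intro k
    induction k with
    | zero => intro m hm; obtain rfl : m = 0 := by omega
              simpa using h0
    | succ k ih =>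
      intro m hm
      rcases Nat.lt_or_ge m (k + 1) with h | h
      · exact ih m (by omega)
      obtain rfl : m = k + 1 := by omega
      have e : coeff k (derivative R F) = coeff k (derivative R G) := by
        rw [hF, hG, coeff_mul, coeff_mul]
        refine sum_congr rfl fun p hp => ?_
        rw [HasAntidiagonal.mem_antidiagonal] at hp
        rw [ih p.1 (by omega)]
      rw [coeff_derivative, coeff_derivative] at e
      have hu : IsUnit ((k : R) + 1) := by
        have : ((k : R) + 1) = algebraMap ℚ R (k + 1) := by simp
        rw [this]
        exact (IsUnit.mk0 _ (by positivity)).map _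
      exact hu.mul_right_cancel e
  ext k
  exact key k k le_rfl

theorem eq_expSeries {F A : PowerSeries R} (hA : constantCoeff A = 0) (h0 : constantCoeff F = 1)
    (hF : derivative R F = F * derivative R A) : F = expSeries A :=
  eq_of_derivative_eq (by simp [h0]) hF (derivative_expSeries hA)

theorem exists_derivative_eq (B : PowerSeries R) :
    ∃ A : PowerSeries R, constantCoeff A = 0 ∧ derivative R A = B := by
  refine ⟨PowerSeries.mk fun k => match k with
    | 0 => 0 | k + 1 => ((k + 1 : ℚ)⁻¹) • coeff k B, by simp [← coeff_zero_eq_constantCoeff_apply], ?_⟩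
  ext k
  rw [coeff_derivative, coeff_mk]
  have : ((k : R) + 1) = algebraMap ℚ R (k + 1) := by simp
  rw [this, mul_comm, ← Algebra.smul_def, smul_smul, mul_inv_cancel₀ (by positivity), one_smul]

theorem isUnit_of_constantCoeff_eq_one {E : PowerSeries R} (h : constantCoeff E = 1) :
    IsUnit E := by
  rw [isUnit_iff_constantCoeff, h]; exact isUnit_one

/-- The logarithm is the antiderivative of the logarithmic derivative E⁻¹ E'. -/
theorem exists_expSeries_eq {E : PowerSeries R} (h : constantCoeff E = 1) :
    ∃ A : PowerSeries R, constantCoeff A = 0 ∧ expSeries A = E := by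
  obtain ⟨u, rfl⟩ := isUnit_of_constantCoeff_eq_one h
  obtain ⟨A, hA, hA'⟩ := exists_derivative_eq ((↑u⁻¹ : PowerSeries R) * derivative R (u : PowerSeries R))
  exact ⟨A, hA, (eq_expSeries hA h (by rw [hA', ← mul_assoc]; simp)).symm⟩

theorem expSeries_injective {A B : PowerSeries R} (hA : constantCoeff A = 0)
    (hB : constantCoeff B = 0) (h : expSeries A = expSeries B) : A = B := by
  have h1 := derivative_expSeries hA
  have h2 := derivative_expSeries hB
  have hu := isUnit_of_constantCoeff_eq_one (constantCoeff_expSeries A)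
  rw [← h, h1] at h2
  have : IsAddTorsionFree R := IsAddTorsionFree.of_module_rat R
  exact derivative.ext (hu.mul_left_cancel h2) (by rw [hA, hB])

theorem rescale_expSeries (a : R) (f : PowerSeries R) :
    rescale a (expSeries f) = expSeries (rescale a f) := by
  ext k
  simp only [expSeries, coeff_rescale, coeff_mk, ← map_pow, mul_sum, mul_smul_comm]

end CommExp

/-! ### Divided powers -/

section DivPow

variable {R : Type*} [Ring R] [Algebra ℚ R]

@[simp] theorem divPow_zero (a : R) : divPow a 0 = 1 := by simp [divPow]

@[simp] theorem divPow_one (a : R) : divPow a 1 = a := by simp [divPow]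

theorem divPow_zero_left (n : ℕ) : divPow (0 : R) (n + 1) = 0 := by simp [divPow]

theorem succ_smul_divPow_succ (a : R) (n : ℕ) :
    ((n + 1 : ℕ) : ℚ) • divPow a (n + 1) = a * divPow a n := by
  rw [divPow, divPow, smul_smul, mul_smul_comm, ← pow_succ', Nat.factorial_succ]
  congr 1
  push_cast
  field_simp

theorem divPow_mul_divPow (a : R) (i j : ℕ) :
    divPow a i * divPow a j = (i + j).choose i • divPow a (i + j) := by
  rw [divPow, divPow, divPow, smul_mul_smul_comm, ← pow_add, ← Nat.cast_smul_eq_nsmul ℚ, smul_smul,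
    mul_comm (((i + j).choose i : ℕ) : ℚ), inv_factorial_mul_choose]

theorem divPow_add {a b : R} (h : Commute a b) (n : ℕ) :
    divPow (a + b) n = ∑ p ∈ antidiagonal n, divPow a p.1 * divPow b p.2 := by
  rw [divPow, h.add_pow', smul_sum]
  refine sum_congr rfl fun p hp => ?_
  rw [HasAntidiagonal.mem_antidiagonal] at hp
  rw [divPow, divPow, smul_mul_smul_comm, ← Nat.cast_smul_eq_nsmul ℚ, smul_smul]
  congr 1
  rw [← hp, inv_factorial_mul_choose]

theorem divPow_smul_int (z : ℤ) (a : R) (n : ℕ) : divPow (z • a) n = z ^ n • divPow a n := by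
  rw [divPow, divPow, smul_pow, smul_comm]

theorem _root_.Commute.divPow_right {a b : R} (h : Commute a b) (n : ℕ) : Commute a (divPow b n) :=
  (h.pow_right n).smul_right _

theorem _root_.Commute.divPow_divPow {a b : R} (h : Commute a b) (m n : ℕ) :
    Commute (divPow a m) (divPow b n) :=
  (Commute.divPow_right (Commute.divPow_right h n).symm m).symm

theorem map_divPow {S : Type*} [Ring S] [Algebra ℚ S] (ρ : R →+* S) (a : R) (n : ℕ) :
    ρ (divPow a n) = divPow (ρ a) n := by
  rw [divPow, divPow, map_rat_smul, map_pow]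

theorem divPow_conj {Y E Z : R} (h : Y * E = E * Z) (n : ℕ) : divPow Y n * E = E * divPow Z n := by
  have : Y ^ n * E = E * Z ^ n := (SemiconjBy.pow_right (a := E) (x := Z) (y := Y) h.symm n).symm
  rw [divPow, divPow, smul_mul_assoc, this, mul_smul_comm]

theorem expSeries_conj {Y E Z : PowerSeries R} (hY : constantCoeff Y = 0)
    (hZ : constantCoeff Z = 0) (h : Y * E = E * Z) : expSeries Y * E = E * expSeries Z := by
  ext k
  rw [coeff_mul, coeff_mul]
  have e1 : ∀ p ∈ antidiagonal k, coeff p.1 (expSeries Y) * coeff p.2 E =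
      coeff p.1 (∑ n ∈ range (k + 1), divPow Y n) * coeff p.2 E := fun p hp => by
    rw [HasAntidiagonal.mem_antidiagonal] at hp
    rw [coeff_expSeries hY (N := k + 1) (by omega)]; simp [divPow]
  have e2 : ∀ p ∈ antidiagonal k, coeff p.1 E * coeff p.2 (expSeries Z) =
      coeff p.1 E * coeff p.2 (∑ n ∈ range (k + 1), divPow Z n) := fun p hp => by
    rw [HasAntidiagonal.mem_antidiagonal] at hp
    rw [coeff_expSeries hZ (N := k + 1) (by omega)]; simp [divPow]
  rw [sum_congr rfl e1, sum_congr rfl e2, ← coeff_mul, ← coeff_mul, sum_mul, mul_sum]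
  simp_rw [divPow_conj h]

/-- Two exponentials with a commutator that commutes with both arguments. -/
theorem expSeries_mul_expSeries_of_commutator {A B C : PowerSeries R} (hA : constantCoeff A = 0)
    (hB : constantCoeff B = 0) (h : A * B = B * A + C) (hAC : Commute A C) (hBC : Commute B C) :
    expSeries A * expSeries B = expSeries B * (expSeries A * expSeries C) := by
  have hC : constantCoeff C = 0 := by
    have : C = A * B - B * A := by rw [h]; abel
    rw [this]; simp [hA, hB]
  have h1 := mul_expSeries_of_chain_three (A := B) (Y₀ := A) (Y₁ := C) (Y₂ := 0) (Y₃ := 0) hB h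
    (by rw [add_zero]; exact hBC.eq.symm) (by simp) (by simp)
  simp only [smul_zero, add_zero] at h1
  rw [expSeries_conj hA (by simp [hA, hC]) h1, expSeries_add hAC hA hC]

/-- With this, identities among divided powers can be read off from identities among exponentials in
one auxiliary variable. -/
theorem coeff_expSeries_X_mul_C (a : R) (n : ℕ) :
    coeff n (expSeries (PowerSeries.X * PowerSeries.C a)) = divPow a n := by
  rw [coeff_expSeries (by simp) (N := n + 1) (by omega), sum_range_succ, sum_eq_zero]
  · rw [((PowerSeries.commute_X (PowerSeries.C a)).symm).mul_pow]
    rw [zero_add, ← map_pow PowerSeries.C, coeff_X_pow_mul', if_pos le_rfl, Nat.sub_self]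
    simp [divPow]
  · intro i hi
    rw [((PowerSeries.commute_X (PowerSeries.C a)).symm).mul_pow, ← map_pow PowerSeries.C,
      coeff_X_pow_mul']
    have : n - i ≠ 0 := by simp at hi; omega
    split_ifs
    · rw [coeff_C, if_neg this, smul_zero]
    · rw [smul_zero]

end DivPow

/-! ### The Baker–Campbell–Hausdorff formula for a central commutator -/

section BCH

variable {R : Type*} [Ring R] [Algebra ℚ R]

/-- The Euler derivation `f ↦ X f'`. -/
def euler (f : PowerSeries R) : PowerSeries R := PowerSeries.mk fun k => k • coeff k f

theorem euler_mul (f g : PowerSeries R) : euler (f * g) = euler f * g + f * euler g := by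
  ext k
  simp only [euler, coeff_mk, coeff_mul, map_add, smul_sum, ← sum_add_distrib]
  refine sum_congr rfl fun p hp => ?_
  rw [HasAntidiagonal.mem_antidiagonal] at hp
  rw [smul_mul_assoc, mul_smul_comm, ← add_smul, hp]

theorem euler_pow_succ {A : PowerSeries R} (h : Commute A (euler A)) (n : ℕ) :
    euler (A ^ (n + 1)) = (n + 1) • (A ^ n * euler A) := by
  induction n with
  | zero => simp
  | succ n ih =>
    rw [pow_succ, euler_mul, ih, smul_mul_assoc, mul_assoc, ← h.eq, ← mul_assoc, ← pow_succ,
      succ_nsmul (A ^ (n + 1) * _) (n + 1)]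

theorem euler_expSeries {A : PowerSeries R} (hA : constantCoeff A = 0)
    (h : Commute A (euler A)) : euler (expSeries A) = expSeries A * euler A := by
  ext k
  have h1 : coeff k (euler (expSeries A)) = ∑ n ∈ range (k + 2), ((n ! : ℚ)⁻¹) •
      coeff k (euler (A ^ n)) := by
    rw [euler, coeff_mk, coeff_expSeries hA (N := k + 2) (by omega), smul_sum]
    refine sum_congr rfl fun n _ => ?_
    rw [euler, coeff_mk, smul_comm]
  rw [h1, sum_range_succ', coeff_mul]
  have h0 : ((0 ! : ℚ)⁻¹) • coeff k (euler (A ^ 0)) = 0 := by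
    simp only [euler, coeff_mk, pow_zero, coeff_one]
    split_ifs with h <;> simp [h]
  rw [h0, add_zero]
  have e : ∀ p ∈ antidiagonal k, coeff p.1 (expSeries A) * coeff p.2 (euler A) =
      ∑ n ∈ range (k + 1), ((n ! : ℚ)⁻¹) • (coeff p.1 (A ^ n) * coeff p.2 (euler A)) := by
    intro p hp
    rw [HasAntidiagonal.mem_antidiagonal] at hp
    rw [coeff_expSeries hA (N := k + 1) (by omega), sum_mul]
    simp
  rw [sum_congr rfl e, sum_comm]
  refine sum_congr rfl fun n _ => ?_
  rw [euler_pow_succ h, ← smul_sum, ← coeff_mul, map_nsmul, ← Nat.cast_smul_eq_nsmul ℚ, smul_smul]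
  congr 1
  rw [Nat.factorial_succ]
  push_cast
  field_simp

/-- The Baker–Campbell–Hausdorff formula when the commutator `a b - b a = -2 z` is central. -/
theorem expSeries_X_mul_C_add {a b z : R} (h : b * a = a * b + (2 : ℕ) • z) (haz : Commute a z)
    (hbz : Commute b z) :
    expSeries (PowerSeries.X * PowerSeries.C (a + b)) =
      expSeries (PowerSeries.X * PowerSeries.C a) * expSeries (PowerSeries.X * PowerSeries.C b) *
        expSeries (PowerSeries.X ^ 2 * PowerSeries.C z) := by
  set A : PowerSeries R := PowerSeries.X * PowerSeries.C a with hA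
  set B : PowerSeries R := PowerSeries.X * PowerSeries.C b with hB
  set Z : PowerSeries R := PowerSeries.X ^ 2 * PowerSeries.C z with hZ
  have cA : constantCoeff A = 0 := by simp [hA]
  have cB : constantCoeff B = 0 := by simp [hB]
  have cZ : constantCoeff Z = 0 := by simp [hZ]
  have eA : euler A = A := by
    ext k; rw [euler, coeff_mk, hA]
    rcases k with _ | _ | k <;> simp [coeff_X]
  have eB : euler B = B := by
    ext k; rw [euler, coeff_mk, hB]
    rcases k with _ | _ | k <;> simp [coeff_X]
  have eZ : euler Z = (2 : ℕ) • Z := by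
    ext k; rw [euler, coeff_mk, map_nsmul, hZ, PowerSeries.coeff_X_pow_mul']
    rcases k with _ | _ | _ | k <;> simp [coeff_C]
  have hAZ : Commute A Z := by
    have h1 : Commute (PowerSeries.C a) (PowerSeries.C z : PowerSeries R) := haz.map PowerSeries.C
    refine Commute.mul_left ?_ ?_
    · exact PowerSeries.X_mul
    · exact Commute.mul_right ((PowerSeries.commute_X _).pow_right 2) h1
  have hBZ : Commute B Z := by
    have h1 : Commute (PowerSeries.C b) (PowerSeries.C z : PowerSeries R) := hbz.map PowerSeries.C
    refine Commute.mul_left ?_ ?_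
    · exact PowerSeries.X_mul
    · exact Commute.mul_right ((PowerSeries.commute_X _).pow_right 2) h1
  have hBA : B * A = A * B + (2 : ℕ) • Z := by
    have e1 : ∀ p q : R, (PowerSeries.X * PowerSeries.C p) * (PowerSeries.X * PowerSeries.C q) =
        PowerSeries.X ^ 2 * (PowerSeries.C (p * q) : PowerSeries R) := fun p q => by
      rw [mul_assoc, ← mul_assoc (PowerSeries.C p), (PowerSeries.commute_X (PowerSeries.C p)).eq,
        map_mul, pow_two]
      simp only [mul_assoc]
    rw [hA, hB, e1, e1, h, hZ, map_add, map_nsmul, mul_add, mul_smul_comm]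
  have hG := mul_expSeries_of_chain_three (A := A) (Y₀ := B) (Y₁ := (2 : ℕ) • Z) (Y₂ := 0)
    (Y₃ := 0) cA hBA (by rw [add_zero]; exact ((hAZ.smul_right 2).eq).symm) (by simp) (by simp)
  simp only [smul_zero, add_zero] at hG
  -- The product solves the Euler equation with multiplier A + B. Moving B leftwards to its place
  -- between exp A and exp B, or back, costs 2 Z, which is exactly the contribution of the
  -- derivative of exp Z. The equation and the constant term 1 determine all coefficients.
  have key : euler (expSeries A * expSeries B * expSeries Z) =
      (A + B) * (expSeries A * expSeries B * expSeries Z) := by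
    have c1 : Commute A (expSeries A) := commute_expSeries cA (Commute.refl A)
    have c2 : Commute B (expSeries B) := commute_expSeries cB (Commute.refl B)
    have c3 : Commute Z (expSeries B) := commute_expSeries cB hBZ.symm
    have c4 : Commute Z (expSeries Z) := commute_expSeries cZ (Commute.refl Z)
    rw [euler_mul, euler_mul, euler_expSeries cA (by rw [eA]), euler_expSeries cB (by rw [eB]),
      euler_expSeries cZ (by rw [eZ]; exact (Commute.refl Z).smul_right 2), eA, eB, eZ, add_mul A B,
      ← c1.eq, ← c2.eq, mul_smul_comm, ← c4.eq, ← mul_assoc B, ← mul_assoc B, hG]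
    simp only [add_mul, mul_add, mul_assoc, smul_mul_assoc, mul_smul_comm]
    rw [← mul_assoc Z (expSeries B), c3.eq, mul_assoc (expSeries B), add_assoc]
  have hrec : ∀ n, coeff n (expSeries A * expSeries B * expSeries Z) = divPow (a + b) n := by
    intro n
    induction n with
    | zero => simp
    | succ n ih =>
      have h1 := congrArg (coeff (n + 1)) key
      rw [show A + B = PowerSeries.X * PowerSeries.C (a + b) by rw [hA, hB, ← mul_add, ← map_add],
        mul_assoc (PowerSeries.X), coeff_succ_X_mul, coeff_C_mul, ih, euler, coeff_mk, ← succ_smul_divPow_succ,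
        ← Nat.cast_smul_eq_nsmul ℚ] at h1
      exact smul_right_injective R (r := ((n + 1 : ℕ) : ℚ)) (by positivity) h1
  ext n
  rw [coeff_expSeries_X_mul_C, hrec]

end BCH

/-! ### Filtered coefficients -/

section Rees

variable {R : Type*} [Ring R]

/-- A multiplicative increasing filtration of a ring by additive subgroups. -/
structure Filt (R : Type*) [Ring R] where
  carrier : ℕ → AddSubgroup R
  mono : Monotone carrier
  one_mem : (1 : R) ∈ carrier 0
  mul_mem : ∀ {i j a b}, a ∈ carrier i → b ∈ carrier j → a * b ∈ carrier (i + j)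

/-- The constant filtration by a subring. -/
def Filt.const (A : Subring R) : Filt R where
  carrier _ := A.toAddSubgroup
  mono _ _ _ := le_rfl
  one_mem := A.one_mem
  mul_mem := A.mul_mem

/-- The series in `t` with coefficients polynomial in `u`, the coefficient of `u ^ i` being in the
`i`-th step of the filtration. -/
def rees (F : Filt R) : Subring (PowerSeries (Polynomial R)) where
  carrier := {f | ∀ m i, (coeff m f).coeff i ∈ F.carrier i}
  zero_mem' m i := by simp
  one_mem' m i := by
    rw [coeff_one]
    split_ifs
    · rw [Polynomial.coeff_one]
      split_ifs with h
      · rw [h]; exact F.one_mem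
      · exact zero_mem _
    · simp
  add_mem' hf hg m i := by simpa using add_mem (hf m i) (hg m i)
  neg_mem' hf m i := by simpa using hf m i
  mul_mem' {f g} hf hg m i := by
    rw [coeff_mul, Polynomial.finsetSum_coeff]
    refine sum_mem fun p _ => ?_
    rw [Polynomial.coeff_mul]
    refine sum_mem fun q hq => ?_
    rw [HasAntidiagonal.mem_antidiagonal] at hq
    rw [← hq]
    exact F.mul_mem (hf _ _) (hg _ _)

end Rees

/-! ### Generating series that are linear in a sequence of ring elements -/

section Lin

variable {R : Type*} [Ring R] [Algebra ℚ R]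

theorem coeff_pow_congr {S : Type*} [Ring S] {f g : PowerSeries S} {m : ℕ}
    (h : ∀ i ≤ m, coeff i f = coeff i g) (n : ℕ) : ∀ i ≤ m, coeff i (f ^ n) = coeff i (g ^ n) := by
  induction n with
  | zero => simp
  | succ n ih =>
    intro i hi
    rw [pow_succ, pow_succ, coeff_mul, coeff_mul]
    refine sum_congr rfl fun p hp => ?_
    rw [HasAntidiagonal.mem_antidiagonal] at hp
    rw [ih p.1 (by omega), h p.2 (by omega)]

theorem coeff_expSeries_congr {f g : PowerSeries R} {m : ℕ}
    (h : ∀ i ≤ m, coeff i f = coeff i g) : coeff m (expSeries f) = coeff m (expSeries g) := by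
  simp only [expSeries, coeff_mk]
  exact sum_congr rfl fun n _ => by rw [coeff_pow_congr h n m le_rfl]

/-- The scalars `ℚ[u]` inside `R[u]`. -/
def scal : Polynomial ℚ →+* Polynomial R := Polynomial.mapRingHom (algebraMap ℚ R)

theorem scal_mul_comm (p : Polynomial ℚ) (q : Polynomial R) : Commute (scal p) q := by
  rw [scal, Polynomial.coe_mapRingHom]
  induction p using Polynomial.induction_on' with
  | add p q hp hq => rw [Polynomial.map_add]; exact hp.add_left hq
  | monomial n a =>
    rw [Polynomial.map_monomial, ← Polynomial.C_mul_X_pow_eq_monomial]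
    refine Commute.mul_left ?_ ((Polynomial.commute_X q).pow_left n)
    rw [← Polynomial.algebraMap_apply]
    exact Algebra.commutes _ _

theorem scal_smul (q : ℚ) (p : Polynomial ℚ) : (scal (q • p) : Polynomial R) = q • scal p :=
  map_rat_smul _ q p

/-- The series `∑ a_k y_k t ^ k` for `a ∈ ℚ[u]⟦t⟧`. -/
def lin (y : ℕ → R) (a : PowerSeries (Polynomial ℚ)) : PowerSeries (Polynomial R) :=
  PowerSeries.mk fun k => scal (coeff k a) * Polynomial.C (y k)

theorem coeff_lin (y : ℕ → R) (a : PowerSeries (Polynomial ℚ)) (k : ℕ) :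
    coeff k (lin y a) = scal (coeff k a) * Polynomial.C (y k) := by simp [lin]

@[simp] theorem lin_add (y : ℕ → R) (a b : PowerSeries (Polynomial ℚ)) :
    lin y (a + b) = lin y a + lin y b := by
  ext1 k; simp [coeff_lin, add_mul]

@[simp] theorem lin_neg (y : ℕ → R) (a : PowerSeries (Polynomial ℚ)) :
    lin y (-a) = -lin y a := by
  ext1 k; simp [coeff_lin]

@[simp] theorem lin_sub (y : ℕ → R) (a b : PowerSeries (Polynomial ℚ)) :
    lin y (a - b) = lin y a - lin y b := by
  ext1 k; simp [coeff_lin, sub_mul]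

@[simp] theorem lin_zero (y : ℕ → R) : lin y 0 = 0 := by
  ext1 k; simp [coeff_lin]

@[simp] theorem lin_smul (y : ℕ → R) (q : ℚ) (a : PowerSeries (Polynomial ℚ)) :
    lin y (q • a) = q • lin y a := by
  ext1 k; simp [coeff_lin, scal_smul]

theorem lin_constantCoeff {y : ℕ → R} {a : PowerSeries (Polynomial ℚ)}
    (h : constantCoeff a = 0) : constantCoeff (lin y a) = 0 := by
  rw [← coeff_zero_eq_constantCoeff_apply, coeff_lin, coeff_zero_eq_constantCoeff_apply, h]
  simp

/-- Coefficientwise multiplication by rational numbers. -/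
def had (c : ℕ → ℚ) (a : PowerSeries (Polynomial ℚ)) : PowerSeries (Polynomial ℚ) :=
  PowerSeries.mk fun k => c k • coeff k a

/-- A commutation relation homogeneous in the indices passes to generating series: the index i + j
becomes the product of the coefficient series, and a scalar of the form c_i d_j becomes a Hadamard
factor on each side. The relation is required only on the supports of `a` and `b`, so that relations
valid for one parity of the index can be used. -/
theorem lin_mul_lin {y z w : ℕ → R} {c d : ℕ → ℚ} {a b : PowerSeries (Polynomial ℚ)}
    (h : ∀ i j, coeff i a ≠ 0 → coeff j b ≠ 0 →
      y i * z j = z j * y i + (c i * d j) • w (i + j)) :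
    lin y a * lin z b = lin z b * lin y a + lin w (had c a * had d b) := by
  ext1 k
  rw [map_add, coeff_mul, coeff_mul,
    ← Finset.Nat.sum_antidiagonal_swap (f := fun p => coeff p.1 (lin z b) * coeff p.2 (lin y a)),
    coeff_lin, coeff_mul, map_sum, sum_mul, ← sum_add_distrib]
  refine sum_congr rfl fun p hp => ?_
  rw [HasAntidiagonal.mem_antidiagonal] at hp
  simp only [Prod.fst_swap, Prod.snd_swap, coeff_lin, had, coeff_mk, map_mul, scal_smul]
  by_cases ha : coeff p.1 a = 0
  · simp [ha]
  by_cases hb : coeff p.2 b = 0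
  · simp [hb]
  have e : ∀ (α β : Polynomial ℚ) (y z : R), (scal α * Polynomial.C y) * (scal β * Polynomial.C z) =
      (scal α * scal β) * Polynomial.C (y * z) := fun α β y z => by
    rw [mul_assoc, ← mul_assoc (Polynomial.C y), ← (scal_mul_comm β (Polynomial.C y)).eq,
      Polynomial.C_mul]
    simp only [mul_assoc]
  rw [e, e, (scal_mul_comm (coeff p.2 b) (scal (coeff p.1 a))).eq, h p.1 p.2 ha hb, hp,
    Polynomial.C_add, mul_add, ← Polynomial.smul_C, mul_smul_comm, smul_mul_smul_comm,
    smul_mul_assoc]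

/-- The inclusion `ℤ[u]⟦t⟧ → ℚ[u]⟦t⟧`. -/
def toQ : PowerSeries (Polynomial ℤ) →+* PowerSeries (Polynomial ℚ) :=
  PowerSeries.map (Polynomial.mapRingHom (Int.castRingHom ℚ))

theorem coeff_toQ (b : PowerSeries (Polynomial ℤ)) (k : ℕ) :
    coeff k (toQ b) = Polynomial.map (Int.castRingHom ℚ) (coeff k b) := by
  simp [toQ]

theorem coeff_scal_map_int (p : Polynomial ℤ) (i : ℕ) :
    (scal (Polynomial.map (Int.castRingHom ℚ) p) : Polynomial R).coeff i = (p.coeff i : R) := by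
  simp [scal]

theorem constantCoeff_toQ (b : PowerSeries (Polynomial ℤ)) (h : constantCoeff b = 0) :
    constantCoeff (toQ b) = 0 := by
  rw [← coeff_zero_eq_constantCoeff_apply, coeff_toQ, coeff_zero_eq_constantCoeff_apply, h]
  simp

theorem monomial_pow_ring {S : Type*} [Ring S] (k : ℕ) (a : S) (n : ℕ) :
    PowerSeries.monomial k a ^ n = PowerSeries.monomial (k * n) (a ^ n) := by
  induction n with
  | zero => simp
  | succ n ih => rw [pow_succ, ih, PowerSeries.monomial_mul_monomial, pow_succ, mul_add_one]

/-- The n-th term is p^n times the divided power y^n/n!. The polynomial p^n is integral and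
divisible by u^(wn), and the divided power lies in step wn of the filtration, which is the condition
on coefficients of u^i with i ≥ wn. -/
theorem expSeries_monomial_mem_rees {F : Filt R} {w : ℕ} {y : R} (p : Polynomial ℤ) (k : ℕ)
    (hk : k ≠ 0) (hw : ∀ i < w, p.coeff i = 0) (hy : ∀ m, divPow y m ∈ F.carrier (w * m)) :
    expSeries (PowerSeries.monomial k
      (scal (Polynomial.map (Int.castRingHom ℚ) p) * Polynomial.C y : Polynomial R)) ∈ rees F := by
  intro m i
  rw [expSeries, coeff_mk, Polynomial.finsetSum_coeff]
  refine sum_mem fun n _ => ?_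
  rw [monomial_pow_ring, PowerSeries.coeff_monomial]
  split_ifs with h
  · rw [(scal_mul_comm _ _).mul_pow, ← map_pow, ← Polynomial.map_pow, ← map_pow,
      ← mul_smul_comm, Polynomial.smul_C, Polynomial.coeff_mul_C, coeff_scal_map_int,
      show ((n ! : ℚ)⁻¹) • y ^ n = divPow y n from rfl]
    by_cases hi : i < w * n
    · have : (p ^ n).coeff i = 0 := by
        have h1 : Polynomial.X ^ w ∣ p := Polynomial.X_pow_dvd_iff.2 hw
        have h2 := pow_dvd_pow_of_dvd h1 n
        rw [← pow_mul] at h2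
        exact Polynomial.X_pow_dvd_iff.1 h2 i hi
      rw [this]; simp
    · rw [← zsmul_eq_mul]
      exact zsmul_mem (F.mono (not_lt.1 hi) (hy n)) _
  · simp

/-- The y_k in the support of `b` commute, so the exponential of a finite partial sum is a product
of exponentials of monomials. The coefficient of t^m depends only on the terms of index at most m,
which is why partial sums suffice. -/
theorem expSeries_lin_mem_rees {F : Filt R} {w : ℕ} {y : ℕ → R} {b : PowerSeries (Polynomial ℤ)}
    (h0 : constantCoeff b = 0) (hw : ∀ k, ∀ i < w, (coeff k b).coeff i = 0)
    (hc : ∀ i j, coeff i b ≠ 0 → coeff j b ≠ 0 → Commute (y i) (y j))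
    (hy : ∀ k, coeff k b ≠ 0 → ∀ m, divPow (y k) m ∈ F.carrier (w * m)) :
    expSeries (lin y (toQ b)) ∈ rees F := by
  have hcoe : ∀ k, coeff k (lin y (toQ b)) = (scal (Polynomial.map (Int.castRingHom ℚ) (coeff k b)) *
      Polynomial.C (y k) : Polynomial R) := fun k => by rw [coeff_lin, coeff_toQ]
  let T : ℕ → PowerSeries (Polynomial R) := fun K =>
    ∑ k ∈ range K, PowerSeries.monomial k (coeff k (lin y (toQ b)))
  have hT : ∀ K, constantCoeff (T K) = 0 := fun K => by
    rw [map_sum]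
    refine sum_eq_zero fun k _ => ?_
    rw [← coeff_zero_eq_constantCoeff_apply, PowerSeries.coeff_monomial]
    split_ifs with h
    · rw [← h, coeff_zero_eq_constantCoeff_apply]
      exact lin_constantCoeff (constantCoeff_toQ b h0)
    · rfl
  have hmem : ∀ K, expSeries (T K) ∈ rees F := by
    intro K
    induction K with
    | zero => simp [T]
    | succ K ih =>
      have e : T (K + 1) = T K + PowerSeries.monomial K (coeff K (lin y (toQ b))) :=
        sum_range_succ _ _
      by_cases hb : coeff K b = 0
      · rw [e, hcoe, hb]; simpa using ih
      have hK : K ≠ 0 := by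
        rintro rfl
        exact hb (by simpa using h0)
      have hcomm : Commute (T K) (PowerSeries.monomial K (coeff K (lin y (toQ b)))) := by
        refine Commute.sum_left _ _ _ fun k _ => ?_
        rw [Commute, SemiconjBy, PowerSeries.monomial_mul_monomial,
          PowerSeries.monomial_mul_monomial, add_comm]
        congr 1
        rw [hcoe, hcoe]
        by_cases hk : coeff k b = 0
        · simp [hk]
        refine Commute.mul_left (scal_mul_comm _ _) (Commute.mul_right (scal_mul_comm _ _).symm ?_)
        exact (hc k K hk hb).map Polynomial.C
      rw [e, expSeries_add hcomm (hT K) (by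
        rw [← coeff_zero_eq_constantCoeff_apply, PowerSeries.coeff_monomial, if_neg hK.symm])]
      refine mul_mem ih ?_
      rw [hcoe]
      exact expSeries_monomial_mem_rees _ _ hK (hw K) (hy K hb)
  intro m i
  rw [coeff_expSeries_congr (g := T (m + 1)) fun j hj => ?_]
  · exact hmem _ m i
  · rw [map_sum, sum_eq_single j]
    · simp
    · intro k _ hk
      rw [PowerSeries.coeff_monomial, if_neg hk.symm]
    · intro h
      simp at h; omega

end Lin

/-! ### Parity of series -/

/-- The substitution `t ↦ s t` on `ℚ[u]⟦t⟧`. -/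
def bar (s : ℚ) : PowerSeries (Polynomial ℚ) →+* PowerSeries (Polynomial ℚ) :=
  rescale (Polynomial.C s)

theorem coeff_bar (s : ℚ) (a : PowerSeries (Polynomial ℚ)) (k : ℕ) :
    coeff k (bar s a) = s ^ k • coeff k a := by
  rw [bar, coeff_rescale, ← Polynomial.C_pow, ← Polynomial.smul_eq_C_mul]

theorem had_pow (s : ℚ) (a : PowerSeries (Polynomial ℚ)) : had (fun k => s ^ k) a = bar s a := by
  ext1 k; rw [coeff_bar, had, coeff_mk]

theorem had_one (a : PowerSeries (Polynomial ℚ)) : had (fun _ => 1) a = a := by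
  ext1 k; rw [had, coeff_mk, one_smul]

theorem had_weight (s : ℚ) (a : PowerSeries (Polynomial ℚ)) :
    had (fun k => 4 - 2 * s ^ k) a = (4 : ℚ) • a - (2 : ℚ) • bar s a := by
  ext1 k; simp [had, coeff_bar, sub_smul, mul_smul]

theorem coeff_ne_zero_of_bar_eq {s r : ℚ} {a : PowerSeries (Polynomial ℚ)} (h : bar s a = r • a)
    (k : ℕ) (hk : coeff k a ≠ 0) : s ^ k = r := by
  have := congrArg (coeff k) h
  rw [coeff_bar, coeff_smul] at this
  exact smul_left_injective ℚ hk this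

/-- The coefficientwise derivative with respect to `u`. -/
def du {R : Type*} [Ring R] : PowerSeries (Polynomial R) →+ PowerSeries (Polynomial R) :=
  cmap (Polynomial.derivative (R := R)).toAddMonoidHom

theorem isLeibniz_derivative {R : Type*} [Ring R] :
    IsLeibniz (Polynomial.derivative (R := R)).toAddMonoidHom :=
  ⟨fun a b => by simp [Polynomial.derivative_mul]⟩

theorem du_mul {R : Type*} [Ring R] (f g : PowerSeries (Polynomial R)) :
    du (f * g) = du f * g + f * du g := cmap_mul isLeibniz_derivative f g

theorem du_expSeries {R : Type*} [Ring R] [Algebra ℚ R] {A : PowerSeries (Polynomial R)}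
    (hA : constantCoeff A = 0) (h : Commute A (du A)) : du (expSeries A) = expSeries A * du A :=
  cmap_expSeries isLeibniz_derivative hA h

theorem coeff_du {R : Type*} [Ring R] (f : PowerSeries (Polynomial R)) (k : ℕ) :
    coeff k (du f) = Polynomial.derivative (coeff k f) := by
  simp [du]

theorem du_lin {R : Type*} [Ring R] [Algebra ℚ R] (y : ℕ → R) (a : PowerSeries (Polynomial ℚ)) :
    du (lin y a) = lin y (du a) := by
  ext1 k
  simp [coeff_du, coeff_lin, scal, Polynomial.derivative_map]

theorem bar_du (s : ℚ) (a : PowerSeries (Polynomial ℚ)) : bar s (du a) = du (bar s a) := by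
  ext1 k
  simp [coeff_du, coeff_bar]

theorem ofNat_smul {A : Type*} [Ring A] [Algebra ℚ A] (n : ℕ) [n.AtLeastTwo] (a : A) :
    (OfNat.ofNat n : ℚ) • a = OfNat.ofNat n * a := by
  rw [Algebra.smul_def, map_ofNat]

theorem inv_two_smul {A : Type*} [Ring A] [Algebra ℚ A] {a b : A} (h : a = 2 * b) :
    (2⁻¹ : ℚ) • a = b := by
  rw [h, ← ofNat_smul, smul_smul]; norm_num

theorem inv_six_smul {A : Type*} [Ring A] [Algebra ℚ A] {a b : A} (h : a = 6 * b) :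
    (6⁻¹ : ℚ) • a = b := by
  rw [h, ← ofNat_smul, smul_smul]; norm_num

/-! ### Half loops -/

/-- The commutation relations satisfied by the families `x⁺_{r+nk}`, `x⁻_{-r+nk}`, `h_{nk}`,
`X⁺_{2r+nk}`, `X⁻_{-2r+nk}` for `k ≥ 0`, suitably normalized; `s` is the sign `(-1) ^ n`. -/
structure HalfLoop (R : Type*) [Ring R] [Algebra ℚ R] (s : ℚ) where
  e : ℕ → R
  f : ℕ → R
  H : ℕ → R
  E : ℕ → R
  F : ℕ → R
  ef : ∀ i j, e i * f j = f j * e i + H (i + j)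
  He : ∀ i j, H i * e j = e j * H i + (4 - 2 * s ^ i) • e (i + j)
  Hf : ∀ i j, H i * f j = f j * H i - (4 - 2 * s ^ i) • f (i + j)
  ee : ∀ i j, e i * e j = e j * e i + s ^ j • E (i + j)
  ff : ∀ i j, f i * f j = f j * f i - s ^ j • F (i + j)
  eF : ∀ i j, s ^ j = -1 → e i * F j = F j * e i + (4 * s ^ i) • f (i + j)
  HF : ∀ i j, s ^ i = -1 → s ^ j = -1 → H i * F j = F j * H i
  E_eq_zero : ∀ k, s ^ k ≠ -1 → E k = 0
  F_eq_zero : ∀ k, s ^ k ≠ -1 → F k = 0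
  eE : ∀ i j, e i * E j = E j * e i
  fF : ∀ i j, f i * F j = F j * f i
  EE : ∀ i j, E i * E j = E j * E i
  FF : ∀ i j, F i * F j = F j * F i
  HH : ∀ i j, H i * H j = H j * H i

namespace HalfLoop

variable {R : Type*} [Ring R] [Algebra ℚ R] {s : ℚ} (L : HalfLoop R s)

theorem _root_.A22.lin_commute {y z : ℕ → R} (h : ∀ i j, y i * z j = z j * y i)
    (a b : PowerSeries (Polynomial ℚ)) : Commute (lin y a) (lin z b) := by
  have := lin_mul_lin (y := y) (z := z) (w := 0) (c := fun _ => 1) (d := fun _ => 1) (a := a)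
    (b := b) (fun i j _ _ => by rw [h]; simp)
  rw [Commute, SemiconjBy, this]
  have h0 : ∀ c : PowerSeries (Polynomial ℚ), lin (0 : ℕ → R) c = 0 := fun c => by
    ext1 k; simp [coeff_lin]
  rw [h0, add_zero]

theorem lin_ef (a b : PowerSeries (Polynomial ℚ)) :
    lin L.e a * lin L.f b = lin L.f b * lin L.e a + lin L.H (a * b) := by
  rw [lin_mul_lin (w := L.H) (c := fun _ => 1) (d := fun _ => 1)
    (fun i j _ _ => by rw [L.ef]; simp), had_one, had_one]

theorem lin_He (a b : PowerSeries (Polynomial ℚ)) :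
    lin L.H a * lin L.e b =
      lin L.e b * lin L.H a + lin L.e (((4 : ℚ) • a - (2 : ℚ) • bar s a) * b) := by
  rw [lin_mul_lin (w := L.e) (c := fun k => 4 - 2 * s ^ k) (d := fun _ => 1)
    (fun i j _ _ => by rw [L.He]; simp), had_one, had_weight]

theorem lin_Hf (a b : PowerSeries (Polynomial ℚ)) :
    lin L.H a * lin L.f b =
      lin L.f b * lin L.H a + lin L.f (-(((4 : ℚ) • a - (2 : ℚ) • bar s a) * b)) := by
  have : had (fun _ => (-1 : ℚ)) b = -b := by ext1 k; simp [had]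
  rw [lin_mul_lin (w := L.f) (c := fun k => 4 - 2 * s ^ k) (d := fun _ => -1)
    (fun i j _ _ => by rw [L.Hf]; simp [sub_eq_add_neg, ← neg_smul]), this, had_weight, mul_neg]

theorem lin_ee (a b : PowerSeries (Polynomial ℚ)) :
    lin L.e a * lin L.e b = lin L.e b * lin L.e a + lin L.E (a * bar s b) := by
  rw [lin_mul_lin (w := L.E) (c := fun _ => 1) (d := fun k => s ^ k)
    (fun i j _ _ => by rw [L.ee]; simp), had_one, had_pow]

theorem lin_ff (a b : PowerSeries (Polynomial ℚ)) :
    lin L.f a * lin L.f b = lin L.f b * lin L.f a + lin L.F (-(a * bar s b)) := by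
  have : had (fun _ => (-1 : ℚ)) a = -a := by ext1 k; simp [had]
  rw [lin_mul_lin (w := L.F) (c := fun _ => -1) (d := fun k => s ^ k)
    (fun i j _ _ => by rw [L.ff]; simp [sub_eq_add_neg]), this, had_pow, neg_mul]

/-- The oddness of `g` confines the second index to those for which the relation `eF` is available.
-/
theorem lin_eF (a : PowerSeries (Polynomial ℚ)) {g : PowerSeries (Polynomial ℚ)}
    (hg : bar s g = -g) :
    lin L.e a * lin L.F g = lin L.F g * lin L.e a + lin L.f ((4 : ℚ) • (bar s a * g)) := by
  have : had (fun _ => (4 : ℚ)) g = (4 : ℚ) • g := by ext1 k; simp [had]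
  rw [lin_mul_lin (w := L.f) (c := fun k => s ^ k) (d := fun _ => 4)
    (fun i j _ hj => by
      rw [L.eF _ _ (coeff_ne_zero_of_bar_eq (r := -1) (by rw [hg, neg_one_smul]) j hj), mul_comm]),
    this, had_pow, mul_smul_comm]

theorem lin_HF {a g : PowerSeries (Polynomial ℚ)} (ha : bar s a = -a) (hg : bar s g = -g) :
    lin L.H a * lin L.F g = lin L.F g * lin L.H a := by
  rw [lin_mul_lin (w := 0) (c := fun k => 1) (d := fun _ => 1)
    (fun i j hi hj => by
      rw [L.HF _ _ (coeff_ne_zero_of_bar_eq (r := -1) (by rw [ha, neg_one_smul]) i hi)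
        (coeff_ne_zero_of_bar_eq (r := -1) (by rw [hg, neg_one_smul]) j hj)]; simp)]
  have h0 : ∀ c : PowerSeries (Polynomial ℚ), lin (0 : ℕ → R) c = 0 := fun c => by
    ext1 k; simp [coeff_lin]
  rw [h0, add_zero]

theorem lin_E_eq_zero {a : PowerSeries (Polynomial ℚ)} (ha : bar s a = a) : lin L.E a = 0 := by
  ext1 k
  rw [coeff_lin]
  by_cases hk : coeff k a = 0
  · simp [hk]
  rw [L.E_eq_zero k (by rw [coeff_ne_zero_of_bar_eq (r := 1) (by rw [ha, one_smul]) k hk]; norm_num)]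
  simp

theorem lin_F_eq_zero {a : PowerSeries (Polynomial ℚ)} (ha : bar s a = a) : lin L.F a = 0 := by
  ext1 k
  rw [coeff_lin]
  by_cases hk : coeff k a = 0
  · simp [hk]
  rw [L.F_eq_zero k (by rw [coeff_ne_zero_of_bar_eq (r := 1) (by rw [ha, one_smul]) k hk]; norm_num)]
  simp

/-- The element e_0 passes the three lower exponentials one at a time, each time through a chain of
iterated commutators of length at most three. The chains are short because the bracket of two
`f`-series of the same parity vanishes. The weight 4 - 2s^k of `H` acts as 2 on the even part and as
6 on the odd part, which is the source of the coefficients. -/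
theorem e_mul_minus {f0 f1 g : PowerSeries (Polynomial ℚ)} (c0 : constantCoeff f0 = 0)
    (c1 : constantCoeff f1 = 0) (cg : constantCoeff g = 0) (b0 : bar s f0 = f0)
    (b1 : bar s f1 = -f1) (bg : bar s g = -g) :
    lin L.e 1 * (expSeries (lin L.f f1) * expSeries (lin L.F g) * expSeries (lin L.f f0)) =
      expSeries (lin L.f f1) * expSeries (lin L.F g) * expSeries (lin L.f f0) *
        (lin L.f (4 * g - 3 * f1 ^ 2 - 6 * (f1 * f0) - f0 ^ 2) +
          lin L.F (-f1 ^ 3 - 4 * (g * f0) + 3 * (f1 * f0 ^ 2)) + lin L.H (f0 + f1) + lin L.e 1) := by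
  have h1 : lin L.e 1 * expSeries (lin L.f f1) = expSeries (lin L.f f1) *
      (lin L.e 1 + lin L.H f1 + lin L.f (-(3 * f1 ^ 2)) + lin L.F (-f1 ^ 3)) := by
    have := mul_expSeries_of_chain_three (A := lin L.f f1) (Y₀ := lin L.e 1) (Y₁ := lin L.H f1)
      (Y₂ := lin L.f (-(6 * f1 ^ 2))) (Y₃ := lin L.F (-(6 * f1 ^ 3))) (lin_constantCoeff c1)
      (by rw [L.lin_ef, one_mul])
      (by rw [L.lin_Hf, b1, ofNat_smul, ofNat_smul]; congr 2; ring)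
      (by rw [L.lin_ff, b1]; congr 2; ring)
      (lin_commute (fun i j => (L.fF j i).symm) _ _)
    rw [this, ← lin_smul, ← lin_smul, inv_two_smul (b := -(3 * f1 ^ 2)) (by ring),
      inv_six_smul (b := -f1 ^ 3) (by ring)]
  have h2 : (lin L.e 1 + lin L.H f1 + lin L.f (-(3 * f1 ^ 2)) + lin L.F (-f1 ^ 3)) *
      expSeries (lin L.F g) = expSeries (lin L.F g) *
      (lin L.e 1 + lin L.H f1 + lin L.f (-(3 * f1 ^ 2)) + lin L.F (-f1 ^ 3) + lin L.f (4 * g)) := by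
    have := mul_expSeries_of_chain_three (A := lin L.F g)
      (Y₀ := lin L.e 1 + lin L.H f1 + lin L.f (-(3 * f1 ^ 2)) + lin L.F (-f1 ^ 3))
      (Y₁ := lin L.f (4 * g))
      (Y₂ := 0) (Y₃ := 0) (lin_constantCoeff cg)
      (by
        have e1 := lin_commute L.fF (-(3 * f1 ^ 2)) g
        have e2 := lin_commute L.FF (-f1 ^ 3) g
        simp only [add_mul, mul_add]
        rw [L.lin_eF _ bg, L.lin_HF b1 bg, e1.eq, e2.eq, map_one, one_mul, ofNat_smul]
        abel)
      (by rw [add_zero]; exact lin_commute L.fF _ _) (by simp) (by simp)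
    simpa using this
  have h3 : (lin L.e 1 + lin L.H f1 + lin L.f (-(3 * f1 ^ 2)) + lin L.F (-f1 ^ 3) +
      lin L.f (4 * g)) * expSeries (lin L.f f0) = expSeries (lin L.f f0) *
      (lin L.f (4 * g - 3 * f1 ^ 2 - 6 * (f1 * f0) - f0 ^ 2) +
          lin L.F (-f1 ^ 3 - 4 * (g * f0) + 3 * (f1 * f0 ^ 2)) + lin L.H (f0 + f1) + lin L.e 1) := by
    have := mul_expSeries_of_chain_three (A := lin L.f f0)
      (Y₀ := lin L.e 1 + lin L.H f1 + lin L.f (-(3 * f1 ^ 2)) + lin L.F (-f1 ^ 3) +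
        lin L.f (4 * g))
      (Y₁ := lin L.H f0 + lin L.f (-(6 * (f1 * f0))) + lin L.F (-(4 * (g * f0))))
      (Y₂ := lin L.f (-(2 * f0 ^ 2)) + lin L.F (6 * (f1 * f0 ^ 2)))
      (Y₃ := 0) (lin_constantCoeff c0)
      (by
        have e2 := lin_commute (fun i j => (L.fF j i).symm) (-f1 ^ 3) f0
        have z1 : lin L.F (-(-(3 * f1 ^ 2) * bar s f0)) = 0 :=
          L.lin_F_eq_zero (by simp [b0, b1, show bar s 3 = 3 from map_ofNat _ _])
        simp only [add_mul, mul_add]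
        rw [L.lin_ef, L.lin_Hf, L.lin_ff _ f0, L.lin_ff (4 * g), e2.eq, z1, one_mul, b0, b1, ofNat_smul,
          ofNat_smul, show -((4 * f1 - 2 * -f1) * f0) = -(6 * (f1 * f0)) by ring,
          show -(4 * g * f0) = -(4 * (g * f0)) by ring]
        abel)
      (by
        have e2 := lin_commute (fun i j => (L.fF j i).symm) (-(4 * (g * f0))) f0
        simp only [add_mul, mul_add]
        rw [L.lin_Hf, L.lin_ff, e2.eq, b0, ofNat_smul,
          ofNat_smul, show -((4 * f0 - 2 * f0) * f0) = -(2 * f0 ^ 2) by ring,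
          show -(-(6 * (f1 * f0)) * f0) = 6 * (f1 * f0 ^ 2) by ring]
        abel)
      (by
        have e2 := lin_commute (fun i j => (L.fF j i).symm) (6 * (f1 * f0 ^ 2)) f0
        have z1 : lin L.F (-(-(2 * f0 ^ 2) * bar s f0)) = 0 :=
          L.lin_F_eq_zero (by simp [b0, show bar s 2 = 2 from map_ofNat _ _])
        simp only [add_mul, mul_add]
        rw [L.lin_ff, e2.eq, z1]
        abel)
      (by simp)
    rw [this, smul_add, ← lin_smul, ← lin_smul, inv_two_smul (b := -f0 ^ 2) (by ring),
      inv_two_smul (b := 3 * (f1 * f0 ^ 2)) (by ring)]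
    congr 1
    simp only [lin_add, lin_sub, lin_neg, smul_zero]
    abel
  rw [← mul_assoc, ← mul_assoc, h1, mul_assoc _ _ (expSeries (lin L.F g)), h2]
  simp only [mul_assoc]
  rw [h3]

/-- Each exponential commutes with the derivative of its exponent. What remains is to move the
derivative of the first exponent to the far right: it commutes with exp F(g), and crossing exp f(f0)
costs the term F(f1' f0). -/
theorem du_minus {f0 f1 g : PowerSeries (Polynomial ℚ)} (c0 : constantCoeff f0 = 0)
    (c1 : constantCoeff f1 = 0) (cg : constantCoeff g = 0) (b0 : bar s f0 = f0)
    (b1 : bar s f1 = -f1) :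
    du (expSeries (lin L.f f1) * expSeries (lin L.F g) * expSeries (lin L.f f0)) =
      expSeries (lin L.f f1) * expSeries (lin L.F g) * expSeries (lin L.f f0) *
        (lin L.f (du f1 + du f0) + lin L.F (du g - du f1 * f0)) := by
  have b0' : bar s (du f0) = du f0 := by rw [bar_du, b0]
  have b1' : bar s (du f1) = -du f1 := by rw [bar_du, b1, map_neg]
  have k1 : Commute (lin L.f f1) (lin L.f (du f1)) := by
    have := L.lin_ff f1 (du f1)
    rw [L.lin_F_eq_zero (by simp [b1, b1'])] at this
    simpa [Commute, SemiconjBy] using this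
  have k0 : Commute (lin L.f f0) (lin L.f (du f0)) := by
    have := L.lin_ff f0 (du f0)
    rw [L.lin_F_eq_zero (by simp [b0, b0'])] at this
    simpa [Commute, SemiconjBy] using this
  rw [du_mul, du_mul, du_expSeries (lin_constantCoeff c1) (by rw [du_lin]; exact k1),
    du_expSeries (lin_constantCoeff cg) (by rw [du_lin]; exact lin_commute L.FF _ _),
    du_expSeries (lin_constantCoeff c0) (by rw [du_lin]; exact k0), du_lin, du_lin, du_lin]
  have h1 : Commute (lin L.f (du f1)) (expSeries (lin L.F g)) :=
    commute_expSeries (lin_constantCoeff cg) (lin_commute L.fF _ _)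
  have h2 : Commute (lin L.F (du g)) (expSeries (lin L.f f0)) :=
    commute_expSeries (lin_constantCoeff c0) (lin_commute (fun i j => (L.fF j i).symm) _ _)
  have h3 : lin L.f (du f1) * expSeries (lin L.f f0) =
      expSeries (lin L.f f0) * (lin L.f (du f1) + lin L.F (-(du f1 * f0))) := by
    have := mul_expSeries_of_chain_three (A := lin L.f f0) (Y₀ := lin L.f (du f1))
      (Y₁ := lin L.F (-(du f1 * f0))) (Y₂ := 0) (Y₃ := 0) (lin_constantCoeff c0)
      (by rw [L.lin_ff, b0])
      (by rw [add_zero]; exact lin_commute (fun i j => (L.fF j i).symm) _ _) (by simp) (by simp)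
    simpa using this
  rw [mul_assoc _ (lin L.f (du f1)), h1.eq]
  simp only [add_mul, mul_assoc, h2.eq, h3]
  simp only [lin_add, lin_sub, lin_neg]
  noncomm_ring

/-- The Cartan exponential acts on the `e`-series by multiplication of the coefficient series: the
iterated commutators with e_0 are e(κ^j) with κ = -(4ψ - 2ψ̄), and they sum to e(exp κ). -/
theorem e_mul_cartan {ψ θ : PowerSeries (Polynomial ℚ)} (cψ : constantCoeff ψ = 0)
    (hθ : θ = expSeries (-((4 : ℚ) • ψ - (2 : ℚ) • bar s ψ))) :
    lin L.e 1 * expSeries (lin L.H ψ) = expSeries (lin L.H ψ) * lin L.e θ := by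
  set κ := -((4 : ℚ) • ψ - (2 : ℚ) • bar s ψ) with hκ
  have cκ : constantCoeff κ = 0 := by
    have : constantCoeff (bar s ψ) = 0 := by
      rw [← coeff_zero_eq_constantCoeff_apply, coeff_bar, coeff_zero_eq_constantCoeff_apply, cψ,
        smul_zero]
    simp [hκ, this, cψ]
  have := mul_expSeries_of_chain (A := lin L.H ψ) (Y := fun j => lin L.e (κ ^ j))
    (lin_constantCoeff cψ) (fun j => by
      rw [L.lin_He ψ (κ ^ j), add_assoc, ← lin_add, pow_succ', hκ, neg_mul, add_neg_cancel,
        lin_zero, add_zero])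
  rw [pow_zero] at this
  rw [this]
  congr 1
  ext1 k
  rw [ssum, coeff_mk, hθ, coeff_lin, coeff_expSeries cκ (Nat.lt_succ_self k), map_sum, sum_mul]
  refine sum_congr rfl fun n _ => ?_
  rw [coeff_smul, coeff_lin, scal_smul, smul_mul_assoc]

/-- Beyond the Cartan factor, e_0 has become e(θ). The equation P' = e(θ) P - P e_0 is what the
upper factor must satisfy, and the conditions on p0, p1 and q are its components along even e, odd e
and E. -/
theorem plus_mul {p0 p1 q θ : PowerSeries (Polynomial ℚ)} (c0 : constantCoeff p0 = 0)
    (c1 : constantCoeff p1 = 0) (cq : constantCoeff q = 0) (b0 : bar s p0 = p0)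
    (b1 : bar s p1 = -p1) (hθ : θ = 1 + du p0 + du p1) (hq : du q = -((1 + du p0) * p1)) :
    lin L.e θ * (expSeries (lin L.e p1) * expSeries (lin L.E q) * expSeries (lin L.e p0)) =
      du (expSeries (lin L.e p1) * expSeries (lin L.E q) * expSeries (lin L.e p0)) +
      expSeries (lin L.e p1) * expSeries (lin L.E q) * expSeries (lin L.e p0) * lin L.e 1 := by
  have b0' : bar s (du p0) = du p0 := by rw [bar_du, b0]
  have b1' : bar s (du p1) = -du p1 := by rw [bar_du, b1, map_neg]
  have k1 : Commute (lin L.e p1) (lin L.e (du p1)) := by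
    have := L.lin_ee p1 (du p1)
    rw [L.lin_E_eq_zero (by simp [b1, b1'])] at this
    simpa [Commute, SemiconjBy] using this
  have k0 : Commute (lin L.e p0) (lin L.e (du p0)) := by
    have := L.lin_ee p0 (du p0)
    rw [L.lin_E_eq_zero (by simp [b0, b0'])] at this
    simpa [Commute, SemiconjBy] using this
  rw [du_mul, du_mul, du_expSeries (lin_constantCoeff c1) (by rw [du_lin]; exact k1),
    du_expSeries (lin_constantCoeff cq) (by rw [du_lin]; exact lin_commute L.EE _ _),
    du_expSeries (lin_constantCoeff c0) (by rw [du_lin]; exact k0), du_lin, du_lin, du_lin]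
  have h1 : ∀ a, Commute (lin L.e a) (expSeries (lin L.E q)) := fun a =>
    commute_expSeries (lin_constantCoeff cq) (lin_commute L.eE _ _)
  have h2 : ∀ a, Commute (lin L.E a) (expSeries (lin L.e p0)) := fun a =>
    commute_expSeries (lin_constantCoeff c0) (lin_commute (fun i j => (L.eE j i).symm) _ _)
  have h3 : ∀ a, lin L.e a * expSeries (lin L.e p0) =
      expSeries (lin L.e p0) * (lin L.e a + lin L.E (a * p0)) := fun a => by
    have := mul_expSeries_of_chain_three (A := lin L.e p0) (Y₀ := lin L.e a)
      (Y₁ := lin L.E (a * p0)) (Y₂ := 0) (Y₃ := 0) (lin_constantCoeff c0)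
      (by rw [L.lin_ee, b0])
      (by rw [add_zero]; exact lin_commute (fun i j => (L.eE j i).symm) _ _) (by simp) (by simp)
    simpa using this
  have h4 : lin L.e θ * expSeries (lin L.e p1) =
      expSeries (lin L.e p1) * (lin L.e θ + lin L.E (-(θ * p1))) := by
    have := mul_expSeries_of_chain_three (A := lin L.e p1) (Y₀ := lin L.e θ)
      (Y₁ := lin L.E (-(θ * p1))) (Y₂ := 0) (Y₃ := 0) (lin_constantCoeff c1)
      (by rw [L.lin_ee, b1, mul_neg])
      (by rw [add_zero]; exact lin_commute (fun i j => (L.eE j i).symm) _ _) (by simp) (by simp)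
    simpa using this
  have h5 : Commute (lin L.E (-(θ * p1))) (expSeries (lin L.E q)) :=
    commute_expSeries (lin_constantCoeff cq) (lin_commute L.EE _ _)
  have h6 : lin L.E (-(θ * p1)) = lin L.E (du q) := by
    have z : lin L.E (-(du p1 * p1)) = 0 := L.lin_E_eq_zero (by simp [b1, b1'])
    rw [hq, hθ, add_mul, neg_add, lin_add, z, add_zero]
  have h7 : lin L.E (θ * p0) = lin L.E (du p1 * p0) := by
    have z : lin L.E ((1 + du p0) * p0) = 0 := L.lin_E_eq_zero (by simp [b0, b0'])
    rw [hθ, add_mul, lin_add, z, zero_add]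
  have h8 : lin L.e θ = lin L.e 1 + lin L.e (du p0) + lin L.e (du p1) := by
    rw [hθ, lin_add, lin_add]
  have e1 : lin L.e θ * (expSeries (lin L.e p1) * expSeries (lin L.E q) * expSeries (lin L.e p0)) =
      expSeries (lin L.e p1) * expSeries (lin L.E q) * expSeries (lin L.e p0) *
        (lin L.e θ + lin L.E (θ * p0) + lin L.E (-(θ * p1))) := by
    rw [← mul_assoc, ← mul_assoc, h4, mul_assoc _ _ (expSeries (lin L.E q)), add_mul, (h1 θ).eq,
      h5.eq]
    simp only [mul_add, add_mul, mul_assoc, h3, (h2 _).eq]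
  rw [e1, mul_assoc _ (lin L.e (du p1)), (h1 _).eq, h6, h7, h8]
  simp only [add_mul, mul_assoc, (h2 _).eq, h3]
  noncomm_ring

/-- The Gauss decomposition `N D P` satisfies the differential equation of the conjugates of its
initial value by `exp (u e_0)`. -/
theorem du_gauss {f0 f1 g ψ p0 p1 q : PowerSeries (Polynomial ℚ)} (cf0 : constantCoeff f0 = 0)
    (cf1 : constantCoeff f1 = 0) (cg : constantCoeff g = 0) (cψ : constantCoeff ψ = 0)
    (cp0 : constantCoeff p0 = 0) (cp1 : constantCoeff p1 = 0) (cq : constantCoeff q = 0)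
    (bf0 : bar s f0 = f0) (bf1 : bar s f1 = -f1) (bg : bar s g = -g) (bp0 : bar s p0 = p0)
    (bp1 : bar s p1 = -p1) (hf1 : du f1 = 4 * g - 6 * (f1 * f0))
    (hf0 : du f0 = -(3 * f1 ^ 2) - f0 ^ 2) (hg : du g = -f1 ^ 3 - 3 * (f1 * f0 ^ 2))
    (hψ : du ψ = f0 + f1)
    (hp : expSeries (-((4 : ℚ) • ψ - (2 : ℚ) • bar s ψ)) = 1 + du p0 + du p1)
    (hq : du q = -((1 + du p0) * p1))
    {W : PowerSeries (Polynomial R)}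
    (hW : W = (expSeries (lin L.f f1) * expSeries (lin L.F g) * expSeries (lin L.f f0)) *
      expSeries (lin L.H ψ) *
      (expSeries (lin L.e p1) * expSeries (lin L.E q) * expSeries (lin L.e p0))) :
    lin L.e 1 * W = du W + W * lin L.e 1 := by
  have h1 := L.e_mul_minus cf0 cf1 cg bf0 bf1 bg
  have h2 := L.du_minus cf0 cf1 cg bf0 bf1
  have h3 := L.e_mul_cartan cψ hp.symm
  have h4 := L.plus_mul cp0 cp1 cq bp0 bp1 rfl hq
  have h5 : du (expSeries (lin L.H ψ)) = lin L.H (f0 + f1) * expSeries (lin L.H ψ) := by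
    have c : Commute (lin L.H (f0 + f1)) (lin L.H ψ) := lin_commute L.HH _ _
    rw [du_expSeries (lin_constantCoeff cψ) (by rw [du_lin, hψ]; exact c.symm), du_lin, hψ,
      (commute_expSeries (lin_constantCoeff cψ) c).eq]
  -- The Riccati equations for f0, f1 and g say that the f- and F-terms left behind by e_0 on
  -- passing N are exactly N⁻¹ N'. The H-term is D' D⁻¹ by the equation for ψ.
  have e1 : du f1 + du f0 = 4 * g - 3 * f1 ^ 2 - 6 * (f1 * f0) - f0 ^ 2 := by
    rw [hf1, hf0]; ring
  have e2 : du g - du f1 * f0 = -f1 ^ 3 - 4 * (g * f0) + 3 * (f1 * f0 ^ 2) := by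
    rw [hf1, hg]; ring
  rw [e1, e2] at h2
  generalize expSeries (lin L.f f1) * expSeries (lin L.F g) * expSeries (lin L.f f0) = N at *
  generalize expSeries (lin L.e p1) * expSeries (lin L.E q) * expSeries (lin L.e p0) = P at *
  generalize expSeries (lin L.H ψ) = D at *
  rw [mul_add, mul_add, ← h2] at h1
  rw [hW, du_mul, du_mul, h5, ← mul_assoc, ← mul_assoc, h1]
  simp only [add_mul, mul_assoc]
  rw [← mul_assoc (lin L.e 1), h3, mul_assoc D, h4]
  noncomm_ring

end HalfLoop

/-! ### The explicit Gauss decomposition -/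

namespace Gauss

section Poly

variable {A : Type*} [CommRing A] (u b0 b1 : A)

/-- The series d = d0 + d1 will be exp(2ψ), and the indices 0 and 1 stand for the even and odd parts
under t ↦ st. Accordingly n0 + n1 is half the u-derivative of d, `disc` is the norm d d̄, and (F0 +
F1)/disc is n/d, the derivative of ψ. -/
def d0 : A := 1 + 2 * u * b0 + u ^ 2 * (b0 ^ 2 - b1 ^ 2)
def d1 : A := 2 * u * b1 - 2 * u ^ 2 * b0 * b1
def disc : A := d0 u b0 b1 ^ 2 - d1 u b0 b1 ^ 2
def n0 : A := b0 + u * (b0 ^ 2 - b1 ^ 2)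
def n1 : A := b1 - 2 * u * b0 * b1
def F0 : A := n0 u b0 b1 * d0 u b0 b1 - n1 u b0 b1 * d1 u b0 b1
def F1 : A := n1 u b0 b1 * d0 u b0 b1 - n0 u b0 b1 * d1 u b0 b1
-- The solution of the system is f_i = F_i/disc, g = G/disc², p0 = P0/disc - u, p1 = P1/disc, q =
-- Q/disc². The polynomial G is forced by the equation f1' = 4g - 6 f1 f0. Likewise P0 + P1 comes
-- from integrating d̄³/disc², and Q from integrating -(1 + p0') p1.
def G : A :=
  u * (-b1 ^ 3 - 4 * b1 ^ 5 * u ^ 2 + b1 ^ 7 * u ^ 4 + 10 * b0 * b1 ^ 3 * u +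
    2 * b0 * b1 ^ 5 * u ^ 3 - 3 * b0 ^ 2 * b1 + 10 * b0 ^ 2 * b1 ^ 3 * u ^ 2 -
    9 * b0 ^ 2 * b1 ^ 5 * u ^ 4 - 12 * b0 ^ 3 * b1 * u + 2 * b0 ^ 3 * b1 ^ 3 * u ^ 3 -
    18 * b0 ^ 4 * b1 * u ^ 2 + 19 * b0 ^ 4 * b1 ^ 3 * u ^ 4 - 12 * b0 ^ 5 * b1 * u ^ 3 -
    3 * b0 ^ 6 * b1 * u ^ 4)
def P0 : A := u * ((1 + u * b0) * d0 u b0 b1 + u * b1 * d1 u b0 b1)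
def P1 : A := u * (-(u * b1 * d0 u b0 b1) - (1 + u * b0) * d1 u b0 b1)
def Q : A :=
  u ^ 2 * (u * (b1 + 4 * b1 ^ 3 * u ^ 2 - b1 ^ 5 * u ^ 4 + 4 * b0 * b1 * u -
    10 * b0 * b1 ^ 3 * u ^ 3 + 2 * b0 * b1 ^ 5 * u ^ 5 + 6 * b0 ^ 2 * b1 * u ^ 2 +
    4 * b0 ^ 3 * b1 * u ^ 3 - 2 * b0 ^ 3 * b1 ^ 3 * u ^ 5 + b0 ^ 4 * b1 * u ^ 4))

variable {B : Type*} [CommRing B] (ρ : A →+* B)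

theorem map_d0 : ρ (d0 u b0 b1) = d0 (ρ u) (ρ b0) (ρ b1) := by simp [d0, map_ofNat ρ]
theorem map_d1 : ρ (d1 u b0 b1) = d1 (ρ u) (ρ b0) (ρ b1) := by simp [d1, map_ofNat ρ]
theorem map_disc : ρ (disc u b0 b1) = disc (ρ u) (ρ b0) (ρ b1) := by simp [disc, map_d0, map_d1]
theorem map_F0 : ρ (F0 u b0 b1) = F0 (ρ u) (ρ b0) (ρ b1) := by
  simp [F0, n0, n1, map_d0, map_d1, map_ofNat ρ]
theorem map_F1 : ρ (F1 u b0 b1) = F1 (ρ u) (ρ b0) (ρ b1) := by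
  simp [F1, n0, n1, map_d0, map_d1, map_ofNat ρ]
theorem map_G : ρ (G u b0 b1) = G (ρ u) (ρ b0) (ρ b1) := by simp [G, map_ofNat ρ]
theorem map_P0 : ρ (P0 u b0 b1) = P0 (ρ u) (ρ b0) (ρ b1) := by simp [P0, map_d0, map_d1]
theorem map_P1 : ρ (P1 u b0 b1) = P1 (ρ u) (ρ b0) (ρ b1) := by simp [P1, map_d0, map_d1]
theorem map_Q : ρ (Q u b0 b1) = Q (ρ u) (ρ b0) (ρ b1) := by simp [Q, map_ofNat ρ]

variable {u b0 b1} {δ : A →+ A}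

theorem leibniz_one (hδ : IsLeibniz δ) : δ 1 = 0 := by
  have := hδ.leibniz 1 1
  simpa using this

theorem leibniz_natCast (hδ : IsLeibniz δ) (n : ℕ) : δ n = 0 := by
  induction n with
  | zero => simp
  | succ n ih => rw [Nat.cast_succ, map_add, ih, leibniz_one hδ, add_zero]

theorem leibniz_ofNat (hδ : IsLeibniz δ) (n : ℕ) [n.AtLeastTwo] : δ (OfNat.ofNat n) = 0 :=
  leibniz_natCast hδ n

theorem leibniz_d0 (hδ : IsLeibniz δ) (hu : δ u = 1) (h0 : δ b0 = 0) (h1 : δ b1 = 0) :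
    δ (d0 u b0 b1) = 2 * n0 u b0 b1 := by
  simp only [d0, n0, pow_two, map_add, map_sub, hδ.leibniz, leibniz_one hδ, leibniz_ofNat hδ, hu, h0, h1]
  ring

theorem leibniz_d1 (hδ : IsLeibniz δ) (hu : δ u = 1) (h0 : δ b0 = 0) (h1 : δ b1 = 0) :
    δ (d1 u b0 b1) = 2 * n1 u b0 b1 := by
  simp only [d1, n1, pow_two, map_sub, hδ.leibniz, leibniz_ofNat hδ, hu, h0, h1]
  ring

theorem leibniz_disc (hδ : IsLeibniz δ) (hu : δ u = 1) (h0 : δ b0 = 0) (h1 : δ b1 = 0) :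
    δ (disc u b0 b1) = 4 * F0 u b0 b1 := by
  simp only [disc, pow_two, map_sub, hδ.leibniz, leibniz_d0 hδ hu h0 h1, leibniz_d1 hδ hu h0 h1, F0]
  ring

/-- The left side is disc² times the derivative of F0/disc. This identity and the ones for F1, G, P
and Q are the differential equations with denominators cleared; for G and Q, whose denominator is
disc², the clearing factor is disc³. -/
theorem leibniz_F0 (hδ : IsLeibniz δ) (hu : δ u = 1) (h0 : δ b0 = 0) (h1 : δ b1 = 0) :
    δ (F0 u b0 b1) * disc u b0 b1 - F0 u b0 b1 * δ (disc u b0 b1) =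
    -(3 * F1 u b0 b1 ^ 2) - F0 u b0 b1 ^ 2 := by
  rw [leibniz_disc hδ hu h0 h1]
  simp only [F0, n0, n1, pow_two, map_add, map_sub, hδ.leibniz, leibniz_d0 hδ hu h0 h1,
    leibniz_d1 hδ hu h0 h1, leibniz_ofNat hδ, hu, h0, h1]
  simp only [F1, d0, d1, disc, n0, n1]
  ring

theorem leibniz_F1 (hδ : IsLeibniz δ) (hu : δ u = 1) (h0 : δ b0 = 0) (h1 : δ b1 = 0) :
    δ (F1 u b0 b1) * disc u b0 b1 - F1 u b0 b1 * δ (disc u b0 b1) =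
    4 * G u b0 b1 - 6 * (F1 u b0 b1 * F0 u b0 b1) := by
  rw [leibniz_disc hδ hu h0 h1]
  simp only [F1, n0, n1, pow_two, map_add, map_sub, hδ.leibniz, leibniz_d0 hδ hu h0 h1,
    leibniz_d1 hδ hu h0 h1, leibniz_ofNat hδ, hu, h0, h1]
  simp only [F0, G, d0, d1, disc, n0, n1]
  ring

theorem leibniz_G (hδ : IsLeibniz δ) (hu : δ u = 1) (h0 : δ b0 = 0) (h1 : δ b1 = 0) :
    δ (G u b0 b1) * disc u b0 b1 - 2 * (G u b0 b1 * δ (disc u b0 b1)) =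
    -F1 u b0 b1 ^ 3 - 3 * (F1 u b0 b1 * F0 u b0 b1 ^ 2) := by
  rw [leibniz_disc hδ hu h0 h1]
  simp only [G, pow_succ, pow_zero, one_mul, map_add, map_sub, map_neg, hδ.leibniz,
    leibniz_ofNat hδ, hu, h0, h1]
  simp only [F0, F1, d0, d1, disc, n0, n1]
  ring

theorem leibniz_P (hδ : IsLeibniz δ) (hu : δ u = 1) (h0 : δ b0 = 0) (h1 : δ b1 = 0) :
    δ (P0 u b0 b1 + P1 u b0 b1) * disc u b0 b1 -
    (P0 u b0 b1 + P1 u b0 b1) * δ (disc u b0 b1) = (d0 u b0 b1 - d1 u b0 b1) ^ 3 := by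
  rw [leibniz_disc hδ hu h0 h1]
  simp only [P0, P1, map_add, map_sub, map_neg, hδ.leibniz, leibniz_d0 hδ hu h0 h1,
    leibniz_d1 hδ hu h0 h1, leibniz_one hδ, hu, h0, h1]
  simp only [F0, d0, d1, disc, n0, n1]
  ring

theorem leibniz_Q (hδ : IsLeibniz δ) (hu : δ u = 1) (h0 : δ b0 = 0) (h1 : δ b1 = 0) :
    δ (Q u b0 b1) * disc u b0 b1 - 2 * (Q u b0 b1 * δ (disc u b0 b1)) =
    -((δ (P0 u b0 b1) * disc u b0 b1 - P0 u b0 b1 * δ (disc u b0 b1)) * P1 u b0 b1) := by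
  rw [leibniz_disc hδ hu h0 h1]
  simp only [Q, P0, pow_succ, pow_zero, one_mul, map_add, map_sub, hδ.leibniz,
    leibniz_ofNat hδ, leibniz_one hδ, leibniz_d0 hδ hu h0 h1, leibniz_d1 hδ hu h0 h1, hu, h0, h1]
  simp only [P1, F0, d0, d1, disc, n0, n1]
  ring

theorem disc_eq : (d0 u b0 b1 + d1 u b0 b1) * (d0 u b0 b1 - d1 u b0 b1) = disc u b0 b1 := by
  simp only [disc]; ring

theorem F0_add_F1 : F0 u b0 b1 + F1 u b0 b1 =
    (n0 u b0 b1 + n1 u b0 b1) * (d0 u b0 b1 - d1 u b0 b1) := by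
  simp only [F0, F1]; ring

end Poly

end Gauss

/-- The variable `u` of `ℤ[u]⟦t⟧`. -/
def uvar (S : Type*) [Ring S] : PowerSeries (Polynomial S) := PowerSeries.C Polynomial.X

theorem toQ_uvar : toQ (uvar ℤ) = uvar ℚ := by simp [toQ, uvar]

theorem du_uvar (S : Type*) [Ring S] : du (uvar S) = 1 := by
  ext1 k
  rw [coeff_du, uvar, coeff_C, coeff_one]
  split_ifs <;> simp

theorem bar_uvar (s : ℚ) : bar s (uvar ℚ) = uvar ℚ := by
  ext1 k
  rw [coeff_bar, uvar, coeff_C]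
  split_ifs with h
  · simp [h]
  · simp

theorem isLeibniz_du (S : Type*) [Ring S] :
    IsLeibniz (du : PowerSeries (Polynomial S) →+ PowerSeries (Polynomial S)) := ⟨du_mul⟩

theorem toQ_du (a : PowerSeries (Polynomial ℤ)) : toQ (du a) = du (toQ a) := by
  ext1 k
  rw [coeff_toQ, coeff_du, coeff_du, coeff_toQ, Polynomial.derivative_map]

theorem coeff_uvar_pow_mul (w : ℕ) (a : PowerSeries (Polynomial ℤ)) (k i : ℕ) (hi : i < w) :
    (coeff k (uvar ℤ ^ w * a)).coeff i = 0 := by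
  rw [uvar, ← map_pow, coeff_C_mul, Polynomial.coeff_X_pow_mul', if_neg (by omega)]

/-- The value at `u = 0`. -/
def atZero (S : Type*) [Ring S] : PowerSeries (Polynomial S) →+* PowerSeries S :=
  PowerSeries.map Polynomial.constantCoeff

theorem atZero_uvar : atZero ℤ (uvar ℤ) = 0 := by simp [atZero, uvar]

theorem atZero_toQ (a : PowerSeries (Polynomial ℤ)) :
    atZero ℚ (toQ a) = PowerSeries.map (Int.castRingHom ℚ) (atZero ℤ a) := by
  ext1 k
  simp [atZero, coeff_toQ]

/-- The parameters of the Gauss decomposition of `exp (u e_0) W exp (-u e_0)` where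
`W = exp (f(b1)) exp (f(b0))`. -/
structure GaussData (s : ℚ) (b0 b1 : PowerSeries (Polynomial ℤ)) where
  f0 : PowerSeries (Polynomial ℤ)
  f1 : PowerSeries (Polynomial ℤ)
  g : PowerSeries (Polynomial ℤ)
  p0 : PowerSeries (Polynomial ℤ)
  p1 : PowerSeries (Polynomial ℤ)
  q : PowerSeries (Polynomial ℤ)
  ψ : PowerSeries (Polynomial ℚ)
  cf0 : constantCoeff f0 = 0
  cf1 : constantCoeff f1 = 0
  cg : constantCoeff g = 0
  cψ : constantCoeff ψ = 0
  cp0 : constantCoeff p0 = 0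
  cp1 : constantCoeff p1 = 0
  cq : constantCoeff q = 0
  bf0 : bar s (toQ f0) = toQ f0
  bf1 : bar s (toQ f1) = -toQ f1
  bg : bar s (toQ g) = -toQ g
  bp0 : bar s (toQ p0) = toQ p0
  bp1 : bar s (toQ p1) = -toQ p1
  bq : bar s (toQ q) = -toQ q
  hf1 : du (toQ f1) = 4 * toQ g - 6 * (toQ f1 * toQ f0)
  hf0 : du (toQ f0) = -(3 * toQ f1 ^ 2) - toQ f0 ^ 2
  hg : du (toQ g) = -toQ f1 ^ 3 - 3 * (toQ f1 * toQ f0 ^ 2)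
  hψ : du ψ = toQ f0 + toQ f1
  hp : expSeries (-((4 : ℚ) • ψ - (2 : ℚ) • bar s ψ)) = 1 + du (toQ p0) + du (toQ p1)
  hq : du (toQ q) = -((1 + du (toQ p0)) * toQ p1)
  dvd_p0 : ∃ a, p0 = uvar ℤ ^ 1 * a
  dvd_p1 : ∃ a, p1 = uvar ℤ ^ 1 * a
  dvd_q : ∃ a, q = uvar ℤ ^ 2 * a
  f0_zero : atZero ℤ f0 = atZero ℤ b0
  f1_zero : atZero ℤ f1 = atZero ℤ b1
  g_zero : atZero ℤ g = 0
  exp_ψ : expSeries ((2 : ℚ) • ψ) = toQ (Gauss.d0 (uvar ℤ) b0 b1 + Gauss.d1 (uvar ℤ) b0 b1)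
  ψ_zero : atZero ℚ ψ = 0

-- The series `disc` has constant term 1 in t, hence an inverse with coefficients in ℤ[u]; so all
-- parameters except ψ are integral. Only ψ = ½ log d needs rational coefficients. The differential
-- equations are the polynomial identities for the numerators combined with the quotient rule, and
-- the parities hold because every numerator is visibly even or odd in b1.
open Gauss in
set_option maxHeartbeats 1000000 in
theorem nonempty_gaussData {s : ℚ} {b0 b1 : PowerSeries (Polynomial ℤ)} (c0 : constantCoeff b0 = 0)
    (c1 : constantCoeff b1 = 0) (h0 : du b0 = 0) (h1 : du b1 = 0) (e0 : bar s (toQ b0) = toQ b0)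
    (e1 : bar s (toQ b1) = -toQ b1) : Nonempty (GaussData s b0 b1) := by
  have hδ := isLeibniz_du ℤ
  have hu := du_uvar ℤ
  set u := uvar ℤ with hudef
  have cd0 : constantCoeff (d0 u b0 b1) = 1 := by rw [map_d0, c0, c1]; simp [d0]
  have cd1 : constantCoeff (d1 u b0 b1) = 0 := by rw [map_d1, c0, c1]; simp [d1]
  have cdisc : constantCoeff (disc u b0 b1) = 1 := by rw [disc, map_sub, map_pow, map_pow, cd0, cd1]; simp
  have hunit : IsUnit (disc u b0 b1) := by rw [isUnit_iff_constantCoeff, cdisc]; exact isUnit_one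
  obtain ⟨e, he⟩ := hunit.exists_right_inv
  have ce : constantCoeff e = 1 := by
    have := congrArg constantCoeff he
    rwa [map_mul, cdisc, one_mul, map_one] at this
  have hde : du e = -(e ^ 2 * du (disc u b0 b1)) := by
    have := congrArg du he
    rw [du_mul, leibniz_one hδ] at this
    linear_combination e * this - du e * he
  have uu : constantCoeff u = Polynomial.X := by rw [hudef, uvar]; simp
  have zu : atZero ℤ u = 0 := atZero_uvar
  have ze : atZero ℤ e = 1 := by
    have := congrArg (atZero ℤ) he
    rw [map_mul, map_disc, zu, map_one] at this
    simpa [disc, d0, d1] using this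
  have bu : bar s (toQ u) = toQ u := by rw [hudef, toQ_uvar, bar_uvar]
  have bd0 : bar s (toQ (d0 u b0 b1)) = toQ (d0 u b0 b1) := by
    simp only [map_d0, bu, e0, e1]; simp only [d0]; ring
  have bd1 : bar s (toQ (d1 u b0 b1)) = -toQ (d1 u b0 b1) := by
    simp only [map_d1, bu, e0, e1]; simp only [d1]; ring
  have bdisc : bar s (toQ (disc u b0 b1)) = toQ (disc u b0 b1) := by
    simp only [disc, map_sub, map_pow, bd0, bd1]; ring
  have heq : toQ (disc u b0 b1) * toQ e = 1 := by rw [← map_mul, he, map_one]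
  have be : bar s (toQ e) = toQ e := by
    have h := congrArg (bar s) heq
    rw [map_mul, bdisc, map_one] at h
    linear_combination (toQ e) * h - (bar s (toQ e)) * heq
  have bF0 : bar s (toQ (F0 u b0 b1)) = toQ (F0 u b0 b1) := by
    simp only [map_F0, bu, e0, e1]; simp only [F0, n0, n1, d0, d1]; ring
  have bF1 : bar s (toQ (F1 u b0 b1)) = -toQ (F1 u b0 b1) := by
    simp only [map_F1, bu, e0, e1]; simp only [F1, n0, n1, d0, d1]; ring
  have bG : bar s (toQ (G u b0 b1)) = -toQ (G u b0 b1) := by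
    simp only [map_G, bu, e0, e1]; simp only [G]; ring
  have bP0 : bar s (toQ (P0 u b0 b1)) = toQ (P0 u b0 b1) := by
    simp only [map_P0, bu, e0, e1]; simp only [P0, d0, d1]; ring
  have bP1 : bar s (toQ (P1 u b0 b1)) = -toQ (P1 u b0 b1) := by
    simp only [map_P1, bu, e0, e1]; simp only [P1, d0, d1]; ring
  have bQ : bar s (toQ (Q u b0 b1)) = -toQ (Q u b0 b1) := by
    simp only [map_Q, bu, e0, e1]; simp only [Q]; ring
  have cd : constantCoeff (toQ (d0 u b0 b1 + d1 u b0 b1)) = 1 := by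
    have : constantCoeff (toQ (d0 u b0 b1 + d1 u b0 b1) - 1) = 0 := by
      rw [← map_one toQ, ← map_sub]
      exact constantCoeff_toQ _ (by rw [map_sub, map_add, cd0, cd1]; simp)
    rwa [map_sub, map_one, sub_eq_zero] at this
  obtain ⟨L, cL, hL⟩ := exists_expSeries_eq cd
  have hψ2 : (2 : ℚ) • ((2⁻¹ : ℚ) • L) = L := by rw [smul_smul]; norm_num
  have hdu : ∀ a, toQ (du (a * e)) = toQ (du a * disc u b0 b1 - a * du (disc u b0 b1)) * toQ e ^ 2 := by
    intro a
    rw [← map_pow, ← map_mul, du_mul, hde]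
    congr 1
    linear_combination - e * du a * he
  have hdu2 : ∀ a, toQ (du (a * e ^ 2)) =
      toQ (du a * disc u b0 b1 - 2 * (a * du (disc u b0 b1))) * toQ e ^ 3 := by
    intro a
    rw [← map_pow, ← map_mul, pow_two e, du_mul, du_mul, hde]
    congr 1
    linear_combination - e ^ 2 * du a * he
  have hddiv : toQ (d0 u b0 b1 + d1 u b0 b1) * (toQ (d0 u b0 b1 - d1 u b0 b1) * toQ e) = 1 := by
    rw [← mul_assoc, ← map_mul, disc_eq, heq]
  have hψd : du ((2⁻¹ : ℚ) • L) = toQ (F0 u b0 b1 * e) + toQ (F1 u b0 b1 * e) := by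
    have hLd : du (expSeries L) = expSeries L * du L := du_expSeries cL (Commute.all _ _)
    have h2 : du L = 2 * du ((2⁻¹ : ℚ) • L) := by
      conv_lhs => rw [← hψ2]
      rw [ofNat_smul, two_mul, map_add, ← two_mul]
    rw [hL, ← toQ_du, map_add, leibniz_d0 hδ hu h0 h1, leibniz_d1 hδ hu h0 h1, h2, ← mul_add, map_mul,
      show toQ 2 = 2 from map_ofNat _ _, mul_left_comm] at hLd
    have h3 : toQ (n0 u b0 b1 + n1 u b0 b1) =
        toQ (d0 u b0 b1 + d1 u b0 b1) * du ((2⁻¹ : ℚ) • L) := by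
      have h4 : (2⁻¹ : ℚ) • (2 * toQ (n0 u b0 b1 + n1 u b0 b1)) = (2⁻¹ : ℚ) •
        (2 * (toQ (d0 u b0 b1 + d1 u b0 b1) * du ((2⁻¹ : ℚ) • L))) := congrArg _ hLd
      rwa [inv_two_smul rfl, inv_two_smul rfl] at h4
    rw [← map_add, ← add_mul, F0_add_F1, map_mul, map_mul, h3]
    linear_combination -(du ((2⁻¹ : ℚ) • L)) * hddiv
  -- With L = log d the left side is d⁻² d̄. Since d⁻¹ = d̄/disc, it equals d̄³/disc², which is the
  -- derivative of (P0 + P1)/disc.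
  have hpp : expSeries (-((4 : ℚ) • ((2⁻¹ : ℚ) • L) - (2 : ℚ) • bar s ((2⁻¹ : ℚ) • L))) =
      toQ (d0 u b0 b1 - d1 u b0 b1) ^ 3 * toQ e ^ 2 := by
    have cb : constantCoeff (bar s L) = 0 := by
      rw [← coeff_zero_eq_constantCoeff_apply, coeff_bar, coeff_zero_eq_constantCoeff_apply, cL,
        smul_zero]
    have e1 : (2 : ℚ) • bar s ((2⁻¹ : ℚ) • L) = bar s L := by
      rw [map_rat_smul, smul_smul]; norm_num
    have e2 : -((4 : ℚ) • ((2⁻¹ : ℚ) • L) - bar s L) = -L + (-L + bar s L) := by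
      rw [smul_smul, show (4 * 2⁻¹ : ℚ) = 2 by norm_num, ofNat_smul]; ring
    have e3 : expSeries (bar s L) = toQ (d0 u b0 b1 - d1 u b0 b1) := by
      have : bar s (expSeries L) = expSeries (bar s L) := rescale_expSeries _ _
      rw [← this, hL, map_add, map_add, bd0, bd1, map_sub, sub_eq_add_neg]
    have e4 : expSeries (-L) = toQ (d0 u b0 b1 - d1 u b0 b1) * toQ e := by
      have := expSeries_mul_expSeries_neg cL
      rw [hL] at this
      linear_combination (toQ (d0 u b0 b1 - d1 u b0 b1) * toQ e) * this - expSeries (-L) * hddiv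
    rw [e1, e2, expSeries_add (Commute.all _ _) (by simp [cL]) (by simp [cL, cb]),
      expSeries_add (Commute.all _ _) (by simp [cL]) cb, e3, e4]
    ring
  have hdp0 : 1 + du (toQ (P0 u b0 b1 * e - u)) = toQ (du (P0 u b0 b1 * e)) := by
    rw [map_sub, map_sub, ← toQ_du, ← toQ_du, hu, map_one]; ring
  refine ⟨{
    f0 := F0 u b0 b1 * e
    f1 := F1 u b0 b1 * e
    g := G u b0 b1 * e ^ 2
    -- Subtracting u turns 1 + p0' into the derivative of P0/disc. It also makes the constant term
    -- in t vanish, because P0/disc reduces to u at t = 0, while divisibility by u is preserved.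
    p0 := P0 u b0 b1 * e - u
    p1 := P1 u b0 b1 * e
    q := Q u b0 b1 * e ^ 2
    ψ := (2⁻¹ : ℚ) • L
    cf0 := by rw [map_mul, map_F0, c0, c1]; simp [F0, n0, n1]
    cf1 := by rw [map_mul, map_F1, c0, c1]; simp [F1, n0, n1]
    cg := by rw [map_mul, map_G, c0, c1]; simp [G]
    cψ := by simp [cL]
    cp0 := by rw [map_sub, map_mul, map_P0, c0, c1, ce]; simp [P0, d0]
    cp1 := by rw [map_mul, map_P1, c0, c1, ce]; simp [P1, d1]
    cq := by rw [map_mul, map_Q, c0, c1]; simp [Q]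
    bf0 := by rw [map_mul, map_mul, bF0, be]
    bf1 := by rw [map_mul, map_mul, bF1, be, neg_mul]
    bg := by rw [map_mul, map_mul, map_pow, map_pow, bG, be, neg_mul]
    bp0 := by rw [map_sub, map_sub, map_mul, map_mul, bP0, be, bu]
    bp1 := by rw [map_mul, map_mul, bP1, be, neg_mul]
    bq := by rw [map_mul, map_mul, map_pow, map_pow, bQ, be, neg_mul]
    hf1 := by
      rw [← toQ_du, hdu, leibniz_F1 hδ hu h0 h1]
      simp only [map_sub, map_mul, map_pow, show toQ 4 = 4 from map_ofNat _ _,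
        show toQ 6 = 6 from map_ofNat _ _]
      ring
    hf0 := by
      rw [← toQ_du, hdu, leibniz_F0 hδ hu h0 h1]
      simp only [map_sub, map_neg, map_mul, map_pow, show toQ 3 = 3 from map_ofNat _ _]
      ring
    hg := by
      rw [← toQ_du, hdu2, leibniz_G hδ hu h0 h1]
      simp only [map_sub, map_neg, map_mul, map_pow, show toQ 3 = 3 from map_ofNat _ _]
      ring
    hψ := hψd
    hp := by
      rw [hpp, hdp0, ← toQ_du, ← map_add, ← map_add, ← add_mul, hdu, leibniz_P hδ hu h0 h1, map_pow]
    hq := by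
      rw [hdp0, ← toQ_du, hdu2, leibniz_Q hδ hu h0 h1, hdu]
      simp only [map_sub, map_neg, map_mul]
      ring
    dvd_p0 := ⟨((1 + u * b0) * d0 u b0 b1 + u * b1 * d1 u b0 b1) * e - 1, by rw [P0]; ring⟩
    dvd_p1 := ⟨_, by rw [P1, pow_one, mul_assoc]⟩
    dvd_q := ⟨_, by rw [Q, mul_assoc]⟩
    f0_zero := by rw [map_mul, map_F0, ze, zu]; simp [F0, n0, n1, d0, d1]
    f1_zero := by rw [map_mul, map_F1, ze, zu]; simp [F1, n0, n1, d0, d1]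
    g_zero := by rw [map_mul, map_G, zu]; simp [G]
    exp_ψ := by rw [hψ2, hL]
    ψ_zero := ?_ }⟩
  have h : atZero ℚ L = 0 := by
    refine expSeries_injective ?_ (map_zero _) ?_
    · rw [atZero, ← coeff_zero_eq_constantCoeff_apply, coeff_map, coeff_zero_eq_constantCoeff_apply,
        cL, map_zero]
    · rw [expSeries_zero, atZero, ← map_expSeries, hL, ← atZero, atZero_toQ, map_add, map_d0, map_d1,
        zu]
      simp [d0, d1]
  rw [map_rat_smul, h, smul_zero]

/-! ### Gauss decomposition in a half loop -/

/-- Integration of the differential equation satisfied by the coefficients of the conjugates. -/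
theorem divPow_mul_eq_sum {R : Type*} [Ring R] [Algebra ℚ R] {e : R} {w : ℕ → R}
    (hw : ∀ i, e * w i = (i + 1) • w (i + 1) + w i * e) (k : ℕ) :
    divPow e k * w 0 = ∑ ij ∈ antidiagonal k, w ij.1 * divPow e ij.2 := by
  induction k with
  | zero => simp
  | succ k ih =>
    have : IsAddTorsionFree R := IsAddTorsionFree.of_module_rat R
    refine nsmul_right_injective k.succ_ne_zero ?_
    have hs : ∀ n, (n + 1) • divPow e (n + 1) = e * divPow e n := fun n => by
      rw [← Nat.cast_smul_eq_nsmul ℚ, succ_smul_divPow_succ]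
    change (k + 1) • _ = (k + 1) • _
    rw [← smul_mul_assoc, hs, mul_assoc, ih, mul_sum]
    -- The factor k + 1 is distributed as ij.1 + ij.2: the first part differentiates the sequence w,
    -- the second the divided power of e.
    have h1 : (k + 1) • ∑ ij ∈ antidiagonal (k + 1), w ij.1 * divPow e ij.2 =
        ∑ ij ∈ antidiagonal (k + 1), ij.1 • (w ij.1 * divPow e ij.2) +
        ∑ ij ∈ antidiagonal (k + 1), ij.2 • (w ij.1 * divPow e ij.2) := by
      rw [smul_sum, ← sum_add_distrib]
      refine sum_congr rfl fun ij h => ?_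
      rw [← add_smul, HasAntidiagonal.mem_antidiagonal.1 h]
    rw [h1, Nat.sum_antidiagonal_succ, Nat.sum_antidiagonal_succ', zero_smul, zero_smul, zero_add,
      zero_add, ← sum_add_distrib]
    refine sum_congr rfl fun ij _ => ?_
    rw [← mul_assoc, hw, add_mul, smul_mul_assoc, mul_assoc, ← hs, mul_smul_comm]

namespace GaussData

variable {R : Type*} [Ring R] [Algebra ℚ R] {s : ℚ} {b0 b1 : PowerSeries (Polynomial ℤ)}
  (D : GaussData s b0 b1) (L : HalfLoop R s)

/-- The lower factor. -/
def lower : PowerSeries (Polynomial R) :=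
  expSeries (lin L.f (toQ D.f1)) * expSeries (lin L.F (toQ D.g)) * expSeries (lin L.f (toQ D.f0))

/-- The diagonal factor. -/
def diag : PowerSeries (Polynomial R) := expSeries (lin L.H D.ψ)

/-- The upper factor. -/
def upper : PowerSeries (Polynomial R) :=
  expSeries (lin L.e (toQ D.p1)) * expSeries (lin L.E (toQ D.q)) * expSeries (lin L.e (toQ D.p0))

theorem coeff_lower_mul_eq (k l : ℕ) :
    divPow (L.e 0) k * (coeff l (D.lower L * D.diag L * D.upper L)).coeff 0 =
      ∑ ij ∈ antidiagonal k,
        (coeff l (D.lower L * D.diag L * D.upper L)).coeff ij.1 * divPow (L.e 0) ij.2 := by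
  have h := L.du_gauss (constantCoeff_toQ _ D.cf0) (constantCoeff_toQ _ D.cf1)
    (constantCoeff_toQ _ D.cg) D.cψ (constantCoeff_toQ _ D.cp0) (constantCoeff_toQ _ D.cp1)
    (constantCoeff_toQ _ D.cq) D.bf0 D.bf1 D.bg D.bp0 D.bp1 D.hf1 D.hf0 D.hg D.hψ D.hp D.hq
    (W := D.lower L * D.diag L * D.upper L) rfl
  have he : lin L.e 1 = PowerSeries.C (Polynomial.C (L.e 0)) := by
    ext1 k
    rw [coeff_lin, coeff_one, coeff_C]
    split_ifs with hk <;> simp [hk]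
  refine divPow_mul_eq_sum (w := fun i => (coeff l (D.lower L * D.diag L * D.upper L)).coeff i)
    (fun i => ?_) k
  have := congrArg (fun p => (coeff l p).coeff i) h
  simp only [he, map_add, coeff_C_mul, coeff_mul_C, Polynomial.coeff_add, Polynomial.coeff_C_mul,
    Polynomial.coeff_mul_C, coeff_du, Polynomial.coeff_derivative] at this
  rw [this, nsmul_eq_mul]
  push_cast
  rw [← Nat.cast_succ, (Nat.cast_commute (i + 1) _).eq]

theorem atZero_lin (y : ℕ → R) (a : PowerSeries (Polynomial ℚ)) :
    atZero R (lin y a) = PowerSeries.mk fun k => (coeff k (atZero ℚ a)) • y k := by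
  ext1 k
  simp [atZero, coeff_lin, scal, Algebra.smul_def]

theorem atZero_expSeries (A : PowerSeries (Polynomial R)) :
    atZero R (expSeries A) = expSeries (atZero R A) := map_expSeries _ _

theorem atZero_diag : atZero R (D.diag L) = 1 := by
  rw [diag, atZero_expSeries, atZero_lin, D.ψ_zero, ← expSeries_zero]
  congr 1
  ext1 k; simp

theorem atZero_eq_zero {w : ℕ} (hw : 0 < w) {a : PowerSeries (Polynomial ℤ)}
    (h : ∃ b, a = uvar ℤ ^ w * b) : atZero ℚ (toQ a) = 0 := by
  obtain ⟨b, rfl⟩ := h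
  rw [atZero_toQ, map_mul, map_pow, atZero_uvar, zero_pow hw.ne', zero_mul, map_zero]

theorem atZero_upper : atZero R (D.upper L) = 1 := by
  have h0 : ∀ y : ℕ → R, (PowerSeries.mk fun k => (coeff k (0 : PowerSeries ℚ)) • y k) = 0 := fun y => by
    ext1 k; simp
  rw [upper, map_mul, map_mul, atZero_expSeries, atZero_expSeries, atZero_expSeries, atZero_lin,
    atZero_lin, atZero_lin, atZero_eq_zero one_pos D.dvd_p0, atZero_eq_zero one_pos D.dvd_p1,
    atZero_eq_zero two_pos D.dvd_q, h0, h0, expSeries_zero, one_mul, one_mul]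

theorem atZero_lower : atZero R (D.lower L) =
    expSeries (PowerSeries.mk fun k => (coeff k (atZero ℤ b1)) • L.f k) *
      expSeries (PowerSeries.mk fun k => (coeff k (atZero ℤ b0)) • L.f k) := by
  have h0 : ∀ y : ℕ → R, (PowerSeries.mk fun k => (coeff k (0 : PowerSeries ℚ)) • y k) = 0 := fun y => by
    ext1 k; simp
  have h1 : ∀ b : PowerSeries (Polynomial ℤ), (PowerSeries.mk fun k => (coeff k (atZero ℚ (toQ b))) • L.f k) =
      PowerSeries.mk fun k => (coeff k (atZero ℤ b)) • L.f k := fun b => by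
    ext1 k
    rw [atZero_toQ, coeff_mk, coeff_mk, coeff_map, eq_intCast, Int.cast_smul_eq_zsmul]
  rw [lower, map_mul, map_mul, atZero_expSeries, atZero_expSeries, atZero_expSeries, atZero_lin,
    atZero_lin, atZero_lin, h1, h1, D.f0_zero, D.f1_zero, atZero_toQ, D.g_zero, map_zero, h0,
    expSeries_zero, mul_one]

/-- The divided powers of `e_0` against the initial value of the Gauss decomposition. -/
theorem divPow_mul_coeff_init (k l : ℕ) :
    divPow (L.e 0) k *
        coeff l (expSeries (PowerSeries.mk fun k => (coeff k (atZero ℤ b1)) • L.f k) *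
          expSeries (PowerSeries.mk fun k => (coeff k (atZero ℤ b0)) • L.f k)) =
      ∑ ij ∈ antidiagonal k,
        (coeff l (D.lower L * D.diag L * D.upper L)).coeff ij.1 * divPow (L.e 0) ij.2 := by
  have h : atZero R (D.lower L * D.diag L * D.upper L) = atZero R (D.lower L) := by
    rw [map_mul, map_mul, atZero_diag, atZero_upper, mul_one, mul_one]
  have h' := congrArg (coeff l) h
  rw [atZero, coeff_map, Polynomial.constantCoeff_apply, ← atZero, D.atZero_lower L] at h'
  rw [← D.coeff_lower_mul_eq L k l, h']

end GaussData

/-! ### The defining relations in the enveloping algebra -/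

section Relations

attribute [local instance] LieRing.ofAssociativeRing

/-- The canonical map from the free Lie algebra to the enveloping algebra. -/
def freeToU : Free →ₗ⁅ℚ⁆ U :=
  { ((UniversalEnvelopingAlgebra.ι ℚ : LieA22 →ₗ⁅ℚ⁆ U) : LieA22 →ₗ[ℚ] U).comp
      (LieSubmodule.Quotient.mk' relIdeal : Free →ₗ[ℚ] LieA22) with
    map_lie' := fun {a b} => by
      change UniversalEnvelopingAlgebra.ι ℚ (LieSubmodule.Quotient.mk (N := relIdeal) ⁅a, b⁆) = _
      rw [LieSubmodule.Quotient.mk_bracket, LieHom.map_lie]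
      rfl }

theorem freeToU_gen (g : Gen) : freeToU (gen g) = toU g := rfl

theorem freeToU_eq_of_rel {a b : Free} (h : Rel a b) : freeToU a = freeToU b := by
  have : (LieSubmodule.Quotient.mk (N := relIdeal) a) = LieSubmodule.Quotient.mk b := by
    refine (Submodule.Quotient.eq _).2 ?_
    exact LieSubmodule.subset_lieSpan ⟨a, b, h, rfl⟩
  exact congrArg (UniversalEnvelopingAlgebra.ι ℚ) this

theorem toU_mul_of_rel {g g' : Gen} {b : Free} (h : Rel ⁅gen g, gen g'⁆ b) :
    toU g * toU g' = toU g' * toU g + freeToU b := by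
  have := freeToU_eq_of_rel h
  rw [LieHom.map_lie, freeToU_gen, freeToU_gen, LieRing.of_associative_ring_bracket] at this
  rw [← this]; abel

theorem c_central (g : Gen) : c * toU g = toU g * c := by
  have := toU_mul_of_rel (Rel.c_central g)
  rwa [map_zero, add_zero] at this

theorem h_mul_h (r s : ℤ) : h r * h s = h s * h r +
    (if r + s = 0 then 2 * (r : ℚ) * (2 + (-1 : ℚ) ^ (r - 1)) else 0) • c := by
  have := toU_mul_of_rel (Rel.h_h r s)
  rwa [map_smul, freeToU_gen] at this

theorem h_mul_x (σ : ℤˣ) (r s : ℤ) : h r * x σ s = x σ s * h r +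
    (sgn σ * (2 * (2 + (-1 : ℚ) ^ (r - 1)))) • x σ (r + s) := by
  have := toU_mul_of_rel (Rel.h_x σ r s)
  rwa [map_smul, freeToU_gen] at this

theorem h_mul_X_odd (σ : ℤˣ) (n m : ℤ) : h (2 * n + 1) * X σ m = X σ m * h (2 * n + 1) := by
  have := toU_mul_of_rel (Rel.h_X_odd σ n m)
  rwa [map_zero, add_zero] at this

/-- `X_j^σ` for odd `j`, and `0` for even `j`. -/
def Xo (σ : ℤˣ) (j : ℤ) : U := if Odd j then X σ ((j - 1) / 2) else 0

theorem Xo_odd (σ : ℤˣ) (m : ℤ) : Xo σ (2 * m + 1) = X σ m := by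
  rw [Xo, if_pos ⟨m, rfl⟩]; congr 1; omega

theorem Xo_even (σ : ℤˣ) {j : ℤ} (h : Even j) : Xo σ j = 0 := by
  rw [Xo, if_neg (Int.not_odd_iff_even.2 h)]

theorem x_mul_x (σ : ℤˣ) (r s : ℤ) : x σ r * x σ s = x σ s * x σ r +
    (sgn σ * (-1 : ℚ) ^ s) • Xo σ (r + s) := by
  rcases Int.even_or_odd (r + s) with h | ⟨m, h⟩
  · have := toU_mul_of_rel (Rel.x_x_even σ r s h)
    rw [map_zero, add_zero] at this
    rw [Xo_even σ h, smul_zero, add_zero]; exact this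
  · have := toU_mul_of_rel (Rel.x_x_odd σ r s m h)
    rw [map_smul, freeToU_gen] at this
    rw [h, Xo_odd]; exact this

theorem x_mul_X (σ : ℤˣ) (r m : ℤ) : x σ r * X σ m = X σ m * x σ r := by
  have := toU_mul_of_rel (Rel.x_X_same σ r m)
  rwa [map_zero, add_zero] at this

theorem X_mul_X (σ : ℤˣ) (n m : ℤ) : X σ n * X σ m = X σ m * X σ n := by
  have := toU_mul_of_rel (Rel.X_X_same σ n m)
  rwa [map_zero, add_zero] at this

theorem x_mul_x_opp (r s : ℤ) : x 1 r * x (-1) s = x (-1) s * x 1 r +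
    (h (r + s) + (if r + s = 0 then (r : ℚ) else 0) • c) := by
  have := toU_mul_of_rel (Rel.x_x_opp r s)
  rwa [map_add, map_smul, freeToU_gen, freeToU_gen] at this

theorem x_mul_X_opp (σ : ℤˣ) (r m : ℤ) : x σ r * X (-σ) m = X (-σ) m * x σ r +
    (sgn σ * ((-1 : ℚ) ^ r * 4)) • x (-σ) (r + (2 * m + 1)) := by
  have := toU_mul_of_rel (Rel.x_X_opp σ r m)
  rwa [map_smul, freeToU_gen] at this

theorem x_mul_Xo (σ : ℤˣ) (r j : ℤ) : x σ r * Xo σ j = Xo σ j * x σ r := by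
  rw [Xo]; split_ifs
  · exact x_mul_X _ _ _
  · simp

theorem Xo_mul_Xo (σ : ℤˣ) (i j : ℤ) : Xo σ i * Xo σ j = Xo σ j * Xo σ i := by
  rw [Xo, Xo]; split_ifs
  · exact X_mul_X _ _ _
  all_goals simp

theorem c_commute_h (r : ℤ) : c * h r = h r * c := c_central _
theorem c_commute_x (σ : ℤˣ) (r : ℤ) : c * x σ r = x σ r * c := c_central _
theorem c_commute_X (σ : ℤˣ) (r : ℤ) : c * X σ r = X σ r * c := c_central _

end Relations

theorem neg_one_zpow_mul_natCast (n : ℤ) (i : ℕ) : ((-1 : ℚ) ^ n) ^ i = (-1) ^ (n * i) := by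
  rw [zpow_mul, zpow_natCast]

theorem neg_one_zpow_eq_neg_one_iff {j : ℤ} : (-1 : ℚ) ^ j = -1 ↔ Odd j := by
  constructor
  · intro h
    by_contra h'
    rw [Int.not_odd_iff_even] at h'
    rw [h'.neg_one_zpow] at h
    norm_num at h
  · exact fun h => h.neg_one_zpow

theorem neg_one_zpow_neg (r : ℤ) : (-1 : ℚ) ^ (-r) = (-1) ^ r := by
  rw [zpow_neg, ← inv_zpow, inv_neg_one]

theorem two_mul_two_add (r : ℤ) : 2 * (2 + (-1 : ℚ) ^ (r - 1)) = 4 - 2 * (-1) ^ r := by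
  rw [zpow_sub_one₀ (by norm_num)]; ring

/-- The half loop generated by `x⁺_r`, `x⁻_{-r}` and the shift by `n`. -/
def loop (r n : ℤ) : HalfLoop U ((-1) ^ n) where
  e k := x 1 (r + n * k)
  f k := x (-1) (-r + n * k)
  -- The central term belongs to degree zero only. For n = 0 it is present for every k, so the
  -- Cartan element is then h_0 + rc throughout.
  H k := h (n * k) + (if n * k = 0 then (r : ℚ) else 0) • c
  -- The factor (-1)^r absorbs the constant part of the sign (-1)^(r + nj) in the bracket of two x's
  -- and leaves s^j. The same normalization is used for F.
  E k := (-1 : ℚ) ^ r • Xo 1 (2 * r + n * k)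
  F k := (-1 : ℚ) ^ r • Xo (-1) (-(2 * r) + n * k)
  ef i j := by
    rw [x_mul_x_opp, show r + n * i + (-r + n * j) = n * ((i + j : ℕ) : ℤ) by push_cast; ring]
    congr 3
    split_ifs with h
    · rcases mul_eq_zero.1 h with h | h
      · simp [h]
      · have : i = 0 := by omega
        simp [this]
    · rfl
  He i j := by
    rw [add_mul, mul_add, h_mul_x, smul_mul_assoc, mul_smul_comm, c_commute_x, two_mul_two_add,
      neg_one_zpow_mul_natCast, show n * i + (r + n * j) = r + n * ((i + j : ℕ) : ℤ) by push_cast; ring]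
    simp only [sgn, Units.val_one, Int.cast_one, one_mul]
    abel
  Hf i j := by
    rw [add_mul, mul_add, h_mul_x, smul_mul_assoc, mul_smul_comm, c_commute_x, two_mul_two_add,
      neg_one_zpow_mul_natCast, show n * i + (-r + n * j) = -r + n * ((i + j : ℕ) : ℤ) by push_cast; ring]
    simp only [sgn, Units.val_neg, Units.val_one, Int.cast_neg, Int.cast_one, neg_mul, one_mul, neg_smul]
    abel
  ee i j := by
    rw [x_mul_x, neg_one_zpow_mul_natCast, smul_smul,
      show r + n * i + (r + n * j) = 2 * r + n * ((i + j : ℕ) : ℤ) by push_cast; ring]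
    congr 2
    rw [zpow_add₀ (by norm_num)]
    simp [sgn, mul_comm]
  ff i j := by
    rw [x_mul_x, neg_one_zpow_mul_natCast, smul_smul,
      show -r + n * i + (-r + n * j) = -(2 * r) + n * ((i + j : ℕ) : ℤ) by push_cast; ring,
      sub_eq_add_neg, ← neg_smul]
    congr 2
    rw [zpow_add₀ (by norm_num), neg_one_zpow_neg]
    simp [sgn, mul_comm]
  eF i j hj := by
    rw [neg_one_zpow_mul_natCast, neg_one_zpow_eq_neg_one_iff] at hj
    obtain ⟨m, hm⟩ := hj
    rw [hm, show -(2 * r) + (2 * m + 1) = 2 * (-r + m) + 1 by ring, Xo_odd, mul_smul_comm,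
      smul_mul_assoc, show (-1 : ℤˣ) = -(1 : ℤˣ) from rfl, x_mul_X_opp, smul_add, smul_smul]
    congr 2
    · simp only [sgn, zpow_add₀ (show (-1 : ℚ) ≠ 0 by norm_num), neg_one_zpow_mul_natCast]
      have : (-1 : ℚ) ^ r * (-1) ^ r = 1 := by rw [← mul_zpow]; norm_num
      simp only [Units.val_one, Int.cast_one]
      linear_combination (4 * (-1 : ℚ) ^ (n * (i : ℤ))) * this
    · congr 1
      push_cast
      linear_combination -hm
  HF i j hi hj := by
    rw [neg_one_zpow_mul_natCast, neg_one_zpow_eq_neg_one_iff] at hi hj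
    obtain ⟨m, hm⟩ := hj
    obtain ⟨l, hl⟩ := hi
    rw [hm, show -(2 * r) + (2 * m + 1) = 2 * (-r + m) + 1 by ring, Xo_odd, hl, mul_smul_comm,
      add_mul, smul_mul_assoc, mul_add, smul_mul_assoc, mul_smul_comm, c_commute_X, h_mul_X_odd, smul_mul_assoc, smul_add,
      smul_comm]
  E_eq_zero k hk := by
    rw [neg_one_zpow_mul_natCast, Ne, neg_one_zpow_eq_neg_one_iff, Int.not_odd_iff_even] at hk
    rw [Xo_even _ ((even_two_mul _).add hk), smul_zero]
  F_eq_zero k hk := by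
    rw [neg_one_zpow_mul_natCast, Ne, neg_one_zpow_eq_neg_one_iff, Int.not_odd_iff_even] at hk
    rw [Xo_even _ ((even_two_mul _).neg.add hk), smul_zero]
  eE i j := by rw [mul_smul_comm, smul_mul_assoc, x_mul_Xo]
  fF i j := by rw [mul_smul_comm, smul_mul_assoc, x_mul_Xo]
  EE i j := by rw [mul_smul_comm, smul_mul_assoc, smul_mul_assoc, mul_smul_comm, Xo_mul_Xo]
  FF i j := by rw [mul_smul_comm, smul_mul_assoc, smul_mul_assoc, mul_smul_comm, Xo_mul_Xo]
  HH i j := by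
    have : h (n * i) * h (n * j) = h (n * j) * h (n * i) := by
      rw [h_mul_h]
      split_ifs with hij
      · have : n * (i : ℤ) = 0 := by
          rcases mul_eq_zero.1 (show n * ((i : ℤ) + j) = 0 by linarith) with h | h
          · simp [h]
          · have : (i : ℤ) = 0 := by omega
            simp [this]
        rw [this]; simp
      · simp
    simp only [add_mul, mul_add, smul_mul_assoc, mul_smul_comm, this, c_commute_h, smul_add]
    rw [smul_comm]
    abel

/-! ### Commuting families with divided multiplication -/

section Monomials

variable {R : Type*} [Ring R] [Algebra ℚ R] {ι : Type*} [LinearOrder ι]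

/-- A subgroup containing `1` and stable under left multiplication by `s` contains the subring
generated by `s`. -/
theorem adjoin_le_of_mul_mem {s : Set R} {M : Submodule ℤ R} (h1 : (1 : R) ∈ M)
    (h : ∀ a ∈ s, ∀ b ∈ M, a * b ∈ M) : Subalgebra.toSubmodule (Algebra.adjoin ℤ s) ≤ M := by
  rw [Algebra.adjoin_eq_span, Submodule.span_le]
  intro z hz
  induction hz using Submonoid.closure_induction_left with
  | one => exact h1
  | mul_left a ha b _ ih => exact h a ha b ih

theorem monomialProd_mem {S : Subalgebra ℤ R} {f : ι → ℕ → R} (h : ∀ i n, f i n ∈ S) (k : ι →₀ ℕ) :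
    monomialProd f k ∈ S := by
  refine Subalgebra.list_prod_mem S fun z hz => ?_
  obtain ⟨i, _, rfl⟩ := List.mem_map.1 hz
  exact h _ _

/-- The elements `f i n` generate a commutative ring, where the ordered product is an unordered one,
and multiplication by `f i n` affects the factor at `i` alone. The integer z is the structure
constant: a binomial coefficient for divided powers, 1 for ordinary powers. -/
theorem exists_monomialProd_eq {f : ι → ℕ → R} (hc : ∀ i j m n, Commute (f i m) (f j n))
    (h0 : ∀ i, f i 0 = 1) (hm : ∀ i m n, ∃ z : ℤ, f i m * f i n = z • f i (m + n)) (i : ι) (n : ℕ)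
    (k : ι →₀ ℕ) : ∃ k' : ι →₀ ℕ, ∃ z : ℤ, f i n * monomialProd f k = z • monomialProd f k' := by
  let s : Set R := {w | ∃ i n, w = f i n}
  have hcomm : IsMulCommutative (Algebra.adjoin ℤ s) := Algebra.isMulCommutative_adjoin ℤ (by
    rintro _ ⟨i, m, rfl⟩ _ ⟨j, n, rfl⟩
    exact hc i j m n)
  let _ : CommRing (Algebra.adjoin ℤ s) :=
    { (inferInstance : Ring (Algebra.adjoin ℤ s)) with mul_comm := hcomm.is_comm.comm }
  let f' : ι → ℕ → Algebra.adjoin ℤ s := fun i n => ⟨f i n, Algebra.subset_adjoin ⟨i, n, rfl⟩⟩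
  have h0' : ∀ i, f' i 0 = 1 := fun i => Subtype.ext (h0 i)
  have key : ∀ k, monomialProd f k = ((k.prod f' : Algebra.adjoin ℤ s) : R) := fun k => by
    rw [Finsupp.prod, Finset.prod_eq_multiset_prod, ← Finset.sort_eq k.support (· ≤ ·),
      Multiset.map_coe, Multiset.prod_coe, monomialProd]
    change _ = (Algebra.adjoin ℤ s).val _
    rw [map_list_prod, List.map_map]
    rfl
  obtain ⟨z, hz⟩ := hm i n (k i)
  refine ⟨k + Finsupp.single i n, z, ?_⟩
  rw [key, key, ← Finsupp.mul_prod_erase' k i f' h0',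
    ← Finsupp.mul_prod_erase' (k + Finsupp.single i n) i f' h0', Finsupp.erase_add,
    Finsupp.erase_single, add_zero]
  change f i n * (f i (k i) * _) = z • (f i ((k + Finsupp.single i n) i) * _)
  rw [← mul_assoc, hz, smul_mul_assoc, Finsupp.add_apply, Finsupp.single_eq_same, add_comm n]

theorem span_monomialProd {f : ι → ℕ → R} (hc : ∀ i j m n, Commute (f i m) (f j n))
    (h0 : ∀ i, f i 0 = 1) (hm : ∀ i m n, ∃ z : ℤ, f i m * f i n = z • f i (m + n)) :
    Submodule.span ℤ (Set.range (monomialProd f)) =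
      Subalgebra.toSubmodule (Algebra.adjoin ℤ {w | ∃ i n, w = f i n}) := by
  refine le_antisymm ?_ (adjoin_le_of_mul_mem ?_ ?_)
  · rw [Submodule.span_le]
    rintro _ ⟨k, rfl⟩
    exact monomialProd_mem (fun i n => Algebra.subset_adjoin (by exact ⟨i, n, rfl⟩)) k
  · exact Submodule.subset_span ⟨0, by simp [monomialProd]⟩
  · rintro _ ⟨i, n, rfl⟩ b hb
    induction hb using Submodule.span_induction with
    | mem b hb =>
      obtain ⟨k, rfl⟩ := hb
      obtain ⟨k', z, h⟩ := exists_monomialProd_eq hc h0 hm i n k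
      rw [h]
      exact Submodule.smul_mem _ _ (Submodule.subset_span ⟨k', rfl⟩)
    | zero => simp
    | add a b _ _ ha hb => rw [mul_add]; exact add_mem ha hb
    | smul z a _ ha => rw [mul_smul_comm]; exact Submodule.smul_mem _ _ ha

/-- For commuting elements a divided power of a sum is a sum of products of divided powers, and a
divided power of an integer multiple is an integer multiple. Hence the divided powers of the
spanning elements generate those of the whole span. -/
theorem divPow_mem_of_span {ι : Type*} {y : ι → R} (hy : ∀ i j, Commute (y i) (y j)) {S : Subalgebra ℤ R}
    (hS : ∀ i n, divPow (y i) n ∈ S) {a : R} (ha : a ∈ Submodule.span ℤ (Set.range y)) (k : ℕ) :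
    divPow a k ∈ S := by
  suffices h : (∀ k, divPow a k ∈ S) ∧ ∀ b ∈ Submodule.span ℤ (Set.range y), Commute a b from h.1 k
  have hcomm : ∀ a ∈ Submodule.span ℤ (Set.range y), ∀ b ∈ Submodule.span ℤ (Set.range y),
      Commute a b := by
    intro a ha b hb
    induction ha using Submodule.span_induction with
    | mem a ha =>
      obtain ⟨i, rfl⟩ := ha
      induction hb using Submodule.span_induction with
      | mem b hb => obtain ⟨j, rfl⟩ := hb; exact hy i j
      | zero => exact Commute.zero_right _
      | add _ _ _ _ h h' => exact h.add_right h'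
      | smul z _ _ h => exact h.smul_right z
    | zero => exact Commute.zero_left _
    | add _ _ _ _ h h' => exact h.add_left h'
    | smul z _ _ h => exact h.smul_left z
  refine ⟨?_, hcomm a ha⟩
  induction ha using Submodule.span_induction with
  | mem a ha => obtain ⟨i, rfl⟩ := ha; exact hS i
  | zero => rintro (_ | k); · simp [one_mem]
            · rw [divPow_zero_left]; exact zero_mem _
  | add a b ha hb iha ihb =>
    intro k
    rw [divPow_add (hcomm a ha b hb)]
    exact sum_mem fun ij _ => mul_mem (iha _) (ihb _)
  | smul z a _ ih =>
    intro k
    rw [divPow_smul_int]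
    exact S.zsmul_mem (ih k) _

theorem divAlg_eq_adjoin {ι : Type*} {y : ι → R} (hy : ∀ i j, Commute (y i) (y j)) :
    divAlg (Set.range y) = Algebra.adjoin ℤ {w | ∃ i n, w = divPow (y i) n} := by
  refine le_antisymm (Algebra.adjoin_le ?_) (Algebra.adjoin_mono ?_)
  · rintro _ ⟨a, ha, k, rfl⟩
    exact divPow_mem_of_span hy (fun i n => Algebra.subset_adjoin (by exact ⟨i, n, rfl⟩)) ha k
  · rintro _ ⟨i, n, rfl⟩
    exact ⟨y i, Submodule.subset_span ⟨i, rfl⟩, n, rfl⟩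

theorem span_monomialProd_divPow {y : ι → R} (hy : ∀ i j, Commute (y i) (y j)) :
    Submodule.span ℤ (Set.range (monomialProd fun i n => divPow (y i) n)) =
      Subalgebra.toSubmodule (divAlg (Set.range y)) := by
  rw [divAlg_eq_adjoin hy]
  refine span_monomialProd (fun i j m n => (hy i j).divPow_divPow m n) (fun i => divPow_zero _)
    fun i m n => ⟨((m + n).choose m : ℕ), ?_⟩
  rw [divPow_mul_divPow, natCast_zsmul]

end Monomials

/-! ### Exchange of divided powers -/

section Exchange

variable {R : Type*} [Ring R] [Algebra ℚ R]

/-- Conjugation by exp(ua) carries b to b + uz, hence b^(l) to (b + uz)^(l), whose coefficient of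
u^i is b^(l-i) z^(i). These coefficients satisfy the hypothesis of `divPow_mul_eq_sum`. -/
theorem divPow_mul_divPow_of_commutator {a b z : R} (h : a * b = b * a + z) (ha : Commute a z)
    (hb : Commute b z) (k l : ℕ) :
    divPow a k * divPow b l = ∑ ij ∈ antidiagonal k,
      (if ij.1 ≤ l then divPow b (l - ij.1) * divPow z ij.1 else 0) * divPow a ij.2 := by
  have hs : ∀ (y : R) n, (n + 1) • divPow y (n + 1) = y * divPow y n := fun y n => by
    rw [← Nat.cast_smul_eq_nsmul ℚ, succ_smul_divPow_succ]
  have hab : ∀ l, a * divPow b (l + 1) = divPow b (l + 1) * a + divPow b l * z := by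
    intro l
    have : IsAddTorsionFree R := IsAddTorsionFree.of_module_rat R
    induction l with
    | zero => simpa using h
    | succ l ih =>
      refine nsmul_right_injective (l + 1).succ_ne_zero ?_
      change (l + 1 + 1) • _ = (l + 1 + 1) • _
      have hbz : divPow b l * z * b = b * divPow b l * z := by
        rw [mul_assoc, ← hb.eq, ← mul_assoc, ((Commute.refl b).divPow_right l).eq]
      have e1 : b * (divPow b l * z) = (l + 1) • (divPow b (l + 1) * z) := by
        rw [← mul_assoc, ← hs, smul_mul_assoc]
      rw [← mul_smul_comm, hs, ← mul_assoc, h, add_mul, mul_assoc b, ih, mul_add, smul_add,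
        ← smul_mul_assoc, hs, e1, (hb.symm.divPow_right (l + 1)).eq, succ_nsmul (divPow b (l + 1) * z)]
      simp only [mul_assoc, add_smul, one_smul]
      abel
  have := divPow_mul_eq_sum (e := a)
    (w := fun i => if i ≤ l then divPow b (l - i) * divPow z i else 0) (fun i => ?_) k
  · simpa using this
  · rcases lt_trichotomy i l with hi | rfl | hi
    · rw [if_pos hi.le, if_pos (by omega), ← mul_assoc, show l - i = (l - (i + 1)) + 1 by omega, hab,
        add_mul, mul_assoc _ a, (ha.divPow_right i).eq, mul_assoc _ z, ← hs, mul_smul_comm]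
      simp only [mul_assoc]
      abel
    · rw [if_pos le_rfl, if_neg (by omega), Nat.sub_self, divPow_zero, one_mul, smul_zero, zero_add,
        (ha.divPow_right i).eq]
    · rw [if_neg (by omega), if_neg (by omega)]; simp

/-- Divided powers of a central commutator lie where the divided powers of the two elements
force them. -/
theorem divPow_commutator_mem {F : Filt R} {a b z : R} (h : a * b = b * a + z) (ha : Commute a z)
    (hb : Commute b z) (hFa : ∀ k, divPow a k ∈ F.carrier k) (hFb : ∀ k, divPow b k ∈ F.carrier k)
    (k : ℕ) : divPow z k ∈ F.carrier (2 * k) := by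
  induction k using Nat.strong_induction_on with
  | _ k ih =>
    -- For k = l the last term of the exchange formula is z^(k) itself, and all other terms contain
    -- only z^(i) with i < k. So z^(k) is an integral expression in elements already under control.
    have := divPow_mul_divPow_of_commutator h ha hb k k
    rw [Nat.sum_antidiagonal_eq_sum_range_succ
      (fun i j => (if i ≤ k then divPow b (k - i) * divPow z i else 0) * divPow a j), sum_range_succ,
      if_pos le_rfl, Nat.sub_self, divPow_zero, divPow_zero, one_mul, mul_one, ← sub_eq_iff_eq_add'] at this
    rw [← this]
    refine sub_mem (two_mul k ▸ F.mul_mem (hFa k) (hFb k)) (sum_mem fun i hi => ?_)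
    have hi := mem_range.1 hi
    rw [if_pos hi.le]
    exact F.mono (by omega) (F.mul_mem (F.mul_mem (hFb (k - i)) (ih i hi)) (hFa (k - i)))

end Exchange

/-! ### The half algebras -/

section Half

variable (σ : ℤˣ)

/-- The `ℤ`-subalgebra generated by the divided powers of the `x_r^σ`. -/
def UZhalf : Subalgebra ℤ U := Algebra.adjoin ℤ {y | ∃ (r : ℤ) (k : ℕ), y = divPow (x σ r) k}

theorem sgn_smul (q : ℚ) (a : U) : (sgn σ * q) • a = (σ : ℤ) • q • a := by
  rw [mul_smul, sgn, Int.cast_smul_eq_zsmul]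

theorem x_commute_x {r s : ℤ} (h : Even (r + s)) : Commute (x σ r) (x σ s) := by
  have := x_mul_x σ r s
  rwa [Xo_even σ h, smul_zero, add_zero] at this

theorem x_odd_mul_x (m r s : ℤ) (h : r + s = 2 * m + 1) : x σ r * x σ s = x σ s * x σ r +
    ((σ : ℤ) * (s.negOnePow : ℤ)) • X σ m := by
  rw [x_mul_x, sgn_smul, h, Xo_odd, mul_smul, ← Int.cast_smul_eq_zsmul ℚ ((s.negOnePow : ℤ)),
    Int.cast_negOnePow]

theorem x_commute_X (r m : ℤ) (z : ℤ) : Commute (x σ r) (z • X σ m) :=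
  Commute.smul_right (x_mul_X σ r m) z

theorem divPow_unit_smul_mem_iff {F : AddSubgroup U} (u : ℤˣ) (a : U) (k : ℕ) :
    divPow ((u : ℤ) • a) k ∈ F ↔ divPow a k ∈ F := by
  rw [divPow_smul_int]
  rcases Int.units_eq_one_or (u ^ k) with h | h
  · rw [← Units.val_pow_eq_pow_val, h]; simp
  · rw [← Units.val_pow_eq_pow_val, h]; simp

/-- Up to sign X_{2m+1} is the commutator of x_{2m+1} and x_0, which commutes with both. The height
doubles because it is a bracket of two elements of height one. -/
theorem divPow_X_mem_filt {F : Filt U} (hF : ∀ r k, divPow (x σ r) k ∈ F.carrier k) (m : ℤ) (k : ℕ) :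
    divPow (X σ m) k ∈ F.carrier (2 * k) := by
  have := divPow_commutator_mem (F := F) (x_odd_mul_x σ m (2 * m + 1) 0 (by ring))
    (x_commute_X σ _ _ _) (x_commute_X σ _ _ _) (hF _) (hF _) k
  rw [Int.negOnePow_zero, Units.val_one, mul_one] at this
  exact (divPow_unit_smul_mem_iff σ _ k).1 this

theorem divPow_X_mem {S : Subring U} (hS : ∀ r k, divPow (x σ r) k ∈ S) (m : ℤ) (k : ℕ) :
    divPow (X σ m) k ∈ S := divPow_X_mem_filt σ (F := Filt.const S) hS m k

theorem UZodd_eq : UZodd σ = Algebra.adjoin ℤ {w | ∃ r n, w = divPow (x σ (2 * r + 1)) n} :=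
  divAlg_eq_adjoin fun r s => x_commute_x σ ⟨r + s + 1, by ring⟩

theorem UZeven_eq : UZeven σ = Algebra.adjoin ℤ {w | ∃ r n, w = divPow (x σ (2 * r)) n} :=
  divAlg_eq_adjoin fun r s => x_commute_x σ ⟨r + s, by ring⟩

theorem UZc_eq : UZc σ = Algebra.adjoin ℤ {w | ∃ r n, w = divPow (X σ r) n} :=
  divAlg_eq_adjoin fun r s => X_mul_X σ r s

theorem divPow_x_mem_half (r : ℤ) (k : ℕ) : divPow (x σ r) k ∈ UZhalf σ :=
  Algebra.subset_adjoin ⟨r, k, rfl⟩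

theorem divPow_X_mem_half (m : ℤ) (k : ℕ) : divPow (X σ m) k ∈ UZhalf σ :=
  divPow_X_mem σ (S := (UZhalf σ).toSubring) (divPow_x_mem_half σ) m k

theorem UZodd_le_half : UZodd σ ≤ UZhalf σ := by
  rw [UZodd_eq]; apply Algebra.adjoin_le
  rintro _ ⟨r, n, rfl⟩; exact divPow_x_mem_half σ _ _

theorem UZeven_le_half : UZeven σ ≤ UZhalf σ := by
  rw [UZeven_eq]; apply Algebra.adjoin_le
  rintro _ ⟨r, n, rfl⟩; exact divPow_x_mem_half σ _ _

theorem UZc_le_half : UZc σ ≤ UZhalf σ := by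
  rw [UZc_eq]; apply Algebra.adjoin_le
  rintro _ ⟨r, n, rfl⟩; exact divPow_X_mem_half σ _ _

theorem half_commute_c {a b : U} (ha : a ∈ UZhalf σ) (hb : b ∈ UZc σ) : Commute a b := by
  rw [UZc_eq] at hb
  induction ha using Algebra.adjoin_induction with
  | mem a ha =>
    obtain ⟨r, k, rfl⟩ := ha
    induction hb using Algebra.adjoin_induction with
    | mem b hb =>
      obtain ⟨m, l, rfl⟩ := hb
      exact Commute.divPow_divPow (x_mul_X σ r m) k l
    | algebraMap z => exact (Algebra.commutes z _).symm
    | add _ _ _ _ h h' => exact h.add_right h'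
    | mul _ _ _ _ h h' => exact h.mul_right h'
  | algebraMap z => exact Algebra.commutes z _
  | add _ _ _ _ h h' => exact h.add_left h'
  | mul _ _ _ _ h h' => exact h.mul_left h'

/-- The product of the three factors of a half algebra. -/
def halfProd : Submodule ℤ U :=
  Subalgebra.toSubmodule (UZodd σ) * Subalgebra.toSubmodule (UZc σ) *
    Subalgebra.toSubmodule (UZeven σ)

theorem mem_halfProd {o z e : U} (ho : o ∈ UZodd σ) (hz : z ∈ UZc σ) (he : e ∈ UZeven σ) :
    o * z * e ∈ halfProd σ :=
  Submodule.mul_mem_mul (Submodule.mul_mem_mul ho hz) he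

theorem halfProd_induction {P : U → Prop} (h : ∀ o ∈ UZodd σ, ∀ z ∈ UZc σ, ∀ e ∈ UZeven σ, P (o * z * e))
    (hadd : ∀ a b, P a → P b → P (a + b)) {a : U} (ha : a ∈ halfProd σ) : P a := by
  induction ha using Submodule.mul_induction_on' with
  | mem_mul_mem m hm e he =>
    induction hm using Submodule.mul_induction_on' with
    | mem_mul_mem o ho z hz => exact h o ho z hz e he
    | add a _ b _ h h' => rw [add_mul]; exact hadd _ _ h h'
  | add a _ b _ h h' => exact hadd _ _ h h'

theorem odd_mul_halfProd {a b : U} (ha : a ∈ UZodd σ) (hb : b ∈ halfProd σ) : a * b ∈ halfProd σ := by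
  refine halfProd_induction σ (P := fun b => a * b ∈ halfProd σ) (fun o ho z hz e he => ?_)
    (fun _ _ h h' => by rw [mul_add]; exact add_mem h h') hb
  rw [← mul_assoc, ← mul_assoc]
  exact mem_halfProd σ (mul_mem ha ho) hz he

theorem c_mul_halfProd {a b : U} (ha : a ∈ UZc σ) (hb : b ∈ halfProd σ) : a * b ∈ halfProd σ := by
  refine halfProd_induction σ (P := fun b => a * b ∈ halfProd σ) (fun o ho z hz e he => ?_)
    (fun _ _ h h' => by rw [mul_add]; exact add_mem h h') hb
  rw [← mul_assoc, ← mul_assoc, ← (half_commute_c σ (UZodd_le_half σ ho) ha).eq, mul_assoc o]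
  exact mem_halfProd σ ho (mul_mem ha hz) he

theorem halfProd_mul_c_even {a z e : U} (ha : a ∈ halfProd σ) (hz : z ∈ UZc σ) (he : e ∈ UZeven σ) :
    a * z * e ∈ halfProd σ := by
  refine halfProd_induction σ (P := fun b => b * z * e ∈ halfProd σ) (fun o ho z' hz' e' he' => ?_)
    (fun _ _ h h' => by rw [add_mul, add_mul]; exact add_mem h h') ha
  rw [mul_assoc _ e', (half_commute_c σ (UZeven_le_half σ he') hz).eq, ← mul_assoc, mul_assoc o z',
    mul_assoc _ e']
  exact mem_halfProd σ ho (mul_mem hz' hz) (mul_mem he' he)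

/-- Induction over words in the odd generators, for all k at once: crossing one letter replaces k by
smaller values and produces divided powers of the central elements X. -/
theorem divPow_even_mul_odd (r : ℤ) (k : ℕ) {o : U} (ho : o ∈ UZodd σ) :
    divPow (x σ (2 * r)) k * o ∈ halfProd σ := by
  have key : Subalgebra.toSubmodule (UZodd σ) ≤
      ⨅ k, (halfProd σ).comap (LinearMap.mulLeft ℤ (divPow (x σ (2 * r)) k)) := by
    rw [UZodd_eq]
    refine adjoin_le_of_mul_mem ?_ ?_
    · refine (Submodule.mem_iInf _).2 fun k => ?_
      have := mem_halfProd σ (one_mem _) (one_mem _) (e := divPow (x σ (2 * r)) k) (by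
        rw [UZeven_eq]; exact Algebra.subset_adjoin ⟨r, k, rfl⟩)
      simpa using this
    · rintro _ ⟨m, l, rfl⟩ b hb
      rw [Submodule.mem_iInf] at hb ⊢
      intro k
      rw [Submodule.mem_comap, LinearMap.mulLeft_apply, ← mul_assoc,
        divPow_mul_divPow_of_commutator (x_odd_mul_x σ (r + m) (2 * r) (2 * m + 1) (by ring))
          (x_commute_X σ _ _ _) (x_commute_X σ _ _ _), sum_mul]
      refine sum_mem fun ij _ => ?_
      split_ifs
      · rw [mul_assoc, mul_assoc]
        refine odd_mul_halfProd σ (by rw [UZodd_eq]; exact Algebra.subset_adjoin ⟨m, _, rfl⟩)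
          (c_mul_halfProd σ ?_ (hb _))
        rw [divPow_smul_int]
        refine (UZc σ).zsmul_mem ?_ _
        rw [UZc_eq]; exact Algebra.subset_adjoin ⟨_, _, rfl⟩
      · simp
  exact (Submodule.mem_iInf _).1 (key ho) k

theorem toSubmodule_half : Subalgebra.toSubmodule (UZhalf σ) = halfProd σ := by
  refine le_antisymm (adjoin_le_of_mul_mem ?_ ?_) ?_
  · simpa using mem_halfProd σ (one_mem _) (one_mem _) (one_mem _)
  · rintro _ ⟨r, k, rfl⟩ b hb
    rcases Int.even_or_odd' r with ⟨m, rfl | rfl⟩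
    · refine halfProd_induction σ (P := fun b => divPow (x σ (2 * m)) k * b ∈ halfProd σ)
        (fun o ho z hz e he => ?_) (fun _ _ h h' => by rw [mul_add]; exact add_mem h h') hb
      rw [← mul_assoc, ← mul_assoc]
      exact halfProd_mul_c_even σ (divPow_even_mul_odd σ m k ho) hz he
    · exact odd_mul_halfProd σ (by rw [UZodd_eq]; exact Algebra.subset_adjoin ⟨_, _, rfl⟩) hb
  · intro a ha
    exact halfProd_induction σ (P := fun a => a ∈ UZhalf σ)
      (fun o ho z hz e he => mul_mem (mul_mem (UZodd_le_half σ ho) (UZc_le_half σ hz))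
        (UZeven_le_half σ he)) (fun _ _ h h' => add_mem h h') ha

/-- `HeightWord σ n w` means that `w` is a product of divided powers of the `x_r^σ` whose
exponents add up to `n`. -/
inductive HeightWord : ℕ → U → Prop
  | one : HeightWord 0 1
  | mul (r : ℤ) (k : ℕ) {n : ℕ} {w : U} : HeightWord n w → HeightWord (k + n) (divPow (x σ r) k * w)

theorem HeightWord.append {m n : ℕ} {v w : U} (hv : HeightWord σ m v) (hw : HeightWord σ n w) :
    HeightWord σ (m + n) (v * w) := by
  induction hv with
  | one => simpa using hw
  | mul r k _ ih => rw [add_assoc, mul_assoc]; exact .mul r k ih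

theorem HeightWord.mem_half {m : ℕ} {v : U} (hv : HeightWord σ m v) : v ∈ UZhalf σ := by
  induction hv with
  | one => exact one_mem _
  | mul r k _ ih => exact mul_mem (divPow_x_mem_half σ r k) ih

/-- The filtration of a half algebra by height. -/
def heightFilt : Filt U where
  carrier n := AddSubgroup.closure {w | ∃ m ≤ n, HeightWord σ m w}
  mono i j hij := AddSubgroup.closure_mono fun w ⟨m, hm, hw⟩ => ⟨m, hm.trans hij, hw⟩
  one_mem := AddSubgroup.subset_closure ⟨0, le_rfl, .one⟩
  mul_mem {i j a b} ha hb := by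
    induction ha using AddSubgroup.closure_induction with
    | mem a ha =>
      obtain ⟨m, hm, ha⟩ := ha
      induction hb using AddSubgroup.closure_induction with
      | mem b hb =>
        obtain ⟨n, hn, hb⟩ := hb
        exact AddSubgroup.subset_closure ⟨m + n, by omega, ha.append σ hb⟩
      | zero => simp
      | add _ _ _ _ h h' => rw [mul_add]; exact add_mem h h'
      | neg _ _ h => rw [mul_neg]; exact neg_mem h
    | zero => simp
    | add _ _ _ _ h h' => rw [add_mul]; exact add_mem h h'
    | neg _ _ h => rw [neg_mul]; exact neg_mem h

theorem divPow_x_mem_heightFilt (r : ℤ) (k : ℕ) : divPow (x σ r) k ∈ (heightFilt σ).carrier k :=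
  AddSubgroup.subset_closure ⟨k, le_rfl, by simpa using HeightWord.mul r k (HeightWord.one (σ := σ))⟩

theorem divPow_X_mem_heightFilt (m : ℤ) (k : ℕ) : divPow (X σ m) k ∈ (heightFilt σ).carrier (2 * k) :=
  divPow_X_mem_filt σ (divPow_x_mem_heightFilt σ) m k

theorem heightFilt_le_half {n : ℕ} {a : U} (ha : a ∈ (heightFilt σ).carrier n) : a ∈ UZhalf σ := by
  induction ha using AddSubgroup.closure_induction with
  | mem a ha => obtain ⟨m, _, ha⟩ := ha; exact ha.mem_half
  | zero => exact zero_mem _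
  | add _ _ _ _ h h' => exact add_mem h h'
  | neg _ _ h => exact neg_mem h

end Half

/-! ### The series `∑ p̂_k u ^ k` -/

section Hat

variable {R : Type*} [Ring R] [Algebra ℚ R]

theorem map_hatSeries {S : Type*} [Ring S] [Algebra ℚ S] (ρ : R →+* S) (p : ℕ → R) :
    PowerSeries.map ρ (hatSeries p) = hatSeries fun r => ρ (p r) := by
  rw [hatSeries, map_expSeries, hatSeries]
  congr 1
  ext1 k
  rw [coeff_map, coeff_mk, coeff_mk]
  split_ifs
  · simp
  · rw [map_rat_smul]

theorem constantCoeff_hatLog (p : ℕ → R) : constantCoeff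
    (PowerSeries.mk fun r => if r = 0 then 0 else ((-1 : ℚ) ^ (r - 1) / (r : ℚ)) • p r) = 0 := by
  simp [← coeff_zero_eq_constantCoeff_apply]

theorem hatSeries_congr {p q : ℕ → R} (h : ∀ r, 0 < r → p r = q r) : hatSeries p = hatSeries q := by
  rw [hatSeries, hatSeries]
  congr 2
  ext k
  split_ifs with hk
  · rfl
  · rw [h k (Nat.pos_of_ne_zero hk)]

theorem coeff_hatSeries_congr {p q : ℕ → R} {N : ℕ} (h : ∀ r, 0 < r → r ≤ N → p r = q r) :
    coeff N (hatSeries p) = coeff N (hatSeries q) := by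
  rw [hatSeries, hatSeries]
  refine coeff_expSeries_congr (m := N) fun k hk => ?_
  rw [coeff_mk, coeff_mk]
  split_ifs with hk
  · rfl
  · rw [h k (Nat.pos_of_ne_zero hk) (by omega)]

end Hat

section HatComm

variable {R : Type*} [CommRing R] [Algebra ℚ R]

theorem hatSeries_add (p q : ℕ → R) : hatSeries (fun r => p r + q r) = hatSeries p * hatSeries q := by
  rw [hatSeries, hatSeries, hatSeries, ← expSeries_add (Commute.all _ _) (constantCoeff_hatLog p)
    (constantCoeff_hatLog q)]
  congr 1
  ext k
  simp only [coeff_mk, map_add]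
  split_ifs <;> simp

theorem hatSeries_zero : hatSeries (fun _ => (0 : R)) = 1 := by
  rw [hatSeries, ← expSeries_zero]
  congr 1
  ext k; simp

theorem hatSeries_sum {ι : Type*} (s : Finset ι) (p : ι → ℕ → R) :
    hatSeries (fun r => ∑ i ∈ s, p i r) = ∏ i ∈ s, hatSeries (p i) := by
  classical
  induction s using Finset.induction_on with
  | empty => simp [hatSeries_zero]
  | insert i s hi ih => simp_rw [sum_insert hi, hatSeries_add, ih, prod_insert hi]

theorem hatSeries_rescale (y : R) (p : ℕ → R) :
    hatSeries (fun r => y ^ r * p r) = rescale y (hatSeries p) := by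
  rw [hatSeries, hatSeries, rescale_expSeries]
  congr 1
  ext k
  simp only [coeff_mk, coeff_rescale]
  split_ifs <;> simp

theorem derivative_hatLog (p : ℕ → R) : derivative R
    (PowerSeries.mk fun r => if r = 0 then 0 else ((-1 : ℚ) ^ (r - 1) / (r : ℚ)) • p r) =
    PowerSeries.mk fun r => (-1) ^ r * p (r + 1) := by
  ext k
  rw [coeff_mk, coeff_derivative, coeff_mk, if_neg k.succ_ne_zero]
  simp only [Nat.add_sub_cancel]
  rw [← Nat.cast_succ, ← nsmul_eq_mul', ← Nat.cast_smul_eq_nsmul ℚ, smul_smul,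
    mul_div_cancel₀ _ (by positivity), Algebra.smul_def]
  simp

/-- This is the bridge to symmetric functions: if p_r is the r-th power sum of some variables, the
p̂_k are their elementary symmetric functions. -/
theorem hatSeries_pow (y : R) : hatSeries (fun r => y ^ r) = 1 + PowerSeries.C y * PowerSeries.X := by
  rw [hatSeries]
  refine (eq_expSeries (constantCoeff_hatLog _) (by simp) ?_).symm
  rw [derivative_hatLog]
  ext k
  rcases k with _ | k
  · simp
  · simp [add_mul, mul_assoc, coeff_succ_X_mul]
    ring

theorem exists_hatSeries_eq {E : PowerSeries R} (h : constantCoeff E = 1) :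
    ∃ p : ℕ → R, hatSeries p = E := by
  obtain ⟨L, hL, rfl⟩ := exists_expSeries_eq h
  refine ⟨fun r => ((-1 : ℚ) ^ (r - 1) * r) • coeff r L, ?_⟩
  rw [hatSeries]
  congr 1
  ext k
  rw [coeff_mk]
  split_ifs with hk
  · rw [hk, coeff_zero_eq_constantCoeff_apply, hL]
  · have : (k : ℚ) ≠ 0 := by exact_mod_cast hk
    rw [smul_smul, show (-1 : ℚ) ^ (k - 1) / k * ((-1) ^ (k - 1) * k) = 1 by
      field_simp; rw [← pow_mul, mul_comm, pow_mul]; simp, one_smul]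

/-- Newton's recursion. -/
theorem newton (p : ℕ → R) (k : ℕ) : (k + 1) * coeff (k + 1) (hatSeries p) =
    ∑ ij ∈ antidiagonal k, coeff ij.1 (hatSeries p) * ((-1) ^ ij.2 * p (ij.2 + 1)) := by
  have h := derivative_expSeries (constantCoeff_hatLog p)
  rw [derivative_hatLog, ← hatSeries] at h
  have := congrArg (coeff k) h
  rw [coeff_derivative, coeff_mul] at this
  simp only [coeff_mk] at this
  rw [mul_comm, this]

/-- By Newton's recursion p_r is determined by p̂_1, …, p̂_r: it appears there with coefficient ±1.
-/
theorem eq_of_coeff_hatSeries_eq {p q : ℕ → R} {N : ℕ}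
    (h : ∀ k ≤ N, coeff k (hatSeries p) = coeff k (hatSeries q)) :
    ∀ r, 0 < r → r ≤ N → p r = q r := by
  intro r
  induction r using Nat.strong_induction_on with
  | _ r ih =>
    intro hr hrN
    obtain ⟨k, rfl⟩ : ∃ k, r = k + 1 := ⟨r - 1, by omega⟩
    have h1 := newton p k
    have h2 := newton q k
    rw [h _ hrN, h2, Nat.sum_antidiagonal_eq_sum_range_succ
      (fun i j => coeff i (hatSeries p) * ((-1) ^ j * p (j + 1))), Nat.sum_antidiagonal_eq_sum_range_succ
      (fun i j => coeff i (hatSeries q) * ((-1) ^ j * q (j + 1))), sum_range_succ', sum_range_succ'] at h1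
    have h3 : ∀ i ∈ range k, coeff (i + 1) (hatSeries p) * ((-1) ^ (k - (i + 1)) * p (k - (i + 1) + 1)) =
        coeff (i + 1) (hatSeries q) * ((-1) ^ (k - (i + 1)) * q (k - (i + 1) + 1)) := by
      intro i hi
      have := mem_range.1 hi
      rw [h _ (by omega), ih _ (by omega) (by omega) (by omega)]
    rw [sum_congr rfl h3, add_right_inj, h 0 (by omega)] at h1
    have hc : constantCoeff (hatSeries q) = 1 := constantCoeff_expSeries _
    rw [coeff_zero_eq_constantCoeff_apply, hc, one_mul, one_mul] at h1
    exact ((isUnit_one.neg.pow _).mul_left_cancel h1).symm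

theorem prod_one_add_eq_sum_esymm (N : ℕ) :
    ∏ j : Fin N, (1 + PowerSeries.C (MvPolynomial.X j : MvPolynomial (Fin N) R) * PowerSeries.X) =
      PowerSeries.mk fun k => MvPolynomial.esymm (Fin N) R k := by
  rw [Finset.prod_one_add]
  ext1 k
  rw [coeff_mk, map_sum, Finset.sum_powerset, MvPolynomial.esymm]
  have : ∀ j, ∀ s ∈ powersetCard j (univ : Finset (Fin N)),
      coeff k (∏ i ∈ s, (PowerSeries.C (MvPolynomial.X i : MvPolynomial (Fin N) R) * PowerSeries.X)) =
      if k = j then ∏ i ∈ s, MvPolynomial.X i else 0 := by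
    intro j s hs
    rw [prod_mul_distrib, prod_const, ← map_prod, coeff_C_mul, coeff_X_pow, (mem_powersetCard.1 hs).2]
    split_ifs <;> simp
  rw [sum_congr rfl fun j _ => sum_congr rfl (this j)]
  by_cases hk : k ∈ range ((univ : Finset (Fin N)).card + 1)
  · rw [sum_eq_single_of_mem k hk fun j _ hj => sum_eq_zero fun _ _ => if_neg (Ne.symm hj)]
    simp
  · rw [powersetCard_eq_empty.2 (by simpa using hk), sum_empty]
    refine sum_eq_zero fun j hj => sum_eq_zero fun _ _ => if_neg ?_
    rintro rfl; exact hk hj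

/-- The coefficients of `hatSeries (p b)` are integral polynomials in those of `hatSeries p`
and `hatSeries b`. -/
theorem coeff_hatSeries_mul_mem (A : Subring R) {p b : ℕ → R}
    (hp : ∀ k, coeff k (hatSeries p) ∈ A) (hb : ∀ k, coeff k (hatSeries b) ∈ A) (N : ℕ) :
    coeff N (hatSeries fun r => p r * b r) ∈ A := by
  -- A generic series with N free coefficients; ν is the sequence of its power sums. The statement
  -- is proved for ν in the place of b and then specialized.
  let E : PowerSeries (MvPolynomial (Fin N) R) := PowerSeries.mk fun i =>
    if i = 0 then 1 else if h : i - 1 < N then MvPolynomial.X ⟨i - 1, h⟩ else 0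
  have hE : constantCoeff E = 1 := by simp [E, ← coeff_zero_eq_constantCoeff_apply]
  obtain ⟨ν, hν⟩ := exists_hatSeries_eq hE
  let θ : MvPolynomial (Fin N) R →ₐ[R] MvPolynomial (Fin N) R :=
    MvPolynomial.aeval fun i : Fin N => MvPolynomial.esymm (Fin N) R (i + 1)
  have hθ : Function.Injective θ := by
    intro a c h
    refine MvPolynomial.esymmAlgHom_injective (σ := Fin N) R (n := N) (by simp) (Subtype.ext ?_)
    rw [MvPolynomial.esymmAlgHom_apply, MvPolynomial.esymmAlgHom_apply]
    exact h
  have hθE : PowerSeries.map (θ : _ →+* MvPolynomial (Fin N) R) E =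
      PowerSeries.mk fun k => MvPolynomial.esymm (Fin N) R k := by
    ext1 k
    rw [coeff_map, coeff_mk, coeff_mk]
    split_ifs with h1 h2
    · rw [h1, map_one, MvPolynomial.esymm_zero]
    · simp only [RingHom.coe_coe, θ, MvPolynomial.aeval_X]
      congr 1; omega
    · rw [map_zero, MvPolynomial.esymm, powersetCard_eq_empty.2 (by simp; omega), sum_empty]
  -- Replacing the free coefficients by the elementary symmetric polynomials in N variables is
  -- injective and turns ν_r into the power sum ∑ X_j^r.
  have hθν : ∀ r, 0 < r → θ (ν r) = ∑ j : Fin N, MvPolynomial.X j ^ r := by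
    intro r hr
    refine eq_of_coeff_hatSeries_eq (p := fun r => θ (ν r))
      (q := fun r => ∑ j : Fin N, MvPolynomial.X j ^ r) (N := r) (fun k _ => ?_) r hr le_rfl
    have := map_hatSeries (θ : _ →+* MvPolynomial (Fin N) R) ν
    rw [hν, hθE, ← prod_one_add_eq_sum_esymm] at this
    rw [hatSeries_sum]
    simp only [hatSeries_pow]
    rw [this]; rfl
  -- For the sequence p_r ∑_j X_j^r the series is a product over j of copies of the series of p with
  -- variable rescaled by X_j. This is visibly symmetric, with coefficients in `A`.
  have h2 : PowerSeries.map (θ : _ →+* MvPolynomial (Fin N) R)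
      (hatSeries fun r => MvPolynomial.C (p r) * ν r) =
      ∏ j : Fin N, rescale (MvPolynomial.X j) (PowerSeries.map MvPolynomial.C (hatSeries p)) := by
    rw [map_hatSeries, map_hatSeries]
    simp_rw [← hatSeries_rescale, ← hatSeries_sum, ← sum_mul]
    refine hatSeries_congr fun r hr => ?_
    rw [map_mul]
    simp only [RingHom.coe_coe, hθν r hr, θ, MvPolynomial.aeval_C, MvPolynomial.algebraMap_eq]
    rw [mul_comm]
  let P : PowerSeries A := PowerSeries.mk fun k => ⟨coeff k (hatSeries p), hp k⟩
  have hP : PowerSeries.map A.subtype P = hatSeries p := by ext; simp [P]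
  let V : PowerSeries (MvPolynomial (Fin N) A) :=
    ∏ j : Fin N, rescale (MvPolynomial.X j) (PowerSeries.map MvPolynomial.C P)
  have hV : (coeff N V).IsSymmetric := by
    intro e
    have : PowerSeries.map (MvPolynomial.rename e : _ →ₐ[A] MvPolynomial (Fin N) A).toRingHom V = V := by
      rw [map_prod]
      refine Fintype.prod_equiv e _ _ fun j => ?_
      ext k
      simp [coeff_rescale]
    have h := congrArg (coeff N) this
    rw [coeff_map] at h
    exact h
  -- The fundamental theorem of symmetric polynomials is applied over `A`, not over `R`; this is
  -- where integrality enters.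
  obtain ⟨W, hW⟩ := MvPolynomial.esymmAlgHom_surjective (σ := Fin N) A (n := N) (by simp) ⟨_, hV⟩
  have hW' : MvPolynomial.aeval (fun i : Fin N => MvPolynomial.esymm (Fin N) A (i + 1)) W = coeff N V := by
    rw [← MvPolynomial.esymmAlgHom_apply, hW]
  have hVR : PowerSeries.map (MvPolynomial.map A.subtype) V =
      ∏ j : Fin N, rescale (MvPolynomial.X j) (PowerSeries.map MvPolynomial.C (hatSeries p)) := by
    rw [map_prod]
    refine prod_congr rfl fun j _ => ?_
    ext k
    simp [coeff_rescale, ← hP]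
  have h3 : coeff N (hatSeries fun r => MvPolynomial.C (p r) * ν r) = MvPolynomial.map A.subtype W := by
    apply hθ
    have := congrArg (coeff N) h2
    rw [coeff_map, ← hVR, coeff_map, ← hW'] at this
    refine Eq.trans this ?_
    simp only [θ, MvPolynomial.aeval_def, MvPolynomial.eval₂_map]
    rw [← MvPolynomial.coe_eval₂Hom, ← RingHom.comp_apply, ← MvPolynomial.coe_eval₂Hom]
    congr 1
    ext <;> simp [MvPolynomial.map_esymm]
  let ev : MvPolynomial (Fin N) R →ₐ[R] R := MvPolynomial.aeval fun i : Fin N => coeff (i + 1) (hatSeries b)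
  -- Specializing the free coefficients to those of the series of b sends ν_r to b_r for r ≤ N.
  -- Larger r do not matter for the coefficient of degree N.
  have hev : ∀ r, 0 < r → r ≤ N → ev (ν r) = b r := by
    refine eq_of_coeff_hatSeries_eq fun k hk => ?_
    have := map_hatSeries (ev : _ →+* R) ν
    rw [hν] at this
    change coeff k (hatSeries fun r => (ev : _ →+* R) (ν r)) = _
    rw [← this, coeff_map, coeff_mk]
    split_ifs with h1 h2
    · rw [h1, map_one, coeff_zero_eq_constantCoeff_apply]; exact (constantCoeff_expSeries _).symm
    · simp only [RingHom.coe_coe, ev, MvPolynomial.aeval_X]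
      rw [Nat.sub_add_cancel (by omega)]
    · omega
  have h4 : coeff N (hatSeries fun r => p r * b r) =
      ev (coeff N (hatSeries fun r => MvPolynomial.C (p r) * ν r)) := by
    have := congrArg (coeff N) (map_hatSeries (ev : _ →+* R) fun r => MvPolynomial.C (p r) * ν r)
    rw [coeff_map] at this
    refine Eq.trans ?_ this.symm
    refine coeff_hatSeries_congr fun r hr hrN => ?_
    rw [map_mul]
    simp only [RingHom.coe_coe]
    rw [hev r hr hrN]
    simp [ev]
  rw [h4, h3]
  simp only [ev, MvPolynomial.aeval_def, MvPolynomial.eval₂_map]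
  rw [MvPolynomial.eval₂_eq']
  refine sum_mem fun d _ => mul_mem ?_ (prod_mem fun i _ => pow_mem (hb _) _)
  simp

end HatComm

/-! ### Binomials -/

/-- The binomial polynomial of degree `k`. -/
def choosePoly (k : ℕ) : Polynomial ℚ := ((k ! : ℚ)⁻¹) • descPochhammer ℚ k

theorem eval_choosePoly_nat (k n : ℕ) : (choosePoly k).eval (n : ℚ) = n.choose k := by
  rw [choosePoly, Polynomial.eval_smul, descPochhammer_eval_eq_descFactorial,
    Nat.descFactorial_eq_factorial_mul_choose, Nat.cast_mul, smul_eq_mul,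
    inv_mul_cancel_left₀ (by positivity)]

theorem eval_choosePoly_int (k : ℕ) (z : ℤ) : (choosePoly k).eval (z : ℚ) = Ring.choose z k := by
  have h := Ring.descPochhammer_eq_factorial_smul_choose z k
  rw [← Polynomial.eval_eq_smeval] at h
  rw [choosePoly, Polynomial.eval_smul, ← descPochhammer_eval_cast, h, nsmul_eq_mul, Int.cast_mul,
    Int.cast_natCast, smul_eq_mul, inv_mul_cancel_left₀ (by positivity)]

theorem degree_choosePoly (k : ℕ) : (choosePoly k).degree = k := by
  rw [choosePoly, Polynomial.degree_smul_of_smul_regular, Polynomial.degree_eq_natDegree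
    (monic_descPochhammer ℚ k).ne_zero, descPochhammer_natDegree]
  exact IsSMulRegular.of_ne_zero (by positivity)

/-- Newton interpolation at 0, 1, 2, …: a polynomial agreeing with f at 0, …, d - 1 is corrected at
d by an integer multiple of the d-th binomial polynomial, which is 0 at the earlier points and 1 at
d. After deg f + 1 steps the interpolating polynomial is f. -/
theorem mem_span_choosePoly {f : Polynomial ℚ} (hf : ∀ n : ℕ, ∃ z : ℤ, f.eval (n : ℚ) = z) :
    f ∈ Submodule.span ℤ (Set.range choosePoly) := by
  have key : ∀ d : ℕ, ∃ g ∈ Submodule.span ℤ (Set.range choosePoly), g.degree < d ∧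
      (∀ n : ℕ, ∃ z : ℤ, g.eval (n : ℚ) = z) ∧ ∀ n < d, g.eval (n : ℚ) = f.eval (n : ℚ) := by
    intro d
    induction d with
    | zero => exact ⟨0, zero_mem _, by simp, fun n => ⟨0, by simp⟩, by simp⟩
    | succ d ih =>
      obtain ⟨g, hg, hdeg, hint, heq⟩ := ih
      obtain ⟨z, hz⟩ := hf d
      obtain ⟨w, hw⟩ := hint d
      refine ⟨g + (z - w) • choosePoly d, add_mem hg (Submodule.smul_mem _ _
        (Submodule.subset_span ⟨d, rfl⟩)), ?_, fun n => ?_, fun n hn => ?_⟩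
      · refine (Polynomial.degree_add_le _ _).trans_lt (max_lt (hdeg.trans ?_) ?_)
        · exact_mod_cast d.lt_succ_self
        · refine (Polynomial.degree_smul_le _ _).trans_lt ?_
          rw [degree_choosePoly]
          exact_mod_cast d.lt_succ_self
      · obtain ⟨v, hv⟩ := hint n
        exact ⟨v + (z - w) * n.choose d, by
          rw [Polynomial.eval_add, hv, Polynomial.eval_smul, eval_choosePoly_nat]; simp⟩
      · rw [Polynomial.eval_add, Polynomial.eval_smul, eval_choosePoly_nat]
        rcases (Nat.lt_succ_iff.1 hn).lt_or_eq with h | rfl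
        · rw [heq n h, Nat.choose_eq_zero_of_lt h]; simp
        · rw [hw, hz, Nat.choose_self]; simp
  obtain ⟨g, hg, hdeg, -, heq⟩ := key (f.natDegree + 1)
  have : f = g := by
    refine Polynomial.eq_of_degrees_lt_of_eval_finset_eq
      ((range (f.natDegree + 1)).image fun n : ℕ => (n : ℚ)) ?_ ?_ ?_
    · rw [card_image_of_injective _ Nat.cast_injective, card_range]
      exact Polynomial.degree_le_natDegree.trans_lt (by exact_mod_cast Nat.lt_succ_self _)
    · rw [card_image_of_injective _ Nat.cast_injective, card_range]; exact hdeg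
    · intro y hy
      obtain ⟨n, hn, rfl⟩ := mem_image.1 hy
      exact (heq n (mem_range.1 hn)).symm
  rw [this]; exact hg

section Binom

variable {R : Type*} [Ring R] [Algebra ℚ R]

theorem binom_eq_aeval (a : R) (k : ℕ) : binom a k = Polynomial.aeval a (choosePoly k) := by
  rw [binom, choosePoly, map_smul]

theorem aeval_mem_span_binom {f : Polynomial ℚ} (hf : ∀ n : ℕ, ∃ z : ℤ, f.eval (n : ℚ) = z) (a : R) :
    Polynomial.aeval a f ∈ Submodule.span ℤ (Set.range (binom a)) := by
  have h := mem_span_choosePoly hf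
  clear hf
  induction h using Submodule.span_induction with
  | mem f hf =>
    obtain ⟨k, rfl⟩ := hf
    exact Submodule.subset_span ⟨k, binom_eq_aeval a k⟩
  | zero => simp
  | add f g _ _ h h' => rw [map_add]; exact add_mem h h'
  | smul z f _ h => rw [map_zsmul]; exact Submodule.smul_mem _ _ h

theorem binom_mul_binom_mem (a : R) (k l : ℕ) :
    binom a k * binom a l ∈ Submodule.span ℤ (Set.range (binom a)) := by
  rw [binom_eq_aeval, binom_eq_aeval, ← map_mul]
  exact aeval_mem_span_binom (fun n => ⟨n.choose k * n.choose l, by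
    rw [Polynomial.eval_mul, eval_choosePoly_nat, eval_choosePoly_nat]; simp⟩) a

theorem binom_zsmul_mem (a : R) (z : ℤ) (k : ℕ) :
    binom (z • a) k ∈ Submodule.span ℤ (Set.range (binom a)) := by
  have h : binom (z • a) k = Polynomial.aeval a ((choosePoly k).comp (z • Polynomial.X)) := by
    rw [binom_eq_aeval, Polynomial.aeval_comp]; simp
  rw [h]
  refine aeval_mem_span_binom (fun n => ⟨Ring.choose (z * n) k, ?_⟩) a
  rw [Polynomial.eval_comp, ← eval_choosePoly_int]
  simp

theorem binom_add {a b : R} (h : Commute a b) (k : ℕ) :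
    binom (a + b) k = ∑ ij ∈ antidiagonal k, binom a ij.1 * binom b ij.2 := by
  have hs : ∀ (a : R) k, Polynomial.aeval a (descPochhammer ℚ k) = (descPochhammer ℤ k).smeval a := by
    intro a k
    rw [← descPochhammer_map (Int.castRingHom ℚ), ← Polynomial.aeval_eq_smeval, ← algebraMap_int_eq,
      Polynomial.aeval_map_algebraMap]
  simp only [binom, hs]
  rw [Ring.descPochhammer_smeval_add k h, smul_sum]
  refine sum_congr rfl fun ij hij => ?_
  rw [← HasAntidiagonal.mem_antidiagonal.1 hij, smul_mul_smul_comm, ← inv_factorial_mul_choose,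
    mul_smul, ← nsmul_eq_mul, Nat.cast_smul_eq_nsmul]

theorem coeff_expSeries_lin_const (a : R) (ℓ : PowerSeries (Polynomial ℚ)) (m i : ℕ) :
    (coeff m (expSeries (lin (fun _ => a) ℓ))).coeff i =
      Polynomial.aeval a (∑ n ∈ range (m + 1),
        Polynomial.monomial n ((n ! : ℚ)⁻¹ * (coeff m (ℓ ^ n)).coeff i)) := by
  have h1 : lin (fun _ => a) ℓ =
      PowerSeries.map scal ℓ * PowerSeries.C (Polynomial.C a) := by
    ext1 k
    rw [coeff_lin, coeff_mul_C, coeff_map]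
  have h2 : Commute (PowerSeries.map (scal : Polynomial ℚ →+* Polynomial R) ℓ)
      (PowerSeries.C (Polynomial.C a)) := by
    ext1 k
    rw [coeff_mul_C, coeff_C_mul, coeff_map, (scal_mul_comm _ _).eq]
  rw [expSeries, coeff_mk, Polynomial.finsetSum_coeff, map_sum]
  refine sum_congr rfl fun n _ => ?_
  rw [h1, h2.mul_pow, ← map_pow, ← map_pow, ← map_pow, coeff_mul_C, coeff_map, Polynomial.coeff_smul,
    Polynomial.coeff_mul_C, Polynomial.aeval_monomial, map_mul, ← Algebra.smul_def, smul_mul_assoc]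
  simp [scal]

/-- `exp (a log E)` has coefficients in any subring containing the binomials of `a`, if `E` is
an integral series. -/
theorem expSeries_lin_const_mem {a : R} {A : Subring R} (ha : ∀ k, binom a k ∈ A)
    {ℓ : PowerSeries (Polynomial ℚ)} (h0 : constantCoeff ℓ = 0) {E : PowerSeries (Polynomial ℤ)}
    (hE : expSeries ℓ = toQ E) : expSeries (lin (fun _ => a) ℓ) ∈ rees (Filt.const A) := by
  intro m i
  rw [coeff_expSeries_lin_const]
  have hspan : Submodule.span ℤ (Set.range (binom a)) ≤ AddSubgroup.toIntSubmodule A.toAddSubgroup := by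
    rw [Submodule.span_le]
    rintro _ ⟨k, rfl⟩; exact ha k
  -- Each coefficient is a rational polynomial evaluated at a. At a = N it is the corresponding
  -- coefficient of E^N, an integer, so it is an integral combination of binomials of a.
  refine hspan (aeval_mem_span_binom (fun N => ⟨(coeff m (E ^ N)).coeff i, ?_⟩) a)
  have h1 : expSeries ((N : ℚ) • ℓ) = toQ (E ^ N) := by
    induction N with
    | zero => simp
    | succ N ih =>
      rw [Nat.cast_succ, add_smul, one_smul, expSeries_add (Commute.all _ _) (by simp [h0]) h0, ih, hE,
        pow_succ, map_mul]
  have h2 := congrArg (fun f => (coeff m f).coeff i) h1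
  simp only [expSeries, coeff_mk, coeff_toQ, Polynomial.coeff_map, Polynomial.finsetSum_coeff] at h2
  rw [eq_intCast] at h2
  rw [← h2, Polynomial.eval_finsetSum]
  refine sum_congr rfl fun n _ => ?_
  rw [Polynomial.eval_monomial, smul_pow, coeff_smul, smul_smul, Polynomial.coeff_smul, smul_eq_mul]
  ring

end Binom

/-! ### The algebra of binomials in `h_0` and `c` -/

theorem c_commute_h_zero : Commute c (h 0) := c_commute_h 0

theorem span_Bzero : Submodule.span ℤ (Set.range Bzero) = Subalgebra.toSubmodule UZzero := by
  have hcomm : ∀ k l, Commute (binom (h 0) k) (binom c l) := fun k l => by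
    rw [binom_eq_aeval, binom_eq_aeval]
    have h1 : ∀ (a b : U), Commute a b → ∀ f : Polynomial ℚ, Commute a (Polynomial.aeval b f) := by
      intro a b h f
      induction f using Polynomial.induction_on' with
      | add p q hp hq => rw [map_add]; exact hp.add_right hq
      | monomial n q =>
        rw [Polynomial.aeval_monomial]
        exact Commute.mul_right (Algebra.commutes q a).symm (h.pow_right n)
    exact h1 _ _ (h1 _ _ c_commute_h_zero _).symm _
  have hmul : ∀ a ∈ Submodule.span ℤ (Set.range (binom (h 0))),
      ∀ b ∈ Submodule.span ℤ (Set.range (binom c)), a * b ∈ Submodule.span ℤ (Set.range Bzero) := by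
    intro a ha b hb
    induction ha using Submodule.span_induction with
    | mem a ha =>
      obtain ⟨k, rfl⟩ := ha
      induction hb using Submodule.span_induction with
      | mem b hb => obtain ⟨l, rfl⟩ := hb; exact Submodule.subset_span ⟨(k, l), rfl⟩
      | zero => simp
      | add _ _ _ _ h h' => rw [mul_add]; exact add_mem h h'
      | smul z _ _ h => rw [mul_smul_comm]; exact Submodule.smul_mem _ _ h
    | zero => simp
    | add _ _ _ _ h h' => rw [add_mul]; exact add_mem h h'
    | smul z _ _ h => rw [smul_mul_assoc]; exact Submodule.smul_mem _ _ h
  have hbin : ∀ a ∈ Submodule.span ℤ ({h 0, c} : Set U), ∀ k,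
      binom a k ∈ Submodule.span ℤ (Set.range Bzero) := by
    intro a ha k
    obtain ⟨i, j, rfl⟩ := Submodule.mem_span_pair.1 ha
    rw [binom_add ((c_commute_h_zero.symm.smul_left i).smul_right j)]
    exact sum_mem fun ij _ => hmul _ (binom_zsmul_mem _ _ _) _ (binom_zsmul_mem _ _ _)
  have hle : Submodule.span ℤ (Set.range Bzero) ≤ Subalgebra.toSubmodule UZzero := by
    rw [Submodule.span_le]
    rintro _ ⟨⟨k, l⟩, rfl⟩
    exact UZzero.mul_mem (Algebra.subset_adjoin ⟨_, Submodule.subset_span (by simp), k, rfl⟩)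
      (Algebra.subset_adjoin ⟨_, Submodule.subset_span (by simp), l, rfl⟩)
  refine le_antisymm hle (adjoin_le_of_mul_mem ?_ ?_)
  · exact Submodule.subset_span ⟨(0, 0), by simp [Bzero, binom]⟩
  · rintro _ ⟨a, ha, k, rfl⟩ b hb
    have ha' := hbin a ha k
    generalize binom a k = a' at ha'
    induction hb using Submodule.span_induction with
    | mem b hb =>
      obtain ⟨⟨k', l'⟩, rfl⟩ := hb
      induction ha' using Submodule.span_induction with
      | mem a ha =>
        obtain ⟨⟨m, n⟩, rfl⟩ := ha
        rw [Bzero, Bzero, mul_assoc, ← mul_assoc (binom c n), ← (hcomm k' n).eq, mul_assoc, ← mul_assoc]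
        exact hmul _ (binom_mul_binom_mem _ _ _) _ (binom_mul_binom_mem _ _ _)
      | zero => simp
      | add _ _ _ _ h h' => rw [add_mul]; exact add_mem h h'
      | smul z _ _ h => rw [smul_mul_assoc]; exact Submodule.smul_mem _ _ h
    | zero => simp
    | add _ _ _ _ h h' => rw [mul_add]; exact add_mem h h'
    | smul z _ _ h => rw [mul_smul_comm]; exact Submodule.smul_mem _ _ h

theorem binom_mem_UZzero (i j : ℤ) (k : ℕ) : binom (i • h 0 + j • c) k ∈ UZzero :=
  Algebra.subset_adjoin ⟨_, Submodule.mem_span_pair.2 ⟨i, j, rfl⟩, k, rfl⟩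

/-! ### Integral series -/

/-- The series with integral coefficients. -/
def intSeries : Subring (PowerSeries ℚ) := (PowerSeries.map (Int.castRingHom ℚ)).range

theorem exists_mul_eq_one_int {f : PowerSeries ℤ} (hf : constantCoeff f = 1) :
    ∃ g : PowerSeries ℤ, f * g = 1 ∧ constantCoeff g = 1 := by
  have hu : IsUnit f := by rw [isUnit_iff_constantCoeff, hf]; exact isUnit_one
  obtain ⟨g, hg⟩ := hu.exists_right_inv
  refine ⟨g, hg, ?_⟩
  have := congrArg constantCoeff hg
  rwa [map_mul, hf, one_mul, map_one] at this

theorem intSeries_of_mul_eq_one {f g : PowerSeries ℚ} (hf : f ∈ intSeries)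
    (h0 : constantCoeff f = 1) (h : f * g = 1) : g ∈ intSeries := by
  obtain ⟨f, rfl⟩ := hf
  have h0' : constantCoeff f = 1 := by
    have : ((constantCoeff f : ℤ) : ℚ) = 1 := by
      rw [← h0, ← coeff_zero_eq_constantCoeff_apply, ← coeff_zero_eq_constantCoeff_apply]; simp
    exact_mod_cast this
  obtain ⟨k, hk, -⟩ := exists_mul_eq_one_int h0'
  refine ⟨k, ?_⟩
  have hk' := congrArg (PowerSeries.map (Int.castRingHom ℚ)) hk
  rw [map_mul, map_one] at hk'
  linear_combination g * hk' - (PowerSeries.map (Int.castRingHom ℚ)) k * h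

/-- The Catalan series C = 1 + X C² taken at -a solves the equation. The use is that 1 + 2ac is then
an integral square root of 1 + 4a. -/
theorem exists_add_sq_eq {a : PowerSeries ℤ} (h0 : constantCoeff a = 0) :
    ∃ c : PowerSeries ℤ, a * c + (a * c) ^ 2 = a := by
  have hs : HasSubst (-a) := HasSubst.of_constantCoeff_zero' (by simp [h0])
  have hcat : PowerSeries.map (Nat.castRingHom ℤ) (catalanSeries ^ 2 * PowerSeries.X + 1) =
      PowerSeries.map (Nat.castRingHom ℤ) catalanSeries := by
    rw [catalanSeries_sq_mul_X_add_one]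
  let C := PowerSeries.map (Nat.castRingHom ℤ) catalanSeries
  have h1 : C ^ 2 * PowerSeries.X + 1 = C := by simpa [C] using hcat
  have h2 := congrArg (substAlgHom (R := ℤ) hs) h1
  rw [map_add, map_mul, map_pow, map_one, substAlgHom_X] at h2
  exact ⟨substAlgHom (R := ℤ) hs C, by linear_combination (-a) * h2⟩

theorem expand_expSeries {R : Type*} [CommRing R] [Algebra ℚ R] (N : ℕ) (hN : N ≠ 0)
    {f : PowerSeries R} (hf : constantCoeff f = 0) :
    expand N hN (expSeries f) = expSeries (expand N hN f) := by
  ext k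
  rw [coeff_expSeries (N := k + 1) (by rw [constantCoeff_expand, hf]) k.lt_succ_self]
  simp only [← map_pow]
  by_cases h : N ∣ k
  · obtain ⟨m, rfl⟩ := h
    rw [coeff_expand_mul, coeff_expSeries (N := N * m + 1) hf
      (Nat.lt_succ_of_le (Nat.le_mul_of_pos_left m (Nat.pos_of_ne_zero hN)))]
    simp only [coeff_expand_mul]
  · rw [coeff_expand_of_not_dvd _ _ _ h]
    simp only [coeff_expand_of_not_dvd _ _ _ h, smul_zero, sum_const_zero]

theorem exists_log {E : PowerSeries ℚ} (h : constantCoeff E = 1) :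
    ∃ A : PowerSeries ℚ, constantCoeff A = 0 ∧ expSeries A = E := exists_expSeries_eq h

theorem rescale_neg_one_add {L M : PowerSeries ℚ} (h : L + rescale (-1) L = expand 2 two_ne_zero M)
    (k : ℕ) : 2 * coeff (2 * k) L = coeff k M := by
  have := congrArg (coeff (2 * k)) h
  rw [coeff_expand_mul, map_add, coeff_rescale, pow_mul] at this
  rw [← this]; ring

theorem constantCoeff_rescale_eq (a : ℚ) (f : PowerSeries ℚ) :
    constantCoeff (rescale a f) = constantCoeff f := by
  rw [← coeff_zero_eq_constantCoeff_apply, coeff_rescale]; simp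

theorem rescale_X_eq (a : ℚ) : rescale a (PowerSeries.X : PowerSeries ℚ) = PowerSeries.C a * PowerSeries.X :=
  rescale_X a

/-- The logarithm of E(w) E(-w) is twice the even part of log E. -/
theorem even_part_log {L M : PowerSeries ℚ} {E F : PowerSeries ℚ} (hL : constantCoeff L = 0)
    (hM : constantCoeff M = 0) (hLE : expSeries L = E) (hMF : expSeries M = F)
    (h : E * rescale (-1) E = expand 2 two_ne_zero F) (k : ℕ) :
    2 * coeff (2 * k) L = coeff k M := by
  refine rescale_neg_one_add (expSeries_injective ?_ ?_ ?_) k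
  · rw [map_add, constantCoeff_rescale_eq, hL, add_zero]
  · rw [constantCoeff_expand, hM]
  · rw [expSeries_add (Commute.all _ _) hL (by rw [constantCoeff_rescale_eq, hL]), ← rescale_expSeries,
      hLE, h, ← hMF, expand_expSeries _ _ hM]

/-- The series `exp (∑ ε_k ψ_k w ^ k)` is integral, where `exp (2 ψ) = 1 + 2 w - w ^ 2`. -/
theorem expSeries_eps_mem_intSeries {ψ : PowerSeries ℚ} (h0 : constantCoeff ψ = 0)
    (hψ : expSeries ((2 : ℚ) • ψ) = 1 + 2 * PowerSeries.X - PowerSeries.X ^ 2) :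
    expSeries (PowerSeries.mk fun k => eps k * coeff k ψ) ∈ intSeries := by
  -- Iterated norms: E(w) E(-w) = F(w²) for E = 1 + 2w - w² and F = 1 - 6w + w², and F(w) F(-w) =
  -- G(w²) for G = 1 - 34w + w². Hence ω = log G isolates every fourth coefficient: ω_m = 8 ψ_{4m}.
  obtain ⟨χ, hχ0, hχ⟩ := exists_log (E := 1 - 6 * PowerSeries.X + PowerSeries.X ^ 2) (by simp)
  obtain ⟨ω, hω0, hω⟩ := exists_log (E := 1 - 34 * PowerSeries.X + PowerSeries.X ^ 2) (by simp)
  have e2 : ∀ n : ℕ, [n.AtLeastTwo] → rescale (-1 : ℚ) (OfNat.ofNat n) = OfNat.ofNat n := fun n _ =>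
    map_ofNat _ _
  have h1 : ∀ k, 2 * coeff (2 * k) ((2 : ℚ) • ψ) = coeff k χ := even_part_log (by simp [h0]) hχ0 hψ hχ (by
    simp only [map_add, map_sub, map_mul, map_pow, map_one, rescale_X_eq, expand_X, map_neg, e2,
      show expand 2 two_ne_zero (6 : PowerSeries ℚ) = 6 from map_ofNat _ _]
    ring)
  have h2 : ∀ k, 2 * coeff (2 * k) χ = coeff k ω := even_part_log hχ0 hω0 hχ hω (by
    simp only [map_add, map_sub, map_mul, map_pow, map_one, rescale_X_eq, expand_X, map_neg, e2,
      show expand 2 two_ne_zero (34 : PowerSeries ℚ) = 34 from map_ofNat _ _]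
    ring)
  -- Reversing the sign of ψ_{4m} subtracts 2 ψ_{4m}, a quarter of ω_m. So 4β = 4ψ - ω(w⁴), and
  -- exp(4β) is an explicit rational function.
  have h3 : (4 : ℚ) • (PowerSeries.mk fun k => eps k * coeff k ψ) + expand 4 four_ne_zero ω =
      (2 : ℚ) • ψ + (2 : ℚ) • ψ := by
    ext k
    rw [map_add, coeff_smul, coeff_mk, coeff_expand, eps]
    split_ifs with h
    · obtain ⟨m, rfl⟩ := h
      have a1 := h1 (2 * m)
      rw [show 2 * (2 * m) = 4 * m by ring, coeff_smul, smul_eq_mul] at a1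
      rw [Nat.mul_div_cancel_left _ (by norm_num), ← h2, ← a1]
      simp only [map_add, coeff_smul, smul_eq_mul]
      ring
    · simp only [map_add, coeff_smul, smul_eq_mul]; ring
  set β := PowerSeries.mk fun k => eps k * coeff k ψ with hβ
  have β0 : constantCoeff β = 0 := by
    rw [← coeff_zero_eq_constantCoeff_apply, hβ, coeff_mk, coeff_zero_eq_constantCoeff_apply, h0, mul_zero]
  have h4 : expSeries ((4 : ℚ) • β) * (1 - 34 * PowerSeries.X ^ 4 + PowerSeries.X ^ 8) =
      (1 + 2 * PowerSeries.X - PowerSeries.X ^ 2) ^ 2 := by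
    have := congrArg expSeries h3
    rw [expSeries_add (Commute.all _ _) (by simp [β0]) (by simp [hω0]),
      expSeries_add (Commute.all _ _) (by simp [h0]) (by simp [h0]), hψ, ← expand_expSeries _ _ hω0,
      hω] at this
    rw [pow_two, ← this]
    simp only [map_add, map_sub, map_mul, map_pow, map_one, expand_X,
      show expand 4 four_ne_zero (34 : PowerSeries ℚ) = 34 from map_ofNat _ _]
    ring
  -- An integral fourth root of (1 + 2w - w²)²/(1 - 34w⁴ + w⁸). In the numerator, (1 + 2w - w²)(1 -
  -- w⁴) = g² - 4w⁴ with g = 1 + w - w² + w³, and 1 - 4w⁴/g² has an integral square root s3. In the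
  -- denominator, 1 - 34w⁴ + w⁸ = (1 - w⁴)² - 32w⁴, and 1 - 32w⁴/(1 - w⁴)² has an integral fourth
  -- root s2, extracted as two successive square roots.
  have key : ∃ C : PowerSeries ℤ, constantCoeff C = 1 ∧
      C ^ 4 * (1 - 34 * PowerSeries.X ^ 4 + PowerSeries.X ^ 8) =
      (1 + 2 * PowerSeries.X - PowerSeries.X ^ 2) ^ 2 := by
    set w : PowerSeries ℤ := PowerSeries.X with hw
    have w0 : constantCoeff w = 0 := constantCoeff_X
    obtain ⟨v, hv, v0⟩ := exists_mul_eq_one_int (f := 1 - w ^ 4) (by simp [w0])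
    obtain ⟨y, hy, y0⟩ := exists_mul_eq_one_int (f := 1 + w - w ^ 2 + w ^ 3) (by simp [w0])
    obtain ⟨c1, hc1⟩ := exists_add_sq_eq (a := -(8 * (w ^ 4 * v ^ 2))) (by simp [w0])
    obtain ⟨c2, hc2⟩ := exists_add_sq_eq (a := -(4 * (w ^ 4 * v ^ 2)) * c1) (by simp [w0])
    obtain ⟨c3, hc3⟩ := exists_add_sq_eq (a := -(w ^ 4 * y ^ 2)) (by simp [w0])
    set s1 := 1 + 2 * (-(8 * (w ^ 4 * v ^ 2)) * c1) with hs1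
    set s2 := 1 + 2 * (-(4 * (w ^ 4 * v ^ 2)) * c1 * c2) with hs2
    set s3 := 1 + 2 * (-(w ^ 4 * y ^ 2) * c3) with hs3
    have q1 : s1 ^ 2 = 1 - 32 * (w ^ 4 * v ^ 2) := by linear_combination 4 * hc1
    have q2 : s2 ^ 2 = s1 := by linear_combination 4 * hc2
    have q3 : s3 ^ 2 = 1 - 4 * (w ^ 4 * y ^ 2) := by linear_combination 4 * hc3
    obtain ⟨i2, hi2, i20⟩ := exists_mul_eq_one_int (f := s2) (by simp [hs2, w0])
    have s30 : constantCoeff s3 = 1 := by simp [hs3, w0]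
    refine ⟨(1 + w - w ^ 2 + w ^ 3) * s3 * v * i2, by simp [w0, s30, v0, i20], ?_⟩
    set g := 1 + w - w ^ 2 + w ^ 3 with hg
    have r1 : (g * s3) ^ 2 = (1 + 2 * w - w ^ 2) * (1 - w ^ 4) := by
      have : (g * s3) ^ 2 = g ^ 2 - 4 * w ^ 4 * (g * y) ^ 2 := by rw [mul_pow, q3]; ring
      rw [this, hy, hg]; ring
    have r2 : 1 - 34 * w ^ 4 + w ^ 8 = (1 - w ^ 4) ^ 2 * s2 ^ 4 := by
      have : (1 - w ^ 4) ^ 2 * s2 ^ 4 = (1 - w ^ 4) ^ 2 - 32 * w ^ 4 * ((1 - w ^ 4) * v) ^ 2 := by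
        rw [show s2 ^ 4 = (s2 ^ 2) ^ 2 by ring, q2, q1]; ring
      rw [this, hv]; ring
    rw [r2]
    calc (g * s3 * v * i2) ^ 4 * ((1 - w ^ 4) ^ 2 * s2 ^ 4)
        = ((g * s3) ^ 2) ^ 2 * v ^ 2 * ((1 - w ^ 4) * v) ^ 2 * (s2 * i2) ^ 4 := by ring
      _ = (1 + 2 * w - w ^ 2) ^ 2 * ((1 - w ^ 4) * v) ^ 4 * (s2 * i2) ^ 4 := by rw [r1]; ring
      _ = _ := by rw [hv, hi2]; ring
  obtain ⟨C, hC0, hC⟩ := key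
  have hC0' : constantCoeff (PowerSeries.map (Int.castRingHom ℚ) C) = 1 := by
    rw [← coeff_zero_eq_constantCoeff_apply, coeff_map, coeff_zero_eq_constantCoeff_apply, hC0]; simp
  obtain ⟨γ, hγ0, hγ⟩ := exists_log hC0'
  have h5 : expSeries ((4 : ℚ) • γ) = (PowerSeries.map (Int.castRingHom ℚ) C) ^ 4 := by
    rw [ofNat_smul, show (4 : PowerSeries ℚ) * γ = (γ + γ) + (γ + γ) by ring,
      expSeries_add (Commute.all _ _) (by simp [hγ0]) (by simp [hγ0]),
      expSeries_add (Commute.all _ _) hγ0 hγ0, hγ]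
    ring
  have h6 : expSeries ((4 : ℚ) • β) = expSeries ((4 : ℚ) • γ) := by
    have hC' := congrArg (PowerSeries.map (Int.castRingHom ℚ)) hC
    simp only [map_mul, map_pow, map_add, map_sub, map_one, map_X,
      show PowerSeries.map (Int.castRingHom ℚ) 34 = 34 from map_ofNat _ _,
      show PowerSeries.map (Int.castRingHom ℚ) 2 = 2 from map_ofNat _ _] at hC'
    have hu : IsUnit (1 - 34 * PowerSeries.X ^ 4 + PowerSeries.X ^ 8 : PowerSeries ℚ) := by
      rw [isUnit_iff_constantCoeff]; simp
    rw [h5]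
    exact hu.mul_right_cancel (h4.trans hC'.symm)
  have h7 := expSeries_injective (by simp [β0]) (by simp [hγ0]) h6
  -- Two series with constant term 1 and equal fourth powers coincide, seen on logarithms.
  have h8 : β = γ := smul_right_injective _ (show (4 : ℚ) ≠ 0 by norm_num) h7
  rw [h8, hγ]
  exact ⟨C, rfl⟩

/-! ### Homogenization -/

section Homog

variable {R : Type*} [Ring R]

/-- The substitution `w ↦ u t`. -/
def homog : PowerSeries R →+* PowerSeries (Polynomial R) where
  toFun f := PowerSeries.mk fun k => Polynomial.monomial k (coeff k f)
  map_zero' := by ext1 k; simp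
  map_one' := by
    ext1 k
    rw [coeff_mk, coeff_one, coeff_one]
    split_ifs with h <;> simp [h]
  map_add' f g := by ext1 k; simp
  map_mul' f g := by
    ext1 k
    rw [coeff_mk, coeff_mul, coeff_mul, map_sum]
    refine sum_congr rfl fun ij hij => ?_
    rw [coeff_mk, coeff_mk, Polynomial.monomial_mul_monomial, HasAntidiagonal.mem_antidiagonal.1 hij]

theorem coeff_homog (f : PowerSeries R) (k : ℕ) :
    coeff k (homog f) = Polynomial.monomial k (coeff k f) := by
  change coeff k (PowerSeries.mk fun k => Polynomial.monomial k (coeff k f)) = _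
  rw [coeff_mk]

theorem coeff_coeff_homog (f : PowerSeries R) (k i : ℕ) :
    (coeff k (homog f)).coeff i = if k = i then coeff k f else 0 := by
  rw [coeff_homog, Polynomial.coeff_monomial]

variable [Algebra ℚ R]

theorem homog_expSeries (f : PowerSeries R) : homog (expSeries f) = expSeries (homog f) := by
  ext1 k
  rw [coeff_homog, expSeries, expSeries, coeff_mk, coeff_mk, map_sum]
  refine sum_congr rfl fun n _ => ?_
  rw [← map_pow, coeff_homog, Polynomial.smul_monomial]

theorem lin_homog (y : ℕ → R) (f : PowerSeries ℚ) :
    lin y (homog f) = homog (PowerSeries.mk fun k => coeff k f • y k) := by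
  ext1 k
  rw [coeff_lin, coeff_homog, coeff_homog, coeff_mk]
  simp [scal, Polynomial.monomial_mul_C, Algebra.smul_def]

theorem homog_X : homog (PowerSeries.X : PowerSeries R) = uvar R * PowerSeries.X := by
  ext1 k
  rw [coeff_homog, uvar, coeff_C_mul, coeff_X, coeff_X]
  split_ifs with h
  · rw [h]; simp [Polynomial.monomial_one_one_eq_X]
  · simp

theorem constantCoeff_homog {f : PowerSeries R} (h : constantCoeff f = 0) : constantCoeff (homog f) = 0 := by
  rw [← coeff_zero_eq_constantCoeff_apply, coeff_homog, coeff_zero_eq_constantCoeff_apply, h, map_zero]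

end Homog

/-! ### The imaginary algebras -/

section Im

variable (σ : ℤˣ)

theorem h_commute_h {r s : ℤ} (hrs : r + s ≠ 0) : Commute (h r) (h s) := by
  have := h_mul_h r s
  rwa [if_neg hrs, zero_smul, add_zero] at this

theorem h_im_commute (r s : ℕ) : Commute (h ((σ : ℤ) * r)) (h ((σ : ℤ) * s)) := by
  by_cases hrs : (σ : ℤ) * r + (σ : ℤ) * s = 0
  · have h1 : (r : ℤ) + s = 0 := by
      rw [← mul_add] at hrs
      exact (mul_eq_zero.1 hrs).resolve_left σ.ne_zero
    have h2 : r = 0 := by omega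
    have h3 : s = 0 := by omega
    rw [h2, h3]
  · exact h_commute_h hrs

/-- The commutative algebra generated by the `h_{σ r}`. -/
def imRing : Subalgebra ℚ U := Algebra.adjoin ℚ (Set.range (epsH σ))

instance : CommRing (imRing σ) :=
  { (inferInstance : Ring (imRing σ)) with
    mul_comm := (Algebra.isMulCommutative_adjoin ℚ (by
      rintro _ ⟨r, rfl⟩ _ ⟨s, rfl⟩
      exact ((h_im_commute σ r s).smul_right _).smul_left _)).is_comm.comm }

/-- The generators of `imRing`. -/
def imGen (r : ℕ) : imRing σ := ⟨epsH σ r, Algebra.subset_adjoin ⟨r, rfl⟩⟩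

/-- The inclusion of `imRing`. -/
def imVal : imRing σ →+* U := (imRing σ).val.toRingHom

theorem imVal_imGen (r : ℕ) : imVal σ (imGen σ r) = epsH σ r := rfl

theorem hTilde_eq (k : ℕ) : hTilde σ k = imVal σ (coeff k (hatSeries (imGen σ))) := by
  rw [hTilde, ← coeff_map, map_hatSeries]; rfl

theorem hTilde_zero : hTilde σ 0 = 1 := by
  rw [hTilde, coeff_zero_eq_constantCoeff_apply]; exact constantCoeff_expSeries _

theorem hTilde_mem (k : ℕ) : hTilde σ k ∈ UZim σ := by
  rcases Nat.eq_zero_or_pos k with rfl | hk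
  · rw [hTilde_zero]; exact one_mem _
  · exact Algebra.subset_adjoin ⟨k, hk, rfl⟩

theorem hTilde_commute (k l : ℕ) : Commute (hTilde σ k) (hTilde σ l) := by
  rw [hTilde_eq, hTilde_eq]
  exact (Commute.all _ _).map (imVal σ)

theorem UZim_eq : UZim σ = Algebra.adjoin ℤ {w | ∃ (l : ℕ+) (n : ℕ), w = hTilde σ l ^ n} := by
  refine le_antisymm (Algebra.adjoin_le ?_) (Algebra.adjoin_le ?_)
  · rintro _ ⟨k, hk, rfl⟩
    exact Algebra.subset_adjoin ⟨⟨k, hk⟩, 1, by rw [pow_one]; rfl⟩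
  · rintro _ ⟨l, n, rfl⟩
    exact pow_mem (hTilde_mem σ l) n

theorem span_Bim : Submodule.span ℤ (Set.range (Bim σ)) = Subalgebra.toSubmodule (UZim σ) := by
  rw [UZim_eq]
  exact span_monomialProd (fun i j m n => (hTilde_commute σ i j).pow_pow m n) (fun _ => pow_zero _)
    fun i m n => ⟨1, by rw [one_smul, pow_add]⟩

theorem eps_mul_self (r : ℕ) : eps r * eps r = 1 := by
  rw [eps]; split_ifs <;> norm_num

/-- The exponentials of `∑ ψ_k h_{σ N k} w ^ k` that belong to the integral form. -/
theorem coeff_exp_h_mem {N : ℕ} (hN : N ≠ 0) {ψ : PowerSeries ℚ} (h0 : constantCoeff ψ = 0)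
    (hint : expSeries (PowerSeries.mk fun k => eps (N * k) * coeff k ψ) ∈ intSeries) (l : ℕ) :
    coeff l (expSeries (PowerSeries.mk fun k => coeff k ψ • h ((σ : ℤ) * ((N * k : ℕ) : ℤ)))) ∈
      UZim σ := by
  -- Chosen so that the series attached to b is the given integral series in w^N. The sequence ε_r
  -- h_{σr} b_r has the wanted logarithm, since ε_r² = 1.
  let b : ℕ → ℚ := fun r => if N ∣ r then (-1) ^ (r - 1) * r * (eps r * coeff (r / N) ψ) else 0
  let A : Subring (imRing σ) := (UZim σ).toSubring.comap (imVal σ)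
  have hc : constantCoeff (PowerSeries.mk fun k => eps (N * k) * coeff k ψ) = 0 := by
    rw [← coeff_zero_eq_constantCoeff_apply, coeff_mk, coeff_zero_eq_constantCoeff_apply, h0, mul_zero]
  have hlog : ∀ r : ℕ, r ≠ 0 → (-1 : ℚ) ^ (r - 1) / r * ((-1) ^ (r - 1) * r) = 1 := fun r hr => by
    have : (r : ℚ) ≠ 0 := by exact_mod_cast hr
    field_simp
    rw [← pow_mul, mul_comm, pow_mul]; simp
  have hb : hatSeries b = expand N hN (expSeries (PowerSeries.mk fun k => eps (N * k) * coeff k ψ)) := by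
    rw [expand_expSeries _ _ hc, hatSeries]
    congr 1
    ext k
    rw [coeff_mk, coeff_expand]
    simp only [b]
    split_ifs with h1 h2 h2
    · simp [h1, h0, coeff_zero_eq_constantCoeff_apply]
    · rfl
    · obtain ⟨m, rfl⟩ := h2
      rw [Nat.mul_div_cancel_left _ (Nat.pos_of_ne_zero hN), coeff_mk, smul_eq_mul, ← mul_assoc,
        hlog _ h1, one_mul]
    · simp
  have hbA : ∀ k, coeff k (hatSeries fun r => algebraMap ℚ (imRing σ) (b r)) ∈ A := by
    intro k
    rw [← map_hatSeries (algebraMap ℚ (imRing σ)), hb, coeff_map, coeff_expand]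
    split_ifs
    · obtain ⟨f, hf⟩ := hint
      rw [← hf, coeff_map]
      simp
    · rw [map_zero]; exact zero_mem _
  have hpA : ∀ k, coeff k (hatSeries (imGen σ)) ∈ A := fun k => by
    change imVal σ _ ∈ UZim σ
    rw [← hTilde_eq]; exact hTilde_mem σ k
  have key := coeff_hatSeries_mul_mem A hpA hbA (N * l)
  have heq : hatSeries (fun r => imGen σ r * algebraMap ℚ (imRing σ) (b r)) =
      expand N hN (expSeries (PowerSeries.mk fun k => (eps (N * k) * coeff k ψ) • imGen σ (N * k))) := by
    rw [expand_expSeries _ _ (by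
      rw [← coeff_zero_eq_constantCoeff_apply, coeff_mk, coeff_zero_eq_constantCoeff_apply, h0]; simp),
      hatSeries]
    congr 1
    ext1 k
    rw [coeff_mk, coeff_expand]
    simp only [b]
    split_ifs with h1 h2 h2
    · simp [h1, h0, coeff_zero_eq_constantCoeff_apply]
    · rfl
    · obtain ⟨m, rfl⟩ := h2
      rw [Nat.mul_div_cancel_left _ (Nat.pos_of_ne_zero hN), coeff_mk, mul_comm (imGen σ (N * m)), ← Algebra.smul_def,
        smul_smul, ← mul_assoc, hlog _ h1, one_mul]
    · simp
  rw [heq, coeff_expand_mul] at key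
  change imVal σ _ ∈ UZim σ at key
  rw [← coeff_map, map_expSeries] at key
  convert key using 4
  ext1 k
  rw [coeff_mk, coeff_map, coeff_mk, map_rat_smul, imVal_imGen, epsH, smul_smul,
    mul_right_comm, eps_mul_self, one_mul]

end Im

/-! ### The Cartan part -/

section Coeffs

variable {R : Type*} [Ring R]

theorem coeff_coeff_mul_mem {M N : Submodule ℤ R} {f g : PowerSeries (Polynomial R)}
    (hf : ∀ m i, (coeff m f).coeff i ∈ M) (hg : ∀ m i, (coeff m g).coeff i ∈ N) (m i : ℕ) :
    (coeff m (f * g)).coeff i ∈ M * N := by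
  rw [coeff_mul, Polynomial.finsetSum_coeff]
  refine sum_mem fun p _ => ?_
  rw [Polynomial.coeff_mul]
  exact sum_mem fun q _ => Submodule.mul_mem_mul (hf _ _) (hg _ _)

theorem commute_of_mem_adjoin {s t : Set R} (h : ∀ a ∈ s, ∀ b ∈ t, Commute a b) {a b : R}
    (ha : a ∈ Algebra.adjoin ℤ s) (hb : b ∈ Algebra.adjoin ℤ t) : Commute a b := by
  induction ha using Algebra.adjoin_induction with
  | mem a ha =>
    induction hb using Algebra.adjoin_induction with
    | mem b hb => exact h a ha b hb
    | algebraMap z => exact (Algebra.commutes z _).symm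
    | add _ _ _ _ h h' => exact h.add_right h'
    | mul _ _ _ _ h h' => exact h.mul_right h'
  | algebraMap z => exact Algebra.commutes z _
  | add _ _ _ _ h h' => exact h.add_left h'
  | mul _ _ _ _ h h' => exact h.mul_left h'

variable [Algebra ℚ R]

theorem commute_aeval {a b : R} (h : Commute a b) (f : Polynomial ℚ) :
    Commute a (Polynomial.aeval b f) := by
  induction f using Polynomial.induction_on' with
  | add f g hf hg => rw [map_add]; exact hf.add_right hg
  | monomial n q =>
    rw [Polynomial.aeval_monomial, ← Algebra.smul_def]
    exact (h.pow_right n).smul_right q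

theorem commute_binom {a b : R} (h : Commute a b) (k : ℕ) : Commute a (binom b k) :=
  (commute_aeval h _).smul_right _

theorem commute_coeff_expSeries {z : R} {f : PowerSeries R} (h0 : constantCoeff f = 0)
    (h : ∀ k, Commute z (coeff k f)) (k : ℕ) : Commute z (coeff k (expSeries f)) := by
  have : Commute (PowerSeries.C z) f := by
    ext1 k
    rw [coeff_C_mul, coeff_mul_C]; exact h k
  have := congrArg (coeff k) (commute_expSeries h0 this).eq
  rwa [coeff_C_mul, coeff_mul_C] at this

theorem toQ_homog (f : PowerSeries ℤ) : toQ (homog f) = homog (PowerSeries.map (Int.castRingHom ℚ) f) := by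
  ext1 k
  rw [coeff_toQ, coeff_homog, coeff_homog, coeff_map, Polynomial.map_monomial]

theorem toQ_X : toQ PowerSeries.X = PowerSeries.X := by simp [toQ]

theorem bar_X (s : ℚ) : bar s (PowerSeries.X : PowerSeries (Polynomial ℚ)) =
    PowerSeries.C (Polynomial.C s) * PowerSeries.X := by
  rw [bar]
  exact rescale_X _

end Coeffs

theorem h_zero_commute_h (r : ℤ) : Commute (h r) (h 0) := by
  have := h_mul_h r 0
  split_ifs at this with h0
  · rw [add_zero] at h0
    rw [h0]
  · rwa [zero_smul, add_zero] at this

theorem hTilde_commute_of {σ : ℤˣ} {z : U} (hz : ∀ r, Commute z (h r)) (k : ℕ) :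
    Commute z (hTilde σ k) := by
  refine commute_coeff_expSeries (constantCoeff_hatLog _) (fun k => ?_) k
  rw [coeff_mk]
  split_ifs
  · exact Commute.zero_right _
  · exact ((hz _).smul_right _).smul_right _

theorem zero_commute_im (σ : ℤˣ) {z w : U} (hz : z ∈ UZzero) (hw : w ∈ UZim σ) : Commute w z := by
  refine (commute_of_mem_adjoin ?_ hz hw).symm
  rintro _ ⟨a, ha, k, rfl⟩ _ ⟨l, _, rfl⟩
  refine (commute_binom ?_ k).symm
  refine (hTilde_commute_of (z := a) (fun r => ?_) l).symm
  obtain ⟨i, j, rfl⟩ := Submodule.mem_span_pair.1 ha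
  exact ((h_zero_commute_h r).symm.smul_left i).add_left (Commute.smul_left (c_commute_h r) j)

/-- The integral form of the Cartan part. -/
def UZcartan : Subalgebra ℤ U := UZim (-1) ⊔ UZzero ⊔ UZim 1

theorem UZim_le_cartan (σ : ℤˣ) : UZim σ ≤ UZcartan := by
  rcases Int.units_eq_one_or σ with rfl | rfl
  · exact le_sup_right
  · exact le_sup_left.trans le_sup_left

theorem UZzero_le_cartan : UZzero ≤ UZcartan := le_sup_right.trans le_sup_left

/-- The triangular product in the Cartan part. -/
def cartanProd : Submodule ℤ U :=
  Subalgebra.toSubmodule (UZim (-1)) * Subalgebra.toSubmodule UZzero * Subalgebra.toSubmodule (UZim 1)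

theorem mem_cartanProd {i z j : U} (hi : i ∈ UZim (-1)) (hz : z ∈ UZzero) (hj : j ∈ UZim 1) :
    i * z * j ∈ cartanProd :=
  Submodule.mul_mem_mul (Submodule.mul_mem_mul hi hz) hj

theorem cartanProd_induction {P : U → Prop}
    (h : ∀ i ∈ UZim (-1), ∀ z ∈ UZzero, ∀ j ∈ UZim 1, P (i * z * j))
    (hadd : ∀ a b, P a → P b → P (a + b)) {a : U} (ha : a ∈ cartanProd) : P a := by
  induction ha using Submodule.mul_induction_on' with
  | mem_mul_mem m hm j hj =>
    induction hm using Submodule.mul_induction_on' with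
    | mem_mul_mem i hi z hz => exact h i hi z hz j hj
    | add a _ b _ h h' => rw [add_mul]; exact hadd _ _ h h'
  | add a _ b _ h h' => exact hadd _ _ h h'

theorem im_neg_mul_cartanProd {a b : U} (ha : a ∈ UZim (-1)) (hb : b ∈ cartanProd) :
    a * b ∈ cartanProd := by
  refine cartanProd_induction (P := fun b => a * b ∈ cartanProd) (fun i hi z hz j hj => ?_)
    (fun _ _ h h' => by rw [mul_add]; exact add_mem h h') hb
  rw [← mul_assoc, ← mul_assoc]
  exact mem_cartanProd (mul_mem ha hi) hz hj

theorem zero_mul_cartanProd {a b : U} (ha : a ∈ UZzero) (hb : b ∈ cartanProd) :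
    a * b ∈ cartanProd := by
  refine cartanProd_induction (P := fun b => a * b ∈ cartanProd) (fun i hi z hz j hj => ?_)
    (fun _ _ h h' => by rw [mul_add]; exact add_mem h h') hb
  rw [← mul_assoc, ← mul_assoc, ← (zero_commute_im _ ha hi).eq, mul_assoc i]
  exact mem_cartanProd hi (mul_mem ha hz) hj

theorem cartanProd_mul {a z j : U} (ha : a ∈ cartanProd) (hz : z ∈ UZzero) (hj : j ∈ UZim 1) :
    a * z * j ∈ cartanProd := by
  refine cartanProd_induction (P := fun b => b * z * j ∈ cartanProd) (fun i hi z' hz' j' hj' => ?_)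
    (fun _ _ h h' => by rw [add_mul, add_mul]; exact add_mem h h') ha
  rw [mul_assoc _ j', (zero_commute_im _ hz hj').eq, ← mul_assoc, mul_assoc i z', mul_assoc _ j']
  exact mem_cartanProd hi (mul_mem hz' hz) (mul_mem hj' hj)

/-- The coefficients of the logarithm of `∑ h̃_k u ^ k`. -/
def hatCoeff (r : ℕ) : ℚ := if r = 0 then 0 else (-1) ^ (r - 1) / r * eps r

theorem hatCoeff_mul_self {r : ℕ} (hr : r ≠ 0) : hatCoeff r * hatCoeff r = 1 / ((r : ℚ) * r) := by
  have h1 : ((-1 : ℚ) ^ (r - 1)) * (-1) ^ (r - 1) = 1 := by rw [← mul_pow]; norm_num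
  have h2 := eps_mul_self r
  have : (r : ℚ) ≠ 0 := by exact_mod_cast hr
  rw [hatCoeff, if_neg hr]
  field_simp
  linear_combination (eps r * eps r) * h1 + h2

theorem hatSeries_epsH (σ : ℤˣ) : hatSeries (epsH σ) =
    expSeries (PowerSeries.mk fun r => hatCoeff r • h ((σ : ℤ) * r)) := by
  rw [hatSeries]
  congr 1
  ext1 r
  rw [coeff_mk, coeff_mk, hatCoeff]
  split_ifs
  · rw [zero_smul]
  · rw [epsH, smul_smul]

/-- The signs in the two logarithms square to 1, and 2r(2 + (-1)^(r-1))/r² = ((-1)^(r-1)/r)(2 -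
4(-1)^r). The exponential is therefore (1 + w)²/(1 - w)⁴, an integral series. -/
theorem exists_commutator_log : ∃ lam : PowerSeries ℚ, constantCoeff lam = 0 ∧
    (∀ r : ℕ, r ≠ 0 → coeff r lam =
      hatCoeff r * hatCoeff r * (2 * r * (2 + (-1) ^ ((r : ℤ) - 1)))) ∧ expSeries lam ∈ intSeries := by
  let p : ℕ → ℚ := fun r => 2 * 1 ^ r + (-4) * (-1) ^ r
  refine ⟨PowerSeries.mk fun r => if r = 0 then 0 else ((-1 : ℚ) ^ (r - 1) / (r : ℚ)) • p r,
    constantCoeff_hatLog p, ?_, ?_⟩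
  · intro r hr
    have hr' : (r : ℚ) ≠ 0 := by exact_mod_cast hr
    obtain ⟨m, rfl⟩ := Nat.exists_eq_succ_of_ne_zero hr
    rw [hatCoeff_mul_self hr, coeff_mk, if_neg hr]
    have : (-1 : ℚ) ^ (((m + 1 : ℕ) : ℤ) - 1) = (-1) ^ m := by
      rw [← zpow_natCast]; congr 1; push_cast; ring
    have h1 : (-1 : ℚ) ^ m * (-1) ^ m = 1 := by rw [← mul_pow]; norm_num
    simp only [Nat.succ_eq_add_one] at hr' ⊢
    rw [this, Nat.add_sub_cancel]
    simp only [p, smul_eq_mul, one_pow, pow_succ]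
    field_simp
    linear_combination 4 * h1
  · obtain ⟨G, hG, hG0⟩ := exists_mul_eq_one_int (f := (1 - PowerSeries.X) ^ 4) (by simp)
    refine ⟨(1 + PowerSeries.X) ^ 2 * G, ?_⟩
    have h1 : hatSeries p * hatSeries (fun r => 4 * (-1 : ℚ) ^ r) = hatSeries (fun r => 2 * (1 : ℚ) ^ r) := by
      rw [← hatSeries_add]; congr 1; ext r; simp only [p]; ring
    have h2 : ∀ y : ℚ, hatSeries (fun r => 2 * y ^ r) = (1 + PowerSeries.C y * PowerSeries.X) ^ 2 := by
      intro y
      rw [← hatSeries_pow, pow_two, ← hatSeries_add]; congr 1; ext r; ring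
    have h4 : ∀ y : ℚ, hatSeries (fun r => 4 * y ^ r) = (1 + PowerSeries.C y * PowerSeries.X) ^ 4 := by
      intro y
      rw [show 4 = 2 * 2 from rfl, pow_mul, ← h2, pow_two, ← hatSeries_add]; congr 1; ext r; ring
    rw [h2, h4] at h1
    have hG' := congrArg (PowerSeries.map (Int.castRingHom ℚ)) hG
    simp only [map_mul, map_pow, map_add, map_sub, map_one, map_X] at hG' ⊢
    simp only [map_one, map_neg, one_mul, neg_mul, ← sub_eq_add_neg] at h1
    change _ = hatSeries p
    rw [← h1, mul_assoc, hG', mul_one]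

theorem commute_lin_const {R : Type*} [Ring R] [Algebra ℚ R] {z : R} {f : PowerSeries (Polynomial R)}
    (ℓ : PowerSeries (Polynomial ℚ)) (hf : ∀ m i, Commute ((coeff m f).coeff i) z) :
    Commute f (lin (fun _ => z) ℓ) := by
  ext1 m
  rw [coeff_mul, coeff_mul, ← Finset.Nat.sum_antidiagonal_swap]
  refine sum_congr rfl fun ij _ => ?_
  simp only [Prod.fst_swap, Prod.snd_swap, coeff_lin]
  have h1 : Commute (coeff ij.2 f) (Polynomial.C z) := by
    ext1 i
    rw [Polynomial.coeff_mul_C, Polynomial.coeff_C_mul]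
    exact hf _ _
  exact ((scal_mul_comm _ _).symm.mul_right h1).eq

/-- The logarithm of `∑ h̃_k u ^ k`. -/
def hatLog (σ : ℤˣ) : PowerSeries U := PowerSeries.mk fun r => hatCoeff r • h ((σ : ℤ) * r)

theorem constantCoeff_hatLog' (σ : ℤˣ) : constantCoeff (hatLog σ) = 0 := by
  rw [← coeff_zero_eq_constantCoeff_apply, hatLog, coeff_mk]; simp [hatCoeff]

theorem hatLog_commutator {lam : PowerSeries ℚ} (h0 : constantCoeff lam = 0)
    (hlam : ∀ r : ℕ, r ≠ 0 → coeff r lam =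
      hatCoeff r * hatCoeff r * (2 * r * (2 + (-1) ^ ((r : ℤ) - 1)))) (i j : ℕ) :
    coeff i (hatLog 1) * coeff j (hatLog (-1)) = coeff j (hatLog (-1)) * coeff i (hatLog 1) +
      (if i = j then coeff i lam else 0) • c := by
  simp only [hatLog, coeff_mk]
  rw [smul_mul_smul_comm, smul_mul_smul_comm, h_mul_h, smul_add, mul_comm (hatCoeff j), smul_smul]
  congr 2
  simp only [Units.val_one, Units.val_neg, one_mul, neg_mul]
  by_cases hij : i = j
  · subst hij
    rw [if_pos (by ring), if_pos rfl]
    rcases eq_or_ne i 0 with rfl | hi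
    · simp [h0]
    · rw [hlam i hi]; push_cast; ring
  · rw [if_neg (by omega), if_neg hij, mul_zero]

/-- The variables ut and t play the role of two independent variables for the positive and the
negative modes. Only opposite modes fail to commute, so the commutator lives on the diagonal u^r
t^(2r), which the expansion by 2 of the homogenized series encodes. -/
theorem homog_hatLog_mul {lam : PowerSeries ℚ} (h0 : constantCoeff lam = 0)
    (hlam : ∀ r : ℕ, r ≠ 0 → coeff r lam =
      hatCoeff r * hatCoeff r * (2 * r * (2 + (-1) ^ ((r : ℤ) - 1)))) :
    homog (hatLog 1) * PowerSeries.map Polynomial.C (hatLog (-1)) =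
      PowerSeries.map Polynomial.C (hatLog (-1)) * homog (hatLog 1) +
        lin (fun _ => c) (expand 2 two_ne_zero (homog lam)) := by
  ext1 m
  rw [map_add, coeff_mul, coeff_mul, ← Finset.Nat.sum_antidiagonal_swap, ← sub_eq_iff_eq_add',
    ← sum_sub_distrib]
  have hterm : ∀ ij ∈ antidiagonal m,
      coeff ij.swap.1 (homog (hatLog 1)) * coeff ij.swap.2 (PowerSeries.map Polynomial.C (hatLog (-1))) -
      coeff ij.1 (PowerSeries.map Polynomial.C (hatLog (-1))) * coeff ij.2 (homog (hatLog 1)) =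
        if ij.2 = ij.1 then Polynomial.monomial ij.1 (coeff ij.1 lam • c) else 0 := by
    rintro ⟨i, j⟩ -
    simp only [Prod.fst_swap, Prod.snd_swap, coeff_homog, coeff_map]
    rw [Polynomial.monomial_mul_C, Polynomial.C_mul_monomial, hatLog_commutator h0 hlam, ← map_sub,
      add_sub_cancel_left]
    by_cases hji : j = i
    · subst hji; simp
    · simp [hji]
  rw [sum_congr rfl hterm, coeff_lin, coeff_expand]
  split_ifs with h2
  · obtain ⟨r, rfl⟩ := h2
    rw [sum_eq_single (r, r)]
    · rw [if_pos rfl, Nat.mul_div_cancel_left _ two_pos, coeff_homog]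
      simp [scal, Polynomial.monomial_mul_C, Algebra.smul_def]
    · rintro ⟨i, j⟩ hij hne
      rw [HasAntidiagonal.mem_antidiagonal] at hij
      simp only at hij
      rw [if_neg]
      intro h
      simp only at h
      exact hne (by rw [Prod.mk.injEq]; omega)
    · intro h
      exact absurd (HasAntidiagonal.mem_antidiagonal.2 (by omega)) h
  · rw [map_zero, zero_mul]
    refine sum_eq_zero fun ij hij => ?_
    rw [HasAntidiagonal.mem_antidiagonal] at hij
    rw [if_neg]
    intro h
    exact h2 ⟨ij.1, by omega⟩

theorem zero_mul_im_comm : Subalgebra.toSubmodule UZzero * Subalgebra.toSubmodule (UZim 1) =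
    Subalgebra.toSubmodule (UZim 1) * Subalgebra.toSubmodule UZzero :=
  Submodule.mul_comm_of_commute fun _ hz _ hw => (zero_commute_im _ hz hw).symm

theorem toQ_expand (N : ℕ) (hN : N ≠ 0) (f : PowerSeries (Polynomial ℤ)) :
    toQ (expand N hN f) = expand N hN (toQ f) := by
  ext1 k
  rw [coeff_toQ, coeff_expand, coeff_expand]
  split_ifs
  · rw [coeff_toQ]
  · rw [Polynomial.map_zero]

/-- The two exponentials commute up to the c-th power of an integral series, whose coefficients are
integral combinations of binomials of c. The left factor is kept in the span of single elements
h̃_{-l}, not merely in the algebra they generate: the induction in `im_mul_hTilde` needs this. -/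
theorem hTilde_one_mul_hTilde_neg_one (k l : ℕ) : hTilde 1 k * hTilde (-1) l ∈
    Submodule.span ℤ (Set.range (hTilde (-1))) * Subalgebra.toSubmodule UZzero *
      Subalgebra.toSubmodule (UZim 1) := by
  obtain ⟨lam, hlam0, hlam, G, hG⟩ := exists_commutator_log
  have hh0 : constantCoeff (homog lam) = 0 := constantCoeff_homog hlam0
  have hℓ0 : constantCoeff (expand 2 two_ne_zero (homog lam)) = 0 := by rw [constantCoeff_expand, hh0]
  have hE : expSeries (expand 2 two_ne_zero (homog lam)) = toQ (expand 2 two_ne_zero (homog G)) := by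
    rw [toQ_expand, toQ_homog, show PowerSeries.map (Int.castRingHom ℚ) G = expSeries lam from hG,
      homog_expSeries, expand_expSeries 2 two_ne_zero hh0]
  have hA0 : constantCoeff (homog (hatLog 1)) = 0 := constantCoeff_homog (constantCoeff_hatLog' 1)
  have hB0 : constantCoeff (PowerSeries.map Polynomial.C (hatLog (-1))) = 0 := by
    rw [← coeff_zero_eq_constantCoeff_apply, coeff_map, coeff_zero_eq_constantCoeff_apply,
      constantCoeff_hatLog', map_zero]
  have hcL : ∀ (σ : ℤˣ) m, Commute (coeff m (hatLog σ)) c := fun σ m => by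
    rw [hatLog, coeff_mk]; exact (Commute.symm (c_commute_h _)).smul_left _
  have hswap := expSeries_mul_expSeries_of_commutator hA0 hB0 (homog_hatLog_mul hlam0 hlam)
    (commute_lin_const _ fun m i => by
      rw [coeff_coeff_homog]
      split_ifs
      · exact hcL _ _
      · exact Commute.zero_left _)
    (commute_lin_const _ fun m i => by
      rw [coeff_map, Polynomial.coeff_C]
      split_ifs
      · exact hcL _ _
      · exact Commute.zero_left _)
  have hexpA : expSeries (homog (hatLog 1)) = homog (hatSeries (epsH 1)) := by
    rw [hatSeries_epsH, homog_expSeries]; rfl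
  have hexpB : expSeries (PowerSeries.map Polynomial.C (hatLog (-1))) =
      PowerSeries.map Polynomial.C (hatSeries (epsH (-1))) := by
    rw [hatSeries_epsH, map_expSeries]; rfl
  have hlhs : (coeff (k + l) (expSeries (homog (hatLog 1)) *
      expSeries (PowerSeries.map Polynomial.C (hatLog (-1))))).coeff k = hTilde 1 k * hTilde (-1) l := by
    rw [hexpA, hexpB, coeff_mul, Polynomial.finsetSum_coeff, sum_eq_single (k, l)]
    · rw [coeff_map, Polynomial.coeff_mul_C, coeff_coeff_homog, if_pos rfl]; rfl
    · rintro ⟨i, j⟩ hij hne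
      rw [HasAntidiagonal.mem_antidiagonal] at hij
      simp only at hij
      rw [coeff_map, Polynomial.coeff_mul_C, coeff_coeff_homog, if_neg, zero_mul]
      rintro rfl
      exact hne (by rw [Prod.mk.injEq]; omega)
    · intro h
      exact absurd (HasAntidiagonal.mem_antidiagonal.2 (show k + l = k + l from rfl)) h
  have hmA : ∀ m i, (coeff m (homog (hatSeries (epsH 1)))).coeff i ∈
      Subalgebra.toSubmodule (UZim 1) := fun m i => by
    rw [coeff_coeff_homog]
    split_ifs
    · exact hTilde_mem 1 m
    · exact zero_mem _
  have hmB : ∀ m i, (coeff m (PowerSeries.map Polynomial.C (hatSeries (epsH (-1))))).coeff i ∈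
      Submodule.span ℤ (Set.range (hTilde (-1))) := fun m i => by
    rw [coeff_map, Polynomial.coeff_C]
    split_ifs
    · exact Submodule.subset_span ⟨m, rfl⟩
    · exact zero_mem _
  have hmC : ∀ m i, (coeff m (expSeries (lin (fun _ => c) (expand 2 two_ne_zero (homog lam))))).coeff i ∈
      Subalgebra.toSubmodule UZzero :=
    expSeries_lin_const_mem (A := UZzero.toSubring) (fun k => by
      have := binom_mem_UZzero 0 1 k
      rwa [zero_smul, one_smul, zero_add] at this) hℓ0 hE
  rw [← hlhs, hswap, hexpA, hexpB, mul_assoc, zero_mul_im_comm]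
  exact coeff_coeff_mul_mem hmB (coeff_coeff_mul_mem hmA hmC) _ _

theorem im_commute (σ : ℤˣ) {a b : U} (ha : a ∈ UZim σ) (hb : b ∈ UZim σ) : Commute a b := by
  refine commute_of_mem_adjoin ?_ ha hb
  rintro _ ⟨k, _, rfl⟩ _ ⟨l, _, rfl⟩
  exact hTilde_commute σ k l

theorem im_mul_hTilde {j : U} (hj : j ∈ UZim 1) (l : ℕ) : j * hTilde (-1) l ∈ cartanProd := by
  have key : Subalgebra.toSubmodule (UZim 1) ≤ Subalgebra.toSubmodule (UZim 1) ⊓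
      ⨅ l, cartanProd.comap (LinearMap.mulRight ℤ (hTilde (-1) l)) := by
    refine adjoin_le_of_mul_mem ⟨(UZim 1).one_mem, (Submodule.mem_iInf _).2 fun l => ?_⟩ ?_
    · have := mem_cartanProd (hTilde_mem (-1) l) (one_mem _) (one_mem _)
      simpa using this
    · rintro _ ⟨k, hk, rfl⟩ b ⟨hb1, hb⟩
      refine ⟨(UZim 1).mul_mem (hTilde_mem 1 k) hb1, ?_⟩
      rw [SetLike.mem_coe, Submodule.mem_iInf] at hb ⊢
      intro l
      change hTilde 1 k * b * hTilde (-1) l ∈ cartanProd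
      -- The new letter is moved next to h̃_{-l}. Exchanging the two leaves combinations of single
      -- h̃_{-l'} on the left, to which the induction hypothesis for b applies.
      rw [(im_commute 1 (hTilde_mem 1 k) hb1).eq, mul_assoc]
      have hs := hTilde_one_mul_hTilde_neg_one k l
      generalize hTilde 1 k * hTilde (-1) l = w at hs
      induction hs using Submodule.mul_induction_on' with
      | mem_mul_mem m hm j hj =>
        induction hm using Submodule.mul_induction_on' with
        | mem_mul_mem i hi z hz =>
          rw [← mul_assoc, ← mul_assoc]
          refine cartanProd_mul ?_ hz hj
          induction hi using Submodule.span_induction with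
          | mem i hi => obtain ⟨l', rfl⟩ := hi; exact hb l'
          | zero => rw [mul_zero]; exact zero_mem _
          | add _ _ _ _ h h' => rw [mul_add]; exact add_mem h h'
          | smul n _ _ h => rw [mul_smul_comm]; exact Submodule.smul_mem _ n h
        | add a _ b _ h h' => rw [add_mul, mul_add]; exact add_mem h h'
      | add a _ b _ h h' => rw [mul_add]; exact add_mem h h'
  exact (Submodule.mem_iInf _).1 (key hj).2 l

theorem im_mul_cartanProd {j b : U} (hj : j ∈ UZim 1) (hb : b ∈ cartanProd) : j * b ∈ cartanProd := by
  have key : Subalgebra.toSubmodule (UZim (-1)) ≤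
      ⨅ j : UZim 1, cartanProd.comap (LinearMap.mulLeft ℤ (j : U)) := by
    refine adjoin_le_of_mul_mem ((Submodule.mem_iInf _).2 fun j => ?_) ?_
    · have := mem_cartanProd (one_mem _) (one_mem _) j.2
      simpa using this
    · rintro _ ⟨l, _, rfl⟩ b hb
      rw [Submodule.mem_iInf] at hb ⊢
      intro j
      rw [Submodule.mem_comap, LinearMap.mulLeft_apply, ← mul_assoc]
      refine cartanProd_induction (P := fun a => a * b ∈ cartanProd) (fun i hi z hz j hj => ?_)
        (fun _ _ h h' => by rw [add_mul]; exact add_mem h h') (im_mul_hTilde j.2 l)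
      rw [mul_assoc, mul_assoc]
      exact im_neg_mul_cartanProd hi (zero_mul_cartanProd hz (hb ⟨j, hj⟩))
  refine cartanProd_induction (P := fun b => j * b ∈ cartanProd) (fun i hi z hz j' hj' => ?_)
    (fun _ _ h h' => by rw [mul_add]; exact add_mem h h') hb
  rw [← mul_assoc, ← mul_assoc]
  exact cartanProd_mul ((Submodule.mem_iInf _).1 (key hi) ⟨j, hj⟩) hz hj'

theorem toSubmodule_cartan : Subalgebra.toSubmodule UZcartan = cartanProd := by
  refine le_antisymm ?_ ?_
  · have : UZcartan = Algebra.adjoin ℤ ((UZim (-1) : Set U) ∪ UZzero ∪ UZim 1) := by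
      rw [Algebra.adjoin_union, Algebra.adjoin_union, Algebra.adjoin_eq, Algebra.adjoin_eq,
        Algebra.adjoin_eq]
      rfl
    rw [this]
    refine adjoin_le_of_mul_mem ?_ ?_
    · simpa using mem_cartanProd (one_mem _) (one_mem _) (one_mem _)
    · rintro a ((ha | ha) | ha) b hb
      · exact im_neg_mul_cartanProd ha hb
      · exact zero_mul_cartanProd ha hb
      · exact im_mul_cartanProd ha hb
  · intro a ha
    exact cartanProd_induction (P := fun a => a ∈ UZcartan)
      (fun i hi z hz j hj => mul_mem (mul_mem (UZim_le_cartan _ hi) (UZzero_le_cartan hz))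
        (UZim_le_cartan _ hj)) (fun _ _ h h' => add_mem h h') ha

/-! ### The diagonal factors -/

/-- The parameters of `x⁻_s`: `t` is put into the component of the parity of `n`. -/
def bEven (n : ℤ) : PowerSeries (Polynomial ℤ) := if Even n then PowerSeries.X else 0

/-- The parameters of `x⁻_s`, as in `bEven`: the component of the other parity. -/
def bOdd (n : ℤ) : PowerSeries (Polynomial ℤ) := if Even n then 0 else PowerSeries.X

theorem psi_eq {s : ℚ} {b0 b1 : PowerSeries (Polynomial ℤ)} (D : GaussData s b0 b1)
    {ψ : PowerSeries ℚ} (h0 : constantCoeff ψ = 0)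
    (hψ : homog (expSeries ((2 : ℚ) • ψ)) =
      toQ (Gauss.d0 (uvar ℤ) b0 b1 + Gauss.d1 (uvar ℤ) b0 b1)) : D.ψ = homog ψ := by
  have h2 : homog ((2 : ℚ) • ψ) = (2 : ℚ) • homog ψ := by
    ext1 k
    rw [coeff_homog, map_smul, coeff_smul, coeff_homog, Polynomial.smul_monomial]
  have h1 : (2 : ℚ) • D.ψ = (2 : ℚ) • homog ψ := by
    refine expSeries_injective (by simp [D.cψ]) (by simp [constantCoeff_homog h0]) ?_
    rw [D.exp_ψ, ← hψ, homog_expSeries, h2]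
  have := congrArg ((2⁻¹ : ℚ) • ·) h1
  simpa [smul_smul] using this

theorem diag_eq {s : ℚ} {b0 b1 : PowerSeries (Polynomial ℤ)} {R : Type*} [Ring R] [Algebra ℚ R]
    (D : GaussData s b0 b1) (L : HalfLoop R s) {ψ : PowerSeries ℚ} (h : D.ψ = homog ψ) :
    D.diag L = homog (expSeries (PowerSeries.mk fun k => coeff k ψ • L.H k)) := by
  rw [GaussData.diag, h, lin_homog, homog_expSeries]

theorem homog_mem_rees {A : Subring U} {f : PowerSeries U} (hf : ∀ k, coeff k f ∈ A) :
    homog f ∈ rees (Filt.const A) := by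
  intro m i
  rw [coeff_coeff_homog]
  split_ifs
  · exact hf m
  · exact zero_mem _

theorem du_X : du (PowerSeries.X : PowerSeries (Polynomial ℤ)) = 0 := by
  ext1 k
  rw [coeff_du, coeff_X]
  split_ifs <;> simp

theorem nonempty_basicData (n : ℤ) : Nonempty (GaussData ((-1) ^ n) (bEven n) (bOdd n)) := by
  rcases Int.even_or_odd n with hn | hn
  · rw [bEven, bOdd, if_pos hn, if_pos hn, hn.neg_one_zpow]
    refine nonempty_gaussData (by simp) (by simp) du_X (by simp) ?_ (by simp)
    rw [toQ_X, bar_X]; simp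
  · rw [bEven, bOdd, if_neg (Int.not_even_iff_odd.2 hn), if_neg (Int.not_even_iff_odd.2 hn),
      hn.neg_one_zpow]
    refine nonempty_gaussData (by simp) (by simp) (by simp) du_X (by simp) ?_
    rw [toQ_X, bar_X]; simp

/-- The series `log (1 + w)`. -/
def logOneAdd : PowerSeries ℚ :=
  PowerSeries.mk fun r => if r = 0 then 0 else ((-1 : ℚ) ^ (r - 1) / (r : ℚ)) • 1 ^ r

theorem constantCoeff_logOneAdd : constantCoeff logOneAdd = 0 := constantCoeff_hatLog _

theorem expSeries_logOneAdd : expSeries logOneAdd = 1 + PowerSeries.X := by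
  have := hatSeries_pow (1 : ℚ)
  rwa [map_one, one_mul] at this

theorem psi_even {n : ℤ} (hn : Even n) (D : GaussData ((-1) ^ n) (bEven n) (bOdd n)) :
    D.ψ = homog logOneAdd := by
  refine psi_eq D constantCoeff_logOneAdd ?_
  rw [two_smul, expSeries_add (Commute.refl _) constantCoeff_logOneAdd constantCoeff_logOneAdd,
    expSeries_logOneAdd, bEven, bOdd, if_pos hn, if_pos hn]
  simp only [Gauss.d0, Gauss.d1, map_add, map_mul, map_one, map_sub, map_pow, map_zero, toQ_X,
    toQ_uvar, homog_X, show toQ 2 = 2 from map_ofNat _ _]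
  ring

theorem psi_odd {n : ℤ} (hn : Odd n) (D : GaussData ((-1) ^ n) (bEven n) (bOdd n)) {ψ : PowerSeries ℚ}
    (h0 : constantCoeff ψ = 0)
    (hψ : expSeries ((2 : ℚ) • ψ) = 1 + 2 * PowerSeries.X - PowerSeries.X ^ 2) : D.ψ = homog ψ := by
  refine psi_eq D h0 ?_
  rw [hψ, bEven, bOdd, if_neg (Int.not_even_iff_odd.2 hn), if_neg (Int.not_even_iff_odd.2 hn)]
  simp only [Gauss.d0, Gauss.d1, map_add, map_mul, map_one, map_sub, map_pow, map_zero, toQ_X,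
    toQ_uvar, homog_X, show toQ 2 = 2 from map_ofNat _ _, show homog (2 : PowerSeries ℚ) = 2 from map_ofNat _ _]
  ring

/-- The sign y is 1 when 4 divides N; otherwise N ≡ 2 modulo 4 and y = -1. -/
theorem eps_even_mul {N : ℕ} (hN : Even N) : ∃ y : ℤ, ∀ k, eps (N * k) = -(y : ℚ) ^ k := by
  obtain ⟨m, rfl⟩ := hN
  by_cases h4 : 4 ∣ m + m
  · refine ⟨1, fun k => ?_⟩
    rw [eps, if_pos (h4.mul_right k)]; simp
  · refine ⟨-1, fun k => ?_⟩
    rcases Nat.even_or_odd k with hk | hk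
    · obtain ⟨l, rfl⟩ := hk
      rw [eps, if_pos ⟨m * l, by ring⟩]; simp
    · rw [eps, if_neg]
      · push_cast; rw [hk.neg_one_pow]; norm_num
      · obtain ⟨l, rfl⟩ := hk
        intro h
        apply h4
        rw [mul_add, mul_one, Nat.dvd_add_right ⟨m * l, by ring⟩] at h
        exact h

theorem eps_odd_mul {N : ℕ} (hN : Odd N) (k : ℕ) : eps (N * k) = eps k := by
  have : Nat.Coprime 4 N := by
    rw [show 4 = 2 ^ 2 from rfl]
    exact Nat.Coprime.pow_left 2 (Nat.coprime_two_left.2 hN)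
  simp only [eps, this.dvd_mul_left]

/-- For even N the series is 1/(1 + yw) with y = ±1. -/
theorem expSeries_eps_logOneAdd_mem {N : ℕ} (hN : Even N) :
    expSeries (PowerSeries.mk fun k => eps (N * k) * coeff k logOneAdd) ∈ intSeries := by
  obtain ⟨y, hy⟩ := eps_even_mul hN
  refine intSeries_of_mul_eq_one (f := 1 + PowerSeries.C (y : ℚ) * PowerSeries.X)
    ⟨1 + PowerSeries.C y * PowerSeries.X, by simp⟩ (by simp) ?_
  have h1 : expSeries (PowerSeries.mk fun k => eps (N * k) * coeff k logOneAdd) =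
      hatSeries fun r => -(y : ℚ) ^ r := by
    rw [hatSeries]
    congr 1
    ext1 r
    rw [coeff_mk, coeff_mk, logOneAdd, coeff_mk, hy]
    split_ifs
    · rw [mul_zero]
    · simp only [smul_eq_mul, one_pow]; ring
  rw [h1, ← hatSeries_pow, ← hatSeries_add]
  simp only [add_neg_cancel]
  exact hatSeries_zero

/-- Three cases. For n = 0 the factor is (1 + ut)^(h_0 + rc), with binomials as coefficients. For n
≠ 0 the criterion `coeff_exp_h_mem` applies, with σ the sign of n and N its absolute value: ψ =
log(1 + w) for n even and ψ = ½ log(1 + 2w - w²) for n odd. In the odd case multiplication by N does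
not affect the signs ε. -/
theorem diag_mem (r n : ℤ) (D : GaussData ((-1) ^ n) (bEven n) (bOdd n)) :
    D.diag (loop r n) ∈ rees (Filt.const UZcartan.toSubring) := by
  rcases eq_or_ne n 0 with rfl | hn
  · have hψ := psi_even (by simp) D
    have h1 : (loop r 0).H = fun _ => h 0 + (r : ℚ) • c := by
      ext k; simp [loop]
    rw [GaussData.diag, h1]
    refine expSeries_lin_const_mem (fun k => ?_) D.cψ (E := homog (1 + PowerSeries.X)) ?_
    · have := binom_mem_UZzero 1 r k
      rw [one_smul, ← Int.cast_smul_eq_zsmul ℚ] at this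
      exact UZzero_le_cartan this
    · rw [hψ, ← homog_expSeries, expSeries_logOneAdd, toQ_homog]
      congr 1
      simp
  obtain ⟨σ, hσ⟩ : ∃ σ : ℤˣ, n = σ * (n.natAbs : ℤ) := by
    rcases Int.natAbs_eq n with h | h
    · exact ⟨1, by rw [Units.val_one, one_mul]; exact h⟩
    · exact ⟨-1, by rw [Units.val_neg, Units.val_one, neg_one_mul]; exact h⟩
  have hN : n.natAbs ≠ 0 := Int.natAbs_ne_zero.2 hn
  have key : ∀ ψ : PowerSeries ℚ, D.ψ = homog ψ → constantCoeff ψ = 0 →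
      expSeries (PowerSeries.mk fun k => eps (n.natAbs * k) * coeff k ψ) ∈ intSeries →
      D.diag (loop r n) ∈ rees (Filt.const UZcartan.toSubring) := by
    intro ψ hψ h0 hint
    rw [diag_eq D _ hψ]
    refine homog_mem_rees fun l => UZim_le_cartan σ ?_
    have := coeff_exp_h_mem σ hN h0 hint l
    convert this using 4
    ext1 k
    rcases eq_or_ne k 0 with rfl | hk
    · rw [coeff_zero_eq_constantCoeff_apply, h0, zero_smul, zero_smul]
    · have : (loop r n).H k = h (n * k) + (if n * (k : ℤ) = 0 then (r : ℚ) else 0) • c := rfl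
      rw [this, if_neg (mul_ne_zero hn (by exact_mod_cast hk)), zero_smul, add_zero]
      congr 2
      conv_lhs => rw [hσ]
      push_cast
      ring
  rcases Int.even_or_odd n with he | ho
  · exact key _ (psi_even he D) constantCoeff_logOneAdd (expSeries_eps_logOneAdd_mem (Int.natAbs_even.2 he))
  · obtain ⟨χ, hχ0, hχ⟩ := exists_log (E := 1 + 2 * PowerSeries.X - PowerSeries.X ^ 2) (by simp)
    have h0 : constantCoeff ((2⁻¹ : ℚ) • χ) = 0 := by simp [hχ0]
    have hψ : expSeries ((2 : ℚ) • (2⁻¹ : ℚ) • χ) = 1 + 2 * PowerSeries.X - PowerSeries.X ^ 2 := by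
      rw [smul_smul]; simpa using hχ
    refine key _ (psi_odd ho D h0 hψ) h0 ?_
    simp only [eps_odd_mul (Int.natAbs_odd.2 ho)]
    exact expSeries_eps_mem_intSeries h0 hψ

/-! ### The Cartan part against the half algebras -/

section SeriesDivPow

variable {R : Type*} [Ring R] [Algebra ℚ R]

theorem expSeries_nsmul {A : PowerSeries R} (hA : constantCoeff A = 0) (n : ℕ) :
    expSeries (n • A) = expSeries A ^ n := by
  induction n with
  | zero =>
    rw [zero_smul, pow_zero, expSeries_zero]
  | succ n ih =>
    rw [succ_nsmul, expSeries_add ((Commute.refl A).smul_left n) (by rw [map_nsmul, hA, smul_zero]) hA, ih,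
      pow_succ]

theorem divPow_monomial (j : ℕ) (a : R) (k : ℕ) :
    divPow (PowerSeries.monomial j a) k = PowerSeries.monomial (j * k) (divPow a k) := by
  rw [divPow, monomial_pow_ring, divPow]
  ext1 n
  rw [coeff_smul, coeff_monomial, coeff_monomial]
  split_ifs
  · rfl
  · rw [smul_zero]

theorem coeff_divPow_sum_mem {F : Filt R} {w : ℕ} {a : ℕ → R} (hc : ∀ i j, Commute (a i) (a j))
    (h : ∀ j k, divPow (a j) k ∈ F.carrier (w * k)) (N k m : ℕ) :
    coeff m (divPow (∑ j ∈ range N, PowerSeries.monomial j (a j)) k) ∈ F.carrier (w * k) := by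
  have hcm : ∀ i j, Commute (PowerSeries.monomial i (a i)) (PowerSeries.monomial j (a j)) := fun i j => by
    rw [Commute, SemiconjBy, PowerSeries.monomial_mul_monomial, PowerSeries.monomial_mul_monomial,
      (hc i j).eq, add_comm]
  induction N generalizing k m with
  | zero =>
    rw [sum_range_zero]
    rcases k with _ | k
    · rw [divPow, pow_zero]
      simp only [Nat.factorial_zero, Nat.cast_one, inv_one, one_smul, coeff_one]
      split_ifs
      · exact F.mono (Nat.zero_le _) F.one_mem
      · exact zero_mem _
    · rw [divPow_zero_left, map_zero]; exact zero_mem _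
  | succ N ih =>
    rw [sum_range_succ, divPow_add (Commute.sum_left _ _ _ fun i _ => hcm i N), map_sum]
    refine sum_mem fun p hp => ?_
    rw [coeff_mul]
    refine sum_mem fun q _ => ?_
    rw [← HasAntidiagonal.mem_antidiagonal.1 hp, mul_add]
    refine F.mul_mem (ih _ _) ?_
    rw [divPow_monomial, coeff_monomial]
    split_ifs
    · exact h _ _
    · exact zero_mem _

theorem coeff_divPow_mem {F : Filt R} {w : ℕ} {a : PowerSeries R}
    (hc : ∀ i j, Commute (coeff i a) (coeff j a))
    (h : ∀ j k, divPow (coeff j a) k ∈ F.carrier (w * k)) (k m : ℕ) :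
    coeff m (divPow a k) ∈ F.carrier (w * k) := by
  have := coeff_divPow_sum_mem hc h (m + 1) k m
  have he : coeff m (divPow a k) =
      coeff m (divPow (∑ j ∈ range (m + 1), PowerSeries.monomial j (coeff j a)) k) := by
    rw [divPow, divPow, coeff_smul, coeff_smul]
    congr 1
    refine coeff_pow_congr (fun i hi => ?_) k m le_rfl
    rw [map_sum, sum_eq_single i]
    · rw [coeff_monomial_same]
    · intro j _ hj; rw [coeff_monomial, if_neg (Ne.symm hj)]
    · intro hn; exact absurd (mem_range.2 (by omega)) hn
  rwa [he]

/-- Divided powers of a sum of two series whose commutator is even and central. -/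
theorem coeff_divPow_add_mem {F : Filt R} {a b z : PowerSeries R} (h : b * a = a * b + (2 : ℕ) • z)
    (haz : Commute a z) (hbz : Commute b z) (ha : ∀ k m, coeff m (divPow a k) ∈ F.carrier k)
    (hb : ∀ k m, coeff m (divPow b k) ∈ F.carrier k)
    (hz : ∀ k m, coeff m (divPow z k) ∈ F.carrier (2 * k)) (k m : ℕ) :
    coeff m (divPow (a + b) k) ∈ F.carrier k := by
  -- The divided powers of a + b are the coefficients of one exponential, which factors into those
  -- of a, b and z. The variable enters z through its square, matching the doubled step of the
  -- filtration.
  rw [← coeff_expSeries_X_mul_C, expSeries_X_mul_C_add h haz hbz, coeff_mul, map_sum]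
  refine sum_mem fun p hp => ?_
  have hz' : ∀ n m, coeff m (coeff n (expSeries (PowerSeries.X ^ 2 * PowerSeries.C z))) ∈
      F.carrier n := by
    intro n m
    rw [coeff_expSeries (N := n + 1) (by simp) n.lt_succ_self, map_sum]
    refine sum_mem fun i _ => ?_
    have : (PowerSeries.X ^ 2 * PowerSeries.C z) ^ i = PowerSeries.C (z ^ i) * PowerSeries.X ^ (2 * i) := by
      rw [((PowerSeries.commute_X _).symm.pow_left 2 : Commute (PowerSeries.X ^ 2) (PowerSeries.C z)).mul_pow,
        ← pow_mul, ← map_pow]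
      exact (((PowerSeries.commute_X _).symm.pow_left (2 * i) : Commute (PowerSeries.X ^ (2 * i)) (PowerSeries.C (z ^ i)))).eq
    rw [this, coeff_C_mul, coeff_X_pow]
    split_ifs with hn
    · rw [hn, mul_one]; exact hz i m
    · rw [mul_zero, smul_zero, map_zero]; exact zero_mem _
  rw [coeff_mul]
  refine sum_mem fun s _ => ?_
  rw [← HasAntidiagonal.mem_antidiagonal.1 hp]
  refine F.mul_mem ?_ (hz' _ _)
  rw [coeff_mul, map_sum]
  refine sum_mem fun q hq => ?_
  rw [coeff_expSeries_X_mul_C, coeff_expSeries_X_mul_C, coeff_mul]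
  refine sum_mem fun s _ => ?_
  rw [← HasAntidiagonal.mem_antidiagonal.1 hq]
  exact F.mul_mem (ha _ _) (hb _ _)

end SeriesDivPow

/-! The coefficients of the conjugation by `∑ h̃_k u ^ k`. -/

/-- The logarithm of the conjugation series. -/
def kap (σ : ℤˣ) : PowerSeries ℚ :=
  PowerSeries.mk fun j => sgn σ * (hatCoeff j * (4 - 2 * (-1) ^ j))

theorem kap_neg (σ : ℤˣ) : kap (-σ) = -kap σ := by
  ext j
  rw [map_neg, kap, kap, coeff_mk, coeff_mk]
  simp [sgn]

theorem coeff_logOneAdd {r : ℕ} (hr : r ≠ 0) : coeff r logOneAdd = (-1) ^ (r - 1) / r := by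
  rw [logOneAdd, coeff_mk, if_neg hr]; simp

/-- In exponential form: exp(kap) = (1 + σw)⁶ (1 - w²)⁻³ (1 + w²)^(-σ). -/
theorem kap_eq (σ : ℤˣ) : kap σ = 6 • rescale (sgn σ) logOneAdd +
    (3 • -expand 2 two_ne_zero (rescale (-1) logOneAdd) -
      sgn σ • expand 2 two_ne_zero logOneAdd) := by
  have hσ : sgn σ * sgn σ = 1 := by
    rcases Int.units_eq_one_or σ with rfl | rfl <;> simp [sgn]
  ext j
  rw [kap, coeff_mk]
  simp only [map_add, map_sub, map_neg, map_nsmul, coeff_smul, coeff_rescale, coeff_expand]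
  rcases eq_or_ne j 0 with rfl | hj
  · simp [hatCoeff, constantCoeff_logOneAdd]
  have hj' : (j : ℚ) ≠ 0 := by exact_mod_cast hj
  rw [hatCoeff, if_neg hj, coeff_logOneAdd hj]
  rcases Nat.even_or_odd' j with ⟨m, rfl | rfl⟩
  · have hm : m ≠ 0 := by omega
    have hm' : (m : ℚ) ≠ 0 := by exact_mod_cast hm
    obtain ⟨n, rfl⟩ := Nat.exists_eq_succ_of_ne_zero hm
    have heps : eps (2 * n.succ) = (-1) ^ n := by
      rw [eps]
      rcases Nat.even_or_odd' n with ⟨l, rfl | rfl⟩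
      · rw [if_neg (by omega)]; simp
      · rw [if_pos (by omega)]; simp [pow_succ]
    rw [if_pos (dvd_mul_right 2 _), if_pos (dvd_mul_right 2 _), Nat.mul_div_cancel_left _ two_pos,
      coeff_logOneAdd hm, heps, pow_mul (sgn σ), pow_two (sgn σ), hσ, show 2 * n.succ - 1 = 2 * n + 1 by omega]
    simp only [Nat.succ_eq_add_one, Nat.add_sub_cancel, pow_succ, pow_mul] at hm' ⊢
    have h1 : (-1 : ℚ) ^ n * (-1) ^ n = 1 := by rw [← mul_pow]; norm_num
    push_cast at hm' ⊢
    norm_num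
    field_simp
    linear_combination (-6) * h1
  · have heps : eps (2 * m + 1) = 1 := by rw [eps, if_neg (by omega)]
    rw [if_neg (by omega), if_neg (by omega), heps, Nat.add_sub_cancel, pow_succ (sgn σ), pow_mul (sgn σ),
      pow_two (sgn σ), hσ, one_pow]
    simp only [pow_succ, pow_mul]
    norm_num
    ring

/-- The last two factors of exp(kap) = (1 + σw)⁶ (1 - w²)⁻³ (1 + w²)^(-σ) are integral and even in
w. The odd-degree coefficients thus come from the odd part of (1 + σw)⁶, whose coefficients ±6, ±20,
±6 are even. This divisibility by 2 will cancel the ½ in the Baker–Campbell–Hausdorff formula. -/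
theorem exists_theta (σ : ℤˣ) : ∃ Θ : PowerSeries ℤ, (∀ j, Odd j → (2 : ℤ) ∣ coeff j Θ) ∧
    PowerSeries.map (Int.castRingHom ℚ) Θ = expSeries (kap σ) := by
  have hL := constantCoeff_logOneAdd
  have hL' : constantCoeff (rescale (-1) logOneAdd) = 0 := by rw [constantCoeff_rescale_eq, hL]
  have hLE' : expSeries (rescale (-1) logOneAdd) = 1 - PowerSeries.X := by
    rw [← rescale_expSeries, expSeries_logOneAdd, map_add, map_one, rescale_X_eq]; simp [sub_eq_add_neg]
  obtain ⟨H1, hH1⟩ : expSeries (3 • -(rescale (-1) logOneAdd)) ∈ intSeries := by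
    rw [expSeries_nsmul (by simp [hL'])]
    refine pow_mem (intSeries_of_mul_eq_one (f := 1 - PowerSeries.X) ⟨1 - PowerSeries.X, by simp⟩ (by simp) ?_) _
    rw [← hLE', expSeries_mul_expSeries_neg hL']
  obtain ⟨H2, hH2⟩ : expSeries (-(sgn σ • logOneAdd)) ∈ intSeries := by
    rcases Int.units_eq_one_or σ with rfl | rfl
    · refine intSeries_of_mul_eq_one (f := 1 + PowerSeries.X) ⟨1 + PowerSeries.X, by simp⟩ (by simp) ?_
      rw [← expSeries_logOneAdd, sgn, Units.val_one, Int.cast_one, one_smul, expSeries_mul_expSeries_neg hL]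
    · refine ⟨1 + PowerSeries.X, ?_⟩
      simp [sgn, expSeries_logOneAdd]
  let s : PowerSeries ℤ := PowerSeries.C (σ : ℤ)
  let H := expand 2 two_ne_zero (H1 * H2)
  have hs : s * s = 1 := by
    rw [← map_mul, ← Units.val_mul, Int.units_mul_self]; simp
  refine ⟨(1 + s * PowerSeries.X) ^ 6 * H, fun j hj => ?_, ?_⟩
  · have h6 : (1 + s * PowerSeries.X) ^ 6 * H =
        expand 2 two_ne_zero ((1 + 15 * PowerSeries.X + 15 * PowerSeries.X ^ 2 + PowerSeries.X ^ 3) * (H1 * H2)) +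
        2 * (s * PowerSeries.X * (3 + 10 * PowerSeries.X ^ 2 + 3 * PowerSeries.X ^ 4) * H) := by
      have e15 : expand 2 two_ne_zero (15 : PowerSeries ℤ) = 15 := map_ofNat _ _
      simp only [map_mul _ _ (H1 * H2), map_add, map_pow, map_one, map_mul _ (15 : PowerSeries ℤ), e15, expand_X, H]
      generalize (expand 2 two_ne_zero (H1 * H2)) = K
      linear_combination (K * (15 * PowerSeries.X ^ 2 + 20 * s * PowerSeries.X ^ 3 +
        15 * (s * s + 1) * PowerSeries.X ^ 4 + 6 * s * (s * s + 1) * PowerSeries.X ^ 5 +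
        ((s * s) ^ 2 + s * s + 1) * PowerSeries.X ^ 6)) * hs
    rw [h6, map_add, coeff_expand, if_neg (by rcases hj with ⟨l, rfl⟩; omega), zero_add,
      show (2 : PowerSeries ℤ) = PowerSeries.C 2 from (map_ofNat _ 2).symm, coeff_C_mul]
    exact dvd_mul_right _ _
  · have hm : PowerSeries.map (Int.castRingHom ℚ) H =
        expand 2 two_ne_zero (expSeries (3 • -(rescale (-1) logOneAdd)) * expSeries (-(sgn σ • logOneAdd))) := by
      rw [← hH1, ← hH2, ← map_mul]
      ext1 k
      rw [coeff_map, coeff_expand, coeff_expand]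
      split_ifs
      · rw [coeff_map]
      · simp
    have h0 : constantCoeff (rescale (sgn σ) logOneAdd) = 0 := by rw [constantCoeff_rescale_eq, hL]
    rw [kap_eq, expSeries_add (Commute.all _ _) (by simp [h0]) (by simp [hL, hL']), expSeries_nsmul h0, ← rescale_expSeries,
      expSeries_logOneAdd, map_mul, hm, ← expSeries_add (Commute.all _ _) (by simp [hL']) (by simp [hL]),
      expand_expSeries _ _ (by simp [hL, hL'])]
    congr 1
    · simp [s, sgn]
    · congr 1
      rw [map_add, map_nsmul, map_neg, map_neg, sub_eq_add_neg]
      congr 2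
      ext k
      simp only [coeff_expand, coeff_smul]
      split_ifs <;> simp

/-- The series `∑ f_j x_{r + τ j} t ^ j`. -/
def shift (σ τ : ℤˣ) (r : ℤ) (f : PowerSeries ℚ) : PowerSeries U :=
  PowerSeries.mk fun j => coeff j f • x σ (r + τ * j)

theorem hatLog_mul_shift (σ τ : ℤˣ) (r : ℤ) (f : PowerSeries ℚ) :
    hatLog τ * shift σ τ r f = shift σ τ r f * hatLog τ + shift σ τ r (kap σ * f) := by
  ext1 m
  rw [map_add, coeff_mul, coeff_mul, ← Finset.Nat.sum_antidiagonal_swap (n := m) (f := fun p =>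
    coeff p.1 (shift σ τ r f) * coeff p.2 (hatLog τ)), show coeff m (shift σ τ r (kap σ * f)) =
      coeff m (kap σ * f) • x σ (r + τ * m) from coeff_mk _ _, coeff_mul, sum_smul, ← sum_add_distrib]
  refine sum_congr rfl fun p hp => ?_
  simp only [Prod.fst_swap, Prod.snd_swap, shift, coeff_mk, hatLog, kap]
  rw [smul_mul_smul_comm, smul_mul_smul_comm, h_mul_x, smul_add, mul_comm (coeff p.2 f), smul_smul,
    two_mul_two_add, ← HasAntidiagonal.mem_antidiagonal.1 hp]
  congr 2
  · have : (-1 : ℚ) ^ ((τ : ℤ) * p.1) = (-1) ^ p.1 := by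
      rw [zpow_mul, zpow_natCast]
      congr 1
      rcases Int.units_eq_one_or τ with rfl | rfl <;> simp
    rw [this]; ring
  · congr 1; push_cast; ring

theorem shift_one (σ τ : ℤˣ) (r : ℤ) : shift σ τ r 1 = PowerSeries.C (x σ r) := by
  ext1 j
  rw [shift, coeff_mk, coeff_one, coeff_C]
  split_ifs with h
  · simp [h]
  · simp

theorem ssum_shift (σ τ : ℤˣ) (r : ℤ) (g : PowerSeries ℚ) :
    (ssum fun n => ((n ! : ℚ)⁻¹) • shift σ τ r (g ^ n)) = shift σ τ r (expSeries g) := by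
  ext1 m
  rw [ssum, coeff_mk, shift, coeff_mk, expSeries, coeff_mk, sum_smul]
  refine sum_congr rfl fun n _ => ?_
  rw [coeff_smul, shift, coeff_mk, smul_smul, smul_eq_mul]

/-- Commutation with the logarithm of the h̃ series multiplies the coefficient series of a shift by
a fixed series, so iterated commutators are powers of that series and sum to its exponential. -/
theorem shift_mul_expSeries (σ τ : ℤˣ) (r : ℤ) : PowerSeries.C (x σ r) * hatSeries (epsH τ) =
    hatSeries (epsH τ) * shift σ τ r (expSeries (kap (-σ))) := by
  have hE : hatSeries (epsH τ) = expSeries (hatLog τ) := hatSeries_epsH τ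
  have hneg : ∀ f, shift σ τ r (-f) = -shift σ τ r f := fun f => by
    ext1 j; simp [shift]
  rw [hE, ← shift_one σ τ r, ← pow_zero (kap (-σ)), ← ssum_shift]
  refine mul_expSeries_of_chain (constantCoeff_hatLog' τ) (Y := fun n => shift σ τ r (kap (-σ) ^ n))
    fun n => ?_
  rw [hatLog_mul_shift, pow_succ', kap_neg, neg_mul (kap σ), hneg, add_neg_cancel_right]

theorem expSeries_mul_shift (σ τ : ℤˣ) (r : ℤ) : hatSeries (epsH τ) * PowerSeries.C (x σ r) =
    shift σ τ r (expSeries (kap σ)) * hatSeries (epsH τ) := by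
  have hE : hatSeries (epsH τ) = expSeries (hatLog τ) := hatSeries_epsH τ
  have h0 := constantCoeff_hatLog' τ
  have key : PowerSeries.C (x σ r) * expSeries (-hatLog τ) =
      expSeries (-hatLog τ) * shift σ τ r (expSeries (kap σ)) := by
    rw [← shift_one σ τ r, ← pow_zero (kap σ), ← ssum_shift]
    refine mul_expSeries_of_chain (by rw [map_neg, h0, neg_zero]) (Y := fun n => shift σ τ r (kap σ ^ n))
      fun n => ?_
    rw [neg_mul, mul_neg, hatLog_mul_shift, pow_succ', neg_add, neg_add_cancel_right]
  rw [hE]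
  calc expSeries (hatLog τ) * PowerSeries.C (x σ r)
      = expSeries (hatLog τ) * (PowerSeries.C (x σ r) * expSeries (-hatLog τ)) * expSeries (hatLog τ) := by
        rw [mul_assoc, mul_assoc (PowerSeries.C (x σ r)), expSeries_neg_mul_expSeries h0, mul_one]
    _ = _ := by
        rw [key, ← mul_assoc, expSeries_mul_expSeries_neg h0, one_mul]

/-- The series splits as a + b into its terms of even and of odd shift. Within each part the
elements commute, so divided powers are harmless. The bracket of the parts is 2z with z an integral
combination of X's, because the odd coefficients of Θ are even; hence the exponential of a + b
factors as that of a, of b and of z without denominators. -/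
theorem coeff_divPow_shift_mem (σ ω τ : ℤˣ) (r : ℤ) (k m : ℕ) :
    coeff m (divPow (shift σ τ r (expSeries (kap ω))) k) ∈ (heightFilt σ).carrier k := by
  obtain ⟨Θ, hΘ, hmap⟩ := exists_theta ω
  have hco : ∀ j, coeff j (shift σ τ r (expSeries (kap ω))) = coeff j Θ • x σ (r + τ * j) := fun j => by
    rw [shift, coeff_mk, ← hmap, coeff_map, eq_intCast, Int.cast_smul_eq_zsmul]
  let a : PowerSeries U := PowerSeries.mk fun j => (if Even j then coeff j Θ else 0) • x σ (r + τ * j)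
  let b : PowerSeries U := PowerSeries.mk fun j => (if Even j then 0 else coeff j Θ) • x σ (r + τ * j)
  have hab : shift σ τ r (expSeries (kap ω)) = a + b := by
    ext1 j
    rw [hco, map_add, coeff_mk, coeff_mk]
    split_ifs <;> simp
  have hτ : ∀ j : ℕ, Even ((τ : ℤ) * j) ↔ Even j := fun j => by
    rcases Int.units_eq_one_or τ with rfl | rfl <;> simp
  have hcomm : ∀ i j : ℕ, (Even i ↔ Even j) → ∀ y z : ℤ,
      Commute (y • x σ (r + τ * i)) (z • x σ (r + τ * j)) := by
    intro i j hij y z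
    refine ((x_commute_x σ ?_).smul_left y).smul_right z
    have : Even ((τ : ℤ) * i + τ * j) := by rw [Int.even_add, hτ, hτ, hij]
    obtain ⟨w, hw⟩ := this
    exact ⟨r + w, by linear_combination hw⟩
  have hx : ∀ (y : ℤ) (i : ℤ) k, divPow (y • x σ i) k ∈ (heightFilt σ).carrier k := fun y i k => by
    rw [divPow_smul_int]; exact zsmul_mem (divPow_x_mem_heightFilt σ _ _) _
  have ha : ∀ k m, coeff m (divPow a k) ∈ (heightFilt σ).carrier k := fun k m => by
    have := coeff_divPow_mem (F := heightFilt σ) (w := 1) (a := a) (fun i j => by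
      simp only [a, coeff_mk]
      by_cases hi : Even i <;> by_cases hj : Even j <;> simp only [hi, hj, if_true, if_false, zero_smul,
        Commute.zero_left, Commute.zero_right]
      exact hcomm i j (by simp [hi, hj]) _ _) (fun j k => by
      rw [one_mul, coeff_mk]; exact hx _ _ _) k m
    rwa [one_mul] at this
  have hb : ∀ k m, coeff m (divPow b k) ∈ (heightFilt σ).carrier k := fun k m => by
    have := coeff_divPow_mem (F := heightFilt σ) (w := 1) (a := b) (fun i j => by
      simp only [b, coeff_mk]
      by_cases hi : Even i <;> by_cases hj : Even j <;> simp only [hi, hj, if_true, if_false, zero_smul,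
        Commute.zero_left, Commute.zero_right]
      exact hcomm i j (by simp [hi, hj]) _ _) (fun j k => by
      rw [one_mul, coeff_mk]; exact hx _ _ _) k m
    rwa [one_mul] at this
  have hz : ∀ m, ∃ n : ℤ, coeff m (b * a - a * b) = n • (2 : ℤ) • Xo σ (2 * r + τ * m) := by
    intro m
    suffices h : coeff m (b * a - a * b) ∈ AddSubgroup.zmultiples ((2 : ℤ) • Xo σ (2 * r + τ * m)) by
      obtain ⟨n, hn⟩ := h
      exact ⟨n, hn.symm⟩
    rw [map_sub, coeff_mul, coeff_mul, ← Finset.Nat.sum_antidiagonal_swap (n := m) (f := fun p =>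
      coeff p.1 a * coeff p.2 b), ← sum_sub_distrib]
    refine sum_mem fun p hp => ?_
    simp only [Prod.fst_swap, Prod.snd_swap, a, b, coeff_mk]
    by_cases hi : Even p.1
    · simp [hi]
    obtain ⟨q, hq⟩ := hΘ p.1 (Nat.not_even_iff_odd.1 hi)
    rw [if_neg hi, hq, smul_mul_smul_comm, smul_mul_smul_comm, x_mul_x,
      show r + τ * p.1 + (r + τ * p.2) = 2 * r + τ * m by
        rw [← HasAntidiagonal.mem_antidiagonal.1 hp]; push_cast; ring,
      show sgn σ * (-1 : ℚ) ^ (r + τ * p.2) = ((σ * (r + τ * p.2).negOnePow : ℤˣ) : ℤ) by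
        rw [Units.val_mul, Int.cast_mul, Int.cast_negOnePow], Int.cast_smul_eq_zsmul, smul_add,
      mul_comm (if Even p.2 then _ else _) (2 * q), add_sub_cancel_left, smul_smul]
    refine ⟨q * (if Even p.2 then coeff p.2 Θ else 0) * ((σ * (r + τ * p.2).negOnePow : ℤˣ) : ℤ), ?_⟩
    simp only [smul_smul]
    congr 1
    ring
  choose n hn using hz
  let z : PowerSeries U := PowerSeries.mk fun m => n m • Xo σ (2 * r + τ * m)
  have hba : b * a = a * b + (2 : ℕ) • z := by
    rw [← sub_eq_iff_eq_add']
    ext1 m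
    rw [hn, map_nsmul, coeff_mk, smul_comm, two_zsmul, two_nsmul]
  have hcz : ∀ f : PowerSeries U, (∀ i, ∃ (y : ℤ) (j : ℤ), coeff i f = y • x σ j) → Commute f z := by
    intro f hf
    ext1 m
    rw [coeff_mul, coeff_mul, ← Finset.Nat.sum_antidiagonal_swap (n := m) (f := fun p =>
      coeff p.1 f * coeff p.2 z)]
    refine sum_congr rfl fun p _ => ?_
    obtain ⟨y, j, hy⟩ := hf p.2
    simp only [Prod.fst_swap, Prod.snd_swap, hy, z, coeff_mk]
    rw [smul_mul_smul_comm, smul_mul_smul_comm, x_mul_Xo, mul_comm]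
  rw [hab]
  refine coeff_divPow_add_mem hba (hcz a fun i => ⟨_, _, coeff_mk _ _⟩) (hcz b fun i => ⟨_, _, coeff_mk _ _⟩)
    ha hb (fun k m => coeff_divPow_mem (fun i j => ?_) (fun j k => ?_) k m) k m
  · simp only [z, coeff_mk]
    exact Commute.smul_left (Commute.smul_right (Xo_mul_Xo σ _ _) _) _
  · simp only [z, coeff_mk]
    rw [divPow_smul_int]
    refine zsmul_mem ?_ _
    rcases Int.even_or_odd' (2 * r + τ * j) with ⟨w, hw | hw⟩
    · rw [Xo_even σ ⟨w, by rw [hw]; ring⟩]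
      rcases k with _ | k
      · simpa [divPow] using (heightFilt σ).one_mem
      · rw [divPow_zero_left]; exact zero_mem _
    · rw [hw, Xo_odd]; exact divPow_X_mem_heightFilt σ _ _

/-- The filtration of a half algebra by height, as `ℤ`-submodules. -/
def heightSub (σ : ℤˣ) (k : ℕ) : Submodule ℤ U := AddSubgroup.toIntSubmodule ((heightFilt σ).carrier k)

theorem mem_heightSub {σ : ℤˣ} {k : ℕ} {a : U} : a ∈ heightSub σ k ↔ a ∈ (heightFilt σ).carrier k :=
  Iff.rfl

theorem heightSub_mul_le (σ : ℤˣ) (i j : ℕ) : heightSub σ i * heightSub σ j ≤ heightSub σ (i + j) :=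
  Submodule.mul_le.2 fun _ ha _ hb => (heightFilt σ).mul_mem ha hb

theorem heightSub_mono (σ : ℤˣ) : Monotone (heightSub σ) := fun _ _ h _ ha => (heightFilt σ).mono h ha

theorem divPow_x_mem_heightSub (σ : ℤˣ) (r : ℤ) (k : ℕ) : divPow (x σ r) k ∈ heightSub σ k :=
  divPow_x_mem_heightFilt σ r k

theorem heightSub_le {σ : ℤˣ} {k : ℕ} {M : Submodule ℤ U}
    (h : ∀ m ≤ k, ∀ w, HeightWord σ m w → w ∈ M) : heightSub σ k ≤ M := by
  intro a ha
  rw [mem_heightSub] at ha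
  change a ∈ AddSubgroup.closure _ at ha
  induction ha using AddSubgroup.closure_induction with
  | mem a ha => obtain ⟨m, hm, ha⟩ := ha; exact h m hm a ha
  | zero => exact zero_mem _
  | add _ _ _ _ h h' => exact add_mem h h'
  | neg _ _ h => exact neg_mem h

theorem mul_heightSub_le {σ : ℤˣ} {V : Submodule ℤ U}
    (h : ∀ r k, ∀ v ∈ V, v * divPow (x σ r) k ∈ heightSub σ k * V) (k : ℕ) :
    V * heightSub σ k ≤ heightSub σ k * V := by
  have hw : ∀ m w, HeightWord σ m w → ∀ v ∈ V, v * w ∈ heightSub σ m * V := by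
    intro m w hw
    induction hw with
    | one =>
      intro v hv
      rw [mul_one, ← one_mul v]
      exact Submodule.mul_mem_mul (heightFilt σ).one_mem hv
    | mul r k _ ih =>
      intro v hv
      rw [← mul_assoc]
      refine Submodule.mul_induction_on (h r k v hv) (fun p hp v' hv' => ?_) (fun _ _ h h' => ?_)
      · rw [mul_assoc]
        have := Submodule.mul_mem_mul hp (ih v' hv')
        rw [← mul_assoc] at this
        exact mul_le_mul' (heightSub_mul_le σ _ _) le_rfl this
      · rw [add_mul]; exact add_mem h h'
  refine Submodule.mul_le.2 fun v hv p hp => ?_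
  have : heightSub σ k ≤ (heightSub σ k * V).comap (LinearMap.mulLeft ℤ v) :=
    heightSub_le fun m hm w hmw => mul_le_mul' (heightSub_mono σ hm) le_rfl (hw m w hmw v hv)
  exact this hp

theorem heightSub_mul_le_mul {σ : ℤˣ} {V : Submodule ℤ U}
    (h : ∀ r k, ∀ v ∈ V, divPow (x σ r) k * v ∈ V * heightSub σ k) (k : ℕ) :
    heightSub σ k * V ≤ V * heightSub σ k := by
  have hw : ∀ m w, HeightWord σ m w → ∀ v ∈ V, w * v ∈ V * heightSub σ m := by
    intro m w hw
    induction hw with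
    | one =>
      intro v hv
      rw [one_mul, ← mul_one v]
      exact Submodule.mul_mem_mul hv (heightFilt σ).one_mem
    | mul r k _ ih =>
      intro v hv
      rw [mul_assoc]
      refine Submodule.mul_induction_on (ih v hv) (fun v' hv' p hp => ?_) (fun _ _ h h' => ?_)
      · rw [← mul_assoc]
        have := Submodule.mul_mem_mul (h r k v' hv') hp
        rw [mul_assoc] at this
        exact mul_le_mul' le_rfl (heightSub_mul_le σ _ _) this
      · rw [mul_add]; exact add_mem h h'
  refine Submodule.mul_le.2 fun p hp v hv => ?_
  have : heightSub σ k ≤ (V * heightSub σ k).comap (LinearMap.mulRight ℤ v) :=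
    heightSub_le fun m hm w hmw => mul_le_mul' le_rfl (heightSub_mono σ hm) (hw m w hmw v hv)
  exact this hp

theorem hTilde_mul_divPow (σ τ : ℤˣ) (r : ℤ) (k l : ℕ) : hTilde τ l * divPow (x σ r) k ∈
    heightSub σ k * Submodule.span ℤ (Set.range (hTilde τ)) := by
  have h1 := divPow_conj (expSeries_mul_shift σ τ r).symm k
  have h2 := congrArg (coeff l) h1
  rw [← map_divPow, coeff_mul_C] at h2
  rw [hTilde, ← h2, coeff_mul]
  exact sum_mem fun p _ => Submodule.mul_mem_mul (coeff_divPow_shift_mem σ _ τ r k _)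
    (Submodule.subset_span ⟨p.2, rfl⟩)

theorem divPow_mul_hTilde (σ τ : ℤˣ) (r : ℤ) (k l : ℕ) : divPow (x σ r) k * hTilde τ l ∈
    Submodule.span ℤ (Set.range (hTilde τ)) * heightSub σ k := by
  have h1 := divPow_conj (shift_mul_expSeries σ τ r) k
  have h2 := congrArg (coeff l) h1
  rw [← map_divPow, coeff_C_mul] at h2
  rw [hTilde, h2, coeff_mul]
  exact sum_mem fun p _ => Submodule.mul_mem_mul (Submodule.subset_span ⟨p.1, rfl⟩)
    (coeff_divPow_shift_mem σ _ τ r k _)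

/-- Letters in `V` cross `F` and stay in `V`, so words cross `F` letter by letter. -/
theorem adjoin_mul_le {s : Set U} {V F : Submodule ℤ U} (hs : s ⊆ V)
    (hV : V ≤ Subalgebra.toSubmodule (Algebra.adjoin ℤ s)) (h : V * F ≤ F * V) :
    Subalgebra.toSubmodule (Algebra.adjoin ℤ s) * F ≤ F * Subalgebra.toSubmodule (Algebra.adjoin ℤ s) := by
  set S := Subalgebra.toSubmodule (Algebra.adjoin ℤ s) with hS
  have hSS : S * S = S := (Subalgebra.isIdempotentElem_toSubmodule _).eq
  have key : S ≤ ⨅ p : F, (F * S).comap (LinearMap.mulRight ℤ (p : U)) := by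
    refine adjoin_le_of_mul_mem ((Submodule.mem_iInf _).2 fun p => ?_) fun a ha b hb => ?_
    · have := Submodule.mul_mem_mul p.2 (show (1 : U) ∈ S from (Algebra.adjoin ℤ s).one_mem)
      simpa using this
    · rw [Submodule.mem_iInf] at hb ⊢
      intro p
      have h1 : a * (b * p) ∈ V * (F * S) := Submodule.mul_mem_mul (hs ha) (hb p)
      have h2 : V * (F * S) ≤ F * S := by
        rw [← mul_assoc]
        refine (mul_le_mul' h le_rfl).trans ?_
        exact (mul_assoc _ _ _).le.trans <| mul_le_mul' le_rfl ((mul_le_mul' hV le_rfl).trans hSS.le)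
      have := h2 h1
      rw [Submodule.mem_comap, LinearMap.mulRight_apply, mul_assoc]
      exact this
  exact Submodule.mul_le.2 fun a ha p hp => (Submodule.mem_iInf _).1 (key ha) ⟨p, hp⟩

/-- Here words must be extended on the right while the generation of the algebra extends them on the
left; commutativity of the generators reconciles the two. -/
theorem mul_adjoin_le {s : Set U} {V F : Submodule ℤ U} (hs : s ⊆ V)
    (hV : V ≤ Subalgebra.toSubmodule (Algebra.adjoin ℤ s)) (h : F * V ≤ V * F)
    (hc : ∀ a ∈ s, ∀ b ∈ s, Commute a b) :
    F * Subalgebra.toSubmodule (Algebra.adjoin ℤ s) ≤ Subalgebra.toSubmodule (Algebra.adjoin ℤ s) * F := by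
  set S := Subalgebra.toSubmodule (Algebra.adjoin ℤ s) with hS
  have hSS : S * S = S := (Subalgebra.isIdempotentElem_toSubmodule _).eq
  have key : S ≤ S ⊓ ⨅ p : F, (S * F).comap (LinearMap.mulLeft ℤ (p : U)) := by
    refine adjoin_le_of_mul_mem ⟨one_mem (Algebra.adjoin ℤ s), (Submodule.mem_iInf _).2 fun p => ?_⟩ ?_
    · have := Submodule.mul_mem_mul (show (1 : U) ∈ S from (Algebra.adjoin ℤ s).one_mem) p.2
      simpa using this
    · rintro a ha b ⟨hbS, hb⟩
      refine ⟨mul_mem (S := Subalgebra ℤ U) (Algebra.subset_adjoin ha) hbS, ?_⟩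
      rw [SetLike.mem_coe, Submodule.mem_iInf] at hb ⊢
      intro p
      have h1 : p * b * a ∈ S * F * V := Submodule.mul_mem_mul (hb p) (hs ha)
      have h2 : S * F * V ≤ S * F := by
        rw [mul_assoc]
        refine (mul_le_mul' le_rfl h).trans ?_
        exact (mul_assoc _ _ _).ge.trans <| mul_le_mul' ((mul_le_mul' le_rfl hV).trans hSS.le) le_rfl
      have := h2 h1
      rw [Submodule.mem_comap, LinearMap.mulLeft_apply,
        (commute_of_mem_adjoin hc (Algebra.subset_adjoin ha) hbS).eq, ← mul_assoc]
      exact this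
  exact Submodule.mul_le.2 fun p hp a ha => (Submodule.mem_iInf _).1 (key ha).2 ⟨p, hp⟩

theorem span_hTilde_le (τ : ℤˣ) : Submodule.span ℤ (Set.range (hTilde τ)) ≤
    Subalgebra.toSubmodule (UZim τ) :=
  Submodule.span_le.2 (by rintro _ ⟨l, rfl⟩; exact hTilde_mem τ l)

theorem im_mul_heightSub (σ τ : ℤˣ) (k : ℕ) : Subalgebra.toSubmodule (UZim τ) * heightSub σ k ≤
    heightSub σ k * Subalgebra.toSubmodule (UZim τ) := by
  refine adjoin_mul_le (V := Submodule.span ℤ (Set.range (hTilde τ))) ?_ (span_hTilde_le τ)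
    (mul_heightSub_le (fun r k v hv => ?_) k)
  · rintro _ ⟨l, _, rfl⟩; exact Submodule.subset_span ⟨l, rfl⟩
  · induction hv using Submodule.span_induction with
    | mem v hv => obtain ⟨l, rfl⟩ := hv; exact hTilde_mul_divPow σ τ r k l
    | zero => rw [zero_mul]; exact zero_mem _
    | add _ _ _ _ h h' => rw [add_mul]; exact add_mem h h'
    | smul n _ _ h => rw [smul_mul_assoc]; exact Submodule.smul_mem _ n h

theorem heightSub_mul_im (σ τ : ℤˣ) (k : ℕ) : heightSub σ k * Subalgebra.toSubmodule (UZim τ) ≤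
    Subalgebra.toSubmodule (UZim τ) * heightSub σ k := by
  refine mul_adjoin_le (V := Submodule.span ℤ (Set.range (hTilde τ))) ?_ (span_hTilde_le τ)
    (heightSub_mul_le_mul (fun r k v hv => ?_) k) ?_
  · rintro _ ⟨l, _, rfl⟩; exact Submodule.subset_span ⟨l, rfl⟩
  · induction hv using Submodule.span_induction with
    | mem v hv => obtain ⟨l, rfl⟩ := hv; exact divPow_mul_hTilde σ τ r k l
    | zero => rw [mul_zero]; exact zero_mem _
    | add _ _ _ _ h h' => rw [mul_add]; exact add_mem h h'
    | smul n _ _ h => rw [mul_smul_comm]; exact Submodule.smul_mem _ n h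
  · rintro _ ⟨k, _, rfl⟩ _ ⟨l, _, rfl⟩
    exact hTilde_commute τ k l

theorem binom_mul_of_mul_eq {R : Type*} [Ring R] [Algebra ℚ R] {a b y : R} (h : a * y = y * b) (k : ℕ) :
    binom a k * y = y * binom b k := by
  have : ∀ f : Polynomial ℚ, Polynomial.aeval a f * y = y * Polynomial.aeval b f := fun f => by
    induction f using Polynomial.induction_on' with
    | add f g hf hg => rw [map_add, map_add, add_mul, mul_add, hf, hg]
    | monomial n q =>
      have hp : ∀ n : ℕ, a ^ n * y = y * b ^ n := fun n => by
        induction n with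
        | zero => simp
        | succ n ih => rw [pow_succ, pow_succ, mul_assoc, h, ← mul_assoc, ih, mul_assoc]
      rw [Polynomial.aeval_monomial, Polynomial.aeval_monomial, ← Algebra.smul_def, ← Algebra.smul_def,
        smul_mul_assoc, mul_smul_comm, hp]
  rw [binom, binom, smul_mul_assoc, mul_smul_comm, this]

theorem binom_intCast {R : Type*} [Ring R] [Algebra ℚ R] (n : ℤ) (k : ℕ) :
    binom (n : R) k = (Ring.choose n k : ℤ) := by
  rw [binom_eq_aeval, ← map_intCast (algebraMap ℚ R) n, Polynomial.aeval_algebraMap_apply,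
    Polynomial.aeval_def, Algebra.algebraMap_self, Polynomial.eval₂_id, eval_choosePoly_int, map_intCast]

/-- The divided power is a weight vector for h_0, of weight 2σk, and commutes with c. Translation by
an integer preserves the algebra of binomials, which is why `UZzero` normalizes the half algebras.
-/
theorem exists_mul_divPow_x (σ : ℤˣ) (r : ℤ) (k : ℕ) {a : U} (ha : a ∈ Submodule.span ℤ {h 0, c}) :
    ∃ n : ℤ, a * divPow (x σ r) k = divPow (x σ r) k * (a + (n : U)) := by
  obtain ⟨i, j, rfl⟩ := Submodule.mem_span_pair.1 ha
  have h1 : h 0 * x σ r = x σ r * h 0 + (2 * σ : ℤ) • x σ r := by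
    rw [h_mul_x, two_mul_two_add, zero_add, ← Int.cast_smul_eq_zsmul ℚ]
    congr 2
    simp [sgn]; ring
  have h2 : ∀ k : ℕ, h 0 * x σ r ^ k = x σ r ^ k * h 0 + (2 * σ * k : ℤ) • x σ r ^ k := fun k => by
    induction k with
    | zero => simp
    | succ k ih =>
      rw [pow_succ, ← mul_assoc, ih, add_mul, mul_assoc, h1, mul_add, mul_smul_comm, smul_mul_assoc,
        add_assoc, ← add_smul, ← mul_assoc]
      congr 2
      push_cast; ring
  refine ⟨i * (2 * σ * k), ?_⟩
  rw [divPow, mul_smul_comm, smul_mul_assoc]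
  congr 1
  rw [add_mul, smul_mul_assoc, h2, smul_mul_assoc, ((show Commute c (x σ r) from c_commute_x σ r).pow_right k).eq,
    mul_add, mul_add, ← zsmul_eq_mul', smul_add, mul_smul_comm, mul_smul_comm, smul_smul, add_right_comm]

theorem binom_add_intCast_mem {a : U} (ha : a ∈ Submodule.span ℤ {h 0, c}) (n : ℤ) (l : ℕ) :
    binom (a + (n : U)) l ∈ UZzero := by
  rw [binom_add (Int.cast_commute n a).symm]
  refine sum_mem fun p _ => mul_mem (Algebra.subset_adjoin ⟨a, ha, _, rfl⟩) ?_
  rw [binom_intCast]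
  exact intCast_mem _ _

theorem zero_mul_divPow (σ : ℤˣ) (r : ℤ) (k : ℕ) {z : U} (hz : z ∈ UZzero) :
    ∃ w ∈ UZzero, z * divPow (x σ r) k = divPow (x σ r) k * w := by
  induction hz using Algebra.adjoin_induction with
  | mem z hz =>
    obtain ⟨a, ha, l, rfl⟩ := hz
    obtain ⟨n, hn⟩ := exists_mul_divPow_x σ r k ha
    exact ⟨_, binom_add_intCast_mem ha n l, binom_mul_of_mul_eq hn l⟩
  | algebraMap m => exact ⟨_, algebraMap_mem _ m, Algebra.commutes m _⟩
  | add _ _ _ _ h h' =>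
    obtain ⟨w, hw, e⟩ := h
    obtain ⟨w', hw', e'⟩ := h'
    exact ⟨w + w', add_mem hw hw', by rw [add_mul, mul_add, e, e']⟩
  | mul _ _ _ _ h h' =>
    obtain ⟨w, hw, e⟩ := h
    obtain ⟨w', hw', e'⟩ := h'
    exact ⟨w * w', mul_mem hw hw', by rw [mul_assoc, e', ← mul_assoc, e, mul_assoc]⟩

theorem divPow_mul_zero (σ : ℤˣ) (r : ℤ) (k : ℕ) {z : U} (hz : z ∈ UZzero) :
    ∃ w ∈ UZzero, divPow (x σ r) k * z = w * divPow (x σ r) k := by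
  induction hz using Algebra.adjoin_induction with
  | mem z hz =>
    obtain ⟨a, ha, l, rfl⟩ := hz
    obtain ⟨n, hn⟩ := exists_mul_divPow_x σ r k ha
    refine ⟨_, binom_add_intCast_mem ha (-n) l, (binom_mul_of_mul_eq (y := divPow (x σ r) k) ?_ l).symm⟩
    rw [add_mul, hn, mul_add, Int.cast_neg, neg_mul, (Int.cast_commute n _).eq, add_neg_cancel_right]
  | algebraMap m => exact ⟨_, algebraMap_mem _ m, (Algebra.commutes m _).symm⟩
  | add _ _ _ _ h h' =>
    obtain ⟨w, hw, e⟩ := h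
    obtain ⟨w', hw', e'⟩ := h'
    exact ⟨w + w', add_mem hw hw', by rw [add_mul, mul_add, e, e']⟩
  | mul _ _ _ _ h h' =>
    obtain ⟨w, hw, e⟩ := h
    obtain ⟨w', hw', e'⟩ := h'
    exact ⟨w * w', mul_mem hw hw', by rw [← mul_assoc, e, mul_assoc, e', mul_assoc]⟩

theorem zero_mul_heightSub (σ : ℤˣ) (k : ℕ) : Subalgebra.toSubmodule UZzero * heightSub σ k ≤
    heightSub σ k * Subalgebra.toSubmodule UZzero :=
  mul_heightSub_le (fun r k v hv => by
    obtain ⟨w, hw, e⟩ := zero_mul_divPow σ r k hv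
    rw [e]; exact Submodule.mul_mem_mul (divPow_x_mem_heightSub σ r k) hw) k

theorem heightSub_mul_zero (σ : ℤˣ) (k : ℕ) : heightSub σ k * Subalgebra.toSubmodule UZzero ≤
    Subalgebra.toSubmodule UZzero * heightSub σ k :=
  heightSub_mul_le_mul (fun r k v hv => by
    obtain ⟨w, hw, e⟩ := divPow_mul_zero σ r k hv
    rw [e]; exact Submodule.mul_mem_mul hw (divPow_x_mem_heightSub σ r k)) k

theorem cartan_mul_heightSub (σ : ℤˣ) (k : ℕ) : Subalgebra.toSubmodule UZcartan * heightSub σ k ≤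
    heightSub σ k * Subalgebra.toSubmodule UZcartan := by
  rw [toSubmodule_cartan, cartanProd]
  set F := heightSub σ k
  set I := Subalgebra.toSubmodule (UZim (-1))
  set Z := Subalgebra.toSubmodule UZzero
  set J := Subalgebra.toSubmodule (UZim 1)
  calc I * Z * J * F = I * Z * (J * F) := mul_assoc _ _ _
    _ ≤ I * Z * (F * J) := mul_le_mul' le_rfl (im_mul_heightSub σ 1 k)
    _ = I * (Z * F) * J := by simp only [mul_assoc]
    _ ≤ I * (F * Z) * J := mul_le_mul' (mul_le_mul' le_rfl (zero_mul_heightSub σ k)) le_rfl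
    _ = I * F * Z * J := by simp only [mul_assoc]
    _ ≤ F * I * Z * J := mul_le_mul' (mul_le_mul' (im_mul_heightSub σ (-1) k) le_rfl) le_rfl
    _ = F * (I * Z * J) := by simp only [mul_assoc]

theorem heightSub_mul_cartan (σ : ℤˣ) (k : ℕ) : heightSub σ k * Subalgebra.toSubmodule UZcartan ≤
    Subalgebra.toSubmodule UZcartan * heightSub σ k := by
  rw [toSubmodule_cartan, cartanProd]
  set F := heightSub σ k
  set I := Subalgebra.toSubmodule (UZim (-1))
  set Z := Subalgebra.toSubmodule UZzero
  set J := Subalgebra.toSubmodule (UZim 1)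
  calc F * (I * Z * J) = F * I * Z * J := by simp only [mul_assoc]
    _ ≤ I * F * Z * J := mul_le_mul' (mul_le_mul' (heightSub_mul_im σ (-1) k) le_rfl) le_rfl
    _ = I * (F * Z) * J := by simp only [mul_assoc]
    _ ≤ I * (Z * F) * J := mul_le_mul' (mul_le_mul' le_rfl (heightSub_mul_zero σ k)) le_rfl
    _ = I * Z * (F * J) := by simp only [mul_assoc]
    _ ≤ I * Z * (J * F) := mul_le_mul' le_rfl (heightSub_mul_im σ 1 k)
    _ = I * Z * J * F := by simp only [mul_assoc]

/-! ### The triangular decomposition -/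

theorem coeff_ne_zero_toQ {b : PowerSeries (Polynomial ℤ)} {k : ℕ} (h : coeff k b ≠ 0) :
    coeff k (toQ b) ≠ 0 := by
  rw [coeff_toQ]
  intro h0
  exact h (Polynomial.map_injective _ Int.cast_injective (by rw [h0, Polynomial.map_zero]))

namespace HalfLoop

variable {R : Type*} [Ring R] [Algebra ℚ R] {s : ℚ} (L : HalfLoop R s)

theorem f_commute {ω : ℚ} (hω : ω * ω = 1) {i j : ℕ} (hi : s ^ i = ω) (hj : s ^ j = ω) :
    Commute (L.f i) (L.f j) := by
  have := L.ff i j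
  rwa [L.F_eq_zero, smul_zero, sub_zero] at this
  rw [pow_add, hi, hj, hω]; norm_num

theorem e_commute {ω : ℚ} (hω : ω * ω = 1) {i j : ℕ} (hi : s ^ i = ω) (hj : s ^ j = ω) :
    Commute (L.e i) (L.e j) := by
  have := L.ee i j
  rwa [L.E_eq_zero, smul_zero, add_zero] at this
  rw [pow_add, hi, hj, hω]; norm_num

end HalfLoop

theorem divPow_normalized_Xo_mem {σ : ℤˣ} {F : AddSubgroup U} {k : ℕ}
    (h1 : ∀ m, divPow (X σ m) k ∈ F) (h0 : (1 : U) ∈ F) (r j : ℤ) : divPow ((-1 : ℚ) ^ r • Xo σ j) k ∈ F := by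
  rw [← Int.cast_negOnePow ℚ r, Int.cast_smul_eq_zsmul, divPow_unit_smul_mem_iff]
  rcases Int.even_or_odd' j with ⟨w, hw | hw⟩
  · rw [Xo_even σ ⟨w, by rw [hw]; ring⟩]
    rcases k with _ | k
    · simpa [divPow] using h0
    · rw [divPow_zero_left]; exact zero_mem _
  · rw [hw, Xo_odd]; exact h1 _

theorem expSeries_f_mem (r n : ℤ) {ω : ℚ} (hω : ω * ω = 1) {b : PowerSeries (Polynomial ℤ)}
    (h0 : constantCoeff b = 0) (hb : bar ((-1) ^ n) (toQ b) = ω • toQ b) :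
    expSeries (lin (loop r n).f (toQ b)) ∈ rees (Filt.const (UZhalf (-1)).toSubring) := by
  refine expSeries_lin_mem_rees (w := 0) h0 (fun k i hi => absurd hi (Nat.not_lt_zero i))
    (fun i j hi hj => ?_) fun k _ m => divPow_x_mem_half (-1) _ _
  exact (loop r n).f_commute hω (coeff_ne_zero_of_bar_eq hb i (coeff_ne_zero_toQ hi))
    (coeff_ne_zero_of_bar_eq hb j (coeff_ne_zero_toQ hj))

theorem expSeries_F_mem (r n : ℤ) {b : PowerSeries (Polynomial ℤ)} (h0 : constantCoeff b = 0) :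
    expSeries (lin (loop r n).F (toQ b)) ∈ rees (Filt.const (UZhalf (-1)).toSubring) := by
  refine expSeries_lin_mem_rees (w := 0) h0 (fun k i hi => absurd hi (Nat.not_lt_zero i))
    (fun i j _ _ => (loop r n).FF i j) fun k _ m => ?_
  exact divPow_normalized_Xo_mem (F := (UZhalf (-1)).toSubring.toAddSubgroup)
    (fun i => divPow_X_mem_half (-1) i m) (one_mem (UZhalf (-1))) r _

theorem expSeries_e_mem (r n : ℤ) {ω : ℚ} (hω : ω * ω = 1) {b : PowerSeries (Polynomial ℤ)}
    (h0 : constantCoeff b = 0) (hb : bar ((-1) ^ n) (toQ b) = ω • toQ b) (hd : ∃ a, b = uvar ℤ ^ 1 * a) :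
    expSeries (lin (loop r n).e (toQ b)) ∈ rees (heightFilt 1) := by
  obtain ⟨a, ha⟩ := hd
  refine expSeries_lin_mem_rees (w := 1) h0 (fun k i hi => by rw [ha]; exact coeff_uvar_pow_mul 1 a k i hi)
    (fun i j hi hj => ?_) fun k _ m => by rw [one_mul]; exact divPow_x_mem_heightFilt 1 _ m
  exact (loop r n).e_commute hω (coeff_ne_zero_of_bar_eq hb i (coeff_ne_zero_toQ hi))
    (coeff_ne_zero_of_bar_eq hb j (coeff_ne_zero_toQ hj))

theorem expSeries_E_mem (r n : ℤ) {b : PowerSeries (Polynomial ℤ)} (h0 : constantCoeff b = 0)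
    (hd : ∃ a, b = uvar ℤ ^ 2 * a) : expSeries (lin (loop r n).E (toQ b)) ∈ rees (heightFilt 1) := by
  obtain ⟨a, ha⟩ := hd
  refine expSeries_lin_mem_rees (w := 2) h0 (fun k i hi => by rw [ha]; exact coeff_uvar_pow_mul 2 a k i hi)
    (fun i j _ _ => (loop r n).EE i j) fun k _ m => ?_
  exact divPow_normalized_Xo_mem (fun i => divPow_X_mem_heightFilt 1 i m)
    ((heightFilt 1).mono (Nat.zero_le _) (heightFilt 1).one_mem) r _

variable {b0 b1 : PowerSeries (Polynomial ℤ)} {n : ℤ} (D : GaussData ((-1) ^ n) b0 b1) (r : ℤ)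

theorem lower_mem : D.lower (loop r n) ∈ rees (Filt.const (UZhalf (-1)).toSubring) :=
  mul_mem (mul_mem (expSeries_f_mem r n (ω := -1) (by norm_num) D.cf1 (by rw [neg_one_smul]; exact D.bf1))
    (expSeries_F_mem r n D.cg)) (expSeries_f_mem r n (ω := 1) (by norm_num) D.cf0 (by rw [one_smul]; exact D.bf0))

theorem upper_mem : D.upper (loop r n) ∈ rees (heightFilt 1) :=
  mul_mem (mul_mem (expSeries_e_mem r n (ω := -1) (by norm_num) D.cp1 (by rw [neg_one_smul]; exact D.bp1) D.dvd_p1)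
    (expSeries_E_mem r n D.cq D.dvd_q))
    (expSeries_e_mem r n (ω := 1) (by norm_num) D.cp0 (by rw [one_smul]; exact D.bp0) D.dvd_p0)

theorem coeff_coeff_mul_mem_height {M : Submodule ℤ U} {f g : PowerSeries (Polynomial U)}
    (hf : ∀ m i, (coeff m f).coeff i ∈ M) (hg : g ∈ rees (heightFilt 1)) (m i : ℕ) :
    (coeff m (f * g)).coeff i ∈ M * heightSub 1 i := by
  rw [coeff_mul, Polynomial.finsetSum_coeff]
  refine sum_mem fun p _ => ?_
  rw [Polynomial.coeff_mul]
  refine sum_mem fun q hq => Submodule.mul_mem_mul (hf _ _)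
    (heightSub_mono 1 (?_ : q.2 ≤ i) (hg _ _))
  rw [← HasAntidiagonal.mem_antidiagonal.1 hq]
  exact Nat.le_add_left _ _

theorem expSeries_const_smul_eq_one {y : ℕ → U} {b : PowerSeries ℤ} (hb : b = 0) :
    expSeries (PowerSeries.mk fun k => coeff k b • y k) = 1 := by
  subst hb
  rw [← expSeries_zero]
  congr 1
  ext1 k; simp

theorem coeff_expSeries_X_smul (y : ℕ → U) (l : ℕ) :
    coeff l (expSeries (PowerSeries.mk fun k => coeff k (PowerSeries.X : PowerSeries ℤ) • y k)) =
      divPow (y 1) l := by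
  rw [← coeff_expSeries_X_mul_C]
  congr 2
  ext1 k
  rw [coeff_mk, coeff_X, coeff_mul_C, coeff_X]
  split_ifs with h
  · rw [h, one_smul, one_mul]
  · rw [zero_smul, zero_mul]

/-- The ordered product of a lower, a Cartan, and an upper part of height at most `k`. -/
def triProd (k : ℕ) : Submodule ℤ U :=
  Subalgebra.toSubmodule (UZhalf (-1)) * Subalgebra.toSubmodule UZcartan * heightSub 1 k

/-- In the half loop with n = r + s, x⁺_r is e_0 and x⁻_s is f_1, so the coefficient of t^l in the
initial value is the divided power of x⁻_s. The upper factor has coefficient of u^i in height at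
most i, and the remaining k - i powers of x⁺_r make the total at most k. -/
theorem divPow_mul_divPow_mem_triProd (r s : ℤ) (k l : ℕ) :
    divPow (x 1 r) k * divPow (x (-1) s) l ∈ triProd k := by
  obtain ⟨D⟩ := nonempty_basicData (r + s)
  have hX : atZero ℤ (PowerSeries.X : PowerSeries (Polynomial ℤ)) = PowerSeries.X := by simp [atZero]
  have hinit : coeff l (expSeries (PowerSeries.mk fun k => (coeff k (atZero ℤ (bOdd (r + s)))) • (loop r (r + s)).f k) *
      expSeries (PowerSeries.mk fun k => (coeff k (atZero ℤ (bEven (r + s)))) • (loop r (r + s)).f k)) =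
      divPow (x (-1) s) l := by
    have hf : (loop r (r + s)).f 1 = x (-1) s := by
      change x (-1) (-r + (r + s) * ((1 : ℕ) : ℤ)) = _
      congr 1; push_cast; ring
    rw [← hf, bOdd, bEven]
    split_ifs
    · rw [expSeries_const_smul_eq_one (map_zero _), one_mul, hX, coeff_expSeries_X_smul]
    · rw [expSeries_const_smul_eq_one (b := atZero ℤ 0) (map_zero _), mul_one, hX, coeff_expSeries_X_smul]
  have he : (loop r (r + s)).e 0 = x 1 r := by
    change x 1 (r + (r + s) * ((0 : ℕ) : ℤ)) = _
    congr 1; push_cast; ring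
  have key := D.divPow_mul_coeff_init (loop r (r + s)) k l
  rw [hinit, he] at key
  rw [key]
  refine sum_mem fun p hp => ?_
  have h1 := coeff_coeff_mul_mem_height (coeff_coeff_mul_mem
    (M := Subalgebra.toSubmodule (UZhalf (-1))) (N := Subalgebra.toSubmodule UZcartan)
    (lower_mem D r) (diag_mem r _ D)) (upper_mem D r) l p.1
  have h2 := Submodule.mul_mem_mul h1 (divPow_x_mem_heightSub 1 r p.2)
  rw [mul_assoc] at h2
  rw [triProd, ← HasAntidiagonal.mem_antidiagonal.1 hp]
  exact mul_le_mul' le_rfl (heightSub_mul_le 1 _ _) h2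

theorem half_eq_iSup (σ : ℤˣ) {a : U} (ha : a ∈ UZhalf σ) : ∃ n, a ∈ heightSub σ n := by
  induction ha using Algebra.adjoin_induction with
  | mem a ha => obtain ⟨r, k, rfl⟩ := ha; exact ⟨k, divPow_x_mem_heightSub σ r k⟩
  | algebraMap z =>
    refine ⟨0, ?_⟩
    rw [Algebra.algebraMap_eq_smul_one]
    exact Submodule.smul_mem _ z (heightFilt σ).one_mem
  | add a b _ _ h h' =>
    obtain ⟨m, hm⟩ := h
    obtain ⟨n, hn⟩ := h'
    exact ⟨max m n, add_mem (heightSub_mono σ (le_max_left _ _) hm) (heightSub_mono σ (le_max_right _ _) hn)⟩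
  | mul a b _ _ h h' =>
    obtain ⟨m, hm⟩ := h
    obtain ⟨n, hn⟩ := h'
    exact ⟨m + n, (heightFilt σ).mul_mem hm hn⟩

theorem heightSub_le_half (σ : ℤˣ) (k : ℕ) : heightSub σ k ≤ Subalgebra.toSubmodule (UZhalf σ) :=
  fun _ ha => heightFilt_le_half σ ha

theorem cartan_mul_half (σ : ℤˣ) : Subalgebra.toSubmodule UZcartan * Subalgebra.toSubmodule (UZhalf σ) ≤
    Subalgebra.toSubmodule (UZhalf σ) * Subalgebra.toSubmodule UZcartan := by
  refine Submodule.mul_le.2 fun z hz a ha => ?_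
  obtain ⟨n, hn⟩ := half_eq_iSup σ ha
  exact mul_le_mul' (heightSub_le_half σ n) le_rfl
    (cartan_mul_heightSub σ n (Submodule.mul_mem_mul hz hn))

theorem one_mem_toSubmodule (S : Subalgebra ℤ U) : (1 : U) ∈ Subalgebra.toSubmodule S := S.one_mem

theorem one_mem_heightSub (σ : ℤˣ) (k : ℕ) : (1 : U) ∈ heightSub σ k :=
  (heightFilt σ).mono (Nat.zero_le k) (heightFilt σ).one_mem

theorem toSubmodule_mul_self (S : Subalgebra ℤ U) :
    Subalgebra.toSubmodule S * Subalgebra.toSubmodule S = Subalgebra.toSubmodule S :=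
  (Subalgebra.isIdempotentElem_toSubmodule S).eq

theorem lower_cartan_mul_triProd (k : ℕ) : Subalgebra.toSubmodule (UZhalf (-1)) *
    Subalgebra.toSubmodule UZcartan * triProd k ≤ triProd k := by
  rw [triProd]
  set N := Subalgebra.toSubmodule (UZhalf (-1)) with hN
  set Z := Subalgebra.toSubmodule UZcartan with hZ
  calc N * Z * (N * Z * heightSub 1 k) = N * (Z * N) * Z * heightSub 1 k := by simp only [mul_assoc]
    _ ≤ N * (N * Z) * Z * heightSub 1 k :=
      mul_le_mul' (mul_le_mul' (mul_le_mul' le_rfl (cartan_mul_half (-1))) le_rfl) le_rfl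
    _ = (N * N) * (Z * Z) * heightSub 1 k := by simp only [mul_assoc]
    _ = N * Z * heightSub 1 k := by rw [hN, hZ, toSubmodule_mul_self, toSubmodule_mul_self]

theorem triProd_mul_heightSub (i j : ℕ) : triProd i * heightSub 1 j ≤ triProd (i + j) := by
  rw [triProd, mul_assoc]
  exact mul_le_mul' le_rfl (heightSub_mul_le 1 i j)

theorem triProd_mul_cartan (i : ℕ) : triProd i * Subalgebra.toSubmodule UZcartan ≤ triProd i := by
  rw [triProd, mul_assoc]
  refine (mul_le_mul' le_rfl (heightSub_mul_cartan 1 i)).trans ?_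
  rw [← mul_assoc, mul_assoc _ (Subalgebra.toSubmodule UZcartan) (Subalgebra.toSubmodule UZcartan),
    toSubmodule_mul_self]

theorem divPow_zero_eq {R : Type*} [Ring R] [Algebra ℚ R] (a : R) : divPow a 0 = 1 := by simp [divPow]

theorem HeightWord.eq_one_or {σ : ℤˣ} {n : ℕ} {w : U} (hw : HeightWord σ n w) :
    w = 1 ∨ ∃ r k m w', 0 < k ∧ n = k + m ∧ HeightWord σ m w' ∧ w = divPow (x σ r) k * w' := by
  induction hw with
  | one => exact Or.inl rfl
  | @mul r k n w hw ih =>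
    rcases Nat.eq_zero_or_pos k with rfl | hk
    · rw [divPow_zero_eq, one_mul, zero_add]; exact ih
    · exact Or.inr ⟨r, k, n, w, hk, rfl, hw, rfl⟩

/-- Double induction, on the upper height k and then on the lower height n. A single upper divided
power meets the first letter of a lower word, and the result has upper height at most k followed by
a shorter lower word: the inner hypothesis applies. An upper word with several nontrivial letters is
cut into pieces of smaller height, covered by the outer hypothesis. Both steps rely on the fact that
straightening does not increase the upper height. -/
theorem heightSub_mul_lower_le (k : ℕ) : heightSub 1 k * Subalgebra.toSubmodule (UZhalf (-1)) ≤ triProd k := by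
  induction k using Nat.strong_induction_on with
  | _ k ihk =>
  have hN : ∀ n, heightSub 1 k * heightSub (-1) n ≤ triProd k := by
    intro n
    induction n using Nat.strong_induction_on with
    | _ n ihn =>
    have hx : ∀ r : ℤ, ∀ a ∈ heightSub (-1) n, divPow (x 1 r) k * a ∈ triProd k := by
      intro r
      suffices h : heightSub (-1) n ≤ (triProd k).comap (LinearMap.mulLeft ℤ (divPow (x 1 r) k)) from h
      refine heightSub_le fun m hm w hw => ?_
      rw [Submodule.mem_comap, LinearMap.mulLeft_apply]
      rcases hw.eq_one_or with rfl | ⟨s, l, m', w', hl, rfl, hw', rfl⟩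
      · rw [mul_one]
        have := Submodule.mul_mem_mul (Submodule.mul_mem_mul (one_mem_toSubmodule (UZhalf (-1))) (one_mem_toSubmodule UZcartan))
          (divPow_x_mem_heightSub 1 r k)
        rwa [one_mul, one_mul] at this
      · rw [← mul_assoc]
        have h1 : divPow (x 1 r) k * divPow (x (-1) s) l * w' ∈ triProd k * heightSub (-1) m' :=
          Submodule.mul_mem_mul (divPow_mul_divPow_mem_triProd r s k l)
            (AddSubgroup.subset_closure ⟨m', le_rfl, hw'⟩)
        refine lower_cartan_mul_triProd k (mul_le_mul' le_rfl (ihn m' (by omega)) ?_)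
        rwa [triProd, mul_assoc] at h1
    refine Submodule.mul_le.2 fun p hp a ha => ?_
    suffices h : heightSub 1 k ≤ (triProd k).comap (LinearMap.mulRight ℤ a) from h hp
    refine heightSub_le fun m hm w hw => ?_
    rw [Submodule.mem_comap, LinearMap.mulRight_apply]
    have hlt : ∀ {m} {w : U}, HeightWord 1 m w → m < k → w * a ∈ triProd m := fun hw hm =>
      ihk _ hm (Submodule.mul_mem_mul (AddSubgroup.subset_closure ⟨_, le_rfl, hw⟩)
        (heightSub_le_half _ _ ha))
    have hmono : triProd m ≤ triProd k := mul_le_mul' le_rfl (heightSub_mono 1 hm)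
    rcases hm.lt_or_eq with hm | rfl
    · exact hmono (hlt hw hm)
    rcases hw.eq_one_or with rfl | ⟨s, l, m', w', hl, rfl, hw', rfl⟩
    · rw [one_mul]
      have := Submodule.mul_mem_mul (Submodule.mul_mem_mul (heightSub_le_half (-1) n ha) (one_mem_toSubmodule UZcartan))
        (one_mem_heightSub 1 m)
      rwa [mul_one, mul_one] at this
    rcases Nat.eq_zero_or_pos m' with rfl | hm'
    · rcases hw'.eq_one_or with rfl | ⟨_, _, _, _, _, h0, _⟩
      · rw [mul_one]; exact hx s a ha
      · omega
    · rw [mul_assoc]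
      have h1 : divPow (x 1 s) l * (w' * a) ∈ heightSub 1 l * triProd m' :=
        Submodule.mul_mem_mul (divPow_x_mem_heightSub 1 s l) (hlt hw' (by omega))
      have h2 : heightSub 1 l * triProd m' ≤ triProd (l + m') := by
        calc heightSub 1 l * triProd m' = heightSub 1 l * Subalgebra.toSubmodule (UZhalf (-1)) *
              Subalgebra.toSubmodule UZcartan * heightSub 1 m' := by rw [triProd]; simp only [mul_assoc]
          _ ≤ triProd l * Subalgebra.toSubmodule UZcartan * heightSub 1 m' :=
            mul_le_mul' (mul_le_mul' (ihk l (by omega)) le_rfl) le_rfl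
          _ ≤ triProd l * heightSub 1 m' := mul_le_mul' (triProd_mul_cartan l) le_rfl
          _ ≤ triProd (l + m') := triProd_mul_heightSub l m'
      exact h2 h1
  refine Submodule.mul_le.2 fun p hp a ha => ?_
  obtain ⟨n, hn⟩ := half_eq_iSup (-1) ha
  exact hN n (Submodule.mul_mem_mul hp hn)

/-- The ordered product of the lower, the Cartan and the upper part. -/
def triangular : Submodule ℤ U :=
  Subalgebra.toSubmodule (UZhalf (-1)) * Subalgebra.toSubmodule UZcartan * Subalgebra.toSubmodule (UZhalf 1)

theorem triProd_le_triangular (k : ℕ) : triProd k ≤ triangular :=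
  mul_le_mul' le_rfl (heightSub_le_half 1 k)

theorem UZ_le_triangular : Subalgebra.toSubmodule UZ ≤ triangular := by
  refine adjoin_le_of_mul_mem ?_ ?_
  · have := Submodule.mul_mem_mul (Submodule.mul_mem_mul (one_mem_toSubmodule (UZhalf (-1)))
      (one_mem_toSubmodule UZcartan)) (one_mem_toSubmodule (UZhalf 1))
    rwa [one_mul, one_mul] at this
  · rintro _ ⟨σ, r, k, rfl⟩ b hb
    rcases Int.units_eq_one_or σ with rfl | rfl
    · have h1 := Submodule.mul_mem_mul (divPow_x_mem_heightSub 1 r k) hb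
      have h2 : heightSub 1 k * triangular ≤ triangular := by
        calc heightSub 1 k * triangular = heightSub 1 k * Subalgebra.toSubmodule (UZhalf (-1)) *
              Subalgebra.toSubmodule UZcartan * Subalgebra.toSubmodule (UZhalf 1) := by
                rw [triangular]; simp only [mul_assoc]
          _ ≤ triProd k * Subalgebra.toSubmodule UZcartan * Subalgebra.toSubmodule (UZhalf 1) :=
            mul_le_mul' (mul_le_mul' (heightSub_mul_lower_le k) le_rfl) le_rfl
          _ ≤ triProd k * Subalgebra.toSubmodule (UZhalf 1) := mul_le_mul' (triProd_mul_cartan k) le_rfl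
          _ ≤ triangular * Subalgebra.toSubmodule (UZhalf 1) := mul_le_mul' (triProd_le_triangular k) le_rfl
          _ = triangular := by rw [triangular, mul_assoc, toSubmodule_mul_self]
      exact h2 h1
    · have h1 := Submodule.mul_mem_mul (show divPow (x (-1) r) k ∈ Subalgebra.toSubmodule (UZhalf (-1)) from divPow_x_mem_half (-1) r k) hb
      have h2 : Subalgebra.toSubmodule (UZhalf (-1)) * triangular = triangular := by
        rw [triangular, ← mul_assoc, ← mul_assoc, toSubmodule_mul_self]
      rwa [h2] at h1

/-! ### The Cartan part belongs to the integral form -/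

/-- The recursion for the coefficients of the inverse of a series with constant term 1 involves no
division. -/
theorem coeff_mem_of_mul_eq_one {S : Type*} [Ring S] (B : Subring S) {F G : PowerSeries S}
    (hF : ∀ k, coeff k F ∈ B) (h0 : constantCoeff F = 1) (h : F * G = 1) (k : ℕ) : coeff k G ∈ B := by
  induction k using Nat.strong_induction_on with
  | _ k ih =>
  have hk := congrArg (coeff k) h
  rcases k with _ | k
  · rw [coeff_mul, Nat.antidiagonal_zero, sum_singleton, coeff_zero_eq_constantCoeff_apply, h0, one_mul,
      coeff_zero_one] at hk
    rw [hk]; exact one_mem B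
  · rw [coeff_mul, Nat.sum_antidiagonal_succ, coeff_zero_eq_constantCoeff_apply, h0, one_mul, coeff_one,
      if_neg k.succ_ne_zero] at hk
    rw [eq_neg_of_add_eq_zero_left hk]
    refine neg_mem (sum_mem fun p hp => mul_mem (hF _) (ih _ ?_))
    have := HasAntidiagonal.mem_antidiagonal.1 hp
    omega

theorem mem_rees_of_mul_eq_one {R : Type*} [Ring R] {A : Subring R} {f g : PowerSeries (Polynomial R)}
    (hf : f ∈ rees (Filt.const A)) (h0 : constantCoeff f = 1) (h : f * g = 1) : g ∈ rees (Filt.const A) := by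
  have key := coeff_mem_of_mul_eq_one ((rees (Filt.const A)).comap PowerSeries.C) (F := f) (fun k m i => by
    rw [coeff_C]
    split_ifs
    · exact hf k i
    · exact zero_mem _) h0 h
  intro k i
  have := key k 0 i
  rwa [coeff_zero_C] at this

theorem isUnit_expSeries {R : Type*} [Ring R] [Algebra ℚ R] {A : PowerSeries R} (h : constantCoeff A = 0) :
    IsUnit (expSeries A) :=
  ⟨⟨_, _, expSeries_mul_expSeries_neg h, expSeries_neg_mul_expSeries h⟩, rfl⟩

theorem half_le_UZ (σ : ℤˣ) : UZhalf σ ≤ UZ :=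
  Algebra.adjoin_mono (by rintro _ ⟨r, k, rfl⟩; exact ⟨σ, r, k, rfl⟩)

theorem divPow_x_mem_UZ (σ : ℤˣ) (r : ℤ) (k : ℕ) : divPow (x σ r) k ∈ UZ :=
  Algebra.subset_adjoin ⟨σ, r, k, rfl⟩

section Diag

variable {b0 b1 : PowerSeries (Polynomial ℤ)} {n : ℤ} (D : GaussData ((-1) ^ n) b0 b1) (r : ℤ)

/-- The identity e_0^(k) W_0 = ∑ W_i e_0^(k-i) is solved for W_k. Its left side lies in `UZ`, since
W_0 is the lower factor at u = 0. -/
theorem coeff_coeff_gauss_mem (l k : ℕ) : (coeff l (D.lower (loop r n) * D.diag (loop r n) *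
    D.upper (loop r n))).coeff k ∈ UZ := by
  induction k using Nat.strong_induction_on with
  | _ k ih =>
  have key := D.divPow_mul_coeff_init (loop r n) k l
  rw [← D.atZero_lower (loop r n)] at key
  have hl : divPow ((loop r n).e 0) k * coeff l (atZero U (D.lower (loop r n))) ∈ UZ := by
    refine mul_mem (divPow_x_mem_UZ 1 _ k) (half_le_UZ (-1) ?_)
    rw [atZero, coeff_map, Polynomial.constantCoeff_apply]
    exact lower_mem D r l 0
  rw [key] at hl
  rcases k with _ | k
  · simpa [divPow_zero_eq] using hl
  · rw [Nat.sum_antidiagonal_succ', divPow_zero_eq, mul_one] at hl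
    refine (add_mem_cancel_right (sum_mem fun p hp => mul_mem (ih _ ?_) (divPow_x_mem_UZ 1 _ _))).1 hl
    have := HasAntidiagonal.mem_antidiagonal.1 hp
    omega

/-- D = N⁻¹ W P⁻¹, where W, N and P have coefficients in `UZ`, and so do the inverses because N and
P have constant term 1. -/
theorem diag_mem_UZ : D.diag (loop r n) ∈ rees (Filt.const UZ.toSubring) := by
  have h1 : D.lower (loop r n) ∈ rees (Filt.const UZ.toSubring) := fun m i =>
    half_le_UZ (-1) (lower_mem D r m i)
  have h2 : D.upper (loop r n) ∈ rees (Filt.const UZ.toSubring) := fun m i =>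
    half_le_UZ 1 (heightFilt_le_half 1 (upper_mem D r m i))
  have h3 : D.lower (loop r n) * D.diag (loop r n) * D.upper (loop r n) ∈
      rees (Filt.const UZ.toSubring) := fun m i => coeff_coeff_gauss_mem D r m i
  have hc : ∀ (y : ℕ → U) {b : PowerSeries (Polynomial ℤ)}, constantCoeff b = 0 →
      constantCoeff (lin y (toQ b)) = 0 := fun y b hb => lin_constantCoeff (constantCoeff_toQ _ hb)
  obtain ⟨⟨l, l', hl, hl'⟩, rfl' : l = D.lower (loop r n)⟩ : IsUnit (D.lower (loop r n)) :=
    ((isUnit_expSeries (hc _ D.cf1)).mul (isUnit_expSeries (hc _ D.cg))).mul (isUnit_expSeries (hc _ D.cf0))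
  obtain ⟨⟨u, u', hu, hu'⟩, rfu : u = D.upper (loop r n)⟩ : IsUnit (D.upper (loop r n)) :=
    ((isUnit_expSeries (hc _ D.cp1)).mul (isUnit_expSeries (hc _ D.cq))).mul (isUnit_expSeries (hc _ D.cp0))
  rw [rfl'] at hl hl'
  rw [rfu] at hu hu'
  have h4 := mem_rees_of_mul_eq_one h1 (by simp [GaussData.lower]) hl
  have h5 := mem_rees_of_mul_eq_one h2 (by simp [GaussData.upper]) hu
  have h6 := mul_mem (mul_mem h4 h3) h5
  rwa [← mul_assoc, ← mul_assoc, hl', one_mul, mul_assoc, hu, mul_one] at h6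

end Diag

theorem map_binom {R S : Type*} [Ring R] [Algebra ℚ R] [Ring S] [Algebra ℚ S] (ρ : R →ₐ[ℚ] S) (a : R)
    (k : ℕ) : ρ (binom a k) = binom (ρ a) k := by
  rw [binom, binom, map_smul, Polynomial.aeval_algHom_apply]

theorem succ_mul_binom_succ {R : Type*} [Ring R] [Algebra ℚ R] (a : R) (k : ℕ) :
    ((k + 1 : ℕ) : ℚ) • binom a (k + 1) = binom a k * (a - k) := by
  rw [binom, binom, descPochhammer_succ_right, map_mul, smul_smul, Nat.factorial_succ, smul_mul_assoc]
  congr 1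
  · have : ((k ! : ℕ) : ℚ) ≠ 0 := by positivity
    push_cast
    field_simp
  · simp

/-- This is the binomial series (1 + w)^a. It is proved for the variable of ℚ[X], where the
differential equation (1 + w) F' = X F characterizes it, and then specialized to a. -/
theorem coeff_hatSeries_const {R : Type*} [Ring R] [Algebra ℚ R] (a : R) (k : ℕ) :
    coeff k (hatSeries fun _ => a) = binom a k := by
  have key : (PowerSeries.mk fun k => binom (Polynomial.X : Polynomial ℚ) k) =
      hatSeries fun _ => (Polynomial.X : Polynomial ℚ) := by
    refine eq_expSeries (constantCoeff_hatLog _) (by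
      rw [← coeff_zero_eq_constantCoeff_apply, coeff_mk]; simp [binom]) ?_
    rw [derivative_hatLog]
    have h1 : (PowerSeries.mk fun r => (-1) ^ r * (Polynomial.X : Polynomial ℚ)) * (1 + PowerSeries.X) =
        PowerSeries.C Polynomial.X := by
      ext1 k
      rw [mul_add, mul_one, map_add, coeff_C]
      rcases k with _ | k
      · simp
      · rw [coeff_succ_mul_X, coeff_mk, coeff_mk, if_neg k.succ_ne_zero]; ring
    have h2 : derivative (Polynomial ℚ) (PowerSeries.mk fun k => binom (Polynomial.X : Polynomial ℚ) k) *
        (1 + PowerSeries.X) = (PowerSeries.mk fun k => binom (Polynomial.X : Polynomial ℚ) k) *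
          PowerSeries.C Polynomial.X := by
      have hb : ∀ k : ℕ, binom (Polynomial.X : Polynomial ℚ) (k + 1) * ((k : Polynomial ℚ) + 1) =
          binom (Polynomial.X : Polynomial ℚ) k * ((Polynomial.X : Polynomial ℚ) - (k : Polynomial ℚ)) := fun k => by
        rw [← succ_mul_binom_succ, Algebra.smul_def, mul_comm]; simp
      ext1 k
      rw [mul_add, mul_one, map_add, coeff_mul_C, coeff_mk, coeff_derivative, coeff_mk, hb]
      rcases k with _ | k
      · simp
      · rw [coeff_succ_mul_X, coeff_derivative, coeff_mk]; push_cast; ring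
    have hu : IsUnit (1 + PowerSeries.X : PowerSeries (Polynomial ℚ)) := by
      rw [isUnit_iff_constantCoeff]; simp
    apply hu.mul_right_cancel
    rw [h2, mul_assoc, h1]
  have h := congrArg (fun f => (Polynomial.aeval a : Polynomial ℚ →ₐ[ℚ] R) (coeff k f)) key
  simp only [coeff_mk, map_binom, Polynomial.aeval_X] at h
  rw [h]
  have := map_hatSeries ((Polynomial.aeval a : Polynomial ℚ →ₐ[ℚ] R) : Polynomial ℚ →+* R) fun _ => Polynomial.X
  rw [show (fun _ : ℕ => a) = fun _ => ((Polynomial.aeval a : Polynomial ℚ →ₐ[ℚ] R) : Polynomial ℚ →+* R)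
    Polynomial.X by simp, ← this, coeff_map]
  rfl

theorem binom_h_zero_add_mem (r : ℤ) (k : ℕ) : binom (h 0 + r • c) k ∈ UZ := by
  obtain ⟨D⟩ := nonempty_basicData 0
  have h1 := diag_mem_UZ D r k k
  rw [diag_eq D _ (psi_even (by simp) D), coeff_coeff_homog, if_pos rfl] at h1
  have he : (PowerSeries.mk fun m => coeff m logOneAdd • (loop r 0).H m) = PowerSeries.mk fun m =>
      if m = 0 then 0 else ((-1 : ℚ) ^ (m - 1) / (m : ℚ)) • (h 0 + r • c) := by
    ext1 m
    have hH : (loop r 0).H m = h 0 + (r : ℚ) • c := by simp [loop]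
    rw [coeff_mk, coeff_mk, logOneAdd, coeff_mk, hH, Int.cast_smul_eq_zsmul]
    split_ifs <;> simp
  rw [he] at h1
  rw [← coeff_hatSeries_const, hatSeries]
  exact h1

theorem UZzero_le_UZ : UZzero ≤ UZ := by
  have hspan : ∀ (a : U), (∀ k, binom a k ∈ UZ) → ∀ b ∈ Submodule.span ℤ (Set.range (binom a)), b ∈ UZ := by
    intro a ha b hb
    exact (Submodule.span_le (p := Subalgebra.toSubmodule UZ)).2 (by rintro _ ⟨k, rfl⟩; exact ha k) hb
  have h0 : ∀ k, binom (h 0) k ∈ UZ := fun k => by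
    have := binom_h_zero_add_mem 0 k
    rwa [zero_smul, add_zero] at this
  have hc : ∀ k, binom c k ∈ UZ := fun k => by
    -- Only binomials of h_0 + rc are produced by half loops with n = 0; those of c itself come from
    -- the difference of the cases r = 1 and r = 0.
    have he : c = (h 0 + (1 : ℤ) • c) + (-1 : ℤ) • h 0 := by rw [one_smul, neg_one_smul]; abel
    have hcomm : Commute (h 0 + (1 : ℤ) • c) ((-1 : ℤ) • h 0) :=
      ((Commute.refl (h 0)).add_left (Commute.smul_left c_commute_h_zero _)).smul_right _
    rw [he, binom_add hcomm]
    exact sum_mem fun p _ => mul_mem (binom_h_zero_add_mem 1 _) (hspan _ h0 _ (binom_zsmul_mem _ _ _))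
  have : Subalgebra.toSubmodule UZzero ≤ Subalgebra.toSubmodule UZ := by
    rw [← span_Bzero]
    refine Submodule.span_le.2 ?_
    rintro _ ⟨k, rfl⟩
    exact mul_mem (S := Subalgebra ℤ U) (h0 _) (hc _)
  exact this

/-- The evaluation at `u = 1`. -/
def atOne (R : Type*) [Ring R] : PowerSeries (Polynomial R) →+* PowerSeries R :=
  PowerSeries.map (Polynomial.eval₂RingHom' (RingHom.id R) 1 fun _ => Commute.one_right _)

theorem coeff_atOne {R : Type*} [Ring R] (f : PowerSeries (Polynomial R)) (k : ℕ) :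
    coeff k (atOne R f) = (coeff k f).eval₂ (RingHom.id R) 1 := by
  rw [atOne, coeff_map]; rfl

theorem coeff_atOne_mem {R : Type*} [Ring R] {A : Subring R} {f : PowerSeries (Polynomial R)}
    (hf : f ∈ rees (Filt.const A)) (k : ℕ) : coeff k (atOne R f) ∈ A := by
  rw [coeff_atOne, Polynomial.eval₂_eq_sum_range]
  refine sum_mem fun i _ => ?_
  rw [one_pow, mul_one]
  exact hf k i

theorem atOne_lin {R : Type*} [Ring R] [Algebra ℚ R] (y : ℕ → R) (a : PowerSeries (Polynomial ℚ)) :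
    atOne R (lin y a) = PowerSeries.mk fun k => coeff k (atOne ℚ a) • y k := by
  ext1 k
  rw [atOne, coeff_map, coeff_lin, map_mul, coeff_mk, coeff_atOne, Algebra.smul_def]
  congr 1
  · change ((coeff k a).map (algebraMap ℚ R)).eval₂ (RingHom.id R) 1 = _
    rw [Polynomial.eval₂_map, Polynomial.hom_eval₂]
    simp
  · simp [Polynomial.eval₂RingHom']

theorem commute_of_coeff {R : Type*} [Ring R] {f g : PowerSeries R}
    (hfg : ∀ i j, Commute (coeff i f) (coeff j g)) : Commute f g := by
  ext1 m
  rw [coeff_mul, coeff_mul, ← Finset.Nat.sum_antidiagonal_swap (n := m) (f := fun p => coeff p.1 f * coeff p.2 g)]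
  exact sum_congr rfl fun p _ => (hfg _ _).eq

/-- Setting u = 1 forgets the grading by u, which is harmless since only membership in `UZ` is at
stake. Any admissible initial values b0, b1 may be used, and ψ is half the logarithm of d at u = 1;
this gives more freedom than the single series exp(t f_1). -/
theorem coeff_exp_atOne_mem {σ : ℤˣ} {b0 b1 : PowerSeries (Polynomial ℤ)}
    (D : GaussData ((-1) ^ (σ : ℤ)) b0 b1) {ψ : PowerSeries ℚ} (h0 : constantCoeff ψ = 0)
    (hψ : expSeries ((2 : ℚ) • ψ) =
      atOne ℚ (toQ (Gauss.d0 (uvar ℤ) b0 b1 + Gauss.d1 (uvar ℤ) b0 b1))) (k : ℕ) :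
    coeff k (expSeries (PowerSeries.mk fun k => coeff k ψ • h ((σ : ℤ) * k))) ∈ UZ := by
  have h1 : atOne ℚ D.ψ = ψ := by
    have h00 : constantCoeff (atOne ℚ D.ψ) = 0 := by
      rw [← coeff_zero_eq_constantCoeff_apply, coeff_atOne, coeff_zero_eq_constantCoeff_apply, D.cψ]
      simp
    have h2 : atOne ℚ ((2 : ℚ) • D.ψ) = (2 : ℚ) • atOne ℚ D.ψ := by
      rw [ofNat_smul, ofNat_smul, map_mul, map_ofNat]
    have h3 : (2 : ℚ) • atOne ℚ D.ψ = (2 : ℚ) • ψ := by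
      refine expSeries_injective (by simp [h00]) (by simp [h0]) ?_
      rw [hψ, ← D.exp_ψ, ← h2, atOne, map_expSeries]
    have := congrArg ((2⁻¹ : ℚ) • ·) h3
    simpa [smul_smul] using this
  have h2 := coeff_atOne_mem (diag_mem_UZ D 0) k
  rw [GaussData.diag, atOne, map_expSeries, ← atOne, atOne_lin, h1] at h2
  have he : (PowerSeries.mk fun m => coeff m ψ • (loop 0 (σ : ℤ)).H m) =
      PowerSeries.mk fun m => coeff m ψ • h ((σ : ℤ) * m) := by
    ext1 m
    simp [loop]
  rw [he] at h2
  exact h2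

/-- Since ε reverses sign exactly in the degrees divisible by four, the coefficients of the
logarithm of the h̃ series are those of log(1 + t) - ½ log(1 - t⁴). That is the difference of log(1
+ t) + ½ log(1 - t⁴) and log(1 - t⁴), both of which occur as ψ for a diagonal factor. -/
theorem hTilde_mem_UZ (σ : ℤˣ) (k : ℕ) : hTilde σ k ∈ UZ := by
  have hs : ((-1 : ℚ) ^ (σ : ℤ)) = -1 := by
    rcases Int.units_eq_one_or σ with rfl | rfl <;> simp
  have hX : ∀ n : ℕ, bar ((-1) ^ (σ : ℤ)) (toQ (PowerSeries.X ^ n)) = (-1) ^ n * PowerSeries.X ^ n := fun n => by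
    rw [hs, map_pow, map_pow, toQ_X, bar_X, ← mul_pow]; simp
  have hdu : ∀ n : ℕ, du (PowerSeries.X ^ n : PowerSeries (Polynomial ℤ)) = 0 := fun n => by
    ext1 k
    rw [coeff_du, coeff_X_pow]
    split_ifs <;> simp
  have hat1 : atOne ℚ PowerSeries.X = PowerSeries.X := by simp [atOne]
  have hat2 : atOne ℚ (uvar ℚ) = 1 := by
    ext1 k
    rw [coeff_atOne, uvar, coeff_C, coeff_one]
    split_ifs <;> simp
  -- For these initial values d at u = 1 is (1 + t)² (1 - t⁴).
  obtain ⟨D1⟩ := nonempty_gaussData (s := (-1) ^ (σ : ℤ)) (b0 := PowerSeries.X ^ 2)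
    (b1 := PowerSeries.X ^ 1 + PowerSeries.X ^ 3) (by simp) (by simp) (hdu 2)
    (by rw [map_add, hdu, hdu, add_zero]) (by rw [hX, map_pow, toQ_X]; ring)
    (by rw [map_add, map_add, hX, hX, map_pow, map_pow, toQ_X]; ring)
  -- For these initial values d at u = 1 is (1 - t⁴)².
  obtain ⟨D2⟩ := nonempty_gaussData (s := (-1) ^ (σ : ℤ)) (b0 := -PowerSeries.X ^ 4) (b1 := 0)
    (by simp) (by simp) (by rw [map_neg, hdu, neg_zero]) (map_zero _)
    (by rw [map_neg, map_neg, hX, map_pow, toQ_X]; ring) (by simp)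
  have hL := constantCoeff_logOneAdd
  have hL' : constantCoeff (rescale (-1) logOneAdd) = 0 := by rw [constantCoeff_rescale_eq, hL]
  let Λ : PowerSeries ℚ := expand 4 four_ne_zero (rescale (-1) logOneAdd)
  have hΛ0 : constantCoeff Λ = 0 := by simp only [Λ]; rw [constantCoeff_expand, hL']
  have hΛ : expSeries Λ = 1 - PowerSeries.X ^ 4 := by
    simp only [Λ]
    rw [← expand_expSeries _ _ hL', ← rescale_expSeries, expSeries_logOneAdd, map_add, map_one, rescale_X_eq]
    simp [sub_eq_add_neg]
  have e2 : ∀ f : PowerSeries (Polynomial ℤ) →+* PowerSeries ℚ, f 2 = 2 := fun f => map_ofNat f 2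
  let ev : PowerSeries (Polynomial ℤ) →+* PowerSeries ℚ := (atOne ℚ).comp toQ
  have evX : ev PowerSeries.X = PowerSeries.X := by
    change atOne ℚ (toQ PowerSeries.X) = _
    rw [toQ_X, hat1]
  have evu : ev (uvar ℤ) = 1 := by
    change atOne ℚ (toQ (uvar ℤ)) = _
    rw [toQ_uvar, hat2]
  have k1 := coeff_exp_atOne_mem D1 (ψ := logOneAdd + (2⁻¹ : ℚ) • Λ) (by simp [hL, hΛ0]) (by
    rw [smul_add, smul_smul, show (2 : ℚ) * 2⁻¹ = 1 by norm_num, one_smul, two_smul,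
      expSeries_add (Commute.all _ _) (by simp [hL]) hΛ0, expSeries_add (Commute.all _ _) hL hL,
      expSeries_logOneAdd, hΛ]
    change _ = ev _
    simp only [Gauss.d0, Gauss.d1, map_add, map_mul, map_sub, map_pow, map_one, evX, evu, e2 ev]
    ring)
  have k2 := coeff_exp_atOne_mem D2 (ψ := Λ) hΛ0 (by
    rw [two_smul, expSeries_add (Commute.all _ _) hΛ0 hΛ0, hΛ]
    change _ = ev _
    simp only [Gauss.d0, Gauss.d1, map_add, map_mul, map_sub, map_pow, map_one, map_neg, map_zero, evX, evu,
      e2 ev]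
    ring)
  set f1 : PowerSeries U := PowerSeries.mk fun k => coeff k (logOneAdd + (2⁻¹ : ℚ) • Λ) • h ((σ : ℤ) * k)
  set f2 : PowerSeries U := PowerSeries.mk fun k => coeff k Λ • h ((σ : ℤ) * k)
  have hf1 : constantCoeff f1 = 0 := by
    rw [← coeff_zero_eq_constantCoeff_apply, coeff_mk]; simp [hL, hΛ0]
  have hf2 : constantCoeff f2 = 0 := by
    rw [← coeff_zero_eq_constantCoeff_apply, coeff_mk]; simp [hΛ0]
  have hlog : hatSeries (epsH σ) = expSeries f1 * expSeries (-f2) := by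
    rw [← expSeries_add (commute_of_coeff fun i j => by
      rw [map_neg, coeff_mk, coeff_mk]
      exact (((h_im_commute σ i j).smul_left _).smul_right _).neg_right) hf1 (by rw [map_neg, hf2, neg_zero]),
      hatSeries_epsH]
    congr 1
    ext1 r
    rw [map_add, map_neg, coeff_mk, coeff_mk, coeff_mk, ← sub_eq_add_neg, ← sub_smul]
    congr 1
    simp only [Λ, map_add, coeff_smul, coeff_expand, hatCoeff, coeff_rescale]
    rcases eq_or_ne r 0 with rfl | hr
    · simp [hL]
    have hr' : (r : ℚ) ≠ 0 := by exact_mod_cast hr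
    rw [if_neg hr, coeff_logOneAdd hr, eps]
    split_ifs with h4
    · obtain ⟨m, rfl⟩ := h4
      have hm : m ≠ 0 := by omega
      have hm' : (m : ℚ) ≠ 0 := by exact_mod_cast hm
      obtain ⟨n, rfl⟩ := Nat.exists_eq_succ_of_ne_zero hm
      rw [Nat.mul_div_cancel_left _ four_pos, coeff_logOneAdd hm, show 4 * n.succ - 1 = 4 * n + 3 by omega,
        pow_add, pow_mul, Nat.succ_sub_one, pow_succ]
      have h1 : (-1 : ℚ) ^ n * (-1) ^ n = 1 := by rw [← mul_pow]; norm_num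
      push_cast at hm' ⊢
      simp only [smul_eq_mul]
      norm_num
      field_simp
      linear_combination (-4) * h1
    · simp
  rw [hTilde, hlog, coeff_mul]
  exact sum_mem fun p _ => mul_mem (k1 _) (coeff_mem_of_mul_eq_one UZ.toSubring k2
    (constantCoeff_expSeries _) (expSeries_mul_expSeries_neg hf2) _)

theorem UZim_le_UZ (σ : ℤˣ) : UZim σ ≤ UZ :=
  Algebra.adjoin_le (by rintro _ ⟨k, _, rfl⟩; exact hTilde_mem_UZ σ k)

theorem UZcartan_le_UZ : UZcartan ≤ UZ :=
  sup_le (sup_le (UZim_le_UZ _) UZzero_le_UZ) (UZim_le_UZ _)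

theorem toSubmodule_UZ : Subalgebra.toSubmodule UZ = triangular := by
  refine le_antisymm UZ_le_triangular ?_
  rw [triangular]
  calc _ ≤ Subalgebra.toSubmodule UZ * Subalgebra.toSubmodule UZ * Subalgebra.toSubmodule UZ :=
        mul_le_mul' (mul_le_mul' (half_le_UZ (-1)) UZcartan_le_UZ) (half_le_UZ 1)
    _ = Subalgebra.toSubmodule UZ := by rw [toSubmodule_mul_self, toSubmodule_mul_self]

/-! ### Oscillator representation of a central extension of the loop algebra of 3 × 3 matrices -/

section Fock

attribute [local instance] LieRing.ofAssociativeRing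

/-- Polynomials in the variables `y_(p,k)`. -/
abbrev Fock : Type := MvPolynomial (Fin 3 × ℤ) ℚ

abbrev yOp (i : Fin 3 × ℤ) : Module.End ℚ Fock := LinearMap.mulLeft ℚ (MvPolynomial.X i)

abbrev dOp (i : Fin 3 × ℤ) : Module.End ℚ Fock := (MvPolynomial.pderiv i).toLinearMap

theorem mulLeft_lie_mulLeft (a b : Fock) :
    ⁅LinearMap.mulLeft ℚ a, LinearMap.mulLeft ℚ b⁆ = 0 := by
  ext1 m; ext1; simp [Ring.lie_def, mul_left_comm]

theorem derivation_lie_mulLeft (D : Derivation ℚ Fock Fock) (a : Fock) :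
    ⁅(D : Module.End ℚ Fock), LinearMap.mulLeft ℚ a⁆ = LinearMap.mulLeft ℚ (D a) := by
  refine LinearMap.ext fun f => ?_
  simp [Ring.lie_def, mul_comm]

theorem dOp_lie_yOp (i j : Fin 3 × ℤ) : ⁅dOp i, yOp j⁆ = if i = j then 1 else 0 := by
  rw [derivation_lie_mulLeft, MvPolynomial.pderiv_X]
  split_ifs with h
  · subst h; rw [Pi.single_eq_same]; exact LinearMap.mulLeft_one _ _
  · rw [Pi.single_eq_of_ne (Ne.symm h)]; exact LinearMap.ext fun f => zero_mul f

theorem dOp_lie_dOp (i j : Fin 3 × ℤ) : ⁅dOp i, dOp j⁆ = 0 := by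
  rw [← Derivation.commutator_coe_linear_map]
  have : ⁅(MvPolynomial.pderiv i : Derivation ℚ Fock Fock),
      (MvPolynomial.pderiv j : Derivation ℚ Fock Fock)⁆ = 0 := by
    refine MvPolynomial.derivation_ext fun k => ?_
    rw [Derivation.commutator_apply, MvPolynomial.pderiv_X, MvPolynomial.pderiv_X]
    simp [Pi.single_apply, apply_ite]
  rw [this]; rfl

/-- An operator commuting with all multiplications and all derivatives is a scalar. -/
theorem eq_smul_one_of_lie_eq_zero {C : Module.End ℚ Fock} (hy : ∀ i, ⁅C, yOp i⁆ = 0)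
    (hd : ∀ i, ⁅C, dOp i⁆ = 0) : C = (MvPolynomial.constantCoeff (C 1)) • 1 := by
  have h1 : ∀ f, C f = f * C 1 := by
    intro f
    induction f using MvPolynomial.induction_on with
    | C a => rw [MvPolynomial.C_mul', ← map_smul, MvPolynomial.smul_eq_C_mul, mul_one]
    | add f g hf hg => rw [map_add, hf, hg, add_mul]
    | mul_X f i hf =>
      have := LinearMap.congr_fun (hy i) f
      simp only [Ring.lie_def, LinearMap.sub_apply, Module.End.mul_apply, LinearMap.mulLeft_apply,
        LinearMap.zero_apply, sub_eq_zero] at this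
      rw [mul_comm, this, hf]; ring
  have h2 : C 1 = MvPolynomial.C (MvPolynomial.constantCoeff (C 1)) := by
    refine MvPolynomial.ext _ _ fun m => ?_
    rw [MvPolynomial.coeff_C]
    split_ifs with hm
    · subst hm; rfl
    · obtain ⟨i, hi⟩ : ∃ i, m i ≠ 0 := by
        by_contra hcon; push Not at hcon; exact hm (Finsupp.ext fun i => (hcon i).symm)
      have h3 : MvPolynomial.pderiv i (C 1) = 0 := by
        have := LinearMap.congr_fun (hd i) 1
        simpa [Ring.lie_def] using this
      have h4 := congrArg (MvPolynomial.coeff (m - Finsupp.single i 1)) h3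
      rw [MvPolynomial.coeff_pderiv, tsub_add_cancel_of_le
        (Finsupp.single_le_iff.2 (Nat.one_le_iff_ne_zero.2 hi)), MvPolynomial.coeff_zero] at h4
      exact (mul_eq_zero.1 h4).resolve_right (by positivity)
  refine LinearMap.ext fun f => ?_
  rw [h1, h2, mul_comm, MvPolynomial.C_mul']; simp

/-- The oscillator operators `α_(p,k)`. -/
def creat (p : Fin 3) (k : ℤ) : Module.End ℚ Fock := if 0 ≤ k then yOp (p, k) else dOp (p, k)

/-- The oscillator operators `β_(p,k)`, dual to the `α_(p,k)`. -/
def annih (p : Fin 3) (k : ℤ) : Module.End ℚ Fock := if 0 ≤ k then dOp (p, k) else -yOp (p, k)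

variable {M : Type*} [AddCommGroup M] [Module ℚ M] (A B : Fin 3 → Fin 3 → ℚ)

theorem sum_smul_ite_right (s : Finset ℤ) (f : Fin 3 → ℤ → M) (q : Fin 3) (l : ℤ) :
    (∑ l' ∈ s, ∑ p, ∑ q', A p q' • if (q', l') = (q, l) then f p l' else 0) =
      if l ∈ s then ∑ p, A p q • f p l else 0 := by
  have : ∀ l' p, (∑ q', A p q' • if (q', l') = (q, l) then f p l' else 0) =
      if l' = l then A p q • f p l else 0 := fun l' p => by
    rw [Finset.sum_eq_single q (fun q' _ h => by simp [h]) (by simp)]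
    by_cases h : l' = l <;> simp [h]
  simp only [this]
  rw [Finset.sum_comm]
  simp only [Finset.sum_ite_eq']
  split_ifs <;> simp

theorem sum_smul_ite_left (s : Finset ℤ) (f : Fin 3 → ℤ → M) (q : Fin 3) (l n : ℤ) :
    (∑ l' ∈ s, ∑ p, ∑ q', A p q' • if (p, l' + n) = (q, l) then f q' l' else 0) =
      if l - n ∈ s then ∑ p, A q p • f p (l - n) else 0 := by
  have h := sum_smul_ite_right (fun p q => A q p) s f q (l - n)
  rw [← h]
  refine Finset.sum_congr rfl fun l' _ => ?_
  rw [Finset.sum_comm]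
  simp only [Prod.mk.injEq, eq_sub_iff_add_eq]

variable (n m : ℤ)

/-- Normal ordering splits the sum of the α_(p,l+n) β_(q,l) by the signs of l and l + n. Equal signs
give this derivation; l < 0 ≤ l + n gives multiplication by the finite sum `bandPoly`; l + n < 0 ≤ l
gives the finite second-order operator `bandDiff`. -/
def bandDer : Derivation ℚ Fock Fock := MvPolynomial.mkDerivation ℚ fun i =>
  if 0 ≤ i.2 then (if 0 ≤ i.2 + n then ∑ p, A p i.1 • MvPolynomial.X (p, i.2 + n) else 0)
  else if i.2 - n < 0 then -∑ p, A i.1 p • MvPolynomial.X (p, i.2 - n) else 0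

def bandPoly : Fock := -∑ l ∈ Ico (-n) 0, ∑ p, ∑ q,
  A p q • (MvPolynomial.X (p, l + n) * MvPolynomial.X (q, l))

def bandDiff : Module.End ℚ Fock := ∑ l ∈ Ico 0 (-n), ∑ p, ∑ q,
  A p q • (dOp (p, l + n) * dOp (q, l))

/-- The normally ordered quadratic operator `∑ A p q α_(p, l + n) β_(q, l)`. -/
def band : Module.End ℚ Fock :=
  (bandDer A n : Module.End ℚ Fock) + LinearMap.mulLeft ℚ (bandPoly A n) + bandDiff A n

theorem lie_eq_sub_apply (T Z : Module.End ℚ Fock) :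
    ⁅T, Z⁆ = (LinearMap.mulRight ℚ Z - LinearMap.mulLeft ℚ Z) T := rfl

theorem bandDiff_lie_dOp (i : Fin 3 × ℤ) : ⁅bandDiff A n, dOp i⁆ = 0 := by
  have h : ∀ j k, ⁅dOp j * dOp k, dOp i⁆ = 0 := fun j k => by
    have h1 := dOp_lie_dOp j i
    have h2 := dOp_lie_dOp k i
    rw [Ring.lie_def, sub_eq_zero] at h1 h2 ⊢
    rw [mul_assoc, h2, ← mul_assoc, h1, mul_assoc]
  rw [lie_eq_sub_apply]
  simp only [bandDiff, map_sum, map_smul, ← lie_eq_sub_apply, h, smul_zero, Finset.sum_const_zero]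

theorem bandDiff_lie_yOp (q : Fin 3) (l : ℤ) : ⁅bandDiff A n, yOp (q, l)⁆ =
    (if l ∈ Ico 0 (-n) then ∑ p, A p q • dOp (p, l + n) else 0) +
    if l - n ∈ Ico 0 (-n) then ∑ p, A q p • dOp (p, l - n) else 0 := by
  have h : ∀ j k i, ⁅dOp j * dOp k, yOp i⁆ =
      (if k = i then dOp j else 0) + if j = i then dOp k else 0 := fun j k i => by
    have h1 := dOp_lie_yOp j i
    have h2 := dOp_lie_yOp k i
    rw [Ring.lie_def, sub_eq_iff_eq_add] at h1 h2
    rw [Ring.lie_def, mul_assoc, h2, mul_add, ← mul_assoc, ← mul_assoc, h1]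
    split_ifs <;> noncomm_ring
  rw [lie_eq_sub_apply]
  simp only [bandDiff, map_sum, map_smul, ← lie_eq_sub_apply, h, smul_add, Finset.sum_add_distrib]
  rw [sum_smul_ite_right A _ (fun p l => dOp (p, l + n)), sum_smul_ite_left A _ fun p l => dOp (p, l)]

theorem pderiv_sum_X (f : Fin 3 → ℚ) (q : Fin 3) (l k : ℤ) :
    MvPolynomial.pderiv (q, l) (∑ p, f p • (MvPolynomial.X (p, k) : Fock)) =
      if k = l then MvPolynomial.C (f q) else 0 := by
  rw [map_sum, Finset.sum_eq_single q _ (by simp)]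
  · by_cases h : k = l <;> simp [MvPolynomial.pderiv_X, h, MvPolynomial.smul_eq_C_mul]
  · intro p _ h; simp [MvPolynomial.pderiv_X, h]

theorem sum_pderiv_X (f : Fin 3 → ℚ) (p : Fin 3) (l k : ℤ) :
    (∑ q, f q • (MvPolynomial.pderiv (q, l) : Derivation ℚ Fock Fock)) (MvPolynomial.X (p, k)) =
      if k = l then MvPolynomial.C (f p) else 0 := by
  rw [Fin.sum_univ_three]
  simp only [Derivation.add_apply, Derivation.smul_apply, MvPolynomial.pderiv_X, Pi.single_apply]
  by_cases h : k = l <;> fin_cases p <;> simp [h, MvPolynomial.smul_eq_C_mul]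

theorem bandDer_lie_dOp (q : Fin 3) (l : ℤ) : ⁅(bandDer A n : Module.End ℚ Fock), dOp (q, l)⁆ =
    if 0 ≤ l then (if 0 ≤ l - n then -∑ p, A q p • dOp (p, l - n) else 0)
    else if l + n < 0 then ∑ p, A p q • dOp (p, l + n) else 0 := by
  rw [← Derivation.commutator_coe_linear_map]
  have : ⁅bandDer A n, (MvPolynomial.pderiv (q, l) : Derivation ℚ Fock Fock)⁆ =
      if 0 ≤ l then (if 0 ≤ l - n then -∑ p, A q p • MvPolynomial.pderiv (p, l - n) else 0)
      else if l + n < 0 then ∑ p, A p q • MvPolynomial.pderiv (p, l + n) else 0 := by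
    refine MvPolynomial.derivation_ext fun k => ?_
    obtain ⟨p, k⟩ := k
    have hz : bandDer A n (Pi.single (M := fun _ => Fock) (q, l) 1 (p, k)) = 0 := by
      rw [Pi.single_apply]; split_ifs <;> simp
    rw [Derivation.commutator_apply, MvPolynomial.pderiv_X, hz, bandDer,
      MvPolynomial.mkDerivation_X, zero_sub]
    have e1 := sum_pderiv_X (fun p => A q p) p (l - n) k
    have e2 := sum_pderiv_X (fun p => A p q) p (l + n) k
    have e3 := pderiv_sum_X (fun p' => A p' p) q l (k + n)
    have e4 := pderiv_sum_X (fun p' => A p p') q l (k - n)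
    split_ifs at e1 e2 e3 e4 ⊢ <;> first
      | omega
      | simp only [Derivation.neg_apply, Derivation.zero_apply, map_neg, map_zero, neg_neg, neg_zero,
          e1, e2, e3, e4]
  rw [this]
  simp only [Fin.sum_univ_three]
  split_ifs <;> rfl

theorem mulLeft_bandPoly_lie_dOp (q : Fin 3) (l : ℤ) :
    ⁅LinearMap.mulLeft ℚ (bandPoly A n), dOp (q, l)⁆ =
    (if l ∈ Ico (-n) 0 then ∑ p, A p q • yOp (p, l + n) else 0) +
    if l - n ∈ Ico (-n) 0 then ∑ p, A q p • yOp (p, l - n) else 0 := by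
  have h : ∀ i j : Fin 3 × ℤ, MvPolynomial.pderiv (q, l) (MvPolynomial.X i * MvPolynomial.X j : Fock) =
      (if j = (q, l) then MvPolynomial.X i else 0) + if i = (q, l) then MvPolynomial.X j else 0 :=
    fun i j => by
      rw [Derivation.leibniz, MvPolynomial.pderiv_X, MvPolynomial.pderiv_X, Pi.single_apply,
        Pi.single_apply]
      split_ifs <;> simp
  rw [← lie_skew, derivation_lie_mulLeft, bandPoly, map_neg]
  simp only [map_sum, Derivation.map_smul, h, smul_add, Finset.sum_add_distrib]
  rw [sum_smul_ite_right A _ (fun p l => (MvPolynomial.X (p, l + n) : Fock)),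
    sum_smul_ite_left A _ fun p l => (MvPolynomial.X (p, l) : Fock)]
  have hm : ∀ a : Fock, LinearMap.mulLeft ℚ a = LinearMap.mul ℚ Fock a := fun _ => rfl
  simp only [yOp, hm]
  split_ifs <;> simp [map_sum, map_smul, map_add, map_neg]

theorem band_lie_creat (q : Fin 3) (l : ℤ) :
    ⁅band A n, creat q l⁆ = ∑ p, A p q • creat p (l + n) := by
  rw [band, add_lie, add_lie]
  unfold creat
  by_cases h : 0 ≤ l
  · rw [if_pos h, derivation_lie_mulLeft, mulLeft_lie_mulLeft, bandDiff_lie_yOp, bandDer,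
      MvPolynomial.mkDerivation_X]
    have hm : ∀ a : Fock, LinearMap.mulLeft ℚ a = LinearMap.mul ℚ Fock a := fun _ => rfl
    by_cases h1 : 0 ≤ l + n
    · simp [h, h1, show ¬ l < -n by omega, show ¬ l - n < -n by omega, hm, map_sum]
    · simp [h, h1, show l < -n by omega, show ¬ l - n < -n by omega, hm]
  · rw [if_neg h, bandDer_lie_dOp, mulLeft_bandPoly_lie_dOp, bandDiff_lie_dOp]
    by_cases h1 : 0 ≤ l + n
    · simp [h, h1, show ¬ l + n < 0 by omega, show l < 0 by omega, show -n ≤ l by omega, show ¬ -n ≤ l - n by omega]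
    · simp [h, h1, show l + n < 0 by omega, show ¬ -n ≤ l by omega, show ¬ -n ≤ l - n by omega]

theorem band_lie_annih (q : Fin 3) (l : ℤ) :
    ⁅band A n, annih q l⁆ = -∑ p, A q p • annih p (l - n) := by
  rw [band, add_lie, add_lie]
  unfold annih
  have hm : ∀ a : Fock, LinearMap.mulLeft ℚ a = LinearMap.mul ℚ Fock a := fun _ => rfl
  by_cases h : 0 ≤ l
  · rw [if_pos h, bandDer_lie_dOp, mulLeft_bandPoly_lie_dOp, bandDiff_lie_dOp]
    by_cases h1 : n ≤ l
    · simp [h, h1, show ¬ l < 0 by omega]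
    · simp [h, h1, show l < n by omega, show ¬ l < 0 by omega]
  · rw [if_neg h, lie_neg, lie_neg, lie_neg, derivation_lie_mulLeft, mulLeft_lie_mulLeft,
      bandDiff_lie_yOp, bandDer, MvPolynomial.mkDerivation_X]
    by_cases h1 : n ≤ l
    · simp [h, h1, show l - n < -n by omega, show ¬ l < n by omega, hm]
    · simp [h, h1, show l < n by omega, hm, map_sum]

theorem constantCoeff_band_mul (p q : Fin 3) {k l : ℤ} (hk : 0 ≤ k) (hl : l < 0) :
    MvPolynomial.constantCoeff (band A n (MvPolynomial.X (p, k) * MvPolynomial.X (q, l))) =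
      if k + n = l then A q p else 0 := by
  have h1 := LinearMap.congr_fun (band_lie_creat A n p k) (MvPolynomial.X (q, l))
  have h2 : ∀ s, MvPolynomial.constantCoeff (creat s (k + n) (MvPolynomial.X (q, l))) =
      if k + n = l then (if q = s then 1 else 0) else 0 := fun s => by
    unfold creat
    split_ifs with h3 h4 h5 h4 h5
    · omega
    · omega
    · simp
    · subst h5; simp [h4]
    · subst h4; simp [MvPolynomial.pderiv_X, h5]
    · simp [MvPolynomial.pderiv_X, Ne.symm h4]
  rw [Ring.lie_def, LinearMap.sub_apply, Module.End.mul_apply, Module.End.mul_apply, creat, if_pos hk,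
    sub_eq_iff_eq_add] at h1
  have h3 := congrArg MvPolynomial.constantCoeff h1
  rw [LinearMap.mulLeft_apply] at h3
  rw [h3, map_add, LinearMap.mulLeft_apply, map_mul, MvPolynomial.constantCoeff_X, zero_mul, add_zero,
    LinearMap.sum_apply, map_sum]
  simp only [LinearMap.smul_apply, MvPolynomial.constantCoeff_smul, h2]
  split_ifs <;> simp

theorem band_one : band A n 1 = bandPoly A n := by
  simp [band, bandDiff, LinearMap.sum_apply]

theorem constantCoeff_bandPoly : MvPolynomial.constantCoeff (bandPoly A n) = 0 := by
  simp [bandPoly]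

/-- The anomaly of normal ordering: each of the max(m, 0) modes of the quadratic polynomial
contributes one contraction, equal to minus the trace of the product of the matrices. -/
theorem constantCoeff_band_bandPoly : MvPolynomial.constantCoeff (band A n (bandPoly B m)) =
    if n + m = 0 then -((max m 0 : ℤ) : ℚ) * ∑ p, ∑ q, A p q * B q p else 0 := by
  rw [bandPoly, map_neg, map_neg]
  simp only [map_sum, map_smul, MvPolynomial.constantCoeff_smul]
  have : ∀ l ∈ Ico (-m) 0, (∑ p, ∑ q, B p q • MvPolynomial.constantCoeff
      (band A n (MvPolynomial.X (p, l + m) * MvPolynomial.X (q, l)))) =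
      if n + m = 0 then ∑ p, ∑ q, A p q * B q p else 0 := fun l hl => by
    rw [Finset.mem_Ico] at hl
    rw [Finset.sum_comm]
    simp only [constantCoeff_band_mul A n _ _ (show 0 ≤ l + m by omega) hl.2]
    split_ifs with h1 h2 h2
    · simp only [smul_eq_mul, mul_comm]
    · omega
    · omega
    · simp
  rw [Finset.sum_congr rfl this, Finset.sum_const, Int.card_Ico]
  have : (((0 - -m).toNat : ℕ) : ℚ) = ((max m 0 : ℤ) : ℚ) := by
    rw [sub_neg_eq_add, zero_add, ← Int.toNat_eq_max]; norm_cast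
  split_ifs <;> simp only [nsmul_eq_mul, this, mul_zero, neg_zero, neg_mul]

theorem ext_lie {C D : Module.End ℚ Fock} (h1 : ∀ p k, ⁅C, creat p k⁆ = ⁅D, creat p k⁆)
    (h2 : ∀ p k, ⁅C, annih p k⁆ = ⁅D, annih p k⁆) :
    C = D + MvPolynomial.constantCoeff (C 1 - D 1) • 1 := by
  rw [← sub_eq_iff_eq_add']
  refine eq_smul_one_of_lie_eq_zero (fun i => ?_) fun i => ?_
  · rw [sub_lie, sub_eq_zero]
    have := h1 i.1 i.2; have h3 := h2 i.1 i.2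
    unfold creat at this; unfold annih at h3
    split_ifs at this h3
    · exact this
    · rwa [lie_neg, lie_neg, neg_inj] at h3
  · rw [sub_lie, sub_eq_zero]
    have := h1 i.1 i.2; have h3 := h2 i.1 i.2
    unfold creat at this; unfold annih at h3
    split_ifs at this h3
    · exact h3
    · exact this

/-- The operators `band` satisfy the relations of the matrix loop algebra up to a cocycle. -/
theorem band_lie_band :
    ⁅band A n, band B m⁆ = band (fun p q => ∑ s, (A p s * B s q - B p s * A s q)) (n + m) +
      (if n + m = 0 then (n : ℚ) * ∑ p, ∑ q, A p q * B q p else 0) • 1 := by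
  have hsum : ∀ (T : Module.End ℚ Fock) (f : Fin 3 → ℚ) (Z : Fin 3 → Module.End ℚ Fock),
      ⁅T, ∑ p, f p • Z p⁆ = ∑ p, f p • ⁅T, Z p⁆ := fun T f Z => by
    simp only [Ring.lie_def, Finset.mul_sum, Finset.sum_mul, mul_smul_comm, smul_mul_assoc,
      ← Finset.sum_sub_distrib]
    exact Finset.sum_congr rfl fun p _ => (smul_sub _ _ _).symm
  -- Both sides have the same brackets with all oscillators, by the Jacobi identity, so they differ
  -- by a scalar. The scalar is read off from the value at the vacuum 1, where the two anomalies
  -- combine through max(n, 0) - max(-n, 0) = n.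
  rw [ext_lie (C := ⁅band A n, band B m⁆)
    (D := band (fun p q => ∑ s, (A p s * B s q - B p s * A s q)) (n + m))]
  · congr 2
    rw [Ring.lie_def, LinearMap.sub_apply, Module.End.mul_apply, Module.End.mul_apply, band_one,
      band_one, band_one, map_sub, map_sub, constantCoeff_bandPoly, constantCoeff_band_bandPoly,
      constantCoeff_band_bandPoly, add_comm m n, sub_zero, Finset.sum_comm]
    split_ifs with h
    · obtain rfl : m = -n := by omega
      simp only [mul_comm (B _ _)]
      rw [← sub_mul]
      congr 1
      have : max n 0 - max (-n) 0 = n := by omega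
      rw [neg_sub_neg, ← Int.cast_sub, this]
    · simp
  · intro q l
    rw [lie_lie, band_lie_creat, band_lie_creat, band_lie_creat, hsum, hsum]
    simp only [band_lie_creat, Fin.sum_univ_three, add_assoc, add_comm m n]
    module
  · intro q l
    rw [lie_lie, band_lie_annih, band_lie_annih, band_lie_annih, lie_neg, lie_neg, hsum, hsum]
    simp only [band_lie_annih, Fin.sum_univ_three, sub_sub, add_comm m n]
    module

end Fock

/-! ### The Drinfeld generators as twisted loop matrices, and dual functionals -/

section Representation

attribute [local instance] LieRing.ofAssociativeRing

section OfRel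

variable {B : Type*} [Ring B] [Algebra ℚ B] (f : Gen → B)
  (hf : ∀ a b, Rel a b → FreeLieAlgebra.lift ℚ f a = FreeLieAlgebra.lift ℚ f b)

/-- The algebra map out of `U` given by elements satisfying the defining relations. -/
def ofRel : U →ₐ[ℚ] B := UniversalEnvelopingAlgebra.lift ℚ
  { Submodule.liftQ relIdeal.toSubmodule (FreeLieAlgebra.lift ℚ f : Free →ₗ[ℚ] B) (by
      have : relIdeal ≤ (FreeLieAlgebra.lift ℚ f).ker := LieSubmodule.lieSpan_le.2 (by
        rintro _ ⟨a, b, h, rfl⟩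
        rw [SetLike.mem_coe, LieHom.mem_ker, map_sub, hf a b h, sub_self])
      exact fun z hz => LieHom.mem_ker.1 (this hz)) with
    map_lie' := fun {a b} => by
      obtain ⟨a, rfl⟩ := Submodule.Quotient.mk_surjective _ a
      obtain ⟨b, rfl⟩ := Submodule.Quotient.mk_surjective _ b
      exact LieHom.map_lie (FreeLieAlgebra.lift ℚ f) a b }

theorem ofRel_toU (g : Gen) : ofRel f hf (toU g) = f g := by
  rw [ofRel, toU, UniversalEnvelopingAlgebra.lift_ι_apply]
  exact FreeLieAlgebra.lift_of_apply f g

end OfRel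

/-- The matrices of the Drinfeld generators. -/
def genMat : Gen → Fin 3 → Fin 3 → ℚ
  | .c => 0
  | .h r => ![![2, 0, 0], ![0, -2 + 2 * (-1) ^ r, 0], ![0, 0, -2 * (-1) ^ r]]
  | .x σ r => if σ = 1 then ![![0, 2, 0], ![0, 0, (-1) ^ r], ![0, 0, 0]]
      else ![![0, 0, 0], ![1, 0, 0], ![0, 2 * (-1) ^ r, 0]]
  | .X σ _ => if σ = 1 then ![![0, 0, 4], ![0, 0, 0], ![0, 0, 0]]
      else ![![0, 0, 0], ![0, 0, 0], ![4, 0, 0]]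

/-- The degrees of the Drinfeld generators. -/
def genDeg : Gen → ℤ
  | .c => 0
  | .h r => r
  | .x _ r => r
  | .X _ m => 2 * m + 1

/-- The value 4 is the trace of the product of the matrices of x⁺_r and x⁻_{-r}, so that the cocycle
r · 4 matches the central term rc. -/
def genLevel : Gen → ℚ
  | .c => 4
  | _ => 0

def genOp (g : Gen) : Module.End ℚ Fock := band (genMat g) (genDeg g) + genLevel g • 1

theorem band_smul (t : ℚ) (A : Fin 3 → Fin 3 → ℚ) (n : ℤ) : band (t • A) n = t • band A n := by
  have h1 : bandDer (t • A) n = t • bandDer A n := by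
    refine MvPolynomial.derivation_ext fun i => ?_
    rw [Derivation.smul_apply, bandDer, bandDer, MvPolynomial.mkDerivation_X,
      MvPolynomial.mkDerivation_X]
    split_ifs <;> simp [Finset.smul_sum, smul_smul]
  have h2 : bandPoly (t • A) n = t • bandPoly A n := by
    simp [bandPoly, Finset.smul_sum, smul_smul]
  have h3 : bandDiff (t • A) n = t • bandDiff A n := by
    simp [bandDiff, Finset.smul_sum, smul_smul]
  have hm : ∀ a : Fock, LinearMap.mulLeft ℚ a = LinearMap.mul ℚ Fock a := fun _ => rfl
  rw [band, band, h1, h2, h3, hm, hm, map_smul, smul_add, smul_add, Derivation.coe_smul_linearMap]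

theorem band_zero (n : ℤ) : band 0 n = 0 := by
  have := band_smul 0 0 n
  rwa [zero_smul, zero_smul] at this

theorem genOp_c : genOp .c = (4 : ℚ) • 1 := by
  rw [genOp, genMat, band_zero, zero_add, genLevel]

/-- Reduces each defining relation to a 3 × 3 matrix identity and a trace identity for the central
term. When t = 0 the target generator is a dummy and its degree is irrelevant. -/
theorem genOp_lie {g g' g'' : Gen} {t u : ℚ} (hd : t = 0 ∨ genDeg g + genDeg g' = genDeg g'')
    (hA : ∀ p q, ∑ s, (genMat g p s * genMat g' s q - genMat g' p s * genMat g s q) =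
      t * genMat g'' p q)
    (hu : (if genDeg g + genDeg g' = 0 then
      (genDeg g : ℚ) * ∑ p, ∑ q, genMat g p q * genMat g' q p else 0) = t * genLevel g'' + 4 * u) :
    ⁅genOp g, genOp g'⁆ = t • genOp g'' + u • genOp .c := by
  have h1 : ⁅genOp g, genOp g'⁆ = ⁅band (genMat g) (genDeg g), band (genMat g') (genDeg g')⁆ := by
    rw [genOp, genOp, Ring.lie_def, Ring.lie_def]
    simp only [mul_add, add_mul, mul_smul_comm, smul_mul_assoc, mul_one, one_mul, smul_add]
    module
  have h2 : (fun p q => ∑ s, (genMat g p s * genMat g' s q - genMat g' p s * genMat g s q)) =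
      t • genMat g'' := by
    funext p q; exact hA p q
  rw [h1, band_lie_band, h2, band_smul, hu, genOp_c, genOp]
  rcases hd with rfl | hd
  · module
  · rw [hd]; module

theorem genOp_rel (a b : Free) (h : Rel a b) :
    FreeLieAlgebra.lift ℚ genOp a = FreeLieAlgebra.lift ℚ genOp b := by
  have hsq : ∀ r : ℤ, ((-1 : ℚ) ^ r) ^ 2 = 1 := fun r => by
    rw [← zpow_natCast, zpow_comm]; simp
  have hadd : ∀ r s : ℤ, (-1 : ℚ) ^ (r + s) = (-1) ^ r * (-1) ^ s := fun r s =>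
    zpow_add₀ (by norm_num) _ _
  have h2 : ∀ m : ℤ, (-1 : ℚ) ^ (2 * m) = 1 := fun m => Even.neg_one_zpow ⟨m, two_mul m⟩
  have hsub : ∀ r : ℤ, (-1 : ℚ) ^ (r - 1) = -(-1) ^ r := fun r => by
    rw [zpow_sub₀ (by norm_num), zpow_one]; ring
  have hs1 : sgn 1 = 1 := by norm_num [sgn]
  have hs2 : sgn (-1) = -1 := by norm_num [sgn]
  cases h <;> simp only [LieHom.map_lie, map_smul, map_add, map_zero, FreeLieAlgebra.lift_of_apply]
  case c_central g => rw [genOp_c, Ring.lie_def, smul_one_mul, mul_smul_one, sub_self]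
  case h_h r s =>
    have := genOp_lie (g := .h r) (g' := .h s) (g'' := .c) (t := 0)
      (u := (if r + s = 0 then 2 * (r : ℚ) * (2 + (-1 : ℚ) ^ (r - 1)) else 0)) (Or.inl rfl)
      (fun p q => by fin_cases p <;> fin_cases q <;> simp [genMat, Fin.sum_univ_three, mul_comm])
      (by
        simp only [genDeg]
        split_ifs with h
        · obtain rfl : s = -r := by omega
          have := hsq r
          simp [genMat, Fin.sum_univ_three, hsub]
          clear hsq hadd h2 hsub
          grind
        · simp [h])
    rwa [zero_smul, zero_add] at this
  case h_x σ r s =>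
    have := genOp_lie (g := .h r) (g' := .x σ s) (g'' := .x σ (r + s))
      (t := sgn σ * (2 * (2 + (-1 : ℚ) ^ (r - 1)))) (u := 0) (Or.inr rfl) (by
        have := hsq r
        rcases Int.units_eq_one_or σ with rfl | rfl <;> (try simp only [hs1, hs2]) <;> intro p q <;> fin_cases p <;> fin_cases q <;>
          simp [genMat, Fin.sum_univ_three, hsub, hadd] <;> clear hsq hadd h2 hsub <;> grind) (by
        rcases Int.units_eq_one_or σ with rfl | rfl <;>
          simp [genMat, Fin.sum_univ_three, genLevel])
    rwa [zero_smul, add_zero] at this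
  case h_X_even σ n m =>
    have := genOp_lie (g := .h (2 * n)) (g' := .X σ m) (g'' := .X σ (n + m))
      (t := sgn σ * 4) (u := 0) (Or.inr (by simp only [genDeg]; ring)) (by
        rcases Int.units_eq_one_or σ with rfl | rfl <;> (try simp only [hs1, hs2]) <;> intro p q <;> fin_cases p <;> fin_cases q <;>
          simp [genMat, Fin.sum_univ_three, h2] <;> norm_num) (by
        rcases Int.units_eq_one_or σ with rfl | rfl <;>
          simp [genMat, Fin.sum_univ_three, genLevel])
    rwa [zero_smul, add_zero] at this
  case h_X_odd σ n m =>
    have := genOp_lie (g := .h (2 * n + 1)) (g' := .X σ m) (g'' := .c)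
      (t := 0) (u := 0) (Or.inl rfl) (by
        rcases Int.units_eq_one_or σ with rfl | rfl <;> intro p q <;> fin_cases p <;> fin_cases q <;>
          simp [genMat, Fin.sum_univ_three, h2, hadd] <;> norm_num) (by
        rcases Int.units_eq_one_or σ with rfl | rfl <;>
          simp [genMat, Fin.sum_univ_three, genLevel])
    rwa [zero_smul, add_zero] at this
  case x_x_even σ r s h =>
    have := genOp_lie (g := .x σ r) (g' := .x σ s) (g'' := .c)
      (t := 0) (u := 0) (Or.inl rfl) (by
        have e : (-1 : ℚ) ^ r * (-1) ^ s = 1 := by rw [← hadd]; exact h.neg_one_zpow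
        have := hsq r
        have := hsq s
        rcases Int.units_eq_one_or σ with rfl | rfl <;> intro p q <;> fin_cases p <;> fin_cases q <;>
          simp [genMat, Fin.sum_univ_three] <;> clear hsq hadd h2 hsub <;> grind) (by
        rcases Int.units_eq_one_or σ with rfl | rfl <;>
          simp [genMat, Fin.sum_univ_three, genLevel])
    rwa [zero_smul, add_zero] at this
  case x_x_odd σ r s m h =>
    have := genOp_lie (g := .x σ r) (g' := .x σ s) (g'' := .X σ m)
      (t := sgn σ * (-1 : ℚ) ^ s) (u := 0) (Or.inr h) (by
        have e : (-1 : ℚ) ^ r * (-1) ^ s = -1 := by rw [← hadd, h, hadd, h2]; simp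
        have := hsq r
        have := hsq s
        rcases Int.units_eq_one_or σ with rfl | rfl <;> (try simp only [hs1, hs2]) <;> intro p q <;> fin_cases p <;> fin_cases q <;>
          simp [genMat, Fin.sum_univ_three] <;> clear hsq hadd h2 hsub <;> grind) (by
        rcases Int.units_eq_one_or σ with rfl | rfl <;>
          simp [genMat, Fin.sum_univ_three, genLevel])
    rwa [zero_smul, add_zero] at this
  case x_X_same σ r m =>
    have := genOp_lie (g := .x σ r) (g' := .X σ m) (g'' := .c)
      (t := 0) (u := 0) (Or.inl rfl) (by
        rcases Int.units_eq_one_or σ with rfl | rfl <;> intro p q <;> fin_cases p <;> fin_cases q <;>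
          simp [genMat, Fin.sum_univ_three]) (by
        rcases Int.units_eq_one_or σ with rfl | rfl <;>
          simp [genMat, Fin.sum_univ_three, genLevel])
    rwa [zero_smul, add_zero] at this
  case X_X_same σ r m =>
    have := genOp_lie (g := .X σ r) (g' := .X σ m) (g'' := .c)
      (t := 0) (u := 0) (Or.inl rfl) (by
        rcases Int.units_eq_one_or σ with rfl | rfl <;> intro p q <;> fin_cases p <;> fin_cases q <;>
          simp [genMat]) (by
        rcases Int.units_eq_one_or σ with rfl | rfl <;>
          simp [genMat, Fin.sum_univ_three, genLevel])
    rwa [zero_smul, add_zero] at this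
  case x_x_opp r s =>
    have := genOp_lie (g := .x 1 r) (g' := .x (-1) s) (g'' := .h (r + s))
      (t := 1) (u := if r + s = 0 then (r : ℚ) else 0) (Or.inr rfl) (by
        intro p q
        fin_cases p <;> fin_cases q <;>
          simp [genMat, Fin.sum_univ_three, hadd] <;> ring) (by
        simp only [genDeg]
        split_ifs with h
        · obtain rfl : s = -r := by omega
          have := hsq r
          simp [genMat, Fin.sum_univ_three, genLevel]
          clear hsq hadd h2 hsub
          grind
        · simp [genLevel, h])
    rwa [one_smul] at this
  case x_X_opp σ r m =>
    have := genOp_lie (g := .x σ r) (g' := .X (-σ) m) (g'' := .x (-σ) (r + (2 * m + 1)))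
      (t := sgn σ * ((-1 : ℚ) ^ r * 4)) (u := 0) (Or.inr rfl) (by
        have := hsq r
        rcases Int.units_eq_one_or σ with rfl | rfl <;> (try simp only [hs1, hs2]) <;> intro p q <;> fin_cases p <;> fin_cases q <;>
          simp [genMat, Fin.sum_univ_three, hadd, h2] <;> clear hsq hadd h2 hsub <;> grind) (by
        rcases Int.units_eq_one_or σ with rfl | rfl <;>
          simp [genMat, Fin.sum_univ_three, genLevel])
    rwa [zero_smul, add_zero] at this
  case X_X_opp n m =>
    have := genOp_lie (g := .X 1 n) (g' := .X (-1) m) (g'' := .h ((2 * n + 1) + (2 * m + 1)))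
      (t := 8) (u := if (2 * n + 1) + (2 * m + 1) = 0 then 4 * ((2 * n + 1 : ℤ) : ℚ) else 0)
      (Or.inr rfl) (by
        intro p q
        fin_cases p <;> fin_cases q <;>
          simp [genMat, Fin.sum_univ_three, hadd, h2] <;> norm_num) (by
        simp only [genDeg]
        split_ifs with h
        · simp [genMat, Fin.sum_univ_three, genLevel, h]; ring
        · simp [genLevel, h])
    exact this

/-- The oscillator representation of `U`. -/
def rho : U →ₐ[ℚ] Module.End ℚ Fock := ofRel genOp genOp_rel

/-- The augmentation of `U`. -/
def aug : U →ₐ[ℚ] ℚ := UniversalEnvelopingAlgebra.lift ℚ 0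

theorem aug_toU (g : Gen) : aug (toU g) = 0 := by
  rw [aug, toU, UniversalEnvelopingAlgebra.lift_ι_apply]; rfl

/-- The matrix entry at `(p, q)` in degree `n`. -/
def entry (p q : Fin 3) (n : ℤ) : U →ₗ[ℚ] ℚ :=
  -- The offset |n| keeps both the source mode |n| and the target mode |n| + n nonnegative, so both
  -- are variables of the polynomial ring. Subtracting the variable times the vacuum value leaves,
  -- for a generator, its commutator with multiplication by that variable.
  MvPolynomial.lcoeff ℚ (Finsupp.single (p, |n| + n) 1) ∘ₗ
    (LinearMap.applyₗ (MvPolynomial.X (q, |n|)) -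
      LinearMap.mulLeft ℚ (MvPolynomial.X (q, |n|)) ∘ₗ LinearMap.applyₗ 1) ∘ₗ rho.toLinearMap

theorem entry_apply (p q : Fin 3) (n : ℤ) (u : U) : entry p q n u =
    MvPolynomial.coeff (Finsupp.single (p, |n| + n) 1)
      (rho u (MvPolynomial.X (q, |n|)) - MvPolynomial.X (q, |n|) * rho u 1) := rfl

theorem entry_one (p q : Fin 3) (n : ℤ) : entry p q n 1 = 0 := by
  rw [entry_apply, map_one]; simp

theorem entry_toU (p q : Fin 3) (n : ℤ) (g : Gen) :
    entry p q n (toU g) = if genDeg g = n then genMat g p q else 0 := by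
  have h1 : rho (toU g) (MvPolynomial.X (q, |n|)) - MvPolynomial.X (q, |n|) * rho (toU g) 1 =
      ∑ s, genMat g s q • creat s (|n| + genDeg g) 1 := by
    have h2 := LinearMap.congr_fun (band_lie_creat (genMat g) (genDeg g) q |n|) 1
    rw [creat, if_pos (abs_nonneg n), LinearMap.sum_apply] at h2
    simp only [Ring.lie_def, LinearMap.sub_apply, Module.End.mul_apply, LinearMap.mulLeft_apply,
      mul_one, LinearMap.smul_apply] at h2
    rw [← h2, rho, ofRel_toU, genOp]
    simp only [LinearMap.add_apply, LinearMap.smul_apply, Module.End.one_apply, mul_add,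
      mul_smul_comm, mul_one]
    abel
  have h2 : ∀ s, MvPolynomial.coeff (Finsupp.single (p, |n| + n) 1) (creat s (|n| + genDeg g) 1) =
      if genDeg g = n then (if s = p then 1 else 0) else 0 := fun s => by
    have hn : 0 ≤ |n| + n := by have := neg_abs_le n; omega
    unfold creat
    split_ifs with h3 h4 h5 h4 h5
    · subst h4 h5; simp
    · simp [MvPolynomial.coeff_X, Finsupp.single_left_inj, h5]
    · simp [MvPolynomial.coeff_X, Finsupp.single_left_inj, h4]
    · omega
    · omega
    · simp
  rw [entry_apply, h1, MvPolynomial.coeff_sum]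
  simp only [MvPolynomial.coeff_smul, h2]
  split_ifs <;> simp

/-- The generators are independent of each other and of `1`, in a strong form. -/
theorem exists_dual : ∃ lam : Gen → U →ₗ[ℚ] ℚ, (∀ g, lam g 1 = 0) ∧ (∀ g, lam g (toU g) = 1) ∧
    ∀ g g', g' ≠ g → lam g (toU g') = 0 := by
  suffices H : ∀ g, ∃ l : U →ₗ[ℚ] ℚ, l 1 = 0 ∧ l (toU g) = 1 ∧ ∀ g', g' ≠ g → l (toU g') = 0 by
    choose l h1 h2 h3 using H
    exact ⟨l, h1, h2, fun g g' => h3 g g'⟩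
  -- It suffices that some matrix position is occupied by g alone among the generators of its
  -- degree.
  have key : ∀ g (p q : Fin 3), genMat g p q ≠ 0 → (∀ g', g' ≠ g → genDeg g' = genDeg g →
      genMat g' p q = 0) → ∃ l : U →ₗ[ℚ] ℚ, l 1 = 0 ∧ l (toU g) = 1 ∧
      ∀ g', g' ≠ g → l (toU g') = 0 := fun g p q h1 h2 => by
    refine ⟨(genMat g p q)⁻¹ • entry p q (genDeg g), ?_, ?_, fun g' hg => ?_⟩
    · rw [LinearMap.smul_apply, entry_one, smul_zero]
    · rw [LinearMap.smul_apply, entry_toU, if_pos rfl, smul_eq_mul, inv_mul_cancel₀ h1]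
    · rw [LinearMap.smul_apply, entry_toU]
      split_ifs with h
      · rw [h2 g' hg h, smul_zero]
      · rw [smul_zero]
  intro g
  cases g with
  | c =>
    -- The matrix of c is zero, so c is detected by its level: the constant term of its value at the
    -- vacuum. The quadratic parts have no constant term there, and a multiple of the augmentation
    -- corrects the value at 1.
    let l : U →ₗ[ℚ] ℚ := (4 : ℚ)⁻¹ • MvPolynomial.lcoeff ℚ 0 ∘ₗ LinearMap.applyₗ 1 ∘ₗ rho.toLinearMap
    have hl : ∀ u, l u = (4 : ℚ)⁻¹ * MvPolynomial.coeff 0 (rho u 1) := fun u => rfl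
    have hg : ∀ g, l (toU g) = 4⁻¹ * genLevel g := fun g => by
      have := constantCoeff_bandPoly (genMat g) (genDeg g)
      rw [MvPolynomial.constantCoeff_eq] at this
      rw [hl, rho, ofRel_toU, genOp, LinearMap.add_apply, band_one, MvPolynomial.coeff_add, this]
      simp
    refine ⟨l - l 1 • aug.toLinearMap, ?_, ?_, fun g' hg' => ?_⟩
    · simp
    · simp [aug_toU, hg, genLevel]
    · rw [LinearMap.sub_apply, hg, LinearMap.smul_apply, AlgHom.toLinearMap_apply, aug_toU, smul_zero,
        sub_zero]
      cases g' <;> simp_all [genLevel]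
  | h r =>
    refine key _ 0 0 (by simp [genMat]) fun g' h1 h2 => ?_
    cases g' with
    | c => rfl
    | h s => exact absurd (congrArg Gen.h h2) h1
    | x τ s => simp only [genMat]; split_ifs <;> rfl
    | X τ s => simp only [genMat]; split_ifs <;> rfl
  | x σ r =>
    rcases Int.units_eq_one_or σ with rfl | rfl
    · refine key _ 0 1 (by simp [genMat]) fun g' h1 h2 => ?_
      cases g' with
      | c => rfl
      | h s => rfl
      | x τ s =>
        obtain rfl : s = r := h2
        have : τ ≠ 1 := by rintro rfl; exact h1 rfl
        simp only [genMat, if_neg this]; rfl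
      | X τ s => simp only [genMat]; split_ifs <;> rfl
    · refine key _ 1 0 (by simp [genMat]) fun g' h1 h2 => ?_
      cases g' with
      | c => rfl
      | h s => rfl
      | x τ s =>
        obtain rfl : s = r := h2
        have : τ = 1 := (Int.units_eq_one_or τ).resolve_right (by rintro rfl; exact h1 rfl)
        simp only [genMat, if_pos this]; rfl
      | X τ s => simp only [genMat]; split_ifs <;> rfl
  | X σ r =>
    rcases Int.units_eq_one_or σ with rfl | rfl
    · refine key _ 0 2 (by simp [genMat]) fun g' h1 h2 => ?_
      cases g' with
      | c => rfl
      | h s => rfl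
      | x τ s => simp only [genMat]; split_ifs <;> rfl
      | X τ s =>
        obtain rfl : s = r := by simpa [genDeg] using h2
        have : τ ≠ 1 := by rintro rfl; exact h1 rfl
        simp only [genMat, if_neg this]; rfl
    · refine key _ 2 0 (by simp [genMat]) fun g' h1 h2 => ?_
      cases g' with
      | c => rfl
      | h s => rfl
      | x τ s => simp only [genMat]; split_ifs <;> rfl
      | X τ s =>
        obtain rfl : s = r := by simpa [genDeg] using h2
        have : τ = 1 := (Int.units_eq_one_or τ).resolve_right (by rintro rfl; exact h1 rfl)
        simp only [genMat, if_pos this]; rfl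

end Representation

/-! ### Comultiplication and independence of words up to permutation -/

section Coproduct

open scoped TensorProduct

attribute [local instance] LieRing.ofAssociativeRing

/-- The comultiplication of `U`. -/
def comul : U →ₐ[ℚ] U ⊗[ℚ] U := UniversalEnvelopingAlgebra.lift ℚ
  { toFun := fun z => UniversalEnvelopingAlgebra.ι ℚ z ⊗ₜ 1 + 1 ⊗ₜ UniversalEnvelopingAlgebra.ι ℚ z
    map_add' := fun a b => by
      simp only [map_add, TensorProduct.add_tmul, TensorProduct.tmul_add]; abel
    map_smul' := fun t a => by
      simp only [map_smul, TensorProduct.smul_tmul', TensorProduct.tmul_smul, smul_add,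
        RingHom.id_apply]
    map_lie' := fun {a b} => by
      simp only [LieHom.map_lie, Ring.lie_def, mul_add, add_mul,
        Algebra.TensorProduct.tmul_mul_tmul, mul_one, one_mul, TensorProduct.sub_tmul,
        TensorProduct.tmul_sub]
      abel }

theorem comul_toU (g : Gen) : comul (toU g) = toU g ⊗ₜ 1 + 1 ⊗ₜ toU g := by
  rw [comul, toU, UniversalEnvelopingAlgebra.lift_ι_apply]; rfl

/-- The ordered product of a list of generators. -/
def word (J : List Gen) : U := (J.map toU).prod

theorem word_cons (g : Gen) (J : List Gen) : word (g :: J) = toU g * word J := by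
  rw [word, List.map_cons, List.prod_cons, word]

theorem word_append (J K : List Gen) : word (J ++ K) = word J * word K := by
  rw [word, List.map_append, List.prod_append, word, word]

/-- All ways of splitting a list into two complementary sublists. -/
def splits : List Gen → List (List Gen × List Gen)
  | [] => [([], [])]
  | g :: J => (splits J).map (fun p => (g :: p.1, p.2)) ++ (splits J).map (fun p => (p.1, g :: p.2))

theorem comul_word (J : List Gen) :
    comul (word J) = ((splits J).map fun p => word p.1 ⊗ₜ[ℚ] word p.2).sum := by
  induction J with
  | nil => simp [word, splits, Algebra.TensorProduct.one_def]
  | cons g J ih =>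
    rw [word_cons, map_mul, comul_toU, ih, add_mul, ← List.sum_map_mul_left, ← List.sum_map_mul_left,
      splits, List.map_append, List.sum_append, List.map_map, List.map_map]
    simp only [Function.comp_def, Algebra.TensorProduct.tmul_mul_tmul, one_mul, word_cons]

theorem perm_of_mem_splits {J : List Gen} : ∀ {p}, p ∈ splits J → (p.1 ++ p.2).Perm J := by
  induction J with
  | nil => intro p hp; simp only [splits, List.mem_singleton] at hp; subst hp; rfl
  | cons g J ih =>
    intro p hp
    simp only [splits, List.mem_append, List.mem_map] at hp
    obtain ⟨q, hq, rfl⟩ | ⟨q, hq, rfl⟩ := hp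
    · exact (ih hq).cons g
    · exact List.perm_middle.trans ((ih hq).cons g)

theorem nil_mem_splits (J : List Gen) : ([], J) ∈ splits J := by
  induction J with
  | nil => simp [splits]
  | cons g J ih => exact List.mem_append_right _ (List.mem_map.2 ⟨_, ih, rfl⟩)

theorem exists_singleton_mem_splits {J : List Gen} {g : Gen} (h : g ∈ J) :
    ∃ T, ([g], T) ∈ splits J := by
  induction J with
  | nil => simp at h
  | cons g' J ih =>
    rcases List.mem_cons.1 h with rfl | h
    · exact ⟨J, List.mem_append_left _ (List.mem_map.2 ⟨_, nil_mem_splits J, rfl⟩)⟩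
    · obtain ⟨T, hT⟩ := ih h
      exact ⟨g' :: T, List.mem_append_right _ (List.mem_map.2 ⟨_, hT, rfl⟩)⟩

/-- The functionals on `U` dual to a list of functionals, through the comultiplication. -/
def pairing (lam : Gen → U →ₗ[ℚ] ℚ) : List Gen → U →ₗ[ℚ] ℚ
  | [] => aug.toLinearMap
  | g :: M => LinearMap.mul' ℚ ℚ ∘ₗ TensorProduct.map (lam g) (pairing lam M) ∘ₗ comul.toLinearMap

theorem pairing_cons_word (lam : Gen → U →ₗ[ℚ] ℚ) (g : Gen) (M J : List Gen) :
    pairing lam (g :: M) (word J) =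
      ((splits J).map fun p => lam g (word p.1) * pairing lam M (word p.2)).sum := by
  rw [pairing, LinearMap.comp_apply, LinearMap.comp_apply, AlgHom.toLinearMap_apply, comul_word,
    map_list_sum, map_list_sum, List.map_map, List.map_map]
  rfl

/-- Expand along the comultiplication. A split with empty first part is killed because λ_g vanishes
at 1. If the first part has two or more letters, where λ_g is uncontrolled, the second part is too
short to be a permutation of M and pairs to zero by induction. A first part of one letter gives 1 or
0. So all terms are nonnegative, and one is positive exactly when J is a permutation of g :: M. -/
theorem pairing_word {lam : Gen → U →ₗ[ℚ] ℚ} (h0 : ∀ g, lam g 1 = 0) (h1 : ∀ g, lam g (toU g) = 1)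
    (h2 : ∀ g g', g' ≠ g → lam g (toU g') = 0) (M J : List Gen) (hJ : J.length ≤ M.length) :
    (J.Perm M → 0 < pairing lam M (word J)) ∧ (¬J.Perm M → pairing lam M (word J) = 0) := by
  induction M generalizing J with
  | nil =>
    obtain rfl : J = [] := by simpa using hJ
    exact ⟨fun _ => by simp [pairing, word], fun h => absurd (List.Perm.refl _) h⟩
  | cons g M ih =>
    have key : ∀ p ∈ splits J, (lam g (word p.1) * pairing lam M (word p.2) = 0) ∨
        (J.Perm (g :: M) ∧ 0 < lam g (word p.1) * pairing lam M (word p.2)) := fun p hp => by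
      have hperm := perm_of_mem_splits hp
      have hlen := hperm.length_eq
      rw [List.length_append] at hlen
      rw [List.length_cons] at hJ
      rcases hp1 : p.1 with _ | ⟨g', S⟩
      · left; rw [word, List.map_nil, List.prod_nil, h0, zero_mul]
      · rw [hp1, List.length_cons] at hlen
        rw [hp1] at hperm
        have ih' := ih p.2 (by omega)
        by_cases hpm : p.2.Perm M
        · obtain rfl : S = [] := List.eq_nil_of_length_eq_zero (by have := hpm.length_eq; omega)
          rw [word_cons, word, List.map_nil, List.prod_nil, mul_one]
          by_cases hg : g' = g
          · subst hg
            rw [h1, one_mul]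
            exact Or.inr ⟨hperm.symm.trans (hpm.cons g'), ih'.1 hpm⟩
          · left; rw [h2 _ _ hg, zero_mul]
        · left; rw [ih'.2 hpm, mul_zero]
    rw [pairing_cons_word]
    refine ⟨fun hperm => ?_, fun hperm => ?_⟩
    · obtain ⟨T, hT⟩ := exists_singleton_mem_splits (hperm.symm.subset List.mem_cons_self)
      have hTM : T.Perm M := List.Perm.cons_inv ((perm_of_mem_splits hT).trans hperm)
      have hpos : 0 < lam g (word [g]) * pairing lam M (word T) := by
        rw [word_cons, word, List.map_nil, List.prod_nil, mul_one, h1, one_mul]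
        exact (ih T hTM.length_eq.le).1 hTM
      refine lt_of_lt_of_le hpos (List.single_le_sum ?_ _ (List.mem_map.2 ⟨_, hT, rfl⟩))
      intro z hz
      obtain ⟨p, hp, rfl⟩ := List.mem_map.1 hz
      rcases key p hp with h | h
      · exact h.ge
      · exact h.2.le
    · refine List.sum_eq_zero fun z hz => ?_
      obtain ⟨p, hp, rfl⟩ := List.mem_map.1 hz
      exact (key p hp).resolve_right fun h => hperm h.1

/-- Nonzero multiples of words that are pairwise not permutations of each other are linearly
independent. -/
theorem linearIndependent_word {κ : Type*} (J : κ → List Gen) (hJ : ∀ i j, (J i).Perm (J j) → i = j)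
    {v : κ → U} (hv : ∀ i, ∃ a : ℚ, a ≠ 0 ∧ v i = a • word (J i)) : LinearIndependent ℚ v := by
  obtain ⟨lam, h0, h1, h2⟩ := exists_dual
  rw [linearIndependent_iff']
  intro s f hf i hi
  by_contra hne
  classical
  -- Pairing with a word of maximal length among those in the relation kills every other term, so
  -- its coefficient vanishes. Maximality provides the length bound that `pairing_word` requires.
  obtain ⟨k, hk, hmax⟩ := (s.filter fun i => f i ≠ 0).exists_max_image (fun i => (J i).length)
    ⟨i, Finset.mem_filter.2 ⟨hi, hne⟩⟩
  rw [Finset.mem_filter] at hk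
  have h := congrArg (pairing lam (J k)) hf
  rw [map_sum, map_zero, Finset.sum_eq_single_of_mem k hk.1] at h
  · obtain ⟨a, ha, hk'⟩ := hv k
    rw [map_smul, hk', map_smul] at h
    have := (pairing_word h0 h1 h2 (J k) (J k) le_rfl).1 (List.Perm.refl _)
    simp only [smul_eq_mul, mul_eq_zero] at h
    rcases h with h | h | h
    · exact hk.2 h
    · exact ha h
    · exact this.ne' h
  · intro j hj hjk
    by_cases hfj : f j = 0
    · rw [hfj, zero_smul, map_zero]
    · obtain ⟨a, -, hj'⟩ := hv j
      rw [map_smul, hj', map_smul, (pairing_word h0 h1 h2 (J k) (J j)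
        (hmax j (Finset.mem_filter.2 ⟨hj, hfj⟩))).2 fun hp => hjk (hJ _ _ hp), smul_zero, smul_zero]

end Coproduct

/-! ### Ordered products of divided powers as multiples of words -/

section Blocks

variable {ι : Type*} [LinearOrder ι]

/-- The list in which `γ i` occurs `k i` times. -/
def blockList (γ : ι → Gen) (k : ι →₀ ℕ) : List Gen :=
  (k.support.sort (· ≤ ·)).flatMap fun i => List.replicate (k i) (γ i)

open Classical in
theorem count_blockList (γ : ι → Gen) (k : ι →₀ ℕ) (g : Gen) :
    (blockList γ k).count g = ∑ i ∈ k.support, if γ i = g then k i else 0 := by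
  rw [blockList, List.count_flatMap, ← List.sum_toFinset _ (Finset.sort_nodup _ _),
    Finset.sort_toFinset]
  refine Finset.sum_congr rfl fun i _ => ?_
  simp [List.count_replicate]

theorem monomialProd_eq_smul_word {γ : ι → Gen} {f : ι → ℕ → U}
    (hf : ∀ i n, ∃ a : ℚ, a ≠ 0 ∧ f i n = a • toU (γ i) ^ n) (k : ι →₀ ℕ) :
    ∃ a : ℚ, a ≠ 0 ∧ monomialProd f k = a • word (blockList γ k) := by
  rw [monomialProd, blockList]
  induction k.support.sort (· ≤ ·) with
  | nil => exact ⟨1, one_ne_zero, by simp [word]⟩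
  | cons i l ih =>
    obtain ⟨a, ha, h1⟩ := ih
    obtain ⟨b, hb, h2⟩ := hf i (k i)
    refine ⟨b * a, mul_ne_zero hb ha, ?_⟩
    rw [List.map_cons, List.prod_cons, h1, h2, List.flatMap_cons, word_append, smul_mul_smul_comm]
    congr 2
    simp [word]

theorem divPow_eq_smul_pow (γ : ι → Gen) (i : ι) (n : ℕ) :
    ∃ a : ℚ, a ≠ 0 ∧ divPow (toU (γ i)) n = a • toU (γ i) ^ n :=
  ⟨_, inv_ne_zero (by positivity), rfl⟩

end Blocks

/-! ### Exchanging the basis in one factor of a family of products -/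

section Replace

variable {R : Type*} [Ring R] [Algebra ℚ R]

/-- In a linearly independent family of products, the image of a basis in the middle factor can be
replaced by the image of any linearly independent family. -/
theorem linearIndependent_replace {κ δ β P : Type*} [AddCommGroup P] [Module ℚ P] (e : κ ≃ δ × β)
    (L L' : δ → R) (Y : P →ₗ[ℚ] R) (b : Module.Basis β ℚ P) {t : β → P} (ht : LinearIndependent ℚ t)
    (h : LinearIndependent ℚ fun k => L (e k).1 * Y (b (e k).2) * L' (e k).1) :
    LinearIndependent ℚ fun k => L (e k).1 * Y (t (e k).2) * L' (e k).1 := by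
  -- Independence for one basis of P is equivalent to injectivity of this map, which no longer
  -- refers to the basis; any independent family in P may then be inserted.
  let Ψ : (δ →₀ P) →ₗ[ℚ] R :=
    Finsupp.lsum ℚ fun d => LinearMap.mulRight ℚ (L' d) ∘ₗ LinearMap.mulLeft ℚ (L d) ∘ₗ Y
  have hΨ : ∀ d p, Ψ (Finsupp.single d p) = L d * Y p * L' d := fun d p => by
    simp only [Ψ, Finsupp.lsum_single]; rfl
  have hinj : Function.Injective Ψ := by
    let B := Finsupp.basis fun _ : δ => b
    refine LinearMap.injective_of_linearIndependent (v := B) B.span_eq ?_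
    have := h.comp (fun i : Σ _ : δ, β => e.symm (i.1, i.2)) (fun i j hij => by
      have := e.symm.injective hij
      obtain ⟨i1, i2⟩ := i; obtain ⟨j1, j2⟩ := j
      simp only [Prod.mk.injEq] at this
      obtain ⟨rfl, rfl⟩ := this; rfl)
    convert! this using 1
    funext i
    simp only [Function.comp_apply, B, Finsupp.coe_basis, hΨ, Equiv.apply_symm_apply]
  have h2 := ((Finsupp.linearIndependent_single (fun _ : δ => t) fun _ => ht).map' Ψ
    (LinearMap.ker_eq_bot.2 hinj)).comp (fun k => (⟨(e k).1, (e k).2⟩ : Σ _ : δ, β)) (fun i j hij => by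
      simp only [Sigma.mk.injEq, heq_eq_eq] at hij
      exact e.injective (Prod.ext hij.1 hij.2))
  convert! h2 using 1
  funext k
  simp only [Function.comp_apply, hΨ]

theorem linearIndependent_replace_slot {κ β P : Type*} [AddCommGroup P] [Module ℚ P] [Inhabited β]
    (p : κ → β) (upd : κ → β → κ) (h1 : ∀ k b, p (upd k b) = b)
    (h2 : ∀ k b b', upd (upd k b) b' = upd k b') (h3 : ∀ k, upd k (p k) = k) (L L' : κ → R)
    (hL : ∀ k b, L (upd k b) = L k) (hL' : ∀ k b, L' (upd k b) = L' k) (Y : P →ₗ[ℚ] R)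
    (b : Module.Basis β ℚ P) {t : β → P} (ht : LinearIndependent ℚ t) {v w : κ → R}
    (hv : ∀ k, v k = L k * Y (b (p k)) * L' k) (hw : ∀ k, w k = L k * Y (t (p k)) * L' k)
    (h : LinearIndependent ℚ v) : LinearIndependent ℚ w := by
  -- An index is split into the content of the slot and the index with that slot reset to a default
  -- value.
  let e : κ ≃ {k // p k = default} × β :=
    ⟨fun k => (⟨upd k default, h1 _ _⟩, p k), fun d => upd d.1 d.2, fun k => by dsimp only; rw [h2, h3],
      fun d => Prod.ext (Subtype.ext (by
        have := h3 d.1; rw [d.1.2] at this; dsimp only; rw [h2, this])) (h1 _ _)⟩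
  have key := linearIndependent_replace e (fun d => L d) (fun d => L' d) Y b ht (by
    convert! h using 1; funext k; rw [hv]; simp only [e, Equiv.coe_fn_mk, hL, hL'])
  convert! key using 1
  funext k; rw [hw]; simp only [e, Equiv.coe_fn_mk, hL, hL']

theorem monomialProd_map_pow {C ι : Type*} [CommRing C] [Algebra ℚ C] [LinearOrder ι] (ψ : C →ₐ[ℚ] R)
    (g : ι → C) (k : ι →₀ ℕ) :
    monomialProd (fun i n => ψ (g i) ^ n) k = ψ (k.prod fun i n => g i ^ n) := by
  rw [Finsupp.prod, Finset.prod_eq_multiset_prod, ← Finset.sort_eq k.support (· ≤ ·),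
    Multiset.map_coe, Multiset.prod_coe, monomialProd, map_list_prod, List.map_map]
  simp only [Function.comp_def, map_pow]

end Replace

/-! ### Change of variables from the h's to the h̃'s -/

section HatPolynomials

/-- The polynomials `p̂_l` in the variables `p_r`, `r > 0`. -/
def hatPoly (l : ℕ) : MvPolynomial ℕ+ ℚ :=
  coeff l (hatSeries fun r => if hr : 0 < r then MvPolynomial.X ⟨r, hr⟩ else 0)

/-- The substitution has a left inverse: sending each variable to the power sum of the series with
generic coefficients recovers those coefficients. -/
theorem injective_aeval_hatPoly :
    Function.Injective (MvPolynomial.aeval (R := ℚ) fun l : ℕ+ => hatPoly l) := by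
  let E : PowerSeries (MvPolynomial ℕ+ ℚ) :=
    PowerSeries.mk fun r => if hr : 0 < r then MvPolynomial.X ⟨r, hr⟩ else 1
  obtain ⟨p, hp⟩ := exists_hatSeries_eq (E := E) (by
    rw [← coeff_zero_eq_constantCoeff_apply, coeff_mk]; simp)
  let Θ : MvPolynomial ℕ+ ℚ →ₐ[ℚ] MvPolynomial ℕ+ ℚ := MvPolynomial.aeval fun l : ℕ+ => p l
  have hΘ : ∀ l : ℕ+, Θ (hatPoly l) = MvPolynomial.X l := fun l => by
    have h1 : PowerSeries.map (Θ : MvPolynomial ℕ+ ℚ →+* MvPolynomial ℕ+ ℚ) (hatSeries fun r =>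
        if hr : 0 < r then MvPolynomial.X ⟨r, hr⟩ else 0) = E := by
      rw [map_hatSeries, ← hp]
      refine hatSeries_congr fun r hr => ?_
      simp only [dif_pos hr, Θ]
      exact MvPolynomial.aeval_X _ _
    have h2 := congrArg (coeff (l : ℕ)) h1
    rw [coeff_map, coeff_mk, dif_pos l.pos] at h2
    exact h2
  refine Function.LeftInverse.injective (g := Θ) fun f => ?_
  rw [← AlgHom.comp_apply]
  refine DFunLike.congr_fun (?_ : Θ.comp _ = AlgHom.id ℚ _) f
  refine MvPolynomial.algHom_ext fun l => ?_
  rw [AlgHom.comp_apply, MvPolynomial.aeval_X, hΘ, AlgHom.id_apply]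

variable (σ : ℤˣ)

/-- The polynomials in the `ε_r h_{σ r}` as elements of `U`. -/
def imEval : MvPolynomial ℕ+ ℚ →ₐ[ℚ] U :=
  (imRing σ).val.comp (MvPolynomial.aeval fun l : ℕ+ => imGen σ l)

theorem imEval_X (l : ℕ+) : imEval σ (MvPolynomial.X l) = epsH σ l := by
  rw [imEval, AlgHom.comp_apply, MvPolynomial.aeval_X]; rfl

theorem imEval_hatPoly {l : ℕ} : imEval σ (hatPoly l) = hTilde σ l := by
  have h1 : PowerSeries.map (imEval σ : MvPolynomial ℕ+ ℚ →+* U) (hatSeries fun r =>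
      if hr : 0 < r then MvPolynomial.X ⟨r, hr⟩ else 0) = hatSeries (epsH σ) := by
    rw [map_hatSeries]
    refine hatSeries_congr fun r hr => ?_
    simp only [dif_pos hr]
    exact imEval_X σ ⟨r, hr⟩
  rw [hTilde, ← h1, coeff_map]; rfl

theorem Bim_eq (k : ℕ+ →₀ ℕ) : Bim σ k = imEval σ
    (MvPolynomial.aeval (R := ℚ) (fun l : ℕ+ => hatPoly l) (MvPolynomial.basisMonomials ℕ+ ℚ k)) := by
  rw [MvPolynomial.coe_basisMonomials, MvPolynomial.aeval_monomial, map_one, one_mul,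
    ← monomialProd_map_pow]
  simp only [imEval_hatPoly]; rfl

theorem imEval_basisMonomials (k : ℕ+ →₀ ℕ) : ∃ a : ℚ, a ≠ 0 ∧
    imEval σ (MvPolynomial.basisMonomials ℕ+ ℚ k) =
      a • word (blockList (fun l : ℕ+ => Gen.h ((σ : ℤ) * (l : ℕ))) k) := by
  simp only [MvPolynomial.coe_basisMonomials]
  rw [MvPolynomial.monomial_eq, map_one, one_mul,
    ← monomialProd_map_pow]
  refine monomialProd_eq_smul_word (fun l n => ?_) k
  refine ⟨eps l ^ n, pow_ne_zero _ (left_ne_zero_of_mul_eq_one (eps_mul_self l)), ?_⟩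
  rw [imEval_X, epsH, smul_pow]; rfl

theorem linearIndependent_hatPoly : LinearIndependent ℚ fun k : ℕ+ →₀ ℕ =>
    MvPolynomial.aeval (R := ℚ) (fun l : ℕ+ => hatPoly l) (MvPolynomial.basisMonomials ℕ+ ℚ k) :=
  (MvPolynomial.basisMonomials ℕ+ ℚ).linearIndependent.map'
    (MvPolynomial.aeval (R := ℚ) fun l : ℕ+ => hatPoly l).toLinearMap
    (LinearMap.ker_eq_bot.2 injective_aeval_hatPoly)

theorem linearIndependent_choosePoly : LinearIndependent ℚ choosePoly :=
  (⟨choosePoly, degree_choosePoly⟩ : Polynomial.Sequence ℚ).linearIndependent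

end HatPolynomials

/-! ### Linear independence of the products of the nine bases -/

section Total

/-- The products of nine blocks, the imaginary ones and those of degree zero being arbitrary. -/
def blockProd (y z : (ℕ+ →₀ ℕ) → U) (y' z' : ℕ → U) (k : Exponents) : U :=
  Bodd (-1) k.oddMinus * Bc (-1) k.cMinus * Beven (-1) k.evenMinus *
    y k.imMinus * (y' k.zero.1 * z' k.zero.2) * z k.imPlus *
    Bodd 1 k.oddPlus * Bc 1 k.cPlus * Beven 1 k.evenPlus

/-- The list of generators of exponents `k`. -/
def expList (k : Exponents) : List Gen :=
  blockList (fun r => .x (-1) (2 * r + 1)) k.oddMinus ++ blockList (fun r => .X (-1) r) k.cMinus ++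
    blockList (fun r => .x (-1) (2 * r)) k.evenMinus ++
    blockList (fun l : ℕ+ => .h (((-1 : ℤˣ) : ℤ) * (l : ℕ))) k.imMinus ++
    (List.replicate k.zero.1 (.h 0) ++ List.replicate k.zero.2 .c) ++
    blockList (fun l : ℕ+ => .h (((1 : ℤˣ) : ℤ) * (l : ℕ))) k.imPlus ++
    blockList (fun r => .x 1 (2 * r + 1)) k.oddPlus ++ blockList (fun r => .X 1 r) k.cPlus ++
    blockList (fun r => .x 1 (2 * r)) k.evenPlus

/-- Each generator occurs in exactly one of the nine blocks, at one index, so its multiplicity in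
the list is the corresponding exponent. -/
theorem eq_of_expList_perm (k k' : Exponents) (h : (expList k).Perm (expList k')) : k = k' := by
  classical
  have hc : ∀ g, (expList k).count g = (expList k').count g := fun g => h.count_eq g
  simp only [expList, List.count_append, List.count_replicate] at hc
  have e1 : ∀ i r : ℤ, (2 * i + 1 = 2 * r + 1) = (i = r) := fun i r => by simp
  have e2 : ∀ i r : ℤ, (2 * i = 2 * r) = (i = r) := fun i r => by simp
  have e3 : ∀ i r : ℤ, (2 * i = 2 * r + 1) = False := fun i r => eq_false (by omega)
  have e4 : ∀ i r : ℤ, (2 * i + 1 = 2 * r) = False := fun i r => eq_false (by omega)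
  have e5 : ((-1 : ℤˣ) = 1) = False := by simp
  have e6 : ((1 : ℤˣ) = -1) = False := by simp
  have hpos : ∀ l : ℕ+, 0 < ((l : ℕ) : ℤ) := fun l => by exact_mod_cast l.pos
  have e7 : ∀ i r : ℕ+, (((-1 : ℤˣ) : ℤ) * ((i : ℕ) : ℤ) = ((1 : ℤˣ) : ℤ) * ((r : ℕ) : ℤ)) = False :=
    fun i r => eq_false (by have := hpos i; have := hpos r; push_cast; omega)
  have e8 : ∀ i r : ℕ+, (((1 : ℤˣ) : ℤ) * ((i : ℕ) : ℤ) = ((-1 : ℤˣ) : ℤ) * ((r : ℕ) : ℤ)) = False :=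
    fun i r => eq_false (by have := hpos i; have := hpos r; push_cast; omega)
  have e9 : ∀ (σ : ℤˣ) (i : ℕ+), ((σ : ℤ) * ((i : ℕ) : ℤ) = 0) = False := fun σ i =>
    eq_false (mul_ne_zero σ.ne_zero (hpos i).ne')
  have e10 : ∀ (σ : ℤˣ) (i : ℕ+), (0 = (σ : ℤ) * ((i : ℕ) : ℤ)) = False := fun σ i =>
    eq_false (mul_ne_zero σ.ne_zero (hpos i).ne').symm
  have e11 : ∀ (σ : ℤˣ) (i r : ℕ+), ((σ : ℤ) * ((i : ℕ) : ℤ) = (σ : ℤ) * ((r : ℕ) : ℤ)) = (i = r) :=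
    fun σ i r => by simp
  have e12 : ∀ n : ℕ, (if n ≠ 0 then n else 0) = n := fun n => by split_ifs <;> simp_all
  have hs : ∀ {ι : Type} [LinearOrder ι] (k : ι →₀ ℕ) (i : ι),
      (∑ j ∈ k.support, if j = i then k j else 0) = k i := fun k i => by
    simp only [Finset.sum_ite_eq', Finsupp.mem_support_iff, e12]
  simp only [count_blockList, beq_iff_eq] at hc
  obtain ⟨a1, a2, a3, a4, ⟨a5, a5'⟩, a6, a7, a8, a9⟩ := k
  obtain ⟨b1, b2, b3, b4, ⟨b5, b5'⟩, b6, b7, b8, b9⟩ := k'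
  have h1 := fun r => hc (.x (-1) (2 * r + 1))
  have h2 := fun r => hc (.X (-1) r)
  have h3 := fun r => hc (.x (-1) (2 * r))
  have h4 := fun r : ℕ+ => hc (.h (((-1 : ℤˣ) : ℤ) * ((r : ℕ) : ℤ)))
  have h5 := hc (.h 0)
  have h5' := hc .c
  have h6 := fun r : ℕ+ => hc (.h (((1 : ℤˣ) : ℤ) * ((r : ℕ) : ℤ)))
  have h7 := fun r => hc (.x 1 (2 * r + 1))
  have h8 := fun r => hc (.X 1 r)
  have h9 := fun r => hc (.x 1 (2 * r))
  simp only [Gen.x.injEq, Gen.X.injEq, Gen.h.injEq, reduceCtorEq, true_and, false_and, e1, e2, e3, e4,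
    e5, e6, e7, e8, e9, e10, e11, if_false, if_true, Finset.sum_const_zero, hs, add_zero, zero_add,
    and_false] at h1 h2 h3 h4 h5 h5' h6 h7 h8 h9
  obtain rfl := Finsupp.ext h1
  obtain rfl := Finsupp.ext h2
  obtain rfl := Finsupp.ext h3
  obtain rfl := Finsupp.ext h4
  obtain rfl := Finsupp.ext h6
  obtain rfl := Finsupp.ext h7
  obtain rfl := Finsupp.ext h8
  obtain rfl := Finsupp.ext h9
  subst h5 h5'
  rfl

/-- With plain monomials in the h's and plain powers of h_0 and c, the products are nonzero
multiples of words that are pairwise not permutations of each other. The four slots are then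
exchanged in turn: the two imaginary ones for monomials in the h̃'s, and the powers of h_0 and c for
binomials. -/
theorem linearIndependent_Btotal : LinearIndependent ℚ Btotal := by
  have h0 : LinearIndependent ℚ (blockProd (fun k => imEval (-1) (MvPolynomial.basisMonomials ℕ+ ℚ k))
      (fun k => imEval 1 (MvPolynomial.basisMonomials ℕ+ ℚ k))
      (fun n => Polynomial.aeval (h 0) (Polynomial.basisMonomials ℚ n))
      (fun n => Polynomial.aeval c (Polynomial.basisMonomials ℚ n))) := by
    refine linearIndependent_word expList eq_of_expList_perm fun k => ?_
    obtain ⟨a1, ha1, h1⟩ := monomialProd_eq_smul_word (divPow_eq_smul_pow fun r => .x (-1) (2 * r + 1)) k.oddMinus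
    obtain ⟨a2, ha2, h2⟩ := monomialProd_eq_smul_word (divPow_eq_smul_pow fun r => .X (-1) r) k.cMinus
    obtain ⟨a3, ha3, h3⟩ := monomialProd_eq_smul_word (divPow_eq_smul_pow fun r => .x (-1) (2 * r)) k.evenMinus
    obtain ⟨a4, ha4, h4⟩ := imEval_basisMonomials (-1) k.imMinus
    obtain ⟨a6, ha6, h6⟩ := imEval_basisMonomials 1 k.imPlus
    obtain ⟨a7, ha7, h7⟩ := monomialProd_eq_smul_word (divPow_eq_smul_pow fun r => .x 1 (2 * r + 1)) k.oddPlus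
    obtain ⟨a8, ha8, h8⟩ := monomialProd_eq_smul_word (divPow_eq_smul_pow fun r => .X 1 r) k.cPlus
    obtain ⟨a9, ha9, h9⟩ := monomialProd_eq_smul_word (divPow_eq_smul_pow fun r => .x 1 (2 * r)) k.evenPlus
    have e5 : ∀ (g : Gen) n, Polynomial.aeval (toU g) (Polynomial.basisMonomials ℚ n) =
        word (List.replicate n g) := fun g n => by
      rw [Polynomial.coe_basisMonomials, Polynomial.aeval_monomial]; simp [word]
    refine ⟨a1 * a2 * a3 * a4 * a6 * a7 * a8 * a9, by simp [*], ?_⟩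
    rw [blockProd, Bodd, Bc, Beven, Bodd, Bc, Beven, h4, h6, h, c, e5, e5]
    simp only [x, X, h1, h2, h3, h7, h8, h9, expList, word_append, smul_mul_assoc, mul_smul_comm,
      smul_smul]
    congr 1; ring
  have h1 : LinearIndependent ℚ (blockProd (Bim (-1))
      (fun k => imEval 1 (MvPolynomial.basisMonomials ℕ+ ℚ k))
      (fun n => Polynomial.aeval (h 0) (Polynomial.basisMonomials ℚ n))
      (fun n => Polynomial.aeval c (Polynomial.basisMonomials ℚ n))) :=
    linearIndependent_replace_slot Exponents.imMinus (fun k b => { k with imMinus := b })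
      (fun _ _ => rfl) (fun _ _ _ => rfl) (fun _ => rfl)
      (fun k => Bodd (-1) k.oddMinus * Bc (-1) k.cMinus * Beven (-1) k.evenMinus)
      (fun k => (Polynomial.aeval (h 0) (Polynomial.basisMonomials ℚ k.zero.1) *
        Polynomial.aeval c (Polynomial.basisMonomials ℚ k.zero.2)) *
        imEval 1 (MvPolynomial.basisMonomials ℕ+ ℚ k.imPlus) *
        Bodd 1 k.oddPlus * Bc 1 k.cPlus * Beven 1 k.evenPlus)
      (fun _ _ => rfl) (fun _ _ => rfl) (imEval (-1)).toLinearMap (MvPolynomial.basisMonomials ℕ+ ℚ)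
      linearIndependent_hatPoly (fun k => by simp only [blockProd, mul_assoc]; rfl)
      (fun k => by simp only [blockProd, mul_assoc, Bim_eq]; rfl) h0
  have h2 : LinearIndependent ℚ (blockProd (Bim (-1)) (Bim 1)
      (fun n => Polynomial.aeval (h 0) (Polynomial.basisMonomials ℚ n))
      (fun n => Polynomial.aeval c (Polynomial.basisMonomials ℚ n))) :=
    linearIndependent_replace_slot Exponents.imPlus (fun k b => { k with imPlus := b })
      (fun _ _ => rfl) (fun _ _ _ => rfl) (fun _ => rfl)
      (fun k => Bodd (-1) k.oddMinus * Bc (-1) k.cMinus * Beven (-1) k.evenMinus * Bim (-1) k.imMinus *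
        (Polynomial.aeval (h 0) (Polynomial.basisMonomials ℚ k.zero.1) *
        Polynomial.aeval c (Polynomial.basisMonomials ℚ k.zero.2)))
      (fun k => Bodd 1 k.oddPlus * Bc 1 k.cPlus * Beven 1 k.evenPlus)
      (fun _ _ => rfl) (fun _ _ => rfl) (imEval 1).toLinearMap (MvPolynomial.basisMonomials ℕ+ ℚ)
      linearIndependent_hatPoly (fun k => by simp only [blockProd, mul_assoc]; rfl)
      (fun k => by simp only [blockProd, mul_assoc, Bim_eq]; rfl) h1
  have h3 : LinearIndependent ℚ (blockProd (Bim (-1)) (Bim 1) (binom (h 0))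
      (fun n => Polynomial.aeval c (Polynomial.basisMonomials ℚ n))) :=
    linearIndependent_replace_slot (fun k : Exponents => k.zero.1)
      (fun k b => { k with zero := (b, k.zero.2) })
      (fun _ _ => rfl) (fun _ _ _ => rfl) (fun _ => rfl)
      (fun k => Bodd (-1) k.oddMinus * Bc (-1) k.cMinus * Beven (-1) k.evenMinus * Bim (-1) k.imMinus)
      (fun k => Polynomial.aeval c (Polynomial.basisMonomials ℚ k.zero.2) * Bim 1 k.imPlus *
        Bodd 1 k.oddPlus * Bc 1 k.cPlus * Beven 1 k.evenPlus)
      (fun _ _ => rfl) (fun _ _ => rfl) (Polynomial.aeval (h 0)).toLinearMap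
      (Polynomial.basisMonomials ℚ)
      linearIndependent_choosePoly (fun k => by simp only [blockProd, mul_assoc]; rfl)
      (fun k => by simp only [blockProd, mul_assoc, binom_eq_aeval]; rfl) h2
  exact linearIndependent_replace_slot (fun k : Exponents => k.zero.2)
    (fun k b => { k with zero := (k.zero.1, b) })
    (fun _ _ => rfl) (fun _ _ _ => rfl) (fun _ => rfl)
    (fun k => Bodd (-1) k.oddMinus * Bc (-1) k.cMinus * Beven (-1) k.evenMinus * Bim (-1) k.imMinus *
      binom (h 0) k.zero.1)
    (fun k => Bim 1 k.imPlus * Bodd 1 k.oddPlus * Bc 1 k.cPlus * Beven 1 k.evenPlus)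
    (fun _ _ => rfl) (fun _ _ => rfl) (Polynomial.aeval c).toLinearMap
    (Polynomial.basisMonomials ℚ)
    linearIndependent_choosePoly (fun k => by simp only [blockProd, mul_assoc]; rfl)
    (fun k => by simp only [Btotal, Bzero, mul_assoc, binom_eq_aeval]; rfl) h3

end Total

/-! ### Integral forms from bases -/

section IntegralForms

variable {R : Type*} [Ring R] [Algebra ℚ R]

/-- The basis of a subalgebra given by a `ℤ`-basis in the larger algebra. -/
theorem IsZBasis.exists_basis {ι : Type*} {v : ι → R} {S : Subalgebra ℤ R} (hv : IsZBasis v S) :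
    ∃ b : Module.Basis ι ℤ S, ∀ i, (b i : R) = v i := by
  have hmem : ∀ i, v i ∈ S := fun i => by
    rw [← Subalgebra.mem_toSubmodule, ← hv.2]; exact Submodule.subset_span ⟨i, rfl⟩
  have hli : LinearIndependent ℤ fun i => (⟨v i, hmem i⟩ : S) :=
    LinearIndependent.of_comp S.val.toLinearMap hv.1
  refine ⟨Module.Basis.mk hli ?_, fun i => by rw [Module.Basis.mk_apply]⟩
  rintro ⟨z, hz⟩ -
  have h1 : Submodule.map S.val.toLinearMap (Submodule.span ℤ (Set.range fun i => (⟨v i, hmem i⟩ : S))) =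
      Subalgebra.toSubmodule S := by
    rw [Submodule.map_span, ← Set.range_comp, ← hv.2]; rfl
  have h2 : z ∈ Subalgebra.toSubmodule S := hz
  rw [← h1] at h2
  obtain ⟨w, hw, hwz⟩ := h2
  have : w = ⟨z, hz⟩ := Subtype.ext hwz
  rwa [← this]

/-- A subalgebra with a `ℤ`-basis that is a `ℚ`-basis of the whole algebra is an integral form. -/
theorem IsZBasis.isIntegralForm {ι : Type*} {v : ι → R} {S : Subalgebra ℤ R} (hv : IsZBasis v S)
    (hli : LinearIndependent ℚ v) (hspan : Submodule.span ℚ (S : Set R) = ⊤) : IsIntegralForm S := by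
  obtain ⟨b, hb⟩ := hv.exists_basis
  have h1 : ⊤ ≤ Submodule.span ℚ (Set.range v) := by
    rw [← hspan, Submodule.span_le]
    intro z hz
    have hz' : z ∈ Submodule.span ℤ (Set.range v) := hv.2 ▸ hz
    exact Submodule.span_subset_span ℤ ℚ _ hz'
  refine ⟨Module.Free.of_basis b, ?_⟩
  have h2 := IsBaseChange.of_basis ℤ (Module.Basis.mk hli h1)
  have h3 := IsBaseChange.comp_equiv b.repr (Finsupp.linearCombination ℤ (Module.Basis.mk hli h1)) h2
  have h4 : S.val.toLinearMap =
      (Finsupp.linearCombination ℤ (Module.Basis.mk hli h1)) ∘ₗ b.repr.toLinearMap :=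
    b.ext fun i => by
      rw [LinearMap.comp_apply, LinearEquiv.coe_coe, b.repr_self, Finsupp.linearCombination_single,
        one_smul, Module.Basis.mk_apply, ← hb]
      rfl
  rw [h4]
  exact h3

end IntegralForms

/-! ### Generation of the enveloping algebra -/

section Generation

attribute [local instance] LieRing.ofAssociativeRing

theorem U_hom_ext {B : Type*} [Ring B] [Algebra ℚ B] {F G : U →ₐ[ℚ] B}
    (h : ∀ g, F (toU g) = G (toU g)) : F = G := by
  apply UniversalEnvelopingAlgebra.hom_ext
  refine LieHom.ext fun z => ?_
  obtain ⟨a, rfl⟩ := Submodule.Quotient.mk_surjective _ z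
  exact LieHom.congr_fun (FreeLieAlgebra.hom_ext (F₁ := ((F : U →ₗ⁅ℚ⁆ B).comp freeToU))
    (F₂ := ((G : U →ₗ⁅ℚ⁆ B).comp freeToU)) h) a

/-- The defining relations hold inside `A`, so there is a map U → A. Its composite with the
inclusion fixes the generators, hence is the identity, and every element lies in `A`. -/
theorem subalgebra_eq_top {A : Subalgebra ℚ U} (h : ∀ g, toU g ∈ A) : A = ⊤ := by
  let f : Gen → A := fun g => ⟨toU g, h g⟩
  have hf : ∀ a, (FreeLieAlgebra.lift ℚ f a : U) = freeToU a := fun a =>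
    LieHom.congr_fun (FreeLieAlgebra.hom_ext
      (F₁ := ((A.val : A →ₗ⁅ℚ⁆ U).comp (FreeLieAlgebra.lift ℚ f))) (F₂ := freeToU) fun g => by
        change ((FreeLieAlgebra.lift ℚ f (FreeLieAlgebra.of ℚ g) : A) : U) = _
        rw [FreeLieAlgebra.lift_of_apply]; rfl) a
  have hrel : ∀ a b, Rel a b → FreeLieAlgebra.lift ℚ f a = FreeLieAlgebra.lift ℚ f b :=
    fun a b hab => Subtype.ext (by rw [hf, hf, freeToU_eq_of_rel hab])
  have key : A.val.comp (ofRel f hrel) = AlgHom.id ℚ U := U_hom_ext fun g => by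
    rw [AlgHom.comp_apply, ofRel_toU]; rfl
  refine eq_top_iff.2 fun u _ => ?_
  rw [← AlgHom.id_apply (R := ℚ) u, ← key]
  exact (ofRel f hrel u).2

theorem span_UZ : Submodule.span ℚ (UZ : Set U) = ⊤ := by
  have h1 : Subalgebra.toSubmodule (Algebra.adjoin ℚ (UZ : Set U)) = Submodule.span ℚ (UZ : Set U) := by
    rw [Algebra.adjoin_eq_span]
    congr 1
    exact congrArg _ (Submonoid.closure_eq UZ.toSubmonoid)
  have hx : ∀ σ r, x σ r ∈ Algebra.adjoin ℚ (UZ : Set U) := fun σ r => by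
    have := divPow_x_mem_UZ σ r 1
    rw [divPow, Nat.factorial_one, Nat.cast_one, inv_one, one_smul, pow_one] at this
    exact Algebra.subset_adjoin this
  have hh : ∀ r, h r ∈ Algebra.adjoin ℚ (UZ : Set U) := fun r => by
    have := x_mul_x_opp r 0
    have h0 : (if r + 0 = 0 then (r : ℚ) else 0) = 0 := by split_ifs with h <;> simp_all
    rw [h0, zero_smul, add_zero, add_zero, ← sub_eq_iff_eq_add'] at this
    rw [← this]
    exact sub_mem (mul_mem (hx _ _) (hx _ _)) (mul_mem (hx _ _) (hx _ _))
  rw [← h1, ← Algebra.top_toSubmodule]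
  refine congrArg _ (subalgebra_eq_top fun g => ?_)
  cases g with
  | c =>
    -- The bracket is h_0 + c, and h_0 has already been obtained from x⁺_0 and x⁻_0.
    have := x_mul_x_opp 1 (-1)
    rw [if_pos (by norm_num), Int.cast_one, one_smul, ← sub_eq_iff_eq_add', ← sub_eq_iff_eq_add'] at this
    change c ∈ _
    rw [← this]
    exact sub_mem (sub_mem (mul_mem (hx _ _) (hx _ _)) (mul_mem (hx _ _) (hx _ _))) (hh _)
  | h r => exact hh r
  | x σ r => exact hx σ r
  | X σ m =>
    have := x_mul_x σ (2 * m + 1) 0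
    rw [add_zero, Xo_odd, zpow_zero, mul_one, ← sub_eq_iff_eq_add'] at this
    have h2 : sgn σ * sgn σ = 1 := by
      rcases Int.units_eq_one_or σ with rfl | rfl <;> norm_num [sgn]
    have h3 : sgn σ • (x σ (2 * m + 1) * x σ 0 - x σ 0 * x σ (2 * m + 1)) = X σ m := by
      rw [this, smul_smul, h2, one_smul]
    change X σ m ∈ _
    rw [← h3]
    exact Subalgebra.smul_mem _ (sub_mem (mul_mem (hx _ _) (hx _ _)) (mul_mem (hx _ _) (hx _ _))) _

end Generation

/-! ### ℤ-bases of the factors and of the whole algebra -/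

section Bases

theorem span_Beven (σ : ℤˣ) : Submodule.span ℤ (Set.range (Beven σ)) = Subalgebra.toSubmodule (UZeven σ) :=
  span_monomialProd_divPow fun r s => x_commute_x σ ⟨r + s, by ring⟩

theorem span_Bodd (σ : ℤˣ) : Submodule.span ℤ (Set.range (Bodd σ)) = Subalgebra.toSubmodule (UZodd σ) :=
  span_monomialProd_divPow fun r s => x_commute_x σ ⟨r + s + 1, by ring⟩

theorem span_Bc (σ : ℤˣ) : Submodule.span ℤ (Set.range (Bc σ)) = Subalgebra.toSubmodule (UZc σ) :=
  span_monomialProd_divPow fun r s => X_mul_X σ r s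

theorem linearIndependent_int_Btotal : LinearIndependent ℤ Btotal :=
  linearIndependent_Btotal.restrict_scalars' ℤ

open scoped Pointwise in
theorem span_Btotal : Submodule.span ℤ (Set.range Btotal) = Subalgebra.toSubmodule UZ := by
  have h1 : Set.range Btotal = Set.range (Bodd (-1)) * Set.range (Bc (-1)) * Set.range (Beven (-1)) *
      (Set.range (Bim (-1)) * Set.range Bzero * Set.range (Bim 1)) *
      (Set.range (Bodd 1) * Set.range (Bc 1) * Set.range (Beven 1)) := by
    ext z
    simp only [Set.mem_mul, Set.mem_range]
    constructor
    · rintro ⟨k, rfl⟩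
      exact ⟨_, ⟨_, ⟨_, ⟨_, ⟨k.oddMinus, rfl⟩, _, ⟨k.cMinus, rfl⟩, rfl⟩, _, ⟨k.evenMinus, rfl⟩, rfl⟩,
        _, ⟨_, ⟨_, ⟨k.imMinus, rfl⟩, _, ⟨k.zero, rfl⟩, rfl⟩, _, ⟨k.imPlus, rfl⟩, rfl⟩, rfl⟩,
        _, ⟨_, ⟨_, ⟨k.oddPlus, rfl⟩, _, ⟨k.cPlus, rfl⟩, rfl⟩, _, ⟨k.evenPlus, rfl⟩, rfl⟩,
        by simp only [Btotal, mul_assoc]⟩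
    · rintro ⟨_, ⟨_, ⟨_, ⟨_, ⟨k1, rfl⟩, _, ⟨k2, rfl⟩, rfl⟩, _, ⟨k3, rfl⟩, rfl⟩,
        _, ⟨_, ⟨_, ⟨k4, rfl⟩, _, ⟨k5, rfl⟩, rfl⟩, _, ⟨k6, rfl⟩, rfl⟩, rfl⟩,
        _, ⟨_, ⟨_, ⟨k7, rfl⟩, _, ⟨k8, rfl⟩, rfl⟩, _, ⟨k9, rfl⟩, rfl⟩, rfl⟩
      exact ⟨⟨k1, k2, k3, k4, k5, k6, k7, k8, k9⟩, by simp only [Btotal, mul_assoc]⟩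
  rw [h1]
  simp only [← Submodule.span_mul_span, span_Bodd, span_Bc, span_Beven, span_Bim, span_Bzero]
  rw [toSubmodule_UZ, triangular, toSubmodule_half, toSubmodule_half, toSubmodule_cartan]
  rfl

theorem isZBasis_Btotal : IsZBasis Btotal UZ := ⟨linearIndependent_int_Btotal, span_Btotal⟩

theorem Bodd_zero (σ : ℤˣ) : Bodd σ 0 = 1 := by simp [Bodd, monomialProd]
theorem Bc_zero (σ : ℤˣ) : Bc σ 0 = 1 := by simp [Bc, monomialProd]
theorem Beven_zero (σ : ℤˣ) : Beven σ 0 = 1 := by simp [Beven, monomialProd]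
theorem Bim_zero (σ : ℤˣ) : Bim σ 0 = 1 := by simp [Bim, monomialProd]
theorem Bzero_zero : Bzero 0 = 1 := by simp [Bzero, binom]

/-- A family occurring among the products of the nine bases is linearly independent. -/
theorem linearIndependent_of_exponents {ι : Type*} {v : ι → U} (f : ι → Exponents)
    (hf : Function.Injective f) (h : ∀ k, Btotal (f k) = v k) : LinearIndependent ℤ v := by
  have := linearIndependent_int_Btotal.comp f hf
  rwa [show Btotal ∘ f = v from funext h] at this

theorem Btotal_mk (a b d : ℤ →₀ ℕ) (e : ℕ+ →₀ ℕ) (k : ℕ × ℕ) (e' : ℕ+ →₀ ℕ) (a' b' d' : ℤ →₀ ℕ) :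
    Btotal ⟨a, b, d, e, k, e', a', b', d'⟩ = Bodd (-1) a * Bc (-1) b * Beven (-1) d * Bim (-1) e *
      Bzero k * Bim 1 e' * Bodd 1 a' * Bc 1 b' * Beven 1 d' := rfl

theorem isZBasis_Beven (σ : ℤˣ) : IsZBasis (Beven σ) (UZeven σ) := by
  refine ⟨?_, span_Beven σ⟩
  rcases Int.units_eq_one_or σ with rfl | rfl
  · refine linearIndependent_of_exponents (fun k => ⟨0, 0, 0, 0, 0, 0, 0, 0, k⟩) (fun k l hkl => by
      simpa using hkl) fun k => ?_
    simp only [Btotal_mk, Bodd_zero, Bc_zero, Beven_zero, Bim_zero, Bzero_zero, one_mul, mul_one]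
  · refine linearIndependent_of_exponents (fun k => ⟨0, 0, k, 0, 0, 0, 0, 0, 0⟩) (fun k l hkl => by
      simpa using hkl) fun k => ?_
    simp only [Btotal_mk, Bodd_zero, Bc_zero, Beven_zero, Bim_zero, Bzero_zero, one_mul, mul_one]

theorem isZBasis_Bodd (σ : ℤˣ) : IsZBasis (Bodd σ) (UZodd σ) := by
  refine ⟨?_, span_Bodd σ⟩
  rcases Int.units_eq_one_or σ with rfl | rfl
  · refine linearIndependent_of_exponents (fun k => ⟨0, 0, 0, 0, 0, 0, k, 0, 0⟩) (fun k l hkl => by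
      simpa using hkl) fun k => ?_
    simp only [Btotal_mk, Bodd_zero, Bc_zero, Beven_zero, Bim_zero, Bzero_zero, one_mul, mul_one]
  · refine linearIndependent_of_exponents (fun k => ⟨k, 0, 0, 0, 0, 0, 0, 0, 0⟩) (fun k l hkl => by
      simpa using hkl) fun k => ?_
    simp only [Btotal_mk, Bc_zero, Beven_zero, Bim_zero, Bzero_zero, Bodd_zero, mul_one]

theorem isZBasis_Bc (σ : ℤˣ) : IsZBasis (Bc σ) (UZc σ) := by
  refine ⟨?_, span_Bc σ⟩
  rcases Int.units_eq_one_or σ with rfl | rfl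
  · refine linearIndependent_of_exponents (fun k => ⟨0, 0, 0, 0, 0, 0, 0, k, 0⟩) (fun k l hkl => by
      simpa using hkl) fun k => ?_
    simp only [Btotal_mk, Bodd_zero, Bc_zero, Beven_zero, Bim_zero, Bzero_zero, one_mul, mul_one]
  · refine linearIndependent_of_exponents (fun k => ⟨0, k, 0, 0, 0, 0, 0, 0, 0⟩) (fun k l hkl => by
      simpa using hkl) fun k => ?_
    simp only [Btotal_mk, Bodd_zero, Bc_zero, Beven_zero, Bim_zero, Bzero_zero, one_mul, mul_one]

theorem isZBasis_Bim (σ : ℤˣ) : IsZBasis (Bim σ) (UZim σ) := by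
  refine ⟨?_, span_Bim σ⟩
  rcases Int.units_eq_one_or σ with rfl | rfl
  · refine linearIndependent_of_exponents (fun k => ⟨0, 0, 0, 0, 0, k, 0, 0, 0⟩) (fun k l hkl => by
      simpa using hkl) fun k => ?_
    simp only [Btotal_mk, Bodd_zero, Bc_zero, Beven_zero, Bim_zero, Bzero_zero, one_mul, mul_one]
  · refine linearIndependent_of_exponents (fun k => ⟨0, 0, 0, k, 0, 0, 0, 0, 0⟩) (fun k l hkl => by
      simpa using hkl) fun k => ?_
    simp only [Btotal_mk, Bodd_zero, Bc_zero, Beven_zero, Bim_zero, Bzero_zero, one_mul, mul_one]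

theorem isZBasis_Bzero : IsZBasis Bzero UZzero := by
  refine ⟨linearIndependent_of_exponents (fun k => ⟨0, 0, 0, 0, k, 0, 0, 0, 0⟩) (fun k l hkl => by
    simpa using hkl) fun k => ?_, span_Bzero⟩
  simp only [Btotal_mk, Bodd_zero, Bc_zero, Beven_zero, Bim_zero, one_mul, mul_one]

end Bases

/-! ### The imaginary factors as polynomial rings -/

section Polynomial

variable (σ : ℤˣ)

/-- Integral polynomials evaluated at the `h̃_{σ l}`. -/
def hTildeEval : MvPolynomial ℕ+ ℤ →ₐ[ℤ] U :=
  ((((imEval σ).comp (MvPolynomial.aeval (R := ℚ) fun l : ℕ+ => hatPoly l)) :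
    MvPolynomial ℕ+ ℚ →+* U).comp (MvPolynomial.map (Int.castRingHom ℚ))).toIntAlgHom

theorem hTildeEval_apply (f : MvPolynomial ℕ+ ℤ) : hTildeEval σ f = imEval σ
    (MvPolynomial.aeval (R := ℚ) (fun l : ℕ+ => hatPoly l) (MvPolynomial.map (Int.castRingHom ℚ) f)) := rfl

theorem hTildeEval_X (l : ℕ+) : hTildeEval σ (MvPolynomial.X l) = hTilde σ l := by
  rw [hTildeEval_apply, MvPolynomial.map_X, MvPolynomial.aeval_X, imEval_hatPoly]

theorem hTildeEval_injective : Function.Injective (hTildeEval σ) := by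
  refine LinearMap.injective_of_linearIndependent (f := (hTildeEval σ).toLinearMap)
    (MvPolynomial.basisMonomials ℕ+ ℤ).span_eq ?_
  convert! (isZBasis_Bim σ).1 using 1
  funext k
  rw [Bim_eq, Function.comp_apply, AlgHom.toLinearMap_apply, hTildeEval_apply]
  simp

theorem range_hTildeEval : (hTildeEval σ).range = UZim σ := by
  rw [← Algebra.map_top, ← MvPolynomial.adjoin_range_X, AlgHom.map_adjoin, UZim, symAlg]
  congr 1
  ext z
  simp only [Set.mem_image, Set.mem_range, exists_exists_eq_and, hTildeEval_X, Set.mem_ofPred_eq]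
  exact ⟨fun ⟨l, hl⟩ => ⟨l, l.pos, hl.symm⟩, fun ⟨k, hk, hz⟩ => ⟨⟨k, hk⟩, hz.symm⟩⟩

theorem exists_algEquiv_UZim : ∃ e : MvPolynomial ℕ+ ℤ ≃ₐ[ℤ] UZim σ,
    ∀ k : ℕ+, ((e (MvPolynomial.X k) : UZim σ) : U) = hTilde σ k :=
  ⟨(AlgEquiv.ofInjective _ (hTildeEval_injective σ)).trans
    (Subalgebra.equivOfEq _ _ (range_hTildeEval σ)), fun k => hTildeEval_X σ k⟩

end Polynomial

/-! ### The multiplication map on the tensor product of the nine factors -/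

section Tensor

/-- The exponents of the nine factors. -/
def FactorIndex : Fin 9 → Type :=
  ![ℤ →₀ ℕ, ℤ →₀ ℕ, ℤ →₀ ℕ, ℕ+ →₀ ℕ, ℕ × ℕ, ℕ+ →₀ ℕ, ℤ →₀ ℕ, ℤ →₀ ℕ, ℤ →₀ ℕ]

/-- The exponents of the nine factors, assembled. -/
def toExponents (k : ∀ i, FactorIndex i) : Exponents :=
  ⟨k 0, k 1, k 2, k 3, k 4, k 5, k 6, k 7, k 8⟩

theorem toExponents_bijective : Function.Bijective toExponents := by
  refine Function.bijective_iff_has_inverse.2 ⟨fun e => fun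
    | 0 => e.oddMinus | 1 => e.cMinus | 2 => e.evenMinus | 3 => e.imMinus | 4 => e.zero
    | 5 => e.imPlus | 6 => e.oddPlus | 7 => e.cPlus | 8 => e.evenPlus, fun k => ?_, fun e => rfl⟩
  funext i
  fin_cases i <;> rfl

theorem exists_factor_basis : ∃ b : ∀ i, Module.Basis (FactorIndex i) ℤ (factors i),
    ∀ k : ∀ i, FactorIndex i, mulMap factors (Basis.piTensorProduct b k) = Btotal (toExponents k) := by
  obtain ⟨b0, h0⟩ := (isZBasis_Bodd (-1)).exists_basis
  obtain ⟨b1, h1⟩ := (isZBasis_Bc (-1)).exists_basis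
  obtain ⟨b2, h2⟩ := (isZBasis_Beven (-1)).exists_basis
  obtain ⟨b3, h3⟩ := (isZBasis_Bim (-1)).exists_basis
  obtain ⟨b4, h4⟩ := isZBasis_Bzero.exists_basis
  obtain ⟨b5, h5⟩ := (isZBasis_Bim 1).exists_basis
  obtain ⟨b6, h6⟩ := (isZBasis_Bodd 1).exists_basis
  obtain ⟨b7, h7⟩ := (isZBasis_Bc 1).exists_basis
  obtain ⟨b8, h8⟩ := (isZBasis_Beven 1).exists_basis
  let b : ∀ i, Module.Basis (FactorIndex i) ℤ (factors i)
    | 0 => b0 | 1 => b1 | 2 => b2 | 3 => b3 | 4 => b4 | 5 => b5 | 6 => b6 | 7 => b7 | 8 => b8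
  refine ⟨b, fun k => ?_⟩
  rw [Basis.piTensorProduct_apply, mulMap, PiTensorProduct.lift.tprod,
    MultilinearMap.compLinearMap_apply, MultilinearMap.mkPiAlgebraFin_apply]
  simp only [List.ofFn_succ, List.ofFn_zero, List.prod_cons, List.prod_nil, mul_one]
  have key : ∀ e : Exponents, Btotal e = (b0 e.oddMinus : U) * (b1 e.cMinus * (b2 e.evenMinus *
      (b3 e.imMinus * (b4 e.zero * (b5 e.imPlus * (b6 e.oddPlus * (b7 e.cPlus * b8 e.evenPlus))))))) :=
    fun e => by rw [h0, h1, h2, h3, h4, h5, h6, h7, h8]; simp only [Btotal, mul_assoc]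
  rw [key]
  rfl

theorem mulMap_factors : Function.Injective (mulMap factors) ∧
    LinearMap.range (mulMap factors) = Subalgebra.toSubmodule UZ := by
  obtain ⟨b, hb⟩ := exists_factor_basis
  have hcomp : mulMap factors ∘ Basis.piTensorProduct b = Btotal ∘ toExponents := funext hb
  refine ⟨LinearMap.injective_of_linearIndependent (Basis.piTensorProduct b).span_eq ?_, ?_⟩
  · rw [hcomp]; exact linearIndependent_int_Btotal.comp _ toExponents_bijective.1
  · rw [LinearMap.range_eq_map, ← (Basis.piTensorProduct b).span_eq, Submodule.map_span,
      ← Set.range_comp, hcomp, Set.range_comp, toExponents_bijective.2.range_eq, Set.image_univ,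
      span_Btotal]

end Tensor

end A22

end

theorem mainTheorem1 :
    -- the divided powers generate an integral form
    A22.IsIntegralForm A22.UZ ∧
    -- it is the ordered tensor product of the nine factors, through multiplication
    (Function.Injective (A22.mulMap A22.factors) ∧
      LinearMap.range (A22.mulMap A22.factors) = Subalgebra.toSubmodule A22.UZ) ∧
    -- bases of the factors
    (∀ σ : ℤˣ,
      A22.IsZBasis (A22.Beven σ) (A22.UZeven σ) ∧
      A22.IsZBasis (A22.Bodd σ) (A22.UZodd σ) ∧
      A22.IsZBasis (A22.Bc σ) (A22.UZc σ) ∧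
      A22.IsZBasis (A22.Bim σ) (A22.UZim σ)) ∧
    A22.IsZBasis A22.Bzero A22.UZzero ∧
    -- the imaginary factors are polynomial algebras in the `h̃_k`
    (∀ σ : ℤˣ, ∃ e : MvPolynomial ℕ+ ℤ ≃ₐ[ℤ] A22.UZim σ,
      ∀ k : ℕ+, ((e (MvPolynomial.X k) : A22.UZim σ) : A22.U) = A22.hTilde σ k) ∧
    -- the product of these bases is a basis of the whole algebra
    A22.IsZBasis A22.Btotal A22.UZ := by
  exact ⟨A22.isZBasis_Btotal.isIntegralForm A22.linearIndependent_Btotal A22.span_UZ,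
    A22.mulMap_factors, fun σ => ⟨A22.isZBasis_Beven σ, A22.isZBasis_Bodd σ, A22.isZBasis_Bc σ,
    A22.isZBasis_Bim σ⟩, A22.isZBasis_Bzero, A22.exists_algEquiv_UZim, A22.isZBasis_Btotal⟩
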